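/- **Setting.** Let $n\ge 1$, let $M^n$ and $N^{n+1}$ be orientable smooth manifolds (Hausdorff, second countable), $g$ a Riemannian metric on $N$ and $f\colon M\to N$ an $A$-front: $f$ is smooth, it has locally smooth unit normal fields $\nu$ for which $(f,[\nu])$ is a Legendrian immersion into the projective cotangent bundle, and at each point $p$ of its singular set $S(f)$ (the points where $f$ is not an immersion) it is, for some $1\le k\le n$, right-left equivalent to the $A_{k+1}$-front singularity $$(t,x_2,\dots,x_n)\mapsto\Bigl((k+1)t^{k+2}+\sum_{j=2}^k(j-1)t^jx_j,\;-(k+2)t^{k+1}-\sum_{j=2}^kjt^{j-1}x_j,\;x_2,\dots,x_n\Bigr)$$ at the origin. The image of this germ is the discriminant set $\{F=F_\tau=0\}$ of $F(\tau,u)=\tau^{k+2}+u_k\tau^k+\dots+u_1\tau+u_0$; at a regular point near $p$ the *inward* unit normal is the one pointing to the side where the number of real roots of $F$ (near the double root corresponding to the point) increases. Fix a point $o\notin S(f)$ and a unit normal vector $\nu_0$ of $f$ at $o$. A loop $\gamma\colon[0,1]\to M$ at $o$ is *co-orientable* if there is a continuous unit normal field $\nu$ of $f$ along $\gamma$ with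 $\nu(0)=\nu(1)$. A *null loop* is a closed regular $C^1$ curve $\gamma$ at $o$ (so $\gamma'(0)=\gamma'(1)$) with $\gamma'(t)\in\ker df$ whenever $\gamma(t)\in S(f)$, which meets $S(f)$ at finitely many parameters only, in $A_2$-singular points, and is of class $C^2$ near these parameters. **Zig-zag number.** Let $t_1<\dots<t_m$ be the parameters at which the co-orientable null loop $\gamma$ meets $S(f)$, and put $t_0=0$, $t_{m+1}=1$. For $0\le j\le m$ let $\hat\nu_j$ be the continuous unit normal field along $\gamma|_{[t_j,t_{j+1}]}$ with $\hat\nu_0(0)=\nu_0$ and, for $j\ge1$, with $\hat\nu_j$ inward just after $t_j$. Let $\varepsilon_0=+1$; for $1\le j\le m$ let $\varepsilon_j=\varepsilon_{j-1}$ if $\hat\nu_{j-1}$ is inward just before $t_j$, and $\varepsilon_j=-\varepsilon_{j-1}$ if $-\hat\nu_{j-1}$ is; let $\varepsilon_{m+1}=\pm\varepsilon_m$ if $\hat\nu_m(1)=\pm\nu_0$. Cancel successively pairs of equal adjacent signs in $\varepsilon_0,\dots,\varepsilon_{m+1}$ until none is left. The number of signs $-$ that remain is the zig-zag number $z(\gamma)$.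 **Normal curvature map.** Let $\hat\gamma=f\circ\gamma$, let $\nu$ be the continuous unit normal field along $\gamma$ with $\nu(0)=\nu_0$, and $\nu'$ its covariant derivative along $\hat\gamma$. The normal curvature map $C_\gamma\colon[0,1]\to P^1(\mathbb R)$ is the continuous extension of $t\mapsto[g(\hat\gamma',\hat\gamma'):g(\nu',\hat\gamma')]$, $\gamma(t)\notin S(f)$. Its rotation index $\mu_f(\gamma)$ is the number of full turns of the line $C_\gamma(t)$: if $C_\gamma(t)=[\cos\theta(t):\sin\theta(t)]$ with $\theta$ continuous, then $\mu_f(\gamma)=(\theta(1)-\theta(0))/2\pi$. **Proposition.** For every co-orientable null loop $\gamma$ the continuous extension $C_\gamma$ exists and is unique, $\mu_f(\gamma)$ is an integer, $z(\gamma)$ is well defined, and $$|\mu_f(\gamma)|=z(\gamma).$$ Moreover, the homotopy classes of co-orientable loops form a subgroup $\hat\pi_1(M)$ of $\pi_1(M,o)$, every loop in such a class is co-orientable, and there is a unique group homomorphism $\hat\rho_f\colon\hat\pi_1(M)\to\mathbb Z$ (the Maslov representation) with $\hat\rho_f([\gamma])=\mu_f(\gamma)$ for every co-orientable null loop $\gamma$.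 -/

import Mathlib

open Set Filter
open scoped Manifold ContDiff Topology LinearAlgebra.Projectivization

namespace FrontMaslov

/-- Euclidean `d`-space, the model of `d`-dimensional manifolds. -/
abbrev Euc (d : ℕ) := EuclideanSpace ℝ (Fin d)

/-- A smooth Riemannian metric on a `d`-dimensional smooth manifold. -/
abbrev RiemMetric (d : ℕ) (N : Type*) [TopologicalSpace N] [ChartedSpace (Euc d) N]
    [IsManifold (𝓡 d) ∞ N] :=
  Bundle.ContMDiffRiemannianMetric (𝓡 d) ∞ (Euc d) (fun x : N => TangentSpace (𝓡 d) x)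

/-- Orientability: the manifold is covered by smooth charts whose coordinate changes have
positive Jacobian determinant. -/
def IsOrientable (d : ℕ) (M : Type*) [TopologicalSpace M] [ChartedSpace (Euc d) M] : Prop :=
  ∃ A : Set (OpenPartialHomeomorph M (Euc d)),
    A ⊆ IsManifold.maximalAtlas (𝓡 d) ∞ M ∧
    (∀ x : M, ∃ e ∈ A, x ∈ e.source) ∧
    ∀ e ∈ A, ∀ e' ∈ A, ∀ x ∈ (e.symm.trans e').source,
      0 < (fderiv ℝ (fun y => e' (e.symm y)) x).det

section Curves

variable {d : ℕ} {N : Type*} [TopologicalSpace N] [ChartedSpace (Euc d) N]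

/-- The velocity vector of a curve. -/
noncomputable def velocity (d : ℕ) {N : Type*} [TopologicalSpace N] [ChartedSpace (Euc d) N]
    (σ : ℝ → N) (t : ℝ) : TangentSpace (𝓡 d) (σ t) :=
  mfderiv 𝓘(ℝ, ℝ) (𝓡 d) σ t (1 : ℝ)

variable [IsManifold (𝓡 d) ∞ N]

/-- The coefficients of the metric in the preferred chart at `y`: the value of the
pulled-back metric at the point `z` of the chart on the coordinate vectors `a`, `b`. -/
noncomputable def metricCoeff (g : RiemMetric d N) (y : N) (z a b : Euc d) : ℝ :=
  g.inner ((extChartAt (𝓡 d) y).symm z)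
    (mfderiv 𝓘(ℝ, Euc d) (𝓡 d) (extChartAt (𝓡 d) y).symm z a)
    (mfderiv 𝓘(ℝ, Euc d) (𝓡 d) (extChartAt (𝓡 d) y).symm z b)

/-- `g(∇_t V, w)` for a vector field `V` along the curve `σ` and a tangent vector `w` at `σ t`,
where `∇_t` is the covariant derivative along `σ` of the Levi-Civita connection of `g`.
It is computed in the preferred chart at `σ t`, with `x` the coordinates of `σ` and `v` those
of `V`, as `g_{kl} (dv^k/dt) w^l + Γ_{ij,l} (dx^i/dt) v^j w^l`, with the Christoffel symbols of the
first kind `Γ_{ij,l} = (∂_i g_{jl} + ∂_j g_{il} - ∂_l g_{ij}) / 2`. -/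
noncomputable def covDerivPairing (g : RiemMetric d N) (σ : ℝ → N)
    (V : ∀ t, TangentSpace (𝓡 d) (σ t)) (t : ℝ) (w : TangentSpace (𝓡 d) (σ t)) : ℝ :=
  let φ := extChartAt (𝓡 d) (σ t)
  let x : ℝ → Euc d := fun s => φ (σ s)
  let v : ℝ → Euc d := fun s => mfderiv (𝓡 d) 𝓘(ℝ, Euc d) φ (σ s) (V s)
  let w' : Euc d := mfderiv (𝓡 d) 𝓘(ℝ, Euc d) φ (σ t) w
  let x' : Euc d := deriv x t
  let G : Euc d → Euc d → Euc d → ℝ := metricCoeff g (σ t)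
  G (x t) (deriv v t) w' +
    (fderiv ℝ (fun z => G z (v t) w') (x t) x' + fderiv ℝ (fun z => G z x' w') (x t) (v t)
      - fderiv ℝ (fun z => G z x' (v t)) (x t) w') / 2

end Curves

section NormalForms

/-- The `j`-th coordinate (counted from `0`) of a vector, for a natural number `j`. -/
noncomputable def coord {d : ℕ} (x : Euc d) (j : ℕ) : ℝ :=
  if h : j < d then x ⟨j, h⟩ else 0

/-- The `A_{k+1}`-front singularity: for `X = (t, x_2, …, x_n)`, the point
`((k+1) t^{k+2} + ∑_{j=2}^k (j-1) t^j x_j, -(k+2) t^{k+1} - ∑_{j=2}^k j t^{j-1} x_j, x_2, …, x_n)`. -/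
noncomputable def frontGerm {n : ℕ} (k : ℕ) (X : Euc n) : Euc (n + 1) :=
  WithLp.toLp 2 fun i : Fin (n + 1) =>
    if (i : ℕ) = 0 then
      ((k : ℝ) + 1) * coord X 0 ^ (k + 2)
        + ∑ j ∈ Finset.Icc 2 k, ((j : ℝ) - 1) * coord X 0 ^ j * coord X (j - 1)
    else if (i : ℕ) = 1 then
      -((k : ℝ) + 2) * coord X 0 ^ (k + 1)
        - ∑ j ∈ Finset.Icc 2 k, (j : ℝ) * coord X 0 ^ (j - 1) * coord X (j - 1)
    else coord X ((i : ℕ) - 1)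

/-- The versal unfolding `F(τ, u_0, …, u_d) = τ^{k+2} + u_k τ^k + ⋯ + u_1 τ + u_0`, whose
discriminant set `F = F_τ = 0` is the image of the `A_{k+1}`-front singularity;
`frontGerm k X` is the parameter `u` for which `F` has a double root at `t = coord X 0`. -/
noncomputable def versalUnfolding {d : ℕ} (k : ℕ) (u : Euc d) (τ : ℝ) : ℝ :=
  τ ^ (k + 2) + ∑ j ∈ Finset.range (k + 1), coord u j * τ ^ j

/-- The number of real roots of `F(·, u)` at distance less than `δ` from `τ`. -/
noncomputable def rootCount {d : ℕ} (k : ℕ) (u : Euc d) (τ δ : ℝ) : ℕ :=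
  {s : ℝ | |s - τ| < δ ∧ versalUnfolding k u s = 0}.ncard

/-- At the parameter `u`, where `F` has the multiple root `τ`, the direction `w` increases the
number of real roots of `F` (near `τ`, so that only the sheet of the discriminant set that
corresponds to the root `τ` is concerned). -/
def IncreasesRoots {d : ℕ} (k : ℕ) (u : Euc d) (τ : ℝ) (w : Euc d) : Prop :=
  ∀ᶠ δ in 𝓝[>] (0 : ℝ), ∀ᶠ s in 𝓝[>] (0 : ℝ),
    rootCount k (u - s • w) τ δ < rootCount k (u + s • w) τ δ

end NormalForms

section Fronts

variable {n : ℕ}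
  {M : Type*} [TopologicalSpace M] [ChartedSpace (Euc n) M] [IsManifold (𝓡 n) ∞ M]
  {N : Type*} [TopologicalSpace N] [ChartedSpace (Euc (n + 1)) N] [IsManifold (𝓡 (n + 1)) ∞ N]

/-- The singular set `S(f)`: the points at which `f` is not an immersion. -/
def singularSet (n : ℕ) {M : Type*} [TopologicalSpace M] [ChartedSpace (Euc n) M]
    {N : Type*} [TopologicalSpace N] [ChartedSpace (Euc (n + 1)) N] (f : M → N) : Set M :=
  {p | ¬ Function.Injective (mfderiv (𝓡 n) (𝓡 (n + 1)) f p)}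

/-- The map `x ↦ (f x, ν x)` into the tangent bundle of `N` given by a vector field along `f`. -/
def lift (f : M → N) (ν : ∀ x, TangentSpace (𝓡 (n + 1)) (f x)) (x : M) :
    TangentBundle (𝓡 (n + 1)) N :=
  ⟨f x, ν x⟩

/-- `ν` is a smooth unit normal vector field of `f` on the open set `U`. -/
structure IsUnitNormalField (g : RiemMetric (n + 1) N) (f : M → N) (U : Set M)
    (ν : ∀ x, TangentSpace (𝓡 (n + 1)) (f x)) : Prop where
  isOpen : IsOpen U
  smooth : ContMDiffOn (𝓡 n) (𝓡 (n + 1)).tangent ∞ (lift f ν) U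
  unit : ∀ x ∈ U, g.inner (f x) (ν x) (ν x) = 1
  normal : ∀ x ∈ U, ∀ u : TangentSpace (𝓡 n) x,
    g.inner (f x) (mfderiv (𝓡 n) (𝓡 (n + 1)) f x u) (ν x) = 0

/-- `f` is a (wave) front: it is smooth and has locally smooth unit normal fields `ν` for which
`(f, [ν])` is a (Legendrian) immersion into the projective cotangent bundle. The unit tangent
bundle being a double covering of the latter by means of the metric, this says that `(f, ν)` is
an immersion. -/
def IsFront (g : RiemMetric (n + 1) N) (f : M → N) : Prop :=
  ContMDiff (𝓡 n) (𝓡 (n + 1)) ∞ f ∧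
  ∀ p : M, ∃ (U : Set M) (ν : ∀ x, TangentSpace (𝓡 (n + 1)) (f x)),
    p ∈ U ∧ IsUnitNormalField g f U ν ∧
    ∀ x ∈ U, Function.Injective (mfderiv (𝓡 n) (𝓡 (n + 1)).tangent (lift f ν) x)

/-- Smooth charts `e`, `e'` centred at `p` and `f p` in which `f` is the `A_{k+1}`-front
singularity. -/
structure IsNormalFormAt (f : M → N) (p : M) (k : ℕ) (e : OpenPartialHomeomorph M (Euc n))
    (e' : OpenPartialHomeomorph N (Euc (n + 1))) : Prop where
  mem_atlas : e ∈ IsManifold.maximalAtlas (𝓡 n) ∞ M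
  mem_atlas' : e' ∈ IsManifold.maximalAtlas (𝓡 (n + 1)) ∞ N
  mem_source : p ∈ e.source
  center : e p = 0
  mapsTo : MapsTo f e.source e'.source
  eq_germ : ∀ q ∈ e.source, e' (f q) = frontGerm k (e q)

/-- `f` at `p` is right-left equivalent to the `A_{k+1}`-front singularity. -/
def IsASingularity (n : ℕ) {M : Type*} [TopologicalSpace M] [ChartedSpace (Euc n) M]
    {N : Type*} [TopologicalSpace N] [ChartedSpace (Euc (n + 1)) N] (f : M → N) (p : M) (k : ℕ) : Prop :=
  ∃ (e : OpenPartialHomeomorph M (Euc n)) (e' : OpenPartialHomeomorph N (Euc (n + 1))),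
    IsNormalFormAt f p k e e'

/-- An `A`-front: a front all of whose singular points are `A_{k+1}`-singular points for some
`k` with `1 ≤ k ≤ n`. -/
def IsAFront (g : RiemMetric (n + 1) N) (f : M → N) : Prop :=
  IsFront g f ∧ ∀ p ∈ singularSet n f, ∃ k, 1 ≤ k ∧ k ≤ n ∧ IsASingularity n f p k

/-- `v` is a unit normal vector of `f` at `p`, that is, the value at `p` of a smooth unit normal
field of `f` around `p`. (At a singular point this is stronger than being orthogonal to the image
of the differential.) -/
def IsUnitNormalAt (g : RiemMetric (n + 1) N) (f : M → N) (p : M)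
    (v : TangentSpace (𝓡 (n + 1)) (f p)) : Prop :=
  ∃ (U : Set M) (ν : ∀ x, TangentSpace (𝓡 (n + 1)) (f x)),
    p ∈ U ∧ IsUnitNormalField g f U ν ∧ ν p = v

/-- `ν` restricts to a continuous unit normal vector field of `f` along `γ` on `s`. -/
def IsUnitNormalAlong {T : Type*} [TopologicalSpace T] (g : RiemMetric (n + 1) N) (f : M → N)
    (γ : T → M) (s : Set T) (ν : ∀ t, TangentSpace (𝓡 (n + 1)) (f (γ t))) : Prop :=
  ContinuousOn (fun t => (⟨f (γ t), ν t⟩ : TangentBundle (𝓡 (n + 1)) N)) s ∧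
  ∀ t ∈ s, IsUnitNormalAt g f (γ t) (ν t)

/-- A loop is co-orientable if there is a continuous unit normal field `ν` of `f` along it with
`ν 0 = ν 1`. -/
def IsCoorientable (g : RiemMetric (n + 1) N) (f : M → N) {o : M} (γ : Path o o) : Prop :=
  ∃ ν : ∀ t : unitInterval, TangentSpace (𝓡 (n + 1)) (f (γ t)),
    IsUnitNormalAlong g f γ univ ν ∧
    (⟨f (γ 0), ν 0⟩ : TangentBundle (𝓡 (n + 1)) N) = ⟨f (γ 1), ν 1⟩

/-- In the normal form given by `e`, `e'`, the vector `v` at `f q` points in the direction in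
which the number of roots of the versal unfolding increases. -/
def IsInward (f : M → N) (k : ℕ) (e : OpenPartialHomeomorph M (Euc n))
    (e' : OpenPartialHomeomorph N (Euc (n + 1))) (q : M)
    (v : TangentSpace (𝓡 (n + 1)) (f q)) : Prop :=
  IncreasesRoots k (e' (f q)) (coord (e q) 0)
    (mfderiv (𝓡 (n + 1)) 𝓘(ℝ, Euc (n + 1)) e' (f q) v)

/-- The vector field `v` along `c` is inward along the filter `l` of parameters (with limit `τ`),
where `c τ` is a singular point. -/
def IsInwardNear (f : M → N) (c : ℝ → M) (v : ∀ t, TangentSpace (𝓡 (n + 1)) (f (c t)))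
    (τ : ℝ) (l : Filter ℝ) : Prop :=
  ∃ (k : ℕ) (e : OpenPartialHomeomorph M (Euc n)) (e' : OpenPartialHomeomorph N (Euc (n + 1))),
    1 ≤ k ∧ k ≤ n ∧ IsNormalFormAt f (c τ) k e e' ∧ ∀ᶠ t in l, IsInward f k e e' (c t) (v t)

/-- A null loop at `o`, as a curve `c` of period `1`: a closed regular `C^1` curve starting at `o`
whose velocity lies in the kernel of `df` whenever it meets the singular set; it meets the singular
set only finitely often and in `A_2`-singular points, and is of class `C^2` near there. -/
structure IsNullLoop (n : ℕ) {M : Type*} [TopologicalSpace M] [ChartedSpace (Euc n) M]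
    {N : Type*} [TopologicalSpace N] [ChartedSpace (Euc (n + 1)) N] (f : M → N) (o : M) (c : ℝ → M) : Prop where
  contMDiff : ContMDiff 𝓘(ℝ, ℝ) (𝓡 n) 1 c
  periodic : Function.Periodic c 1
  base : c 0 = o
  regular : ∀ t, velocity n c t ≠ 0
  null : ∀ t, c t ∈ singularSet n f → mfderiv (𝓡 n) (𝓡 (n + 1)) f (c t) (velocity n c t) = 0
  finite : {t | t ∈ Icc (0 : ℝ) 1 ∧ c t ∈ singularSet n f}.Finite
  isA2 : ∀ t, c t ∈ singularSet n f → IsASingularity n f (c t) 1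
  contMDiffAt : ∀ t, c t ∈ singularSet n f → ContMDiffAt 𝓘(ℝ, ℝ) (𝓡 n) 2 c t

/-- A null loop as a path `[0,1] → M` from `o` to `o`. -/
def IsNullLoop.path {f : M → N} {o : M} {c : ℝ → M} (h : IsNullLoop n f o c) : Path o o where
  toFun t := c t
  continuous_toFun := h.contMDiff.continuous.comp continuous_subtype_val
  source' := by simpa using h.base
  target' := by simpa using (h.periodic 0).trans h.base

/-- The class in the fundamental group of a loop. -/
def loopClass {o : M} (γ : Path o o) : FundamentalGroup M o :=
  FundamentalGroup.fromPath (Path.Homotopic.Quotient.mk γ)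

/-! ### The zig-zag number -/

/-- Successive cancellation of pairs of equal adjacent signs, until no two adjacent signs of the
sequence are equal. -/
def normalize : List ℤˣ → List ℤˣ
  | [] => []
  | a :: l =>
    match normalize l with
    | [] => [a]
    | b :: l' => if a = b then l' else a :: b :: l'

/-- `ε 0, …, ε (m+1)` is the sequence of signs of the null loop `c` (and the unit normal `ν₀`
at `o`). Here `τ 1 < ⋯ < τ m` are the parameters at which `c` meets the singular set, `τ 0 = 0`,
`τ (m+1) = 1`. On each `[τ j, τ (j+1)]` a continuous unit normal field `μ j` is chosen that starts
with `ν₀` for `j = 0` and with the inward normal for `j ≥ 1`. The sign changes at `j ≤ m` if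
`μ (j-1)` is not inward (that is, its negative is) at the end of its interval, and at
`j = m + 1` if `μ m` does not end with `ν₀`. -/
def IsSignSequence (g : RiemMetric (n + 1) N) (f : M → N) {o : M}
    (ν₀ : TangentSpace (𝓡 (n + 1)) (f o)) (c : ℝ → M) (m : ℕ) (ε : ℕ → ℤˣ) : Prop :=
  ∃ (τ : ℕ → ℝ) (μ : ℕ → ∀ t : ℝ, TangentSpace (𝓡 (n + 1)) (f (c t))),
    (τ 0 = 0 ∧ τ (m + 1) = 1 ∧ ∀ j ≤ m, τ j < τ (j + 1)) ∧
    (∀ t ∈ Icc (0 : ℝ) 1, c t ∈ singularSet n f ↔ ∃ j, 1 ≤ j ∧ j ≤ m ∧ t = τ j) ∧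
    (∀ j ≤ m, IsUnitNormalAlong g f c (Icc (τ j) (τ (j + 1))) (μ j)) ∧
    (⟨f (c 0), μ 0 0⟩ : TangentBundle (𝓡 (n + 1)) N) = ⟨f o, ν₀⟩ ∧
    (∀ j, 1 ≤ j → j ≤ m → IsInwardNear f c (μ j) (τ j) (𝓝[>] (τ j))) ∧
    ε 0 = 1 ∧
    (∀ j < m,
      (IsInwardNear f c (μ j) (τ (j + 1)) (𝓝[<] (τ (j + 1))) ∧ ε (j + 1) = ε j) ∨
      (IsInwardNear f c (fun t => -μ j t) (τ (j + 1)) (𝓝[<] (τ (j + 1))) ∧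
        ε (j + 1) = -ε j)) ∧
    (((⟨f (c 1), μ m 1⟩ : TangentBundle (𝓡 (n + 1)) N) = ⟨f o, ν₀⟩ ∧ ε (m + 1) = ε m) ∨
      ((⟨f (c 1), μ m 1⟩ : TangentBundle (𝓡 (n + 1)) N) = ⟨f o, -ν₀⟩ ∧ ε (m + 1) = -ε m))

/-- The zig-zag number of the null loop `c` is `z`: the number of minus signs in the normalized
sequence of signs. -/
def HasZigzagNumber (g : RiemMetric (n + 1) N) (f : M → N) {o : M}
    (ν₀ : TangentSpace (𝓡 (n + 1)) (f o)) (c : ℝ → M) (z : ℕ) : Prop :=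
  ∃ (m : ℕ) (ε : ℕ → ℤˣ), IsSignSequence g f ν₀ c m ε ∧
    z = (normalize ((List.range (m + 2)).map ε)).count (-1)

/-! ### The normal curvature map and its rotation index -/

/-- The quotient topology on the real projective line. -/
instance : TopologicalSpace (ℙ ℝ (ℝ × ℝ)) :=
  inferInstanceAs (TopologicalSpace (Quotient (projectivizationSetoid ℝ (ℝ × ℝ))))

/-- The homogeneous coordinates `(g(ĉ', ĉ'), g(ν', ĉ'))`, `ĉ = f ∘ c`. -/
noncomputable def curvatureVector (g : RiemMetric (n + 1) N) (f : M → N) (c : ℝ → M)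
    (ν : ∀ t, TangentSpace (𝓡 (n + 1)) (f (c t))) (t : ℝ) : ℝ × ℝ :=
  let σ : ℝ → N := fun s => f (c s)
  (g.inner (σ t) (velocity (n + 1) σ t) (velocity (n + 1) σ t), covDerivPairing g σ ν t (velocity (n + 1) σ t))

/-- `C` is the normal curvature map of the null loop `c`: the continuous map `[0,1] → P^1(ℝ)` that
is `[g(ĉ', ĉ') : g(ν', ĉ')]` off the singular set, where `ν` is the continuous unit normal field
along `c` with `ν 0 = ν₀`. -/
def IsNormalCurvatureMap (g : RiemMetric (n + 1) N) (f : M → N) {o : M}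
    (ν₀ : TangentSpace (𝓡 (n + 1)) (f o)) (c : ℝ → M) (C : unitInterval → ℙ ℝ (ℝ × ℝ)) : Prop :=
  ∃ ν : ∀ t : ℝ, TangentSpace (𝓡 (n + 1)) (f (c t)),
    IsUnitNormalAlong g f c univ ν ∧
    (⟨f (c 0), ν 0⟩ : TangentBundle (𝓡 (n + 1)) N) = ⟨f o, ν₀⟩ ∧
    Continuous C ∧
    ∀ t : unitInterval, c t ∉ singularSet n f →
      ∃ h : curvatureVector g f c ν t ≠ 0, C t = Projectivization.mk ℝ _ h

/-- The rotation index of a map `C : [0,1] → P^1(ℝ)` is `μ`: the line `C t` makes, all in all,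
`μ` full turns (through the angle `2π`) in the plane. -/
def HasRotationIndex (C : unitInterval → ℙ ℝ (ℝ × ℝ)) (μ : ℤ) : Prop :=
  ∃ θ : unitInterval → ℝ, Continuous θ ∧
    (∀ t, ∃ h : (Real.cos (θ t), Real.sin (θ t)) ≠ (0 : ℝ × ℝ), C t = Projectivization.mk ℝ _ h) ∧
    θ 1 - θ 0 = 2 * Real.pi * μ

end Fronts

end FrontMaslov

open FrontMaslov

/-! Both numbers are read off from the monodromy of a covering of `M` with fibre `ℤ`. Locally, take
a smooth unit normal field `ν` of `f` and an integer function `j` on the regular points that is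
locally constant there, is larger by one on the side of the singular set on which `ν` is inward, and
is even exactly where the frame formed by `df` and `ν` is positively oriented (`HeightChart`). Such
pairs exist because, near a singular point, the orientation of the frame and the inwardness of `ν`
change together: up to nonvanishing factors both are the sign of `hess`
(`IsNormalFormOn.eventually_isPosFrame_iff`). They do not depend on the normal form, since the
inward side does not (`eventually_inward_sign`). Passing to `-ν` replaces `j` by an odd constant
minus `j`. Hence the pairs glue to a bundle with discrete fibre (`heightCore`), whose transition
maps are of the form `twist c`.

A point of this covering carries a unit normal, given by its parity, and over a regular point a
height. Adding an even integer commutes with the transition maps. Hence a loop is co-orientable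
exactly if its holonomy shifts the fibre by an even number, and minus half of the shift is a
homomorphism on the classes of co-orientable loops (`maslov`).

Along a null loop let `(x, y)` be the homogeneous coordinates of the normal curvature. Off the
singular set `x > 0`, so the line can be vertical at singular parameters only. There a computation
in the normal form shows that `x / (s - t)` tends to `0` and `y / (s - t)` to some `P ≠ 0` whose
sign decides on which side the normal is inward (`exists_tendsto_curvature`). So the jumps of
`arctan (y / x)` by `±π` are exactly those of `π` times the height, the difference of the two is a
continuous angle (`IsHeightLift.exists_angle`), and the rotation index is minus half of the increase
of the height.

The zig-zag number sees the same increase. If `s j = ±1` are the jumps of the height at the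
crossings, then the signs in its definition are `ε j = (-1) ^ j * s j` (with `s 0 = 1`, and a last
sign `(-1) ^ m`). Their alternating sum is therefore the increase of the height. It is unchanged by
cancellation, and a sequence without equal neighbours and with alternating sum `2 * r` contains
`|r|` minus signs (`count_normalize`).

Uniqueness of the homomorphism needs enough null loops. For `n ≥ 2`, arcs in charts with prescribed
end velocities, crossing the singular set along the kernel of `df`, are chained along a given loop
(`exists_isNullLoop_of_two_le`). For `n = 1`, the orientation provides a nowhere vanishing vector
field; every path is homotopic to an arc of an integral curve, so every loop is trivial, or
homotopic to a null loop or to the inverse of one (`exists_isNullLoop_of_one`). -/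

namespace FrontMaslov

set_option linter.unusedSectionVars false

/-! ### Algebra of the normal forms -/

/-- The coordinate functionals. -/
noncomputable def coordL (d j : ℕ) : Euc d →L[ℝ] ℝ :=
  if h : j < d then EuclideanSpace.proj ⟨j, h⟩ else 0

theorem coordL_apply {d : ℕ} (j : ℕ) (x : Euc d) : coordL d j x = coord x j := by
  unfold coordL coord; split_ifs <;> simp

/-- The coordinate vectors. -/
noncomputable def basisVec (d j : ℕ) : Euc d :=
  if h : j < d then EuclideanSpace.single ⟨j, h⟩ 1 else 0

theorem coord_basisVec {d : ℕ} {i : ℕ} (hi : i < d) (j : ℕ) :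
    coord (basisVec d i) j = if j = i then 1 else 0 := by
  unfold coord basisVec
  by_cases hj : j < d
  · simp [hj, hi, Fin.ext_iff]
  · have : j ≠ i := by omega
    simp [hj, this]

theorem coord_add {d : ℕ} (x y : Euc d) (j : ℕ) : coord (x + y) j = coord x j + coord y j := by
  simp [← coordL_apply]

theorem coord_sub {d : ℕ} (x y : Euc d) (j : ℕ) : coord (x - y) j = coord x j - coord y j := by
  simp [← coordL_apply]

theorem coord_smul {d : ℕ} (c : ℝ) (x : Euc d) (j : ℕ) : coord (c • x) j = c * coord x j := by
  simp [← coordL_apply]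

theorem coord_sum {d : ℕ} {ι : Type*} (s : Finset ι) (x : ι → Euc d) (j : ℕ) :
    coord (∑ i ∈ s, x i) j = ∑ i ∈ s, coord (x i) j := by
  simp [← coordL_apply]

theorem coord_zero {d : ℕ} (j : ℕ) : coord (0 : Euc d) j = 0 := by
  simp [← coordL_apply]

theorem coord_ext {d : ℕ} {x y : Euc d} (h : ∀ j < d, coord x j = coord y j) : x = y := by
  ext i
  have := h i i.2
  simpa [coord] using this

theorem contDiff_coord {d : ℕ} (j : ℕ) {m : WithTop ℕ∞} :
    ContDiff ℝ m (fun x : Euc d => coord x j) := by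
  simpa only [← coordL_apply] using (coordL d j).contDiff

/-- The shift `(x_1, …, x_n) ↦ (0, 0, x_2, …, x_n)`. -/
noncomputable def shiftL (n : ℕ) : Euc n →L[ℝ] Euc (n + 1) :=
  ∑ i ∈ Finset.Ico 2 (n + 1), (coordL n (i - 1)).smulRight (basisVec (n + 1) i)

theorem coord_shiftL {n : ℕ} (Y : Euc n) {i : ℕ} (hi : i < n + 1) :
    coord (shiftL n Y) i = if 2 ≤ i then coord Y (i - 1) else 0 := by
  have h : ∀ x ∈ Finset.Ico 2 (n + 1), coord Y (x - 1) * coord (basisVec (n + 1) x) i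
      = if i = x then coord Y (x - 1) else 0 := by
    intro x hx
    rw [coord_basisVec (Finset.mem_Ico.1 hx).2]; split_ifs <;> simp
  simp only [shiftL, FunLike.coe_sum, Finset.sum_apply,
    ContinuousLinearMap.smulRight_apply, coordL_apply, coord_sum, coord_smul]
  rw [Finset.sum_congr rfl h, Finset.sum_ite_eq]
  simp [hi]

/-- The conormal `(1, τ, …, τ^k)` of the discriminant set at a parameter with double root `τ`. -/
noncomputable def conormal (d k : ℕ) (τ : ℝ) : Euc d →L[ℝ] ℝ :=
  ∑ j ∈ Finset.range (k + 1), τ ^ j • coordL d j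

/-- The derivative of the conormal. -/
noncomputable def conormal' (d k : ℕ) (τ : ℝ) : Euc d →L[ℝ] ℝ :=
  ∑ j ∈ Finset.range (k + 1), ((j : ℝ) * τ ^ (j - 1)) • coordL d j

theorem conormal_apply {d k : ℕ} (τ : ℝ) (u : Euc d) :
    conormal d k τ u = ∑ j ∈ Finset.range (k + 1), coord u j * τ ^ j := by
  simp [conormal, coordL_apply, mul_comm]

theorem conormal'_apply {d k : ℕ} (τ : ℝ) (u : Euc d) :
    conormal' d k τ u = ∑ j ∈ Finset.range (k + 1), j * τ ^ (j - 1) * coord u j := by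
  simp [conormal', coordL_apply]

theorem hasDerivAt_conormal (d k : ℕ) (τ : ℝ) :
    HasDerivAt (conormal d k) (conormal' d k τ) τ := by
  unfold conormal conormal'
  refine HasDerivAt.fun_sum fun j _ => ?_
  exact HasDerivAt.smul_const (hasDerivAt_pow j τ) (coordL d j)

theorem contDiff_conormal (d k : ℕ) {m : WithTop ℕ∞} : ContDiff ℝ m (conormal d k) := by
  unfold conormal
  exact ContDiff.sum fun j _ => (contDiff_id.pow j).smul contDiff_const

theorem contDiff_conormal' (d k : ℕ) {m : WithTop ℕ∞} : ContDiff ℝ m (conormal' d k) := by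
  unfold conormal'
  exact ContDiff.sum fun j _ => (contDiff_const.mul (contDiff_id.pow _)).smul contDiff_const

theorem versalUnfolding_eq {d : ℕ} (k : ℕ) (u : Euc d) (τ : ℝ) :
    versalUnfolding k u τ = τ ^ (k + 2) + conormal d k τ u := by
  rw [conormal_apply]; rfl

/-- The second derivative of the versal unfolding at the double root, as a function on the source
of the front germ; its zero set is the singular set. -/
noncomputable def hess {n : ℕ} (k : ℕ) (X : Euc n) : ℝ :=
  ((k : ℝ) + 2) * ((k : ℝ) + 1) * coord X 0 ^ k
    + ∑ j ∈ Finset.Icc 2 k, (j : ℝ) * ((j : ℝ) - 1) * coord X 0 ^ (j - 2) * coord X (j - 1)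

theorem contDiff_hess {n k : ℕ} {m : WithTop ℕ∞} : ContDiff ℝ m (hess k : Euc n → ℝ) := by
  unfold hess
  exact (contDiff_const.mul ((contDiff_coord 0).pow k)).add (ContDiff.sum fun j _ =>
    (contDiff_const.mul ((contDiff_coord 0).pow _)).mul (contDiff_coord _))

/-- The direction `(τ, -1, 0, …, 0)` of the null derivative. -/
noncomputable def nullImage (n : ℕ) (τ : ℝ) : Euc (n + 1) :=
  τ • basisVec (n + 1) 0 - basisVec (n + 1) 1

/-- The part of the differential of the front germ that comes from the variables
`x_2, …, x_n`. -/
noncomputable def germRest (n k : ℕ) (τ : ℝ) : Euc n →L[ℝ] Euc (n + 1) :=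
  (∑ j ∈ Finset.Icc 2 k, (((j : ℝ) - 1) * τ ^ j) • coordL n (j - 1)).smulRight
      (basisVec (n + 1) 0)
    - (∑ j ∈ Finset.Icc 2 k, ((j : ℝ) * τ ^ (j - 1)) • coordL n (j - 1)).smulRight
      (basisVec (n + 1) 1)
    + shiftL n

theorem germRest_apply (n k : ℕ) (τ : ℝ) (Y : Euc n) : germRest n k τ Y =
    (∑ j ∈ Finset.Icc 2 k, (((j : ℝ) - 1) * τ ^ j) * coord Y (j - 1)) • basisVec (n + 1) 0
    - (∑ j ∈ Finset.Icc 2 k, ((j : ℝ) * τ ^ (j - 1)) * coord Y (j - 1)) • basisVec (n + 1) 1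
    + shiftL n Y := by
  simp [germRest, coordL_apply]

theorem frontGerm_eq {n : ℕ} (hn : 0 < n) (k : ℕ) (X : Euc n) : frontGerm k X =
    (((k : ℝ) + 1) * coord X 0 ^ (k + 2)
        + ∑ j ∈ Finset.Icc 2 k, ((j : ℝ) - 1) * coord X 0 ^ j * coord X (j - 1)) •
      basisVec (n + 1) 0
    + (-((k : ℝ) + 2) * coord X 0 ^ (k + 1)
        - ∑ j ∈ Finset.Icc 2 k, (j : ℝ) * coord X 0 ^ (j - 1) * coord X (j - 1)) •
      basisVec (n + 1) 1
    + shiftL n X := by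
  refine coord_ext fun i hi => ?_
  rw [coord_add, coord_add, coord_smul, coord_smul, coord_basisVec (by omega),
    coord_basisVec (by omega), coord_shiftL X hi]
  rcases i with _ | _ | i
  · simp [coord, frontGerm]
  · simp [coord, frontGerm, hn]
  · simp [coord, frontGerm, hi]

theorem contDiff_frontGerm {n : ℕ} (hn : 0 < n) (k : ℕ) {m : WithTop ℕ∞} :
    ContDiff ℝ m (frontGerm k : Euc n → Euc (n + 1)) := by
  rw [show (frontGerm k : Euc n → Euc (n + 1)) = _ from funext (frontGerm_eq hn k)]
  have hs : ∀ (c : ℕ → ℝ) (p : ℕ → ℕ), ContDiff ℝ m (fun X : Euc n =>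
      ∑ j ∈ Finset.Icc 2 k, c j * coord X 0 ^ (p j) * coord X (j - 1)) := fun c p =>
    ContDiff.sum fun j _ => (contDiff_const.mul ((contDiff_coord 0).pow _)).mul (contDiff_coord _)
  exact ((((contDiff_const.mul ((contDiff_coord 0).pow _)).add (hs _ _)).smul contDiff_const).add
    (((contDiff_const.mul ((contDiff_coord 0).pow _)).sub (hs _ _)).smul contDiff_const)).add
    (shiftL n).contDiff

/-- The differential of the front germ. -/
noncomputable def germDeriv {n : ℕ} (k : ℕ) (X : Euc n) : Euc n →L[ℝ] Euc (n + 1) :=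
  (hess k X • coordL n 0).smulRight (nullImage n (coord X 0)) + germRest n k (coord X 0)

theorem germDeriv_apply {n : ℕ} (k : ℕ) (X Y : Euc n) : germDeriv k X Y =
    (hess k X * coord Y 0) • nullImage n (coord X 0) + germRest n k (coord X 0) Y := by
  simp [germDeriv, coordL_apply]

theorem hasFDerivAt_coord {d : ℕ} (j : ℕ) (X : Euc d) :
    HasFDerivAt (fun X : Euc d => coord X j) (coordL d j) X := by
  simpa only [← coordL_apply] using (coordL d j).hasFDerivAt

/-- The derivatives of the first two coordinates with respect to `t` are `t * hess` and `-hess`. The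
`t`-column is thus `hess` times a vector that never vanishes, which isolates the degeneration of the
germ in one scalar factor. -/
theorem hasFDerivAt_frontGerm {n : ℕ} (hn : 0 < n) (k : ℕ) (X : Euc n) :
    HasFDerivAt (frontGerm k) (germDeriv k X) X := by
  rw [show (frontGerm k : Euc n → Euc (n + 1)) = _ from funext (frontGerm_eq hn k)]
  have hs : ∀ (c : ℕ → ℝ) (p : ℕ → ℕ), HasFDerivAt (fun X : Euc n =>
      ∑ j ∈ Finset.Icc 2 k, c j * coord X 0 ^ (p j) * coord X (j - 1))
      (∑ j ∈ Finset.Icc 2 k, ((c j * coord X 0 ^ (p j)) • coordL n (j - 1) +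
        (coord X (j - 1)) • (c j • ((p j * coord X 0 ^ (p j - 1)) • coordL n 0)))) X := by
    intro c p
    refine HasFDerivAt.fun_sum fun j _ => ?_
    have h0 := ((hasFDerivAt_coord 0 X).pow (p j)).const_mul (c j)
    convert! h0.mul (hasFDerivAt_coord (j - 1) X) using 2
    simp only [nsmul_eq_mul]
  have h1 := ((hasFDerivAt_coord 0 X).pow (k + 2)).const_mul ((k : ℝ) + 1)
  have h2 := ((hasFDerivAt_coord 0 X).pow (k + 1)).const_mul (-((k : ℝ) + 2))
  convert! (((h1.add (hs (fun j => (j : ℝ) - 1) fun j => j)).smul_const (basisVec (n + 1) 0)).add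
    ((h2.sub (hs (fun j => (j : ℝ)) fun j => j - 1)).smul_const (basisVec (n + 1) 1))).add
    (shiftL n).hasFDerivAt using 1
  ext1 Y
  simp only [germDeriv_apply, germRest_apply, nullImage, _root_.add_apply,
    ContinuousLinearMap.smulRight_apply, _root_.sub_apply,
    _root_.smul_apply, FunLike.coe_sum, Finset.sum_apply, coordL_apply,
    smul_eq_mul, hess]
  rw [← add_assoc]
  congr 1
  rw [smul_sub, smul_smul, Finset.sum_add_distrib, Finset.sum_add_distrib]
  have e1 : ∑ j ∈ Finset.Icc 2 k, coord X (j - 1) * (((j : ℝ) - 1) * (j * coord X 0 ^ (j - 1) * coord Y 0))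
      = (∑ j ∈ Finset.Icc 2 k, (j : ℝ) * ((j : ℝ) - 1) * coord X 0 ^ (j - 2) * coord X (j - 1))
        * coord Y 0 * coord X 0 := by
    rw [Finset.sum_mul, Finset.sum_mul]
    refine Finset.sum_congr rfl fun j hj => ?_
    obtain ⟨i, rfl⟩ : ∃ i, j = i + 2 := ⟨j - 2, by have := (Finset.mem_Icc.1 hj).1; omega⟩
    simp only [Nat.add_sub_cancel, show i + 2 - 1 = i + 1 from rfl]
    ring
  have e2 : ∑ j ∈ Finset.Icc 2 k, coord X (j - 1) * ((j : ℝ) * (((j - 1 : ℕ) : ℝ) * coord X 0 ^ (j - 1 - 1) * coord Y 0))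
      = (∑ j ∈ Finset.Icc 2 k, (j : ℝ) * ((j : ℝ) - 1) * coord X 0 ^ (j - 2) * coord X (j - 1))
        * coord Y 0 := by
    rw [Finset.sum_mul]
    refine Finset.sum_congr rfl fun j hj => ?_
    obtain ⟨i, rfl⟩ : ∃ i, j = i + 2 := ⟨j - 2, by have := (Finset.mem_Icc.1 hj).1; omega⟩
    simp only [Nat.add_sub_cancel, show i + 2 - 1 = i + 1 from rfl]
    push_cast; ring
  rw [e1, e2]
  simp only [nsmul_eq_mul, Nat.add_sub_cancel, show k + 2 - 1 = k + 1 from rfl]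
  push_cast
  module

theorem conormal_basisVec_zero (n k : ℕ) (τ : ℝ) : conormal (n + 1) k τ (basisVec (n + 1) 0) = 1 := by
  rw [conormal_apply, Finset.sum_eq_single 0] <;> simp +contextual [coord_basisVec]

theorem conormal_basisVec {n k i : ℕ} (hi : i ≤ k) (hk : k ≤ n) (τ : ℝ) :
    conormal (n + 1) k τ (basisVec (n + 1) i) = τ ^ i := by
  rw [conormal_apply, Finset.sum_eq_single i]
  · simp [coord_basisVec (show i < n + 1 by omega)]
  · intro b _ hb; simp [coord_basisVec (show i < n + 1 by omega), hb]
  · simp; omega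

theorem conormal'_basisVec {n k i : ℕ} (hi : i ≤ k) (hk : k ≤ n) (τ : ℝ) :
    conormal' (n + 1) k τ (basisVec (n + 1) i) = i * τ ^ (i - 1) := by
  rw [conormal'_apply, Finset.sum_eq_single i]
  · simp [coord_basisVec (show i < n + 1 by omega)]
  · intro b _ hb; simp [coord_basisVec (show i < n + 1 by omega), hb]
  · simp; omega

theorem conormal_nullImage {n k : ℕ} (h1 : 1 ≤ k) (hk : k ≤ n) (τ : ℝ) :
    conormal (n + 1) k τ (nullImage n τ) = 0 := by
  simp [nullImage, conormal_basisVec_zero, conormal_basisVec h1 hk]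

theorem conormal'_nullImage {n k : ℕ} (h1 : 1 ≤ k) (hk : k ≤ n) (τ : ℝ) :
    conormal' (n + 1) k τ (nullImage n τ) = -1 := by
  simp [nullImage, conormal'_basisVec (Nat.zero_le k) hk, conormal'_basisVec h1 hk]

theorem sum_shift {n k : ℕ} (hk : k ≤ n) (c : ℕ → ℝ) (Y : Euc n) :
    ∑ j ∈ Finset.range (k + 1), c j * coord (shiftL n Y) j
      = ∑ j ∈ Finset.Icc 2 k, c j * coord Y (j - 1) := by
  have : ∀ j ∈ Finset.range (k + 1), c j * coord (shiftL n Y) j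
      = if 2 ≤ j then c j * coord Y (j - 1) else 0 := by
    intro j hj
    rw [coord_shiftL Y (by have := Finset.mem_range.1 hj; omega)]; split_ifs <;> simp
  rw [Finset.sum_congr rfl this, ← Finset.sum_filter]
  refine Finset.sum_congr ?_ fun _ _ => rfl
  ext j; simp; omega

/-- For `2 ≤ j ≤ k` the column of `x_j` pairs to `(j - 1) τ^j - j τ^(j-1) τ + τ^j = 0`; for `j > k`
the conormal does not see the coordinate `j`. -/
theorem conormal_germRest {n k : ℕ} (h1 : 1 ≤ k) (hk : k ≤ n) (τ : ℝ) (Y : Euc n) :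
    conormal (n + 1) k τ (germRest n k τ Y) = 0 := by
  rw [germRest_apply, map_add, map_sub, map_smul, map_smul, conormal_basisVec_zero,
    conormal_basisVec h1 hk, conormal_apply]
  simp only [mul_comm (coord (shiftL n Y) _)]
  rw [sum_shift hk]
  simp only [smul_eq_mul, mul_one, pow_one]
  rw [Finset.sum_mul, ← Finset.sum_sub_distrib, ← Finset.sum_add_distrib]
  refine Finset.sum_eq_zero fun j hj => ?_
  obtain ⟨i, rfl⟩ : ∃ i, j = i + 2 := ⟨j - 2, by have := (Finset.mem_Icc.1 hj).1; omega⟩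
  simp only [show i + 2 - 1 = i + 1 from rfl]
  push_cast; ring

theorem conormal'_germRest {n k : ℕ} (h1 : 1 ≤ k) (hk : k ≤ n) (τ : ℝ) (Y : Euc n) :
    conormal' (n + 1) k τ (germRest n k τ Y) = 0 := by
  rw [germRest_apply, map_add, map_sub, map_smul, map_smul, conormal'_basisVec (Nat.zero_le k) hk,
    conormal'_basisVec h1 hk, conormal'_apply, sum_shift hk (fun j => (j : ℝ) * τ ^ (j - 1))]
  simp

theorem conormal_germDeriv {n k : ℕ} (h1 : 1 ≤ k) (hk : k ≤ n) (X Y : Euc n) :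
    conormal (n + 1) k (coord X 0) (germDeriv k X Y) = 0 := by
  simp [germDeriv_apply, conormal_nullImage h1 hk, conormal_germRest h1 hk]

/-- The derivative of the conormal kills all columns but the one of `t`. This pairing recovers
`hess` from the differential, and so makes it comparable between different normal forms. -/
theorem conormal'_germDeriv {n k : ℕ} (h1 : 1 ≤ k) (hk : k ≤ n) (X Y : Euc n) :
    conormal' (n + 1) k (coord X 0) (germDeriv k X Y) = -(hess k X * coord Y 0) := by
  simp [germDeriv_apply, conormal'_nullImage h1 hk, conormal'_germRest h1 hk]

theorem coord_germRest {n k i : ℕ} (τ : ℝ) (Y : Euc n) (h2 : 2 ≤ i) (hi : i < n + 1) :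
    coord (germRest n k τ Y) i = coord Y (i - 1) := by
  rw [germRest_apply, coord_add, coord_sub, coord_smul, coord_smul, coord_shiftL Y hi,
    coord_basisVec (by omega), coord_basisVec (by omega)]
  simp [h2, show i ≠ 0 by omega, show i ≠ 1 by omega]

theorem coord_nullImage {n i : ℕ} (τ : ℝ) (h2 : 2 ≤ i) (hn : 0 < n) :
    coord (nullImage n τ) i = 0 := by
  rw [nullImage, coord_sub, coord_smul, coord_basisVec (by omega), coord_basisVec (by omega)]
  simp [show i ≠ 0 by omega, show i ≠ 1 by omega]

/-- A vector all of whose coordinates but the first vanish. -/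
theorem germRest_eq_zero {n : ℕ} (k : ℕ) (τ : ℝ) {Y : Euc n} (hY : ∀ j, 1 ≤ j → coord Y j = 0) :
    germRest n k τ Y = 0 := by
  have hs : ∀ c : ℕ → ℝ, ∑ j ∈ Finset.Icc 2 k, c j * coord Y (j - 1) = 0 := fun c =>
    Finset.sum_eq_zero fun j hj => by
      rw [hY _ (by have := (Finset.mem_Icc.1 hj).1; omega), mul_zero]
  rw [germRest_apply, hs, hs]
  refine coord_ext fun i hi => ?_
  rw [coord_add, coord_shiftL _ hi]
  split_ifs with h
  · rw [hY _ (by omega)]; simp [coord_zero]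
  · simp [coord_zero]

/-- The coordinates of the image from `2` on return the coordinates of `Y` from `1` on, and the
pairing with `conormal'` returns the remaining one times `hess`. -/
theorem germDeriv_eq_zero_iff {n k : ℕ} (hn : 0 < n) (h1 : 1 ≤ k) (hk : k ≤ n) (X Y : Euc n) :
    germDeriv k X Y = 0 ↔ (∀ j, 1 ≤ j → coord Y j = 0) ∧ hess k X * coord Y 0 = 0 := by
  constructor
  · intro h
    refine ⟨fun j hj => ?_, ?_⟩
    · by_cases hjn : j < n
      · have := congrArg (fun z => coord z (j + 1)) h
        simp only [germDeriv_apply, coord_add, coord_smul, coord_zero] at this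
        rwa [coord_germRest _ _ (by omega) (by omega), coord_nullImage _ (by omega) hn, mul_zero,
          zero_add] at this
      · simp [coord, hjn]
    · have := conormal'_germDeriv h1 hk X Y
      rw [h, map_zero] at this; linarith
  · rintro ⟨h, h0⟩
    rw [germDeriv_apply, h0, germRest_eq_zero k _ h]; simp

theorem injective_germDeriv_iff {n k : ℕ} (hn : 0 < n) (h1 : 1 ≤ k) (hk : k ≤ n) (X : Euc n) :
    Function.Injective (germDeriv k X) ↔ hess k X ≠ 0 := by
  rw [injective_iff_map_eq_zero]
  constructor
  · intro h h0
    have := h (basisVec n 0) ((germDeriv_eq_zero_iff hn h1 hk X _).2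
      ⟨fun j hj => by rw [coord_basisVec hn]; simp; omega, by simp [h0]⟩)
    have := congrArg (fun z => coord z 0) this
    simp [coord_basisVec hn, coord_zero] at this
  · intro h Y hY
    obtain ⟨h2, h3⟩ := (germDeriv_eq_zero_iff hn h1 hk X Y).1 hY
    refine coord_ext fun j _ => ?_
    rw [coord_zero]
    rcases j with _ | j
    · exact (mul_eq_zero.1 h3).resolve_left h
    · exact h2 _ (by omega)

/-- The functionals that vanish on the image of the differential at a regular point are the
multiples of the conormal. -/
theorem eq_smul_conormal {n k : ℕ} (hn : 0 < n) (h1 : 1 ≤ k) (hk : k ≤ n) {X : Euc n}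
    (hX : hess k X ≠ 0) (β : Euc (n + 1) →L[ℝ] ℝ) (hβ : ∀ Y, β (germDeriv k X Y) = 0) :
    β = β (basisVec (n + 1) 0) • conormal (n + 1) k (coord X 0) := by
  set τ := coord X 0
  -- At a regular point the factor `hess` of the first column can be divided out.
  have hw : β (nullImage n τ) = 0 := by
    have := hβ (basisVec n 0)
    rw [germDeriv_apply, germRest_eq_zero k τ (fun j hj => by rw [coord_basisVec hn]; simp; omega),
      coord_basisVec hn] at this
    simpa [hX] using this
  have hR : ∀ Y, β (germRest n k τ Y) = 0 := by
    intro Y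
    have := hβ Y
    rw [germDeriv_apply, map_add, map_smul, hw] at this
    simpa using this
  have hb1 : β (basisVec (n + 1) 1) = τ * β (basisVec (n + 1) 0) := by
    rw [nullImage, map_sub, map_smul, smul_eq_mul] at hw; linarith
  have hsum : ∀ u : Euc (n + 1), u = ∑ i ∈ Finset.range (n + 1), coord u i • basisVec (n + 1) i := by
    intro u
    refine coord_ext fun j hj => ?_
    rw [coord_sum, Finset.sum_eq_single j]
    · simp [coord_smul, coord_basisVec hj]
    · intro b hb hbj
      rw [coord_smul, coord_basisVec (Finset.mem_range.1 hb), if_neg (Ne.symm hbj), mul_zero]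
    · intro h; exact absurd (Finset.mem_range.2 hj) h
  -- Vanishing on `nullImage` gives `β e_1 = τ β e_0`. Vanishing on the column of `x_i` then gives
  -- `β e_i = τ^i β e_0` for `2 ≤ i ≤ k` and `β e_i = 0` for `i > k`.
  have key : ∀ i < n + 1, β (basisVec (n + 1) i)
      = β (basisVec (n + 1) 0) * conormal (n + 1) k τ (basisVec (n + 1) i) := by
    intro i hi
    rcases Nat.lt_or_ge i 2 with h | h
    · interval_cases i
      · rw [conormal_basisVec_zero, mul_one]
      · rw [conormal_basisVec h1 hk, hb1]; ring
    · have hr := hR (basisVec n (i - 1))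
      have hsh : shiftL n (basisVec n (i - 1)) = basisVec (n + 1) i := by
        refine coord_ext fun j hj => ?_
        rw [coord_shiftL _ hj, coord_basisVec (by omega), coord_basisVec hi]
        split_ifs <;> first | rfl | omega
      have hs : ∀ c : ℕ → ℝ, ∑ j ∈ Finset.Icc 2 k, c j * coord (basisVec n (i - 1)) (j - 1)
          = if i ≤ k then c i else 0 := by
        intro c
        have : ∀ j ∈ Finset.Icc 2 k, c j * coord (basisVec n (i - 1)) (j - 1)
            = if i = j then c j else 0 := by
          intro j hj
          have hj2 := (Finset.mem_Icc.1 hj).1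
          rw [coord_basisVec (by omega)]
          by_cases hij : i = j
          · simp [hij]
          · rw [if_neg (by omega), if_neg hij, mul_zero]
        rw [Finset.sum_congr rfl this, Finset.sum_ite_eq]
        simp [h]
      rw [germRest_apply, hs, hs, hsh, map_add, map_sub, map_smul, map_smul, hb1] at hr
      by_cases hik : i ≤ k
      · rw [conormal_basisVec hik hk]
        simp only [hik, if_true, smul_eq_mul] at hr
        obtain ⟨m, rfl⟩ : ∃ m, i = m + 1 := ⟨i - 1, by omega⟩
        simp only [Nat.add_sub_cancel] at hr
        rw [pow_succ] at hr ⊢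
        linear_combination hr
      · simp only [hik, if_false, zero_smul, sub_zero, zero_add] at hr
        rw [hr, conormal_apply, Finset.sum_eq_zero, mul_zero]
        intro j hj
        rw [coord_basisVec hi, if_neg (by have := Finset.mem_range.1 hj; omega), zero_mul]
  ext u
  rw [hsum u]
  simp only [map_sum, map_smul, _root_.smul_apply, smul_eq_mul]
  exact Finset.sum_congr rfl fun i hi => by rw [key i (Finset.mem_range.1 hi)]

/-! ### Roots of the versal unfolding -/

/-- The versal unfolding as a polynomial. -/
noncomputable def unfoldingPoly {d : ℕ} (k : ℕ) (u : Euc d) : Polynomial ℝ :=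
  Polynomial.X ^ (k + 2) +
    ∑ j ∈ Finset.range (k + 1), Polynomial.C (coord u j) * Polynomial.X ^ j

theorem eval_unfoldingPoly {d : ℕ} (k : ℕ) (u : Euc d) (τ : ℝ) :
    (unfoldingPoly k u).eval τ = versalUnfolding k u τ := by
  simp [unfoldingPoly, versalUnfolding, Polynomial.eval_finsetSum]

theorem unfoldingPoly_ne_zero {d : ℕ} (k : ℕ) (u : Euc d) : unfoldingPoly k u ≠ 0 := by
  refine (Polynomial.monic_X_pow_add ?_).ne_zero
  refine (Polynomial.degree_sum_le _ _).trans_lt ?_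
  rw [Finset.sup_lt_iff (WithBot.bot_lt_coe _)]
  intro j hj
  refine (Polynomial.degree_C_mul_X_pow_le _ _).trans_lt ?_
  have := Finset.mem_range.1 hj
  exact_mod_cast (by omega : j < k + 2)

/-- `rootCount` is an `ncard`, which would be `0` on an infinite set; a nonzero polynomial excludes
this. -/
theorem finite_roots {d : ℕ} (k : ℕ) (u : Euc d) (τ δ : ℝ) :
    {s : ℝ | |s - τ| < δ ∧ versalUnfolding k u s = 0}.Finite := by
  refine ((unfoldingPoly k u).roots.toFinset.finite_toSet).subset fun s hs => ?_
  simp [Polynomial.mem_roots (unfoldingPoly_ne_zero k u), Polynomial.IsRoot, eval_unfoldingPoly,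
    hs.2]

/-- The polynomial and its derivative vanish at `t = coord X 0`, and its second derivative there is
`hess`. Dividing twice by `τ - t` leaves the continuous cofactor `q`, with half of that second
derivative as its value at `t`. -/
theorem exists_double_root {n k : ℕ} (hn : 0 < n) (h1 : 1 ≤ k) (hk : k ≤ n) (X : Euc n) :
    ∃ q : ℝ → ℝ, Continuous q ∧ q (coord X 0) = hess k X / 2 ∧
      ∀ τ, versalUnfolding k (frontGerm k X) τ = (τ - coord X 0) ^ 2 * q τ := by
  set t := coord X 0
  set u := frontGerm k X with hu
  set P := unfoldingPoly k u
  have hc : ∀ j ∈ Finset.range (k + 1), coord u j = (((k : ℝ) + 1) * t ^ (k + 2)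
        + ∑ j ∈ Finset.Icc 2 k, ((j : ℝ) - 1) * t ^ j * coord X (j - 1)) * (if j = 0 then 1 else 0)
      + (-((k : ℝ) + 2) * t ^ (k + 1)
        - ∑ j ∈ Finset.Icc 2 k, (j : ℝ) * t ^ (j - 1) * coord X (j - 1)) * (if j = 1 then 1 else 0)
      + coord (shiftL n X) j := by
    intro j hj
    rw [hu, frontGerm_eq hn, coord_add, coord_add, coord_smul, coord_smul,
      coord_basisVec (by omega), coord_basisVec (by omega)]
  have hsum : ∀ c : ℕ → ℝ, ∑ j ∈ Finset.range (k + 1), c j * coord u j =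
      (((k : ℝ) + 1) * t ^ (k + 2)
        + ∑ j ∈ Finset.Icc 2 k, ((j : ℝ) - 1) * t ^ j * coord X (j - 1)) * c 0
      + (-((k : ℝ) + 2) * t ^ (k + 1)
        - ∑ j ∈ Finset.Icc 2 k, (j : ℝ) * t ^ (j - 1) * coord X (j - 1)) * c 1
      + ∑ j ∈ Finset.Icc 2 k, c j * coord X (j - 1) := by
    intro c
    have hsh := sum_shift hk c X
    rw [← hsh, Finset.sum_congr rfl fun j hj => by rw [hc j hj]]
    simp only [mul_add, Finset.sum_add_distrib]
    congr 2
    · rw [Finset.sum_eq_single 0] <;> simp +contextual [mul_comm]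
    · rw [Finset.sum_eq_single 1]
      · simp [mul_comm]
      · simp +contextual
      · intro h; simp at h; omega
  have e0 : P.eval t = 0 := by
    simp only [P, unfoldingPoly, Polynomial.eval_add, Polynomial.eval_pow, Polynomial.eval_X,
      Polynomial.eval_finsetSum, Polynomial.eval_mul, Polynomial.eval_C]
    simp only [mul_comm (coord u _)]
    rw [hsum fun j => t ^ j]
    have : ∑ j ∈ Finset.Icc 2 k, ((j : ℝ) - 1) * t ^ j * coord X (j - 1)
      - (∑ j ∈ Finset.Icc 2 k, (j : ℝ) * t ^ (j - 1) * coord X (j - 1)) * t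
      + ∑ j ∈ Finset.Icc 2 k, t ^ j * coord X (j - 1) = 0 := by
      rw [Finset.sum_mul, ← Finset.sum_sub_distrib, ← Finset.sum_add_distrib]
      refine Finset.sum_eq_zero fun j hj => ?_
      obtain ⟨i, rfl⟩ : ∃ i, j = i + 2 := ⟨j - 2, by have := (Finset.mem_Icc.1 hj).1; omega⟩
      simp only [show i + 2 - 1 = i + 1 from rfl]
      push_cast; ring
    linear_combination this
  have e1 : P.derivative.eval t = 0 := by
    simp only [P, unfoldingPoly, Polynomial.derivative_add, Polynomial.derivative_X_pow,
      Polynomial.derivative_sum, Polynomial.derivative_C_mul_X_pow,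
      Polynomial.eval_add, Polynomial.eval_pow, Polynomial.eval_X,
      Polynomial.eval_finsetSum, Polynomial.eval_mul, Polynomial.eval_C, mul_assoc]
    simp only [mul_comm (coord u _)]
    rw [hsum fun j => (j : ℝ) * t ^ (j - 1)]
    simp only [show k + 2 - 1 = k + 1 from rfl]
    push_cast
    ring
  have e2 : P.derivative.derivative.eval t = hess k X := by
    simp only [P, unfoldingPoly, Polynomial.derivative_add, Polynomial.derivative_X_pow,
      Polynomial.derivative_sum, Polynomial.derivative_C_mul,
      Polynomial.eval_add, Polynomial.eval_pow, Polynomial.eval_X,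
      Polynomial.eval_finsetSum, Polynomial.eval_mul, Polynomial.eval_C]
    simp only [mul_comm (coord u _)]
    simp only [mul_assoc]
    have := hsum fun j => (j : ℝ) * (((j - 1 : ℕ) : ℝ) * t ^ (j - 1 - 1))
    simp only [mul_assoc] at this
    rw [this, hess]
    simp only [show k + 2 - 1 = k + 1 from rfl, Nat.add_sub_cancel]
    have : ∑ j ∈ Finset.Icc 2 k, (j : ℝ) * (((j - 1 : ℕ) : ℝ) * (t ^ (j - 1 - 1) * coord X (j - 1)))
        = ∑ j ∈ Finset.Icc 2 k, (j : ℝ) * ((j : ℝ) - 1) * t ^ (j - 2) * coord X (j - 1) := by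
      refine Finset.sum_congr rfl fun j hj => ?_
      obtain ⟨i, rfl⟩ : ∃ i, j = i + 2 := ⟨j - 2, by have := (Finset.mem_Icc.1 hj).1; omega⟩
      simp only [show i + 2 - 1 = i + 1 from rfl, Nat.add_sub_cancel]
      push_cast; ring
    rw [this]
    push_cast; ring
  obtain ⟨R, hR⟩ := Polynomial.dvd_iff_isRoot.2 e0
  rw [hR] at e1 e2
  have e1' : R.eval t = 0 := by simpa using e1
  obtain ⟨Q, hQ⟩ := Polynomial.dvd_iff_isRoot.2 e1'
  refine ⟨fun τ => Q.eval τ, Q.continuous, ?_, fun τ => ?_⟩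
  · rw [hQ] at e2
    simp at e2
    change Q.eval t = _
    linarith
  · rw [← eval_unfoldingPoly]
    change P.eval τ = _
    rw [hR, hQ]; simp; ring

/-- Near `t` the values of `q` and `p` have the same sign, so the product of the perturbed function
with `p` is positive. -/
theorem eventually_no_root {p q : ℝ → ℝ} (hp : Continuous p) (hq : Continuous q) {t : ℝ}
    (h : 0 < q t * p t) :
    ∀ᶠ δ in 𝓝[>] (0 : ℝ), ∀ s > 0, ∀ τ, |τ - t| < δ → (τ - t) ^ 2 * q τ + s * p τ ≠ 0 := by
  have hev : ∀ᶠ τ in 𝓝 t, 0 < q τ * p τ := (hq.mul hp).continuousAt.eventually_const_lt h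
  obtain ⟨ε, hε, hb⟩ := Metric.eventually_nhds_iff.1 hev
  filter_upwards [Ioo_mem_nhdsGT hε] with δ hδ s hs τ hτ h0
  have hqp := hb (show dist τ t < ε by rw [Real.dist_eq]; exact hτ.trans hδ.2)
  have hp0 : p τ ≠ 0 := by rintro h; simp [h] at hqp
  have : 0 < ((τ - t) ^ 2 * q τ + s * p τ) * p τ := by
    have h1 : 0 < s * p τ ^ 2 := by positivity
    nlinarith [mul_nonneg (sq_nonneg (τ - t)) hqp.le]
  rw [h0] at this; simp at this

/-- At `t` the perturbed function has the sign of `p t`; at `t + δ / 2`, for small `s`, it has the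
opposite sign, that of `q`. The intermediate value theorem gives a root in between. -/
theorem eventually_root {p q : ℝ → ℝ} (hp : Continuous p) (hq : Continuous q) {t : ℝ}
    (h : q t * p t < 0) :
    ∀ᶠ δ in 𝓝[>] (0 : ℝ), ∀ᶠ s in 𝓝[>] (0 : ℝ), ∃ τ, |τ - t| < δ ∧
      (τ - t) ^ 2 * q τ + s * p τ = 0 := by
  have hev : ∀ᶠ τ in 𝓝 t, q τ * p t < 0 :=
    (hq.mul continuous_const).continuousAt.eventually_lt_const h
  obtain ⟨ε, hε, hb⟩ := Metric.eventually_nhds_iff.1 hev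
  filter_upwards [Ioo_mem_nhdsGT hε] with δ hδ
  have h1 := hb (show dist (t + δ / 2) t < ε by
    rw [Real.dist_eq, add_sub_cancel_left, abs_of_pos (by linarith [hδ.1])]; linarith [hδ.1, hδ.2])
  have h2 : ∀ᶠ s in 𝓝 (0 : ℝ),
      ((t + δ / 2 - t) ^ 2 * q (t + δ / 2) + s * p (t + δ / 2)) * p t < 0 := by
    have hc : ContinuousAt (fun s : ℝ =>
        ((t + δ / 2 - t) ^ 2 * q (t + δ / 2) + s * p (t + δ / 2)) * p t) 0 := by fun_prop
    refine hc.eventually_lt_const ?_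
    have : 0 < (δ / 2) ^ 2 := by have := hδ.1; positivity
    simp only [add_sub_cancel_left, zero_mul, add_zero]
    nlinarith
  filter_upwards [h2.filter_mono nhdsWithin_le_nhds, self_mem_nhdsWithin] with s hs hs0
  have hs0 : 0 < s := hs0
  have hcont : ContinuousOn (fun τ => ((τ - t) ^ 2 * q τ + s * p τ) * p t) (Icc t (t + δ / 2)) := by
    fun_prop
  have hpt : p t ≠ 0 := by rintro h0; simp [h0] at h
  obtain ⟨τ, hτ, hτ0⟩ := intermediate_value_Icc' (by linarith [hδ.1]) hcont
    (show (0 : ℝ) ∈ Icc _ _ from ⟨hs.le, by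
      simp only [sub_self, ne_eq, OfNat.ofNat_ne_zero, not_false_eq_true, zero_pow, zero_mul,
        zero_add]
      have := sq_nonneg (p t)
      nlinarith⟩)
  refine ⟨τ, ?_, (mul_eq_zero.1 hτ0).resolve_right hpt⟩
  rw [abs_of_nonneg (by linarith [hτ.1])]
  linarith [hτ.2, hδ.1]

/-- Moving the parameter by `s • v` adds `s * conormal τ v` to `(τ - t)^2 q τ`. If the signs of `q`
and of this perturbation are opposite, a real root survives for `v`, and none is left for `-v`. -/
theorem increasesRoots_of_neg {n k : ℕ} (hn : 0 < n) (h1 : 1 ≤ k) (hk : k ≤ n) (X : Euc n)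
    (v : Euc (n + 1)) (h : hess k X * conormal (n + 1) k (coord X 0) v < 0) :
    IncreasesRoots k (frontGerm k X) (coord X 0) v := by
  obtain ⟨q, hq, hqt, hF⟩ := exists_double_root hn h1 hk X
  set t := coord X 0
  set p : ℝ → ℝ := fun τ => conormal (n + 1) k τ v with hp
  have hpc : Continuous p := by
    have := (contDiff_conormal (n + 1) k (m := 0)).continuous
    exact this.clm_apply continuous_const
  have hpert : ∀ s τ : ℝ, versalUnfolding k (frontGerm k X + s • v) τ
      = (τ - t) ^ 2 * q τ + s * p τ := by
    intro s τ
    have := hF τ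
    rw [versalUnfolding_eq] at this ⊢
    rw [map_add, map_smul, smul_eq_mul, ← add_assoc, this]
  have hpert' : ∀ s τ : ℝ, versalUnfolding k (frontGerm k X - s • v) τ
      = (τ - t) ^ 2 * q τ + s * (-p τ) := by
    intro s τ
    have := hpert (-s) τ
    rw [neg_smul, ← sub_eq_add_neg] at this
    rw [this]; ring
  filter_upwards [eventually_root hpc hq (t := t) (by rw [hqt]; change _ * conormal _ _ _ _ < 0; linarith),
    eventually_no_root hpc.neg hq (t := t)
      (by rw [hqt]; change 0 < _ * (-conormal _ _ _ _); linarith)] with δ hδ1 hδ2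
  filter_upwards [hδ1, self_mem_nhdsWithin] with s hs hs0
  have h0 : rootCount k (frontGerm k X - s • v) t δ = 0 := by
    unfold rootCount
    rw [Set.ncard_eq_zero (finite_roots _ _ _ _), Set.eq_empty_iff_forall_notMem]
    rintro τ ⟨hτ, hτ0⟩
    rw [hpert'] at hτ0
    exact hδ2 s hs0 τ hτ hτ0
  rw [h0]
  unfold rootCount
  rw [Set.ncard_pos (finite_roots _ _ _ _)]
  obtain ⟨τ, hτ, hτ0⟩ := hs
  exact ⟨τ, hτ, by rw [hpert]; exact hτ0⟩

/-- If the sign is the wrong one, it is the right one for `-v`, and the root count cannot increase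
in both directions. -/
theorem increasesRoots_iff {n k : ℕ} (hn : 0 < n) (h1 : 1 ≤ k) (hk : k ≤ n) (X : Euc n)
    (v : Euc (n + 1)) (h : hess k X * conormal (n + 1) k (coord X 0) v ≠ 0) :
    IncreasesRoots k (frontGerm k X) (coord X 0) v ↔
      hess k X * conormal (n + 1) k (coord X 0) v < 0 := by
  refine ⟨fun hi => ?_, increasesRoots_of_neg hn h1 hk X v⟩
  by_contra hlt
  have hpos := lt_of_le_of_ne (not_lt.1 hlt) h.symm
  have hi' := increasesRoots_of_neg hn h1 hk X (-v) (by rw [map_neg]; linarith)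
  obtain ⟨δ, hδ1, hδ2⟩ := (hi.and hi').exists
  obtain ⟨s, hs1, hs2⟩ := (hδ1.and hδ2).exists
  simp only [smul_neg, sub_neg_eq_add, ← sub_eq_add_neg] at hs2
  omega

/-! ### A null curve in the singular set at the centre of a higher singularity -/

/-- At the centre of an `A_{k+1}`-singularity with `k ≥ 2`, there is a curve in the singular set
that is tangent to the null direction. -/
theorem exists_null_curve {n k : ℕ} (h2 : 2 ≤ k) (hk : k ≤ n) :
    ∃ r : ℝ → Euc n, r 0 = 0 ∧ HasDerivAt r (basisVec n 0) 0 ∧ (∀ t, hess k (r t) = 0) := by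
  -- With all other variables zero, `hess` is `(k + 2) (k + 1) t^k + 2 x_2`, which is solved for
  -- `x_2`. As `k ≥ 2`, the correction has derivative zero at `0`.
  refine ⟨fun t => t • basisVec n 0 - ((((k : ℝ) + 2) * (k + 1) / 2) * t ^ k) • basisVec n 1,
    ?_, ?_, fun t => ?_⟩
  · simp [show k ≠ 0 by omega]
  · have h3 := ((hasDerivAt_id (0 : ℝ)).smul_const (basisVec n 0)).sub
      (((hasDerivAt_pow k (0 : ℝ)).const_mul (((k : ℝ) + 2) * (k + 1) / 2)).smul_const (basisVec n 1))
    convert! h3 using 1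
    simp [show k - 1 ≠ 0 by omega]
  · have hc : ∀ j, coord (t • basisVec n 0 - ((((k : ℝ) + 2) * (k + 1) / 2) * t ^ k) • basisVec n 1) j
        = if j = 0 then t else if j = 1 then -((((k : ℝ) + 2) * (k + 1) / 2) * t ^ k) else 0 := by
      intro j
      rw [coord_sub, coord_smul, coord_smul, coord_basisVec (by omega), coord_basisVec (by omega)]
      rcases j with _ | _ | j <;> simp
    unfold hess
    rw [hc 0, if_pos rfl, Finset.sum_eq_single 2]
    · rw [hc (2 - 1)]; simp; ring
    · intro j hj hj2
      have := (Finset.mem_Icc.1 hj).1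
      rw [hc (j - 1), if_neg (by omega), if_neg (by omega), mul_zero]
    · intro h; simp at h; omega

/-! ### Charts of manifolds -/

section Charts

variable {d : ℕ} {X : Type*} [TopologicalSpace X] [ChartedSpace (Euc d) X]

/-- The derivative of a chart. -/
noncomputable abbrev chartDeriv (e : OpenPartialHomeomorph X (Euc d)) (q : X) :
    TangentSpace (𝓡 d) q →L[ℝ] Euc d :=
  mfderiv (𝓡 d) 𝓘(ℝ, Euc d) e q

/-- The derivative of the inverse of a chart. -/
noncomputable abbrev chartDerivSymm (e : OpenPartialHomeomorph X (Euc d)) (z : Euc d) :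
    Euc d →L[ℝ] TangentSpace (𝓡 d) (e.symm z) :=
  mfderiv 𝓘(ℝ, Euc d) (𝓡 d) e.symm z

theorem mdifferentiable_of_mem_maximalAtlas {e : OpenPartialHomeomorph X (Euc d)}
    (he : e ∈ IsManifold.maximalAtlas (𝓡 d) ∞ X) : e.MDifferentiable (𝓡 d) (𝓡 d) :=
  ⟨(contMDiffOn_of_mem_maximalAtlas he).mdifferentiableOn (by simp),
    (contMDiffOn_symm_of_mem_maximalAtlas he).mdifferentiableOn (by simp)⟩

theorem chartDerivSymm_chartDeriv {e : OpenPartialHomeomorph X (Euc d)}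
    (he : e ∈ IsManifold.maximalAtlas (𝓡 d) ∞ X) {q : X} (hq : q ∈ e.source)
    (v : TangentSpace (𝓡 d) q) : (chartDerivSymm e (e q) (chartDeriv e q v) : Euc d) = v := by
  have := (mdifferentiable_of_mem_maximalAtlas he).symm_comp_deriv hq
  exact congrArg (fun L : Euc d →L[ℝ] Euc d => L v) this

theorem chartDeriv_chartDerivSymm {e : OpenPartialHomeomorph X (Euc d)}
    (he : e ∈ IsManifold.maximalAtlas (𝓡 d) ∞ X) {z : Euc d} (hz : z ∈ e.target)
    (v : Euc d) : chartDeriv e (e.symm z) (chartDerivSymm e z v) = v := by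
  have := (mdifferentiable_of_mem_maximalAtlas he).comp_symm_deriv hz
  exact congrArg (fun L : Euc d →L[ℝ] Euc d => L v) this

theorem chartDeriv_injective {e : OpenPartialHomeomorph X (Euc d)}
    (he : e ∈ IsManifold.maximalAtlas (𝓡 d) ∞ X) {q : X} (hq : q ∈ e.source) :
    Function.Injective (chartDeriv e q) :=
  (mdifferentiable_of_mem_maximalAtlas he).mfderiv_injective hq

theorem chartDeriv_surjective {e : OpenPartialHomeomorph X (Euc d)}
    (he : e ∈ IsManifold.maximalAtlas (𝓡 d) ∞ X) {q : X} (hq : q ∈ e.source) :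
    Function.Surjective (chartDeriv e q) :=
  (mdifferentiable_of_mem_maximalAtlas he).mfderiv_surjective hq

variable [IsManifold (𝓡 d) ∞ X]

/-- The metric in the chart `e`. -/
noncomputable def gram (g : RiemMetric d X) (e : OpenPartialHomeomorph X (Euc d)) (z : Euc d) :
    Euc d →L[ℝ] Euc d →L[ℝ] ℝ :=
  let A : Euc d →L[ℝ] Euc d := chartDerivSymm e z
  let B : Euc d →L[ℝ] Euc d →L[ℝ] ℝ := g.inner (e.symm z)
  B.bilinearComp A A

theorem gram_apply (g : RiemMetric d X) (e : OpenPartialHomeomorph X (Euc d)) (z a b : Euc d) :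
    gram g e z a b = g.inner (e.symm z) (chartDerivSymm e z a) (chartDerivSymm e z b) := rfl

theorem gram_symm (g : RiemMetric d X) (e : OpenPartialHomeomorph X (Euc d)) (z a b : Euc d) :
    gram g e z a b = gram g e z b a := by
  rw [gram_apply, gram_apply, g.symm]

theorem inner_congr_base (g : RiemMetric d X) {y q : X} (h : y = q) (v w : Euc d) :
    g.inner y v w = g.inner q v w := by
  subst h; rfl

theorem gram_chartDeriv (g : RiemMetric d X) {e : OpenPartialHomeomorph X (Euc d)}
    (he : e ∈ IsManifold.maximalAtlas (𝓡 d) ∞ X) {q : X} (hq : q ∈ e.source)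
    (v w : TangentSpace (𝓡 d) q) :
    gram g e (e q) (chartDeriv e q v) (chartDeriv e q w) = g.inner q v w := by
  rw [gram_apply]
  have h1 := chartDerivSymm_chartDeriv he hq v
  have h2 := chartDerivSymm_chartDeriv he hq w
  refine Eq.trans ?_ (inner_congr_base g (e.left_inv hq) v w)
  exact congrArg₂ (fun a b : Euc d => g.inner (e.symm (e q)) a b) h1 h2

theorem gram_pos (g : RiemMetric d X) {e : OpenPartialHomeomorph X (Euc d)}
    (he : e ∈ IsManifold.maximalAtlas (𝓡 d) ∞ X) {z : Euc d} (hz : z ∈ e.target) {a : Euc d}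
    (ha : a ≠ 0) : 0 < gram g e z a a := by
  rw [gram_apply]
  refine g.pos _ _ fun h => ha ?_
  rw [← chartDeriv_chartDerivSymm he hz a, h, map_zero]

theorem contMDiffOn_chartDerivSymm {e : OpenPartialHomeomorph X (Euc d)}
    (he : e ∈ IsManifold.maximalAtlas (𝓡 d) ∞ X) (a : Euc d) :
    ContMDiffOn 𝓘(ℝ, Euc d) (𝓡 d).tangent ∞
      (fun z => (⟨e.symm z, chartDerivSymm e z a⟩ : TangentBundle (𝓡 d) X)) e.target := by
  have h1 := (contMDiffOn_symm_of_mem_maximalAtlas he).contMDiffOn_tangentMapWithin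
    (m := ∞) (by simp) e.open_target.uniqueMDiffOn
  have h2 : ContMDiff 𝓘(ℝ, Euc d) 𝓘(ℝ, Euc d).tangent ∞
      (fun z => (⟨z, a⟩ : TangentBundle 𝓘(ℝ, Euc d) (Euc d))) :=
    contMDiff_vectorSpace_iff_contDiff.2 contDiff_const
  refine (h1.comp h2.contMDiffOn (fun z hz => hz)).congr fun z hz => ?_
  simp only [Function.comp, tangentMapWithin]
  rw [mfderivWithin_of_isOpen e.open_target hz]
  rfl

theorem contDiffOn_gram (g : RiemMetric d X) {e : OpenPartialHomeomorph X (Euc d)}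
    (he : e ∈ IsManifold.maximalAtlas (𝓡 d) ∞ X) : ContDiffOn ℝ ∞ (gram g e) e.target := by
  refine contDiffOn_clm_apply.2 fun a => contDiffOn_clm_apply.2 fun b => ?_
  rw [← contMDiffOn_iff_contDiffOn]
  have hg : ContMDiffOn 𝓘(ℝ, Euc d) _ ∞ _ e.target :=
    g.contMDiff.comp_contMDiffOn (contMDiffOn_symm_of_mem_maximalAtlas he)
  have := ContMDiffOn.clm_bundle_apply₂ (F₁ := Euc d) (F₂ := Euc d) (F₃ := ℝ)
    (E₃ := Bundle.Trivial X ℝ) hg (contMDiffOn_chartDerivSymm he a) (contMDiffOn_chartDerivSymm he b)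
  intro z hz
  exact (Bundle.contMDiffWithinAt_totalSpace.1 (this z hz)).2

end Charts

/-! ### Vector fields along maps, read in a chart -/

section FieldsAlong

variable {d m : ℕ} {X : Type*} [TopologicalSpace X] [ChartedSpace (Euc d) X]
  [IsManifold (𝓡 d) ∞ X]
  {Y : Type*} [TopologicalSpace Y] [ChartedSpace (Euc m) Y]

theorem contMDiffAt_chartDeriv {r : ℕ∞ω} (hr : r + 1 ≤ ∞) {F : Y → X} {ν : ∀ y, TangentSpace (𝓡 d) (F y)} {y : Y}
    {e : OpenPartialHomeomorph X (Euc d)} (he : e ∈ IsManifold.maximalAtlas (𝓡 d) ∞ X)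
    (hy : F y ∈ e.source)
    (h : ContMDiffAt (𝓡 m) (𝓡 d).tangent r
      (fun y => (⟨F y, ν y⟩ : TangentBundle (𝓡 d) X)) y) :
    ContMDiffAt (𝓡 m) 𝓘(ℝ, Euc d) r (fun y => chartDeriv e (F y) (ν y)) y := by
  have h1 := (contMDiffOn_of_mem_maximalAtlas he).contMDiffOn_tangentMapWithin
    (m := r) hr e.open_source.uniqueMDiffOn
  have hmem : (⟨F y, ν y⟩ : TangentBundle (𝓡 d) X) ∈ Bundle.TotalSpace.proj ⁻¹' e.source := hy
  have hopen : IsOpen ((Bundle.TotalSpace.proj : TangentBundle (𝓡 d) X → X) ⁻¹' e.source) :=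
    e.open_source.preimage (FiberBundle.continuous_proj _ _)
  have h2 := (h1 _ hmem).contMDiffAt (hopen.mem_nhds hmem)
  have h3 := (contMDiff_snd_tangentBundle_modelSpace (Euc d) (𝓡 d) (n := r)).contMDiffAt.comp _
    (h2.comp y h)
  refine h3.congr_of_eventuallyEq ?_
  have : ∀ᶠ y' in 𝓝 y, F y' ∈ e.source :=
    h.continuousAt.eventually_mem (hopen.mem_nhds hmem)
  filter_upwards [this] with y' hy'
  simp only [Function.comp, tangentMapWithin]
  rw [mfderivWithin_of_isOpen e.open_source hy']
  rfl

end FieldsAlong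

section FieldsAlong

variable {d : ℕ} {X : Type*} [TopologicalSpace X] [ChartedSpace (Euc d) X]
  [IsManifold (𝓡 d) ∞ X] {T : Type*} [TopologicalSpace T]

theorem continuousWithinAt_chartDeriv {F : T → X} {ν : ∀ y, TangentSpace (𝓡 d) (F y)} {y : T}
    {s : Set T}
    {e : OpenPartialHomeomorph X (Euc d)} (he : e ∈ IsManifold.maximalAtlas (𝓡 d) ∞ X)
    (hy : F y ∈ e.source)
    (h : ContinuousWithinAt (fun y => (⟨F y, ν y⟩ : TangentBundle (𝓡 d) X)) s y) :
    ContinuousWithinAt (fun y => chartDeriv e (F y) (ν y)) s y := by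
  have h1 := (contMDiffOn_of_mem_maximalAtlas he).contMDiffOn_tangentMapWithin
    (m := 0) (by simp) e.open_source.uniqueMDiffOn
  have hmem : (⟨F y, ν y⟩ : TangentBundle (𝓡 d) X) ∈ Bundle.TotalSpace.proj ⁻¹' e.source := hy
  have hopen : IsOpen ((Bundle.TotalSpace.proj : TangentBundle (𝓡 d) X → X) ⁻¹' e.source) :=
    e.open_source.preimage (FiberBundle.continuous_proj _ _)
  have h2 := (h1 _ hmem).contMDiffAt (hopen.mem_nhds hmem)
  have h3 := (contMDiff_snd_tangentBundle_modelSpace (Euc d) (𝓡 d) (n := 0)).contMDiffAt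
    (x := tangentMapWithin (𝓡 d) (𝓡 d) e e.source ⟨F y, ν y⟩) |>.continuousAt
  have h4 := ContinuousAt.comp_continuousWithinAt
    (f := fun y => (⟨F y, ν y⟩ : TangentBundle (𝓡 d) X)) (h3.comp h2.continuousAt) h
  refine h4.congr_of_eventuallyEq ?_ ?_
  · have : ∀ᶠ y' in 𝓝[s] y, F y' ∈ e.source :=
      h.eventually (hopen.mem_nhds hmem)
    filter_upwards [this] with y' hy'
    simp only [Function.comp, tangentMapWithin]
    rw [mfderivWithin_of_isOpen e.open_source hy']
    rfl
  · simp only [Function.comp, tangentMapWithin]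
    rw [mfderivWithin_of_isOpen e.open_source hy]
    rfl

end FieldsAlong

/-! ### Normal forms of the front and its unit normals -/

section NormalForm

variable {n : ℕ}
  {M : Type*} [TopologicalSpace M] [ChartedSpace (Euc n) M]
  {N : Type*} [TopologicalSpace N] [ChartedSpace (Euc (n + 1)) N]

/-- Charts `e`, `e'`, not necessarily centred, in which `f` is the `A_{k+1}`-front singularity. -/
structure IsNormalFormOn (f : M → N) (k : ℕ) (e : OpenPartialHomeomorph M (Euc n))
    (e' : OpenPartialHomeomorph N (Euc (n + 1))) : Prop where
  pos : 0 < n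
  one_le : 1 ≤ k
  le : k ≤ n
  mem_atlas : e ∈ IsManifold.maximalAtlas (𝓡 n) ∞ M
  mem_atlas' : e' ∈ IsManifold.maximalAtlas (𝓡 (n + 1)) ∞ N
  mapsTo : MapsTo f e.source e'.source
  eq_germ : ∀ q ∈ e.source, e' (f q) = frontGerm k (e q)

theorem IsNormalFormAt.isNormalFormOn {f : M → N} {p : M} {k : ℕ}
    {e : OpenPartialHomeomorph M (Euc n)} {e' : OpenPartialHomeomorph N (Euc (n + 1))}
    (h : IsNormalFormAt f p k e e') (h1 : 1 ≤ k) (hk : k ≤ n) : IsNormalFormOn f k e e' :=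
  ⟨by omega, h1, hk, h.mem_atlas, h.mem_atlas', h.mapsTo, h.eq_germ⟩

variable {f : M → N} {k : ℕ} {e : OpenPartialHomeomorph M (Euc n)}
  {e' : OpenPartialHomeomorph N (Euc (n + 1))}

theorem IsNormalFormOn.chartDeriv_mfderiv (h : IsNormalFormOn f k e e')
    (hf : ContMDiff (𝓡 n) (𝓡 (n + 1)) ∞ f) {q : M} (hq : q ∈ e.source)
    (Y : TangentSpace (𝓡 n) q) :
    chartDeriv e' (f q) (mfderiv (𝓡 n) (𝓡 (n + 1)) f q Y) =
      germDeriv k (e q) (chartDeriv e q Y) := by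
  have h1 : HasMFDerivAt (𝓡 n) 𝓘(ℝ, Euc (n + 1)) (e' ∘ f) q _ :=
    HasMFDerivAt.comp q
      (((mdifferentiable_of_mem_maximalAtlas h.mem_atlas').mdifferentiableAt
        (h.mapsTo hq)).hasMFDerivAt)
      ((hf.mdifferentiable (by simp)) q).hasMFDerivAt
  have h2 : HasMFDerivAt (𝓡 n) 𝓘(ℝ, Euc (n + 1)) (frontGerm k ∘ e) q _ :=
    HasMFDerivAt.comp q (hasFDerivAt_frontGerm h.pos k (e q)).hasMFDerivAt
      (((mdifferentiable_of_mem_maximalAtlas h.mem_atlas).mdifferentiableAt hq).hasMFDerivAt)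
  have h3 : (e' ∘ f) =ᶠ[𝓝 q] (frontGerm k ∘ e) := by
    filter_upwards [e.open_source.mem_nhds hq] with q' hq'
    exact h.eq_germ q' hq'
  have h4 := hasMFDerivAt_unique h1 (h2.congr_of_eventuallyEq h3)
  exact congrArg (fun L : Euc n →L[ℝ] Euc (n + 1) => L Y) h4

theorem IsNormalFormOn.mem_singularSet_iff (h : IsNormalFormOn f k e e')
    (hf : ContMDiff (𝓡 n) (𝓡 (n + 1)) ∞ f) {q : M} (hq : q ∈ e.source) :
    q ∈ singularSet n f ↔ hess k (e q) = 0 := by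
  rw [← not_iff_not, ← ne_eq (hess k (e q)), ← injective_germDeriv_iff h.pos h.one_le h.le]
  simp only [singularSet, mem_ofPred_eq, not_not]
  constructor
  · intro hi a b hab
    obtain ⟨a, rfl⟩ := chartDeriv_surjective h.mem_atlas hq a
    obtain ⟨b, rfl⟩ := chartDeriv_surjective h.mem_atlas hq b
    rw [← h.chartDeriv_mfderiv hf hq, ← h.chartDeriv_mfderiv hf hq] at hab
    rw [hi (chartDeriv_injective h.mem_atlas' (h.mapsTo hq) hab)]
  · intro hi a b hab
    refine chartDeriv_injective h.mem_atlas hq (hi ?_)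
    rw [← h.chartDeriv_mfderiv hf hq, ← h.chartDeriv_mfderiv hf hq, hab]

/-- `hess` is affine along one coordinate: it contains `2 x_2` if `k ≥ 2`, and it is `6 t` if `k =
1`. This gives the density of the regular points, the straightening of the singular set, and points
of it that are needed later. -/
theorem hess_add_smul {n k : ℕ} (h1 : 1 ≤ k) (hk : k ≤ n) :
    ∃ b : Euc n, ∃ c : ℝ, 0 < c ∧ ∀ (X : Euc n) (s : ℝ), hess k (X + s • b) = hess k X + s * c := by
  rcases Nat.lt_or_ge 1 k with h | h
  · refine ⟨basisVec n 1, 2, by norm_num, fun X s => ?_⟩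
    have hc : ∀ j, coord (X + s • basisVec n 1) j = coord X j + if j = 1 then s else 0 := by
      intro j
      rw [coord_add, coord_smul, coord_basisVec (by omega)]; simp
    unfold hess
    rw [hc 0, Finset.sum_congr rfl fun j _ => by rw [hc (j - 1), mul_add], Finset.sum_add_distrib]
    rw [Finset.sum_eq_single (f := fun x : ℕ => (x : ℝ) * ((x : ℝ) - 1)
      * (coord X 0 + if 0 = 1 then s else 0) ^ (x - 2) * if x - 1 = 1 then s else 0) 2]
    · norm_num; ring
    · intro j hj hj2
      have := (Finset.mem_Icc.1 hj).1
      rw [if_neg (by omega : ¬ j - 1 = 1), mul_zero]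
    · intro h'; simp at h'; omega
  · obtain rfl : k = 1 := by omega
    refine ⟨basisVec n 0, 6, by norm_num, fun X s => ?_⟩
    have hc : coord (X + s • basisVec n 0) 0 = coord X 0 + s := by
      rw [coord_add, coord_smul, coord_basisVec (by omega)]; simp
    simp [hess, hc]
    ring

theorem dense_setOf_hess_ne_zero {n k : ℕ} (h1 : 1 ≤ k) (hk : k ≤ n) :
    Dense {X : Euc n | hess k X ≠ 0} := by
  obtain ⟨b, c, hc, hb⟩ := hess_add_smul h1 hk
  intro X
  by_cases hX : hess k X = 0
  · have hcont : Tendsto (fun s : ℝ => X + s • b) (𝓝[≠] 0) (𝓝 X) := by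
      have : ContinuousAt (fun s : ℝ => X + s • b) 0 := by fun_prop
      have h2 := this.tendsto
      simp only [zero_smul, add_zero] at h2
      exact h2.mono_left nhdsWithin_le_nhds
    refine mem_closure_of_tendsto hcont ?_
    filter_upwards [self_mem_nhdsWithin] with s hs
    have : s ≠ 0 := hs
    simp only [hb, hX, zero_add]
    positivity
  · exact subset_closure hX

theorem IsNormalFormOn.mem_closure (h : IsNormalFormOn f k e e')
    (hf : ContMDiff (𝓡 n) (𝓡 (n + 1)) ∞ f) {q : M} (hq : q ∈ e.source) :
    q ∈ closure (singularSet n f)ᶜ := by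
  have h1 : Tendsto e.symm (𝓝[{X | hess k X ≠ 0} ∩ e.target] (e q)) (𝓝 q) :=
    (e.tendsto_symm hq).mono_left nhdsWithin_le_nhds
  have hne : (𝓝[{X | hess k X ≠ 0} ∩ e.target] (e q)).NeBot := by
    rw [← mem_closure_iff_nhdsWithin_neBot, inter_comm]
    exact (dense_setOf_hess_ne_zero h.one_le h.le).open_subset_closure_inter e.open_target
      (e.map_source hq)
  refine mem_closure_of_tendsto h1 ?_
  filter_upwards [self_mem_nhdsWithin] with X hX
  rw [mem_compl_iff, h.mem_singularSet_iff hf (e.map_target hX.2), e.right_inv hX.2]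
  exact hX.1

theorem IsASingularity.exists_isNormalFormOn {p : M} (h : IsASingularity n f p k) (h1 : 1 ≤ k)
    (hk : k ≤ n) :
    ∃ (e : OpenPartialHomeomorph M (Euc n)) (e' : OpenPartialHomeomorph N (Euc (n + 1))),
      IsNormalFormOn f k e e' ∧ p ∈ e.source ∧ e p = 0 := by
  obtain ⟨e, e', he⟩ := h
  exact ⟨e, e', he.isNormalFormOn h1 hk, he.mem_source, he.center⟩

end NormalForm

/-! ### Unit normals of a front -/

section UnitNormals

variable {n : ℕ}
  {M : Type*} [TopologicalSpace M] [ChartedSpace (Euc n) M] [IsManifold (𝓡 n) ∞ M]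
  {N : Type*} [TopologicalSpace N] [ChartedSpace (Euc (n + 1)) N] [IsManifold (𝓡 (n + 1)) ∞ N]
  {g : RiemMetric (n + 1) N} {f : M → N}

theorem IsAFront.contMDiff (hf : IsAFront g f) : ContMDiff (𝓡 n) (𝓡 (n + 1)) ∞ f := hf.1.1

theorem IsAFront.exists_normalForm (hf : IsAFront g f) {p : M} (hp : p ∈ singularSet n f) :
    ∃ (k : ℕ) (e : OpenPartialHomeomorph M (Euc n)) (e' : OpenPartialHomeomorph N (Euc (n + 1))),
      IsNormalFormOn f k e e' ∧ p ∈ e.source := by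
  obtain ⟨k, h1, hk, h⟩ := hf.2 p hp
  obtain ⟨e, e', he, hpe, -⟩ := h.exists_isNormalFormOn h1 hk
  exact ⟨k, e, e', he, hpe⟩

theorem IsAFront.dense_compl_singularSet (hf : IsAFront g f) : Dense (singularSet n f)ᶜ := by
  intro p
  by_cases hp : p ∈ singularSet n f
  · obtain ⟨k, e, e', he, hpe⟩ := hf.exists_normalForm hp
    exact he.mem_closure hf.contMDiff hpe
  · exact subset_closure hp

/-- A map in charts. -/
noncomputable def chartRep (f : M → N) (e : OpenPartialHomeomorph M (Euc n))
    (e' : OpenPartialHomeomorph N (Euc (n + 1))) (z : Euc n) : Euc (n + 1) :=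
  e' (f (e.symm z))

theorem contDiffAt_chartRep {e : OpenPartialHomeomorph M (Euc n)}
    {e' : OpenPartialHomeomorph N (Euc (n + 1))}
    (he : e ∈ IsManifold.maximalAtlas (𝓡 n) ∞ M)
    (he' : e' ∈ IsManifold.maximalAtlas (𝓡 (n + 1)) ∞ N)
    (hf : ContMDiff (𝓡 n) (𝓡 (n + 1)) ∞ f) {q : M} (hq : q ∈ e.source) (hq' : f q ∈ e'.source) :
    ContDiffAt ℝ ∞ (chartRep f e e') (e q) := by
  rw [← contMDiffAt_iff_contDiffAt]
  have h1 : ContMDiffAt (𝓡 n) (𝓡 n) ∞ e.symm (e q) :=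
    contMDiffAt_symm_of_mem_maximalAtlas he (e.map_source hq)
  have h2 : ContMDiffAt (𝓡 (n + 1)) (𝓡 (n + 1)) ∞ e' (f (e.symm (e q))) :=
    contMDiffAt_of_mem_maximalAtlas he' (by rwa [e.left_inv hq])
  exact h2.comp (e q) (hf.contMDiffAt.comp (e q) h1)

/-- The differential in charts. -/
theorem chartDeriv_mfderiv {e : OpenPartialHomeomorph M (Euc n)}
    {e' : OpenPartialHomeomorph N (Euc (n + 1))}
    (he : e ∈ IsManifold.maximalAtlas (𝓡 n) ∞ M)
    (he' : e' ∈ IsManifold.maximalAtlas (𝓡 (n + 1)) ∞ N)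
    (hf : ContMDiff (𝓡 n) (𝓡 (n + 1)) ∞ f) {q : M} (hq : q ∈ e.source) (hq' : f q ∈ e'.source)
    (Y : TangentSpace (𝓡 n) q) :
    chartDeriv e' (f q) (mfderiv (𝓡 n) (𝓡 (n + 1)) f q Y) =
      fderiv ℝ (chartRep f e e') (e q) (chartDeriv e q Y) := by
  have h1 : HasMFDerivAt (𝓡 n) 𝓘(ℝ, Euc (n + 1)) (e' ∘ f) q _ :=
    HasMFDerivAt.comp q
      (((mdifferentiable_of_mem_maximalAtlas he').mdifferentiableAt hq').hasMFDerivAt)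
      ((hf.mdifferentiable (by simp)) q).hasMFDerivAt
  have h2 : HasMFDerivAt (𝓡 n) 𝓘(ℝ, Euc (n + 1)) (chartRep f e e' ∘ e) q _ :=
    HasMFDerivAt.comp q
      (((contDiffAt_chartRep he he' hf hq hq').differentiableAt (by simp)).hasFDerivAt).hasMFDerivAt
      (((mdifferentiable_of_mem_maximalAtlas he).mdifferentiableAt hq).hasMFDerivAt)
  have h3 : (e' ∘ f) =ᶠ[𝓝 q] (chartRep f e e' ∘ e) := by
    filter_upwards [e.open_source.mem_nhds hq] with q' hq'
    simp [chartRep, e.left_inv hq']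
  have h4 := hasMFDerivAt_unique h1 (h2.congr_of_eventuallyEq h3)
  exact congrArg (fun L : Euc n →L[ℝ] Euc (n + 1) => L Y) h4

theorem continuousAt_fderiv_chartRep {e : OpenPartialHomeomorph M (Euc n)}
    {e' : OpenPartialHomeomorph N (Euc (n + 1))}
    (he : e ∈ IsManifold.maximalAtlas (𝓡 n) ∞ M)
    (he' : e' ∈ IsManifold.maximalAtlas (𝓡 (n + 1)) ∞ N)
    (hf : ContMDiff (𝓡 n) (𝓡 (n + 1)) ∞ f) {q : M} (hq : q ∈ e.source) (hq' : f q ∈ e'.source) :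
    ContinuousAt (fun q => fderiv ℝ (chartRep f e e') (e q)) q := by
  have h1 := (contDiffAt_chartRep he he' hf hq hq').fderiv_right (m := 0) (by simp)
  exact h1.continuousAt.comp (e.continuousAt hq)

theorem notMem_singularSet_iff {e : OpenPartialHomeomorph M (Euc n)}
    {e' : OpenPartialHomeomorph N (Euc (n + 1))}
    (he : e ∈ IsManifold.maximalAtlas (𝓡 n) ∞ M)
    (he' : e' ∈ IsManifold.maximalAtlas (𝓡 (n + 1)) ∞ N)
    (hf : ContMDiff (𝓡 n) (𝓡 (n + 1)) ∞ f) {q : M} (hq : q ∈ e.source) (hq' : f q ∈ e'.source) :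
    q ∉ singularSet n f ↔ Function.Injective (fderiv ℝ (chartRep f e e') (e q)) := by
  simp only [singularSet, mem_ofPred_eq, not_not]
  constructor
  · intro hi a b hab
    obtain ⟨a, rfl⟩ := chartDeriv_surjective he hq a
    obtain ⟨b, rfl⟩ := chartDeriv_surjective he hq b
    rw [← chartDeriv_mfderiv he he' hf hq hq', ← chartDeriv_mfderiv he he' hf hq hq'] at hab
    rw [hi (chartDeriv_injective he' hq' hab)]
  · intro hi a b hab
    refine chartDeriv_injective he hq (hi ?_)
    rw [← chartDeriv_mfderiv he he' hf hq hq', ← chartDeriv_mfderiv he he' hf hq hq', hab]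

theorem isClosed_singularSet (hf : ContMDiff (𝓡 n) (𝓡 (n + 1)) ∞ f) :
    IsClosed (singularSet n f) := by
  rw [← isOpen_compl_iff, isOpen_iff_mem_nhds]
  intro q hq
  have he := IsManifold.chart_mem_maximalAtlas (I := 𝓡 n) (n := ∞) q
  have he' := IsManifold.chart_mem_maximalAtlas (I := 𝓡 (n + 1)) (n := ∞) (f q)
  have hs := mem_chart_source (Euc n) q
  have hs' := mem_chart_source (Euc (n + 1)) (f q)
  have h1 := (notMem_singularSet_iff he he' hf hs hs').1 hq
  have h2 := (continuousAt_fderiv_chartRep he he' hf hs hs').eventually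
    (ContinuousLinearMap.isOpen_injective.mem_nhds h1)
  filter_upwards [h2, (chartAt (Euc n) q).open_source.mem_nhds hs,
    hf.continuous.continuousAt.eventually ((chartAt (Euc (n + 1)) (f q)).open_source.mem_nhds hs')]
    with q' h3 h4 h5
  exact (notMem_singularSet_iff he he' hf h4 h5).2 h3

/-! #### Unit normals -/

theorem IsUnitNormalAt.inner_self {p : M} {v : TangentSpace (𝓡 (n + 1)) (f p)}
    (h : IsUnitNormalAt g f p v) : g.inner (f p) v v = 1 := by
  obtain ⟨U, ν, hp, hν, rfl⟩ := h
  exact hν.unit p hp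

theorem IsUnitNormalAt.inner_mfderiv {p : M} {v : TangentSpace (𝓡 (n + 1)) (f p)}
    (h : IsUnitNormalAt g f p v) (u : TangentSpace (𝓡 n) p) :
    g.inner (f p) (mfderiv (𝓡 n) (𝓡 (n + 1)) f p u) v = 0 := by
  obtain ⟨U, ν, hp, hν, rfl⟩ := h
  exact hν.normal p hp u

theorem IsUnitNormalAt.ne_zero {p : M} {v : TangentSpace (𝓡 (n + 1)) (f p)}
    (h : IsUnitNormalAt g f p v) : v ≠ 0 := by
  rintro rfl
  have := h.inner_self
  simp at this

theorem IsUnitNormalField.isUnitNormalAt {U : Set M} {ν : ∀ x, TangentSpace (𝓡 (n + 1)) (f x)}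
    (h : IsUnitNormalField g f U ν) {p : M} (hp : p ∈ U) : IsUnitNormalAt g f p (ν p) :=
  ⟨U, ν, hp, h, rfl⟩

theorem contMDiffAt_neg_lift {F : M → N} {ν : ∀ x, TangentSpace (𝓡 (n + 1)) (F x)} {p : M}
    (h : ContMDiffAt (𝓡 n) (𝓡 (n + 1)).tangent ∞ (lift F ν) p) :
    ContMDiffAt (𝓡 n) (𝓡 (n + 1)).tangent ∞ (lift F fun x => -ν x) p := by
  rw [Bundle.contMDiffAt_totalSpace] at h ⊢
  refine ⟨h.1, ?_⟩
  refine (h.2.neg).congr_of_eventuallyEq ?_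
  have hb := h.1.continuousAt.eventually_mem ((trivializationAt (Euc (n + 1))
    (TangentSpace (𝓡 (n + 1))) (F p)).open_baseSet.mem_nhds
      (FiberBundle.mem_baseSet_trivializationAt' (F p)))
  filter_upwards [hb] with x hx
  have hl := ((trivializationAt (Euc (n + 1)) (TangentSpace (𝓡 (n + 1))) (F p)).linear ℝ hx)
  exact (hl.mk' _).map_neg (ν x)

theorem IsUnitNormalField.neg {U : Set M} {ν : ∀ x, TangentSpace (𝓡 (n + 1)) (f x)}
    (h : IsUnitNormalField g f U ν) : IsUnitNormalField g f U fun x => -ν x where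
  isOpen := h.isOpen
  smooth x hx := (contMDiffAt_neg_lift
    ((h.smooth x hx).contMDiffAt (h.isOpen.mem_nhds hx))).contMDiffWithinAt
  unit x hx := by simpa using h.unit x hx
  normal x hx u := by simpa using h.normal x hx u

theorem IsUnitNormalAt.neg {p : M} {v : TangentSpace (𝓡 (n + 1)) (f p)}
    (h : IsUnitNormalAt g f p v) : IsUnitNormalAt g f p (-v) := by
  obtain ⟨U, ν, hp, hν, rfl⟩ := h
  exact ⟨U, _, hp, hν.neg, rfl⟩

/-- A unit normal field in a chart of the target. -/
theorem IsUnitNormalField.contMDiffAt_chartDeriv {U : Set M}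
    {ν : ∀ x, TangentSpace (𝓡 (n + 1)) (f x)} (h : IsUnitNormalField g f U ν) {p : M} (hp : p ∈ U)
    {e' : OpenPartialHomeomorph N (Euc (n + 1))}
    (he' : e' ∈ IsManifold.maximalAtlas (𝓡 (n + 1)) ∞ N) (hp' : f p ∈ e'.source) :
    ContMDiffAt (𝓡 n) 𝓘(ℝ, Euc (n + 1)) ∞ (fun x => chartDeriv e' (f x) (ν x)) p :=
  FrontMaslov.contMDiffAt_chartDeriv (by simp) he' hp'
    ((h.smooth p hp).contMDiffAt (h.isOpen.mem_nhds hp))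

theorem continuousAt_gram {e' : OpenPartialHomeomorph N (Euc (n + 1))}
    (he' : e' ∈ IsManifold.maximalAtlas (𝓡 (n + 1)) ∞ N) (hf : Continuous f) {p : M}
    (hp' : f p ∈ e'.source) : ContinuousAt (fun x => gram g e' (e' (f x))) p :=
  ContinuousAt.comp (f := fun x => e' (f x)) ((contDiffOn_gram g he').continuousOn.continuousAt
    (e'.open_target.mem_nhds (e'.map_source hp')))
    (ContinuousAt.comp (e'.continuousAt hp') hf.continuousAt)

/-- In a normal form, the covector of a unit normal is a multiple of the standard conormal. -/
theorem IsNormalFormOn.gram_unitNormal {k : ℕ} {e : OpenPartialHomeomorph M (Euc n)}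
    {e' : OpenPartialHomeomorph N (Euc (n + 1))} (h : IsNormalFormOn f k e e')
    (hf : ContMDiff (𝓡 n) (𝓡 (n + 1)) ∞ f) {q : M} (hq : q ∈ e.source)
    {v : TangentSpace (𝓡 (n + 1)) (f q)} (hv : IsUnitNormalAt g f q v) :
    gram g e' (e' (f q)) (chartDeriv e' (f q) v) =
      gram g e' (e' (f q)) (chartDeriv e' (f q) v) (basisVec (n + 1) 0) •
        conormal (n + 1) k (coord (e q) 0) := by
  obtain ⟨U, ν, hqU, hν, rfl⟩ := hv
  set β : M → Euc (n + 1) →L[ℝ] ℝ := fun x => gram g e' (e' (f x)) (chartDeriv e' (f x) (ν x))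
  have hβ : ContinuousAt β q :=
    (continuousAt_gram h.mem_atlas' hf.continuous (h.mapsTo hq)).clm_apply
      (hν.contMDiffAt_chartDeriv hqU h.mem_atlas' (h.mapsTo hq)).continuousAt
  have hα : ContinuousAt (fun x => conormal (n + 1) k (coord (e x) 0)) q :=
    (contDiff_conormal (n + 1) k (m := 0)).continuous.continuousAt.comp
      ((contDiff_coord 0 (m := 0)).continuous.continuousAt.comp (e.continuousAt hq))
  -- At regular points the covector of the normal kills the image of the differential and
  -- `eq_smul_conormal` applies. The identity passes to the limit at `q`, because regular points
  -- accumulate there.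
  have hreg : ∀ᶠ x in 𝓝[(singularSet n f)ᶜ] q,
      β x - β x (basisVec (n + 1) 0) • conormal (n + 1) k (coord (e x) 0) = 0 := by
    filter_upwards [self_mem_nhdsWithin, mem_nhdsWithin_of_mem_nhds (e.open_source.mem_nhds hq),
      mem_nhdsWithin_of_mem_nhds (hν.isOpen.mem_nhds hqU)] with x hxS hx hxU
    rw [sub_eq_zero]
    refine eq_smul_conormal h.pos h.one_le h.le (X := e x) ?_ (β x) fun Y => ?_
    · exact fun h0 => hxS ((h.mem_singularSet_iff hf hx).2 h0)
    · obtain ⟨Y, rfl⟩ := chartDeriv_surjective h.mem_atlas hx Y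
      rw [← h.chartDeriv_mfderiv hf hx]
      change gram g e' (e' (f x)) _ _ = 0
      rw [gram_chartDeriv g h.mem_atlas' (h.mapsTo hx), g.symm]
      exact hν.normal x hxU Y
  have hlim : ContinuousAt (fun x => β x - β x (basisVec (n + 1) 0) •
      conormal (n + 1) k (coord (e x) 0)) q :=
    hβ.sub ((hβ.clm_apply continuousAt_const).smul hα)
  have hne : (𝓝[(singularSet n f)ᶜ] q).NeBot :=
    mem_closure_iff_nhdsWithin_neBot.1 (h.mem_closure hf hq)
  have h0 := tendsto_nhds_unique (hlim.tendsto.mono_left nhdsWithin_le_nhds)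
    ((tendsto_const_nhds (x := (0 : Euc (n + 1) →L[ℝ] ℝ))).congr'
      (hreg.mono fun x hx => hx.symm))
  exact sub_eq_zero.1 h0

/-- The value of the standard conormal on a vector. -/
noncomputable def conormalValue (f : M → N) (k : ℕ) (e : OpenPartialHomeomorph M (Euc n))
    (e' : OpenPartialHomeomorph N (Euc (n + 1))) (q : M) (v : TangentSpace (𝓡 (n + 1)) (f q)) : ℝ :=
  conormal (n + 1) k (coord (e q) 0) (chartDeriv e' (f q) v)

/-- Evaluation of the proportionality of covectors on the unit vector `v` itself. In particular
neither factor vanishes, at singular points too. -/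
theorem IsNormalFormOn.coeff_mul_conormalValue {k : ℕ} {e : OpenPartialHomeomorph M (Euc n)}
    {e' : OpenPartialHomeomorph N (Euc (n + 1))} (h : IsNormalFormOn f k e e')
    (hf : ContMDiff (𝓡 n) (𝓡 (n + 1)) ∞ f) {q : M} (hq : q ∈ e.source)
    {v : TangentSpace (𝓡 (n + 1)) (f q)} (hv : IsUnitNormalAt g f q v) :
    gram g e' (e' (f q)) (chartDeriv e' (f q) v) (basisVec (n + 1) 0) *
      conormalValue f k e e' q v = 1 := by
  have h1 := congrArg (fun L => L (chartDeriv e' (f q) v)) (h.gram_unitNormal hf hq hv)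
  rw [gram_chartDeriv g h.mem_atlas' (h.mapsTo hq), hv.inner_self] at h1
  exact h1.symm

theorem IsNormalFormOn.conormalValue_ne_zero {k : ℕ} {e : OpenPartialHomeomorph M (Euc n)}
    {e' : OpenPartialHomeomorph N (Euc (n + 1))} (h : IsNormalFormOn f k e e')
    (hf : ContMDiff (𝓡 n) (𝓡 (n + 1)) ∞ f) {q : M} (hq : q ∈ e.source)
    {v : TangentSpace (𝓡 (n + 1)) (f q)} (hv : IsUnitNormalAt g f q v) :
    conormalValue f k e e' q v ≠ 0 := by
  intro h0
  have := h.coeff_mul_conormalValue hf hq hv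
  simp [h0] at this

/-- The linear map `(Y, r) ↦ A Y + r v`. -/
noncomputable def frameMap (A : Euc n →L[ℝ] Euc (n + 1)) (v : Euc (n + 1)) :
    Euc (n + 1) →L[ℝ] Euc (n + 1) :=
  A.comp (∑ i ∈ Finset.range n, (coordL (n + 1) i).smulRight (basisVec n i))
    + (coordL (n + 1) n).smulRight v

theorem coord_sum_basisVec {d : ℕ} (c : ℕ → ℝ) {j : ℕ} (hj : j < d) :
    coord (∑ i ∈ Finset.range d, c i • basisVec d i) j = c j := by
  rw [coord_sum, Finset.sum_eq_single j]
  · simp [coord_smul, coord_basisVec hj]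
  · intro b hb hbj
    rw [coord_smul, coord_basisVec (Finset.mem_range.1 hb), if_neg (Ne.symm hbj), mul_zero]
  · intro h; exact absurd (Finset.mem_range.2 hj) h

theorem frameMap_apply (A : Euc n →L[ℝ] Euc (n + 1)) (v x : Euc (n + 1)) :
    frameMap A v x = A (∑ i ∈ Finset.range n, coord x i • basisVec n i) + coord x n • v := by
  simp [frameMap, coordL_apply]

theorem injective_frameMap {A : Euc n →L[ℝ] Euc (n + 1)} {v : Euc (n + 1)}
    (h : ∀ (Y : Euc n) (r : ℝ), A Y + r • v = 0 → Y = 0 ∧ r = 0) : Function.Injective (frameMap A v) := by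
  rw [injective_iff_map_eq_zero]
  intro x hx
  rw [frameMap_apply] at hx
  obtain ⟨h1, h2⟩ := h _ _ hx
  refine coord_ext fun j hj => ?_
  rw [coord_zero]
  rcases Nat.lt_or_ge j n with h' | h'
  · rw [← coord_sum_basisVec (d := n) (fun i => coord x i) h', h1, coord_zero]
  · obtain rfl : j = n := by omega
    exact h2

theorem bijective_frameMap {G : Euc (n + 1) →L[ℝ] Euc (n + 1) →L[ℝ] ℝ}
    {A : Euc n →L[ℝ] Euc (n + 1)} {v : Euc (n + 1)} (hA : Function.Injective A)
    (hv : G v v = 1) (hAv : ∀ Y, G (A Y) v = 0) : Function.Bijective (frameMap A v) := by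
  have hinj : Function.Injective (frameMap A v) := by
    refine injective_frameMap fun Y r h0 => ?_
    have h1 := congrArg (fun x => G x v) h0
    simp [hAv, hv] at h1
    subst h1
    rw [zero_smul, add_zero] at h0
    exact ⟨hA (by rw [h0, map_zero]), rfl⟩
  exact ⟨hinj, (LinearMap.injective_iff_surjective (f := (frameMap A v).toLinearMap)).1 hinj⟩

/-- The component of `v'` orthogonal to `v` is orthogonal to the whole frame spanned by the image of
`A` and `v`, hence to itself. -/
theorem eq_or_eq_neg_of_orthogonal {G : Euc (n + 1) →L[ℝ] Euc (n + 1) →L[ℝ] ℝ}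
    {A : Euc n →L[ℝ] Euc (n + 1)} {v v' : Euc (n + 1)} (hA : Function.Injective A)
    (hsymm : ∀ a b, G a b = G b a) (hpos : ∀ a, a ≠ 0 → 0 < G a a)
    (hv : G v v = 1) (hAv : ∀ Y, G (A Y) v = 0) (hv' : G v' v' = 1) (hAv' : ∀ Y, G (A Y) v' = 0) :
    v' = v ∨ v' = -v := by
  set c := G v' v with hc
  have h0 : v' - c • v = 0 := by
    by_contra hne
    obtain ⟨x, hx⟩ := (bijective_frameMap hA hv hAv).2 (v' - c • v)
    have h1 := hpos _ hne
    have h2 : G (frameMap A v x) (v' - c • v) = 0 := by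
      rw [frameMap_apply]
      simp [hAv, hAv', hv, hsymm v v', ← hc]
    rw [hx] at h2
    exact h1.ne' h2
  have h1 : v' = c • v := sub_eq_zero.1 h0
  have h2 : c ^ 2 = 1 := by
    rw [h1] at hv'
    simp only [map_smul, _root_.smul_apply, smul_eq_mul, hv] at hv'
    linarith
  rcases mul_self_eq_one_iff.1 ((sq _).symm.trans h2) with h | h
  · left; rw [h1, h, one_smul]
  · right; rw [h1, h, neg_smul, one_smul]

theorem eq_or_eq_neg_of_proportional {G : Euc (n + 1) →L[ℝ] Euc (n + 1) →L[ℝ] ℝ}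
    {v v' : Euc (n + 1)} {α : Euc (n + 1) →L[ℝ] ℝ} {a a' : ℝ}
    (hpos : ∀ a, a ≠ 0 → 0 < G a a) (hv : G v v = 1) (hv' : G v' v' = 1)
    (h : G v = a • α) (h' : G v' = a' • α) : v' = v ∨ v' = -v := by
  have h0 : a' • v - a • v' = 0 := by
    by_contra hne
    have h1 := hpos _ hne
    have h2 : G (a' • v - a • v') = 0 := by
      rw [map_sub, map_smul, map_smul, h, h', smul_smul, smul_smul, mul_comm, sub_self]
    rw [h2] at h1
    simp at h1
  have ha : a ≠ 0 := by rintro rfl; simp [h] at hv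
  have h1 : v' = (a' / a) • v := by
    rw [div_eq_inv_mul, mul_smul, sub_eq_zero.1 h0, smul_smul, inv_mul_cancel₀ ha, one_smul]
  have h2 : (a' / a) ^ 2 = 1 := by
    rw [h1] at hv'
    simp only [map_smul, _root_.smul_apply, smul_eq_mul, hv] at hv'
    linarith
  rcases mul_self_eq_one_iff.1 ((sq _).symm.trans h2) with h | h
  · left; rw [h1, h, one_smul]
  · right; rw [h1, h, neg_smul, one_smul]

/-- At a singular point the image of the differential is too small for orthogonality to determine
the normal up to sign. There the limit covector is used instead: by `gram_unitNormal` the covectors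
of both normals are multiples of the conormal of a normal form. -/
theorem IsUnitNormalAt.eq_or_eq_neg (hf : IsAFront g f) {q : M}
    {v v' : TangentSpace (𝓡 (n + 1)) (f q)} (hv : IsUnitNormalAt g f q v)
    (hv' : IsUnitNormalAt g f q v') : v' = v ∨ v' = -v := by
  have key : ∀ {e' : OpenPartialHomeomorph N (Euc (n + 1))}
      (he' : e' ∈ IsManifold.maximalAtlas (𝓡 (n + 1)) ∞ N) (hs' : f q ∈ e'.source),
      (chartDeriv e' (f q) v' = chartDeriv e' (f q) v ∨
        chartDeriv e' (f q) v' = -chartDeriv e' (f q) v) → v' = v ∨ v' = -v := by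
    intro e' he' hs' h
    rcases h with h | h
    · exact Or.inl (chartDeriv_injective he' hs' h)
    · exact Or.inr (chartDeriv_injective he' hs' (by rw [h, map_neg]))
  by_cases hq : q ∈ singularSet n f
  · obtain ⟨k, e, e', he, hqe⟩ := hf.exists_normalForm hq
    refine key he.mem_atlas' (he.mapsTo hqe) (eq_or_eq_neg_of_proportional
      (fun a ha => gram_pos g he.mem_atlas' (e'.map_source (he.mapsTo hqe)) ha) ?_ ?_
      (he.gram_unitNormal hf.contMDiff hqe hv) (he.gram_unitNormal hf.contMDiff hqe hv'))
    · rw [gram_chartDeriv g he.mem_atlas' (he.mapsTo hqe), hv.inner_self]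
    · rw [gram_chartDeriv g he.mem_atlas' (he.mapsTo hqe), hv'.inner_self]
  · have he := IsManifold.chart_mem_maximalAtlas (I := 𝓡 n) (n := ∞) q
    have he' := IsManifold.chart_mem_maximalAtlas (I := 𝓡 (n + 1)) (n := ∞) (f q)
    have hs := mem_chart_source (Euc n) q
    have hs' := mem_chart_source (Euc (n + 1)) (f q)
    refine key he' hs' (eq_or_eq_neg_of_orthogonal
      ((notMem_singularSet_iff he he' hf.contMDiff hs hs').1 hq) (gram_symm g _ _)
      (fun a ha => gram_pos g he' ((chartAt (Euc (n + 1)) (f q)).map_source hs') ha) ?_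
      (fun Y => ?_) ?_ (fun Y => ?_))
    · rw [gram_chartDeriv g he' hs', hv.inner_self]
    · obtain ⟨Y, rfl⟩ := chartDeriv_surjective he hs Y
      rw [← chartDeriv_mfderiv he he' hf.contMDiff hs hs', gram_chartDeriv g he' hs',
        hv.inner_mfderiv]
    · rw [gram_chartDeriv g he' hs', hv'.inner_self]
    · obtain ⟨Y, rfl⟩ := chartDeriv_surjective he hs Y
      rw [← chartDeriv_mfderiv he he' hf.contMDiff hs hs', gram_chartDeriv g he' hs',
        hv'.inner_mfderiv]

theorem IsAFront.exists_unitNormalField (hf : IsAFront g f) (p : M) :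
    ∃ (U : Set M) (ν : ∀ x, TangentSpace (𝓡 (n + 1)) (f x)), p ∈ U ∧ IsUnitNormalField g f U ν := by
  obtain ⟨U, ν, hp, hν, -⟩ := hf.1.2 p
  exact ⟨U, ν, hp, hν⟩

theorem ContinuousWithinAt.inner_along {T : Type*} [TopologicalSpace T] {γ : T → N} {s : Set T}
    {t : T} {v w : ∀ t, TangentSpace (𝓡 (n + 1)) (γ t)}
    (hv : ContinuousWithinAt (fun t => (⟨γ t, v t⟩ : TangentBundle (𝓡 (n + 1)) N)) s t)
    (hw : ContinuousWithinAt (fun t => (⟨γ t, w t⟩ : TangentBundle (𝓡 (n + 1)) N)) s t) :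
    ContinuousWithinAt (fun t => g.inner (γ t) (v t) (w t)) s t := by
  have he' := IsManifold.chart_mem_maximalAtlas (I := 𝓡 (n + 1)) (n := ∞) (γ t)
  have hs' := mem_chart_source (Euc (n + 1)) (γ t)
  set e' := chartAt (Euc (n + 1)) (γ t)
  have hγ : ContinuousWithinAt γ s t :=
    (FiberBundle.continuous_proj (Euc (n + 1)) (TangentSpace (𝓡 (n + 1)))).continuousAt.comp_continuousWithinAt hv
  have h1 : ContinuousWithinAt (fun t => gram g e' (e' (γ t))) s t :=
    ContinuousAt.comp_continuousWithinAt (f := fun t => e' (γ t))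
      ((contDiffOn_gram g he').continuousOn.continuousAt
      (e'.open_target.mem_nhds (e'.map_source hs')))
      (ContinuousAt.comp_continuousWithinAt (e'.continuousAt hs') hγ)
  have h2 := (h1.clm_apply (continuousWithinAt_chartDeriv he' hs' hv)).clm_apply
    (continuousWithinAt_chartDeriv he' hs' hw)
  refine h2.congr_of_eventuallyEq ?_ (gram_chartDeriv g he' hs' _ _).symm
  filter_upwards [hγ.eventually (e'.open_source.mem_nhds hs')] with t' ht'
  exact (gram_chartDeriv g he' ht' _ _).symm

end UnitNormals

/-! ### Independence of the inward direction of the normal form -/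

section CoordChange

variable {d : ℕ} {X : Type*} [TopologicalSpace X] [ChartedSpace (Euc d) X]
  [IsManifold (𝓡 d) ∞ X]

/-- The coordinate change between two charts. -/
noncomputable def coordChange (e e₂ : OpenPartialHomeomorph X (Euc d)) (z : Euc d) : Euc d :=
  e₂ (e.symm z)

theorem contDiffAt_coordChange {e e₂ : OpenPartialHomeomorph X (Euc d)}
    (he : e ∈ IsManifold.maximalAtlas (𝓡 d) ∞ X) (he₂ : e₂ ∈ IsManifold.maximalAtlas (𝓡 d) ∞ X)
    {q : X} (hq : q ∈ e.source) (hq₂ : q ∈ e₂.source) :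
    ContDiffAt ℝ ∞ (coordChange e e₂) (e q) := by
  rw [← contMDiffAt_iff_contDiffAt]
  have h1 : ContMDiffAt (𝓡 d) (𝓡 d) ∞ e.symm (e q) :=
    contMDiffAt_symm_of_mem_maximalAtlas he (e.map_source hq)
  have h2 : ContMDiffAt (𝓡 d) (𝓡 d) ∞ e₂ (e.symm (e q)) :=
    contMDiffAt_of_mem_maximalAtlas he₂ (by rwa [e.left_inv hq])
  exact h2.comp (e q) h1

theorem chartDeriv_coordChange {e e₂ : OpenPartialHomeomorph X (Euc d)}
    (he : e ∈ IsManifold.maximalAtlas (𝓡 d) ∞ X) (he₂ : e₂ ∈ IsManifold.maximalAtlas (𝓡 d) ∞ X)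
    {q : X} (hq : q ∈ e.source) (hq₂ : q ∈ e₂.source) (v : TangentSpace (𝓡 d) q) :
    chartDeriv e₂ q v = fderiv ℝ (coordChange e e₂) (e q) (chartDeriv e q v) := by
  have h1 : HasMFDerivAt (𝓡 d) 𝓘(ℝ, Euc d) e₂ q (chartDeriv e₂ q) :=
    ((mdifferentiable_of_mem_maximalAtlas he₂).mdifferentiableAt hq₂).hasMFDerivAt
  have h2 : HasMFDerivAt (𝓡 d) 𝓘(ℝ, Euc d) (coordChange e e₂ ∘ e) q _ :=
    HasMFDerivAt.comp q
      (((contDiffAt_coordChange he he₂ hq hq₂).differentiableAt (by simp)).hasFDerivAt).hasMFDerivAt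
      (((mdifferentiable_of_mem_maximalAtlas he).mdifferentiableAt hq).hasMFDerivAt)
  have h3 : (e₂ : X → Euc d) =ᶠ[𝓝 q] (coordChange e e₂ ∘ e) := by
    filter_upwards [e.open_source.mem_nhds hq] with q' hq'
    simp [coordChange, e.left_inv hq']
  have h4 := hasMFDerivAt_unique h1 (h2.congr_of_eventuallyEq h3)
  exact congrArg (fun L : Euc d →L[ℝ] Euc d => L v) h4

theorem gram_coordChange (g : RiemMetric d X) {e e₂ : OpenPartialHomeomorph X (Euc d)}
    (he : e ∈ IsManifold.maximalAtlas (𝓡 d) ∞ X) (he₂ : e₂ ∈ IsManifold.maximalAtlas (𝓡 d) ∞ X)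
    {q : X} (hq : q ∈ e.source) (hq₂ : q ∈ e₂.source) (a b : Euc d) :
    gram g e₂ (e₂ q) (fderiv ℝ (coordChange e e₂) (e q) a) (fderiv ℝ (coordChange e e₂) (e q) b)
      = gram g e (e q) a b := by
  obtain ⟨a, rfl⟩ := chartDeriv_surjective he hq a
  obtain ⟨b, rfl⟩ := chartDeriv_surjective he hq b
  rw [← chartDeriv_coordChange he he₂ hq hq₂, ← chartDeriv_coordChange he he₂ hq hq₂,
    gram_chartDeriv g he hq, gram_chartDeriv g he₂ hq₂]

end CoordChange

section Inward

variable {n : ℕ}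
  {M : Type*} [TopologicalSpace M] [ChartedSpace (Euc n) M] [IsManifold (𝓡 n) ∞ M]
  {N : Type*} [TopologicalSpace N] [ChartedSpace (Euc (n + 1)) N] [IsManifold (𝓡 (n + 1)) ∞ N]
  {g : RiemMetric (n + 1) N} {f : M → N}
  {k k₂ : ℕ} {e e₂ : OpenPartialHomeomorph M (Euc n)}
  {e' e₂' : OpenPartialHomeomorph N (Euc (n + 1))}

/-- In each normal form the covector of a unit normal is a nonzero multiple of the conormal, and the
coordinate change carries these covectors into each other. The factor is found by evaluation on the
vector on which the first conormal is `1`. -/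
theorem conormal_coordChange (hf : IsAFront g f) (h : IsNormalFormOn f k e e')
    (h₂ : IsNormalFormOn f k₂ e₂ e₂') {q : M} (hq : q ∈ e.source) (hq₂ : q ∈ e₂.source)
    (b : Euc (n + 1)) :
    conormal (n + 1) k₂ (coord (e₂ q) 0) (fderiv ℝ (coordChange e' e₂') (e' (f q)) b) =
      conormal (n + 1) k₂ (coord (e₂ q) 0)
        (fderiv ℝ (coordChange e' e₂') (e' (f q)) (basisVec (n + 1) 0)) *
      conormal (n + 1) k (coord (e q) 0) b := by
  obtain ⟨U, ν, hqU, hν⟩ := hf.exists_unitNormalField q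
  have hv := hν.isUnitNormalAt hqU
  have h1 := h.gram_unitNormal hf.contMDiff hq hv
  have h2 := h₂.gram_unitNormal hf.contMDiff hq₂ hv
  have h3 := h₂.coeff_mul_conormalValue hf.contMDiff hq₂ hv
  set L := gram g e' (e' (f q)) (chartDeriv e' (f q) (ν q)) (basisVec (n + 1) 0)
  set L₂ := gram g e₂' (e₂' (f q)) (chartDeriv e₂' (f q) (ν q)) (basisVec (n + 1) 0)
  have hL₂ : L₂ ≠ 0 := by intro h0; rw [h0, zero_mul] at h3; exact zero_ne_one h3
  have h4 : ∀ b, L₂ * conormal (n + 1) k₂ (coord (e₂ q) 0)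
      (fderiv ℝ (coordChange e' e₂') (e' (f q)) b) = L * conormal (n + 1) k (coord (e q) 0) b := by
    intro b
    have h5 := gram_coordChange g h.mem_atlas' h₂.mem_atlas' (h.mapsTo hq) (h₂.mapsTo hq₂)
      (chartDeriv e' (f q) (ν q)) b
    rw [← chartDeriv_coordChange h.mem_atlas' h₂.mem_atlas' (h.mapsTo hq) (h₂.mapsTo hq₂), h1, h2]
      at h5
    exact h5
  have h6 := h4 b
  have h7 := h4 (basisVec (n + 1) 0)
  rw [conormal_basisVec_zero, mul_one] at h7
  refine mul_left_cancel₀ hL₂ ?_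
  rw [h6, ← h7]; ring

/-- The differential of `f` applied to the `t`-direction of the first form is written in both forms
and paired with `conormal'` of the second. -/
theorem hess_coordChange (hf : IsAFront g f) (h : IsNormalFormOn f k e e')
    (h₂ : IsNormalFormOn f k₂ e₂ e₂') {q : M} (hq : q ∈ e.source) (hq₂ : q ∈ e₂.source) :
    -(hess k₂ (e₂ q) * coord (fderiv ℝ (coordChange e e₂) (e q) (basisVec n 0)) 0) =
      hess k (e q) * conormal' (n + 1) k₂ (coord (e₂ q) 0)
        (fderiv ℝ (coordChange e' e₂') (e' (f q)) (nullImage n (coord (e q) 0))) := by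
  obtain ⟨Y, hY⟩ := chartDeriv_surjective h.mem_atlas hq (basisVec n 0)
  have h1 := h.chartDeriv_mfderiv hf.contMDiff hq Y
  have h2 := h₂.chartDeriv_mfderiv hf.contMDiff hq₂ Y
  rw [chartDeriv_coordChange h.mem_atlas' h₂.mem_atlas' (h.mapsTo hq) (h₂.mapsTo hq₂), h1,
    chartDeriv_coordChange h.mem_atlas h₂.mem_atlas hq hq₂, hY, germDeriv_apply,
    germRest_eq_zero k _ (fun j hj => by rw [coord_basisVec h.pos, if_neg (by omega)]),
    coord_basisVec h.pos, if_pos rfl, add_zero, mul_one, map_smul] at h2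
  have h3 := congrArg (conormal' (n + 1) k₂ (coord (e₂ q) 0)) h2
  rw [conormal'_germDeriv h₂.one_le h₂.le, map_smul, smul_eq_mul] at h3
  exact h3.symm

/-- This is the derivative at `r` of `conormal_coordChange`, applied to the fixed vector `nullImage
n t₀`, along the line in the null direction. On the right-hand side only the derivative of the first
conormal survives, which is `-1` on this vector. -/
theorem conormal'_coordChange (hf : IsAFront g f) (h : IsNormalFormOn f k e e')
    (h₂ : IsNormalFormOn f k₂ e₂ e₂') {r : M} (hr : r ∈ singularSet n f) (hre : r ∈ e.source)
    (hre₂ : r ∈ e₂.source) :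
    conormal' (n + 1) k₂ (coord (e₂ r) 0)
        (fderiv ℝ (coordChange e' e₂') (e' (f r)) (nullImage n (coord (e r) 0))) *
      coord (fderiv ℝ (coordChange e e₂) (e r) (basisVec n 0)) 0 =
    -conormal (n + 1) k₂ (coord (e₂ r) 0)
        (fderiv ℝ (coordChange e' e₂') (e' (f r)) (basisVec (n + 1) 0)) := by
  set T := basisVec n 0
  set t₀ := coord (e r) 0 with ht₀
  set φ := coordChange e e₂
  set ψ := coordChange e' e₂'
  have hline : HasDerivAt (fun s : ℝ => e r + s • T) T 0 := by
    simpa using ((hasDerivAt_id (0 : ℝ)).smul_const T).const_add (e r)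
  have hφ : HasDerivAt (fun s : ℝ => coord (φ (e r + s • T)) 0) (coord (fderiv ℝ φ (e r) T) 0) 0 := by
    have h1 := ((contDiffAt_coordChange h.mem_atlas h₂.mem_atlas hre hre₂).differentiableAt
      (by simp)).hasFDerivAt
    have h2 : HasDerivAt (fun s : ℝ => φ (e r + s • T)) (fderiv ℝ φ (e r) T) 0 := by
      have h1' : HasFDerivAt φ (fderiv ℝ φ (e r)) (e r + (0 : ℝ) • T) := by simpa using h1
      have := h1'.comp_hasDerivAt (0 : ℝ) hline
      exact this
    have h3 := (coordL n 0).hasFDerivAt.comp_hasDerivAt 0 h2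
    simpa only [coordL_apply, Function.comp_def] using h3
  -- The line in the null direction has image of velocity zero at a singular point, so the second
  -- derivative of `ψ` does not enter.
  have hψ : HasDerivAt (fun s : ℝ => fderiv ℝ ψ (frontGerm k (e r + s • T))) 0 0 := by
    have h1 := ((contDiffAt_coordChange h.mem_atlas' h₂.mem_atlas' (h.mapsTo hre)
      (h₂.mapsTo hre₂)).fderiv_right (m := 1) (by norm_cast)).differentiableAt (by simp)
    rw [h.eq_germ r hre] at h1
    have h2 : HasDerivAt (fun s : ℝ => frontGerm k (e r + s • T)) (germDeriv k (e r) T) 0 := by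
      have h1' : HasFDerivAt (frontGerm k) (germDeriv k (e r)) (e r + (0 : ℝ) • T) := by
        simpa using hasFDerivAt_frontGerm h.pos k (e r)
      have := h1'.comp_hasDerivAt (0 : ℝ) hline
      exact this
    have h3 : germDeriv k (e r) T = 0 := by
      rw [germDeriv_apply, (h.mem_singularSet_iff hf.contMDiff hre).1 hr,
        germRest_eq_zero k _ (fun j hj => by rw [coord_basisVec h.pos, if_neg (by omega)])]
      simp
    rw [h3] at h2
    have h4 := (show HasFDerivAt (fderiv ℝ ψ) (fderiv ℝ (fderiv ℝ ψ) (frontGerm k (e r)))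
      (frontGerm k (e r + (0 : ℝ) • T)) by simpa using h1.hasFDerivAt).comp_hasDerivAt 0 h2
    rw [map_zero] at h4
    exact h4
  have hc : HasDerivAt (fun s : ℝ => conormal (n + 1) k₂ (coord (φ (e r + s • T)) 0))
      (coord (fderiv ℝ φ (e r) T) 0 • conormal' (n + 1) k₂ (coord (e₂ r) 0)) 0 := by
    have h1 := hasDerivAt_conormal (n + 1) k₂ (coord (e₂ r) 0)
    have h2 : HasDerivAt (conormal (n + 1) k₂) (conormal' (n + 1) k₂ (coord (e₂ r) 0))
        (coord (φ (e r + (0 : ℝ) • T)) 0) := by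
      simpa [φ, coordChange, e.left_inv hre] using h1
    have := HasDerivAt.scomp (h := fun s : ℝ => coord (φ (e r + s • T)) 0) (0 : ℝ) h2 hφ
    exact this
  have hA : ∀ b : Euc (n + 1), HasDerivAt (fun s : ℝ =>
      conormal (n + 1) k₂ (coord (φ (e r + s • T)) 0) (fderiv ℝ ψ (frontGerm k (e r + s • T)) b))
      (coord (fderiv ℝ φ (e r) T) 0 * conormal' (n + 1) k₂ (coord (e₂ r) 0)
        (fderiv ℝ ψ (e' (f r)) b)) 0 := by
    intro b
    have h1 := hc.clm_apply (hψ.clm_apply (hasDerivAt_const 0 b))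
    convert! h1 using 1
    simp [h.eq_germ r hre]
  have hB : HasDerivAt (fun s : ℝ => conormal (n + 1) k (t₀ + s) (nullImage n t₀)) (-1) 0 := by
    have h1 : HasDerivAt (conormal (n + 1) k) (conormal' (n + 1) k t₀) (t₀ + 0) := by
      rw [add_zero]; exact hasDerivAt_conormal _ _ _
    have h2 := (h1.comp_const_add t₀ 0).clm_apply (hasDerivAt_const 0 (nullImage n t₀))
    simpa [conormal'_nullImage h.one_le h.le] using h2
  have hAB := (hA (basisVec (n + 1) 0)).mul hB
  have hev : (fun s : ℝ => conormal (n + 1) k₂ (coord (φ (e r + s • T)) 0)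
      (fderiv ℝ ψ (frontGerm k (e r + s • T)) (nullImage n t₀))) =ᶠ[𝓝 0]
      fun s => conormal (n + 1) k₂ (coord (φ (e r + s • T)) 0)
        (fderiv ℝ ψ (frontGerm k (e r + s • T)) (basisVec (n + 1) 0)) *
        conormal (n + 1) k (t₀ + s) (nullImage n t₀) := by
    have hcont : ContinuousAt (fun s : ℝ => e r + s • T) 0 := hline.continuousAt
    have hev1 : ∀ᶠ s : ℝ in 𝓝 0, e r + s • T ∈ e.target :=
      hcont.eventually (by simpa using e.open_target.mem_nhds (e.map_source hre))
    have hev2 : ∀ᶠ s : ℝ in 𝓝 0, e.symm (e r + s • T) ∈ e₂.source := by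
      have h1 : ContinuousAt e.symm (e r + (0 : ℝ) • T) := by
        simpa using e.continuousAt_symm (e.map_source hre)
      exact (ContinuousAt.comp (f := fun s : ℝ => e r + s • T) h1 hcont).eventually
        (by simpa [e.left_inv hre] using e₂.open_source.mem_nhds hre₂)
    filter_upwards [hev1, hev2] with s hs1 hs2
    have h1 := conormal_coordChange hf h h₂ (e.map_target hs1) hs2 (nullImage n t₀)
    rw [h.eq_germ _ (e.map_target hs1), e.right_inv hs1] at h1
    have h2 : coord (e r + s • T) 0 = t₀ + s := by
      rw [coord_add, coord_smul, coord_basisVec h.pos]; simp [ht₀]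
    rw [h2] at h1
    exact h1
  have h1 := (hA (nullImage n t₀)).unique (hAB.congr_of_eventuallyEq hev)
  simp only [add_zero, conormal_nullImage h.one_le h.le, mul_zero, zero_add, zero_smul] at h1
  rw [mul_comm, h1, h.eq_germ r hre]
  simp [φ, coordChange, e.left_inv hre]

/-- Near the singular set, off it, the sign that decides whether a unit normal is inward does not
depend on the normal form. -/
theorem eventually_inward_sign (hf : IsAFront g f) (h : IsNormalFormOn f k e e')
    (h₂ : IsNormalFormOn f k₂ e₂ e₂') {r : M} (hr : r ∈ singularSet n f) (hre : r ∈ e.source)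
    (hre₂ : r ∈ e₂.source) :
    ∀ᶠ q in 𝓝 r, q ∉ singularSet n f → ∀ v, IsUnitNormalAt g f q v →
      0 < (hess k (e q) * conormalValue f k e e' q v) *
        (hess k₂ (e₂ q) * conormalValue f k₂ e₂ e₂' q v) := by
  have hcM : ContinuousAt (fun q => fderiv ℝ (coordChange e e₂) (e q)) r :=
    ContinuousAt.comp (f := e) (((contDiffAt_coordChange h.mem_atlas h₂.mem_atlas hre
      hre₂).fderiv_right (m := 0) (by simp)).continuousAt) (e.continuousAt hre)
  have hcN : ContinuousAt (fun q => fderiv ℝ (coordChange e' e₂') (e' (f q))) r :=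
    ContinuousAt.comp (f := fun q => e' (f q)) (((contDiffAt_coordChange h.mem_atlas' h₂.mem_atlas'
      (h.mapsTo hre) (h₂.mapsTo hre₂)).fderiv_right (m := 0) (by simp)).continuousAt)
      (ContinuousAt.comp (e'.continuousAt (h.mapsTo hre)) hf.contMDiff.continuous.continuousAt)
  have hc0 : ∀ {e : OpenPartialHomeomorph M (Euc n)}, r ∈ e.source →
      ContinuousAt (fun q => coord (e q) 0) r := fun {e} he =>
    (contDiff_coord 0 (m := 0)).continuous.continuousAt.comp (e.continuousAt he)
  have hw : ContinuousAt (fun q => nullImage n (coord (e q) 0)) r := by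
    unfold nullImage
    exact ((hc0 hre).smul continuousAt_const).sub continuousAt_const
  have hB : ContinuousAt (fun q => conormal' (n + 1) k₂ (coord (e₂ q) 0)
        (fderiv ℝ (coordChange e' e₂') (e' (f q)) (nullImage n (coord (e q) 0))) *
      coord (fderiv ℝ (coordChange e e₂) (e q) (basisVec n 0)) 0) r := by
    refine ContinuousAt.mul ?_ ?_
    · exact ((contDiff_conormal' (n + 1) k₂ (m := 0)).continuous.continuousAt.comp
        (hc0 hre₂)).clm_apply (hcN.clm_apply hw)
    · exact (contDiff_coord 0 (m := 0)).continuous.continuousAt.comp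
        (hcM.clm_apply continuousAt_const)
  have hK : ContinuousAt (fun q => conormal (n + 1) k₂ (coord (e₂ q) 0)
        (fderiv ℝ (coordChange e' e₂') (e' (f q)) (basisVec (n + 1) 0))) r :=
    ((contDiff_conormal (n + 1) k₂ (m := 0)).continuous.continuousAt.comp
        (hc0 hre₂)).clm_apply (hcN.clm_apply continuousAt_const)
  -- By `conormal'_coordChange` the value at `r` is minus the square of the factor between the
  -- conormals; that factor is nonzero, since otherwise the second conormal would vanish on a unit
  -- normal.
  have hneg := (hB.mul hK).eventually_lt_const (u := 0) (by
    rw [Pi.mul_apply]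
    beta_reduce
    rw [conormal'_coordChange hf h h₂ hr hre hre₂, neg_mul, neg_lt_zero]
    refine mul_self_pos.2 fun h0 => ?_
    obtain ⟨U, ν, hqU, hν⟩ := hf.exists_unitNormalField r
    have hv := hν.isUnitNormalAt hqU
    refine h₂.conormalValue_ne_zero hf.contMDiff hre₂ hv ?_
    unfold conormalValue
    rw [chartDeriv_coordChange h.mem_atlas' h₂.mem_atlas' (h.mapsTo hre) (h₂.mapsTo hre₂),
      conormal_coordChange hf h h₂ hre hre₂, h0, zero_mul])
  filter_upwards [hneg, e.open_source.mem_nhds hre, e₂.open_source.mem_nhds hre₂]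
    with q hq hqe hqe₂ hqS v hv
  rw [Pi.mul_apply] at hq
  beta_reduce at hq
  have h1 := hess_coordChange hf h h₂ hqe hqe₂
  have h2 : conormalValue f k₂ e₂ e₂' q v = conormal (n + 1) k₂ (coord (e₂ q) 0)
        (fderiv ℝ (coordChange e' e₂') (e' (f q)) (basisVec (n + 1) 0)) *
      conormalValue f k e e' q v := by
    unfold conormalValue
    rw [chartDeriv_coordChange h.mem_atlas' h₂.mem_atlas' (h.mapsTo hqe) (h₂.mapsTo hqe₂),
      conormal_coordChange hf h h₂ hqe hqe₂]
  have ha := h.conormalValue_ne_zero hf.contMDiff hqe hv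
  have hh : hess k (e q) ≠ 0 := fun h0 => hqS ((h.mem_singularSet_iff hf.contMDiff hqe).2 h0)
  rw [h2]
  set K := conormal (n + 1) k₂ (coord (e₂ q) 0)
        (fderiv ℝ (coordChange e' e₂') (e' (f q)) (basisVec (n + 1) 0))
  set B := conormal' (n + 1) k₂ (coord (e₂ q) 0)
        (fderiv ℝ (coordChange e' e₂') (e' (f q)) (nullImage n (coord (e q) 0)))
  set D := coord (fderiv ℝ (coordChange e e₂) (e q) (basisVec n 0)) 0
  set a := conormalValue f k e e' q v
  have hD : D ≠ 0 := by intro h0; simp [h0] at hq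
  refine pos_of_mul_pos_left (b := D ^ 2) ?_ (by positivity)
  -- `hess_coordChange` trades `hess k₂ * D` for `-(hess k * B)`, which turns the product into a
  -- square times `-(B * D * K)`.
  have : hess k (e q) * a * (hess k₂ (e₂ q) * (K * a)) * D ^ 2
      = (hess k (e q) * a) ^ 2 * -(B * D * K) := by
    linear_combination (-(hess k (e q) * a ^ 2 * K * D)) * h1
  rw [this]
  have : 0 < -(B * D * K) := by linarith
  positivity

end Inward

/-! ### The covariant derivative in arbitrary charts -/

section Christoffel

variable {E : Type*} [NormedAddCommGroup E] [NormedSpace ℝ E]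

/-- `g(∇_t V, w)` in coordinates: `G` is the metric, `z`, `x'` the point and the velocity of the
curve, `v`, `v'` the value and the derivative of the vector field. -/
noncomputable def covForm (G : E → E →L[ℝ] E →L[ℝ] ℝ) (z x' v v' w : E) : ℝ :=
  G z v' w + (fderiv ℝ G z x' v w + fderiv ℝ G z v x' w - fderiv ℝ G z w x' v) / 2

/-- Differentiating the isometry relation produces terms with the second derivative of `ψ`. In the
combination of the Christoffel symbols they cancel in pairs by symmetry, except for the one that
corrects the derivative `v'` of the transformed field. -/
theorem covForm_eq_of_isometry {G₁ G₂ : E → E →L[ℝ] E →L[ℝ] ℝ} {ψ : E → E} {z : E}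
    (hψ : ContDiffAt ℝ 2 ψ z) (hG₁ : DifferentiableAt ℝ G₁ z) (hG₂ : DifferentiableAt ℝ G₂ (ψ z))
    (hsymm : ∀ a b, G₂ (ψ z) a b = G₂ (ψ z) b a)
    (h : ∀ᶠ y in 𝓝 z, ∀ a b, G₁ y a b = G₂ (ψ y) (fderiv ℝ ψ y a) (fderiv ℝ ψ y b))
    (x' v v' w : E) :
    covForm G₁ z x' v v' w = covForm G₂ (ψ z) (fderiv ℝ ψ z x') (fderiv ℝ ψ z v)
      (fderiv ℝ ψ z v' + fderiv ℝ (fderiv ℝ ψ) z x' v) (fderiv ℝ ψ z w) := by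
  have hsym2 : ∀ a b, fderiv ℝ (fderiv ℝ ψ) z a b = fderiv ℝ (fderiv ℝ ψ) z b a := fun a b =>
    (hψ.isSymmSndFDerivAt (by simp)) a b
  have hψ1 : HasFDerivAt ψ (fderiv ℝ ψ z) z := (hψ.differentiableAt (by simp)).hasFDerivAt
  have hψ2 : HasFDerivAt (fderiv ℝ ψ) (fderiv ℝ (fderiv ℝ ψ) z) z :=
    ((hψ.fderiv_right (m := 1) (by norm_num)).differentiableAt (by simp)).hasFDerivAt
  have hD : ∀ a b c, fderiv ℝ G₁ z a b c =
      fderiv ℝ G₂ (ψ z) (fderiv ℝ ψ z a) (fderiv ℝ ψ z b) (fderiv ℝ ψ z c) +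
      G₂ (ψ z) (fderiv ℝ (fderiv ℝ ψ) z a b) (fderiv ℝ ψ z c) +
      G₂ (ψ z) (fderiv ℝ ψ z b) (fderiv ℝ (fderiv ℝ ψ) z a c) := by
    intro a b c
    have h1 : HasFDerivAt (fun y => G₁ y b c) _ z :=
      (hG₁.hasFDerivAt.clm_apply (hasFDerivAt_const b z)).clm_apply (hasFDerivAt_const c z)
    have h2 : HasFDerivAt (fun y => G₂ (ψ y) (fderiv ℝ ψ y b) (fderiv ℝ ψ y c)) _ z :=
      ((HasFDerivAt.comp z hG₂.hasFDerivAt hψ1).clm_apply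
        (hψ2.clm_apply (hasFDerivAt_const b z))).clm_apply (hψ2.clm_apply (hasFDerivAt_const c z))
    have h3 := (h1.unique (h2.congr_of_eventuallyEq (h.mono fun y hy => hy b c)))
    have h4 := congrArg (fun L : E →L[ℝ] ℝ => L a) h3
    simp only [ContinuousLinearMap.comp_apply, _root_.add_apply, ContinuousLinearMap.flip_apply,
      _root_.zero_apply, map_zero, zero_add] at h4
    rw [h4]; ring
  have h0 := h.self_of_nhds
  unfold covForm
  rw [hD, hD, hD, h0, hsym2 v x', hsym2 w x', hsym2 w v, map_add, _root_.add_apply,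
    hsymm (fderiv ℝ ψ z v) (fderiv ℝ (fderiv ℝ ψ) z x' w)]
  ring

end Christoffel

section CovDeriv

variable {d : ℕ} {N : Type*} [TopologicalSpace N] [ChartedSpace (Euc d) N]
  [IsManifold (𝓡 d) ∞ N]

theorem chartAt_mem (y : N) : chartAt (Euc d) y ∈ IsManifold.maximalAtlas (𝓡 d) ∞ N :=
  IsManifold.chart_mem_maximalAtlas y

theorem differentiableAt_gram (g : RiemMetric d N) {e : OpenPartialHomeomorph N (Euc d)}
    (he : e ∈ IsManifold.maximalAtlas (𝓡 d) ∞ N) {z : Euc d} (hz : z ∈ e.target) :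
    DifferentiableAt ℝ (gram g e) z :=
  ((contDiffOn_gram g he).contDiffAt (e.open_target.mem_nhds hz)).differentiableAt (by simp)

/-- The covariant derivative in the preferred chart. -/
theorem covDerivPairing_eq_chartAt (g : RiemMetric d N) (σ : ℝ → N)
    (V : ∀ t, TangentSpace (𝓡 d) (σ t)) (t : ℝ) (w : TangentSpace (𝓡 d) (σ t)) :
    covDerivPairing g σ V t w = covForm (gram g (chartAt (Euc d) (σ t)))
      (chartAt (Euc d) (σ t) (σ t)) (deriv (fun s => chartAt (Euc d) (σ t) (σ s)) t)
      (chartDeriv (chartAt (Euc d) (σ t)) (σ t) (V t))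
      (deriv (fun s => chartDeriv (chartAt (Euc d) (σ t)) (σ s) (V s)) t)
      (chartDeriv (chartAt (Euc d) (σ t)) (σ t) w) := by
  have hG := differentiableAt_gram g (chartAt_mem (σ t)) (mem_chart_target (Euc d) (σ t))
  have h : ∀ a b c : Euc d, fderiv ℝ (fun z => metricCoeff g (σ t) z a b)
      (chartAt (Euc d) (σ t) (σ t)) c =
      fderiv ℝ (gram g (chartAt (Euc d) (σ t))) (chartAt (Euc d) (σ t) (σ t)) c a b := by
    intro a b c
    have h1 : HasFDerivAt (fun z => metricCoeff g (σ t) z a b) _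
        (chartAt (Euc d) (σ t) (σ t)) :=
      (hG.hasFDerivAt.clm_apply (hasFDerivAt_const a _)).clm_apply (hasFDerivAt_const b _)
    rw [h1.fderiv]
    simp
  unfold covForm
  rw [← h, ← h, ← h]
  rfl

/-- The coordinate change to the preferred chart is an isometry for the two Gram matrices. So the
covariant derivative may be computed in any chart, in particular in that of a normal form. -/
theorem covDerivPairing_eq (g : RiemMetric d N) {σ : ℝ → N}
    {V : ∀ t, TangentSpace (𝓡 d) (σ t)} {t : ℝ} (w : TangentSpace (𝓡 d) (σ t))
    {e : OpenPartialHomeomorph N (Euc d)} (he : e ∈ IsManifold.maximalAtlas (𝓡 d) ∞ N)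
    (ht : σ t ∈ e.source) (hc : ContinuousAt σ t)
    (hσ : DifferentiableAt ℝ (fun s => e (σ s)) t)
    (hV : DifferentiableAt ℝ (fun s => chartDeriv e (σ s) (V s)) t) :
    covDerivPairing g σ V t w = covForm (gram g e) (e (σ t)) (deriv (fun s => e (σ s)) t)
      (chartDeriv e (σ t) (V t)) (deriv (fun s => chartDeriv e (σ s) (V s)) t)
      (chartDeriv e (σ t) w) := by
  rw [covDerivPairing_eq_chartAt]
  set e₁ := chartAt (Euc d) (σ t) with he₁
  have ht₁ : σ t ∈ e₁.source := mem_chart_source _ _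
  have hm₁ : e₁ ∈ IsManifold.maximalAtlas (𝓡 d) ∞ N := chartAt_mem _
  set ψ := coordChange e e₁
  have hψ : ContDiffAt ℝ ∞ ψ (e (σ t)) := contDiffAt_coordChange he hm₁ ht ht₁
  have hψe : ψ (e (σ t)) = e₁ (σ t) := by simp [ψ, coordChange, e.left_inv ht]
  have hev : ∀ᶠ s in 𝓝 t, σ s ∈ e.source ∧ σ s ∈ e₁.source :=
    (hc.eventually (e.open_source.mem_nhds ht)).and (hc.eventually (e₁.open_source.mem_nhds ht₁))
  have hx : HasDerivAt (fun s => e₁ (σ s))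
      (fderiv ℝ ψ (e (σ t)) (deriv (fun s => e (σ s)) t)) t := by
    have h1 : HasDerivAt (fun s => ψ (e (σ s))) _ t :=
      HasFDerivAt.comp_hasDerivAt (f := fun s => e (σ s)) t
        (hψ.differentiableAt (by simp)).hasFDerivAt hσ.hasDerivAt
    refine h1.congr_of_eventuallyEq (hev.mono fun s hs => ?_)
    simp [ψ, coordChange, e.left_inv hs.1]
  have hv : HasDerivAt (fun s => chartDeriv e₁ (σ s) (V s))
      (fderiv ℝ ψ (e (σ t)) (deriv (fun s => chartDeriv e (σ s) (V s)) t) +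
        fderiv ℝ (fderiv ℝ ψ) (e (σ t)) (deriv (fun s => e (σ s)) t) (chartDeriv e (σ t) (V t))) t := by
    have h1 : HasDerivAt (fun s => fderiv ℝ ψ (e (σ s))) _ t :=
      HasFDerivAt.comp_hasDerivAt (f := fun s => e (σ s)) t
        ((hψ.fderiv_right (m := 1) (by norm_cast)).differentiableAt (by simp)).hasFDerivAt
        hσ.hasDerivAt
    have h2 := h1.clm_apply hV.hasDerivAt
    rw [add_comm] at h2
    refine h2.congr_of_eventuallyEq (hev.mono fun s hs => ?_)
    exact chartDeriv_coordChange he hm₁ hs.1 hs.2 (V s)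
  rw [hx.deriv, hv.deriv, chartDeriv_coordChange he hm₁ ht ht₁ (V t),
    chartDeriv_coordChange he hm₁ ht ht₁ w, ← hψe]
  refine (covForm_eq_of_isometry (hψ.of_le (by norm_cast)) (differentiableAt_gram g he (e.map_source ht))
    (differentiableAt_gram g hm₁ (by rw [hψe]; exact e₁.map_source ht₁))
    (fun a b => gram_symm g _ _ a b) ?_ _ _ _ _).symm
  have h3 : ∀ᶠ z in 𝓝 (e (σ t)), e.symm z ∈ e₁.source :=
    (e.continuousAt_symm (e.map_source ht)).eventually
      (by rw [e.left_inv ht]; exact e₁.open_source.mem_nhds ht₁)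
  filter_upwards [h3, e.open_target.mem_nhds (e.map_source ht)] with z hz hz' a b
  have h4 := gram_coordChange g he hm₁ (e.map_target hz') hz a b
  rw [e.right_inv hz'] at h4
  exact h4.symm

end CovDeriv

/-! ### Curves in charts -/

section Velocity

variable {d : ℕ} {X : Type*} [TopologicalSpace X] [ChartedSpace (Euc d) X]
  [IsManifold (𝓡 d) ∞ X] {c : ℝ → X} {t : ℝ} {e : OpenPartialHomeomorph X (Euc d)}

theorem hasDerivAt_chart (he : e ∈ IsManifold.maximalAtlas (𝓡 d) ∞ X) (ht : c t ∈ e.source)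
    (hc : MDifferentiableAt 𝓘(ℝ, ℝ) (𝓡 d) c t) :
    HasDerivAt (fun s => e (c s)) (chartDeriv e (c t) (velocity d c t)) t := by
  have h1 : HasMFDerivAt 𝓘(ℝ, ℝ) 𝓘(ℝ, Euc d) (e ∘ c) t _ :=
    HasMFDerivAt.comp t
      ((mdifferentiable_of_mem_maximalAtlas he).mdifferentiableAt ht).hasMFDerivAt hc.hasMFDerivAt
  have h2 : HasFDerivAt (e ∘ c) (chartDeriv e (c t) ∘L mfderiv 𝓘(ℝ, ℝ) (𝓡 d) c t : ℝ →L[ℝ] Euc d) t :=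
    hasMFDerivAt_iff_hasFDerivAt.1 h1
  exact h2.hasDerivAt

theorem contDiffAt_chart {r : ℕ∞ω} (hr : r ≤ ∞) (he : e ∈ IsManifold.maximalAtlas (𝓡 d) ∞ X)
    (ht : c t ∈ e.source) (hc : ContMDiffAt 𝓘(ℝ, ℝ) (𝓡 d) r c t) :
    ContDiffAt ℝ r (fun s => e (c s)) t := by
  rw [← contMDiffAt_iff_contDiffAt]
  exact ((contMDiffAt_of_mem_maximalAtlas he ht).of_le hr).comp t hc

theorem _root_.ContDiffAt.continuousAt_deriv {E : Type*} [NormedAddCommGroup E] [NormedSpace ℝ E]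
    {x : ℝ → E} {t : ℝ} (h : ContDiffAt ℝ 1 x t) : ContinuousAt (deriv x) t := by
  have h1 : ContDiffAt ℝ 0 (fderiv ℝ x) t := h.fderiv_right (by simp)
  exact h1.continuousAt.clm_apply continuousAt_const

theorem _root_.ContDiffAt.differentiableAt_deriv {E : Type*} [NormedAddCommGroup E] [NormedSpace ℝ E]
    {x : ℝ → E} {t : ℝ} (h : ContDiffAt ℝ 2 x t) : DifferentiableAt ℝ (deriv x) t := by
  have h1 : ContDiffAt ℝ 1 (fderiv ℝ x) t := h.fderiv_right (by norm_num)
  exact (h1.differentiableAt (by simp)).clm_apply (differentiableAt_const (1 : ℝ))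

set_option maxSynthPendingDepth 3 in
theorem continuousAt_fderiv_bilin {E : Type*} [NormedAddCommGroup E] [NormedSpace ℝ E]
    {G : E → E →L[ℝ] E →L[ℝ] ℝ} {x a b c : ℝ → E} {t : ℝ} (hG : ContDiffAt ℝ 1 G (x t))
    (hx : ContinuousAt x t) (ha : ContinuousAt a t) (hb : ContinuousAt b t)
    (hc : ContinuousAt c t) : ContinuousAt (fun s => fderiv ℝ G (x s) (a s) (b s) (c s)) t := by
  have h1 : ContinuousAt (fun s => fderiv ℝ G (x s)) t :=
    ContinuousAt.comp (f := x) (hG.fderiv_right (m := 0) (by simp)).continuousAt hx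
  exact ((h1.clm_apply ha).clm_apply hb).clm_apply hc

end Velocity

/-! ### Unit normals and normal curvature along a curve -/

section Along

variable {n : ℕ}
  {M : Type*} [TopologicalSpace M] [ChartedSpace (Euc n) M] [IsManifold (𝓡 n) ∞ M]
  {N : Type*} [TopologicalSpace N] [ChartedSpace (Euc (n + 1)) N] [IsManifold (𝓡 (n + 1)) ∞ N]
  {g : RiemMetric (n + 1) N} {f : M → N}

theorem velocity_comp (hf : ContMDiff (𝓡 n) (𝓡 (n + 1)) ∞ f) {c : ℝ → M} {t : ℝ}
    (hc : MDifferentiableAt 𝓘(ℝ, ℝ) (𝓡 n) c t) :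
    velocity (n + 1) (fun s => f (c s)) t =
      mfderiv (𝓡 n) (𝓡 (n + 1)) f (c t) (velocity n c t) := by
  have h1 : HasMFDerivAt 𝓘(ℝ, ℝ) (𝓡 (n + 1)) (f ∘ c) t _ :=
    HasMFDerivAt.comp t ((hf.mdifferentiable (by simp)) (c t)).hasMFDerivAt hc.hasMFDerivAt
  exact congrArg (fun L : ℝ →L[ℝ] Euc (n + 1) => L 1) h1.mfderiv

/-- A continuous unit normal field along a map is locally induced by a smooth unit normal field. -/
theorem IsUnitNormalAlong.exists_eventually_eq {T : Type*} [TopologicalSpace T] {γ : T → M}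
    {s : Set T} {ν : ∀ t, TangentSpace (𝓡 (n + 1)) (f (γ t))} (hf : IsAFront g f)
    (hγ : Continuous γ) (h : IsUnitNormalAlong g f γ s ν) {t : T} (ht : t ∈ s) :
    ∃ (U : Set M) (μ : ∀ x, TangentSpace (𝓡 (n + 1)) (f x)), γ t ∈ U ∧
      IsUnitNormalField g f U μ ∧ ∀ᶠ t' in 𝓝[s] t, γ t' ∈ U ∧ ν t' = μ (γ t') := by
  obtain ⟨U, μ, hU, hμ, hμt⟩ := h.2 t ht
  refine ⟨U, μ, hU, hμ, ?_⟩
  have hγU : ∀ᶠ t' in 𝓝[s] t, γ t' ∈ U :=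
    (hγ.continuousAt.eventually (hμ.isOpen.mem_nhds hU)).filter_mono nhdsWithin_le_nhds
  have h1 : ContinuousWithinAt (fun t' => g.inner (f (γ t')) (ν t') (μ (γ t'))) s t := by
    refine ContinuousWithinAt.inner_along (h.1 t ht) ?_
    have h2 : ContinuousAt (lift f μ) (γ t) :=
      ((hμ.smooth _ hU).contMDiffAt (hμ.isOpen.mem_nhds hU)).continuousAt
    exact (ContinuousAt.comp (f := γ) h2 hγ.continuousAt).continuousWithinAt
  have h3 : ∀ᶠ t' in 𝓝[s] t, 0 < g.inner (f (γ t')) (ν t') (μ (γ t')) := by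
    refine h1.eventually_const_lt (show (0 : ℝ) < _ from ?_)
    beta_reduce; rw [← hμt, hμ.unit _ hU]; exact one_pos
  filter_upwards [hγU, h3, self_mem_nhdsWithin] with t' h1 h3 ht'
  refine ⟨h1, ?_⟩
  rcases IsUnitNormalAt.eq_or_eq_neg hf (hμ.isUnitNormalAt h1) (h.2 t' ht') with h4 | h4
  · exact h4
  · rw [h4] at h3
    have := hμ.unit _ h1
    simp only [map_neg, _root_.neg_apply] at h3
    linarith

theorem IsUnitNormalAlong.neg {T : Type*} [TopologicalSpace T] {γ : T → M}
    {s : Set T} {ν : ∀ t, TangentSpace (𝓡 (n + 1)) (f (γ t))} (hf : IsAFront g f)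
    (hγ : Continuous γ) (h : IsUnitNormalAlong g f γ s ν) :
    IsUnitNormalAlong g f γ s fun t => -ν t := by
  refine ⟨fun t ht => ?_, fun t ht => (h.2 t ht).neg⟩
  obtain ⟨U, μ, hU, hμ, hev⟩ := h.exists_eventually_eq hf hγ ht
  have h1 : ContinuousAt (lift f fun x => -μ x) (γ t) :=
    ((hμ.neg.smooth _ hU).contMDiffAt (hμ.isOpen.mem_nhds hU)).continuousAt
  have h2 := (ContinuousAt.comp (f := γ) h1 hγ.continuousAt).continuousWithinAt (s := s)
  refine h2.congr_of_eventuallyEq (hev.mono fun t' ht' => ?_) ?_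
  · simp only [Function.comp, lift]; rw [ht'.2]
  · simp only [Function.comp, lift]; rw [(hev.self_of_nhdsWithin ht).2]

/-- A unit normal field along a curve, in a chart. -/
theorem IsUnitNormalAlong.contDiffAt_chartDeriv {r : ℕ∞ω} (hr : r ≤ ∞) {c : ℝ → M}
    {ν : ∀ t, TangentSpace (𝓡 (n + 1)) (f (c t))} (hf : IsAFront g f)
    (hc : Continuous c) {t : ℝ} (hct : ContMDiffAt 𝓘(ℝ, ℝ) (𝓡 n) r c t)
    (h : IsUnitNormalAlong g f c univ ν) {e' : OpenPartialHomeomorph N (Euc (n + 1))}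
    (he' : e' ∈ IsManifold.maximalAtlas (𝓡 (n + 1)) ∞ N) (ht : f (c t) ∈ e'.source) :
    ContDiffAt ℝ r (fun s => chartDeriv e' (f (c s)) (ν s)) t := by
  obtain ⟨U, μ, hU, hμ, hev⟩ := h.exists_eventually_eq hf hc (mem_univ t)
  have h1 := ((hμ.contMDiffAt_chartDeriv hU he' ht).of_le hr).comp t hct
  rw [contMDiffAt_iff_contDiffAt] at h1
  refine h1.congr_of_eventuallyEq ?_
  rw [nhdsWithin_univ] at hev
  filter_upwards [hev] with s hs
  simp only [Function.comp]; rw [hs.2]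

theorem fderiv_gram_symm {d : ℕ} {X : Type*} [TopologicalSpace X] [ChartedSpace (Euc d) X]
    [IsManifold (𝓡 d) ∞ X] (g : RiemMetric d X) {e : OpenPartialHomeomorph X (Euc d)}
    (he : e ∈ IsManifold.maximalAtlas (𝓡 d) ∞ X) {z : Euc d} (hz : z ∈ e.target) (a b c : Euc d) :
    fderiv ℝ (gram g e) z a b c = fderiv ℝ (gram g e) z a c b := by
  have hG := (differentiableAt_gram g he hz).hasFDerivAt
  have h : ∀ b c : Euc d, HasFDerivAt (fun y => gram g e y b c) _ z := fun b c =>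
    (hG.clm_apply (hasFDerivAt_const b z)).clm_apply (hasFDerivAt_const c z)
  have h1 := (h b c).unique ((h c b).congr_of_eventuallyEq
    (Eventually.of_forall fun y => gram_symm g e y b c))
  simpa using congrArg (fun L : Euc d →L[ℝ] ℝ => L a) h1

/-- The homogeneous coordinates of the normal curvature in a chart. -/
theorem curvatureVector_eq {c : ℝ → M}
    {ν : ∀ t, TangentSpace (𝓡 (n + 1)) (f (c t))} (hf : IsAFront g f)
    (hc : ContMDiff 𝓘(ℝ, ℝ) (𝓡 n) 1 c) {t : ℝ}
    (h : IsUnitNormalAlong g f c univ ν) {e' : OpenPartialHomeomorph N (Euc (n + 1))}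
    (he' : e' ∈ IsManifold.maximalAtlas (𝓡 (n + 1)) ∞ N) (ht : f (c t) ∈ e'.source) :
    curvatureVector g f c ν t =
      (gram g e' (e' (f (c t))) (deriv (fun s => e' (f (c s))) t) (deriv (fun s => e' (f (c s))) t),
        gram g e' (e' (f (c t))) (deriv (fun s => chartDeriv e' (f (c s)) (ν s)) t)
          (deriv (fun s => e' (f (c s))) t) +
        fderiv ℝ (gram g e') (e' (f (c t))) (chartDeriv e' (f (c t)) (ν t))
          (deriv (fun s => e' (f (c s))) t) (deriv (fun s => e' (f (c s))) t) / 2) := by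
  have hσ : ContMDiff 𝓘(ℝ, ℝ) (𝓡 (n + 1)) 1 (fun s => f (c s)) :=
    (hf.contMDiff.of_le (by norm_cast)).comp hc
  have h1 := hasDerivAt_chart (c := fun s => f (c s)) he' ht (hσ.mdifferentiable (by simp) t)
  have h2 := (h.contDiffAt_chartDeriv (r := 1) (by norm_cast) hf hc.continuous hc.contMDiffAt he'
    ht).differentiableAt (by simp)
  unfold curvatureVector
  refine Prod.ext ?_ ?_
  · dsimp only
    rw [h1.deriv, gram_chartDeriv g he' ht]
  · dsimp only
    rw [covDerivPairing_eq g _ he' ht hσ.continuous.continuousAt h1.differentiableAt h2, ← h1.deriv]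
    unfold covForm
    -- For `w` equal to the velocity, two of the three Christoffel terms cancel by this symmetry,
    -- and half of the derivative in the direction of `ν` remains.
    rw [fderiv_gram_symm g he' (e'.map_source ht) _ (chartDeriv e' (f (c t)) (ν t))]
    ring

theorem curvatureVector_fst_pos {c : ℝ → M} {ν : ∀ t, TangentSpace (𝓡 (n + 1)) (f (c t))}
    (hf : ContMDiff (𝓡 n) (𝓡 (n + 1)) ∞ f) {t : ℝ} (hc : MDifferentiableAt 𝓘(ℝ, ℝ) (𝓡 n) c t)
    (hreg : velocity n c t ≠ 0) (ht : c t ∉ singularSet n f) :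
    0 < (curvatureVector g f c ν t).1 := by
  refine g.pos _ _ fun h0 => hreg ?_
  have h1 : velocity (n + 1) (fun s => f (c s)) t = 0 := h0
  rw [velocity_comp hf hc] at h1
  exact (not_not.1 ht) (h1.trans (map_zero _).symm)

/-- In a chart only first derivatives of the curve and of the normal field occur, so a curve of
class `C^1` suffices. -/
theorem continuousAt_curvatureVector {c : ℝ → M}
    {ν : ∀ t, TangentSpace (𝓡 (n + 1)) (f (c t))} (hf : IsAFront g f)
    (hc : ContMDiff 𝓘(ℝ, ℝ) (𝓡 n) 1 c) (h : IsUnitNormalAlong g f c univ ν) (t : ℝ) :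
    ContinuousAt (curvatureVector g f c ν) t := by
  set e' := chartAt (Euc (n + 1)) (f (c t))
  have he' : e' ∈ IsManifold.maximalAtlas (𝓡 (n + 1)) ∞ N := chartAt_mem _
  have ht : f (c t) ∈ e'.source := mem_chart_source _ _
  have hσ : ContMDiff 𝓘(ℝ, ℝ) (𝓡 (n + 1)) 1 (fun s => f (c s)) :=
    (hf.contMDiff.of_le (by norm_cast)).comp hc
  have hx : ContDiffAt ℝ 1 (fun s => e' (f (c s))) t :=
    contDiffAt_chart (c := fun s => f (c s)) (by norm_cast) he' ht hσ.contMDiffAt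
  have hv := h.contDiffAt_chartDeriv (r := 1) (by norm_cast) hf hc.continuous hc.contMDiffAt he' ht
  have hG := (contDiffOn_gram g he').contDiffAt (e'.open_target.mem_nhds (e'.map_source ht))
  have hGx : ContinuousAt (fun s => gram g e' (e' (f (c s)))) t :=
    ContinuousAt.comp (f := fun s => e' (f (c s))) hG.continuousAt hx.continuousAt
  have hx' := hx.continuousAt_deriv
  have hv' := hv.continuousAt_deriv
  have h1 : ContinuousAt (fun t =>
      (gram g e' (e' (f (c t))) (deriv (fun s => e' (f (c s))) t) (deriv (fun s => e' (f (c s))) t),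
        gram g e' (e' (f (c t))) (deriv (fun s => chartDeriv e' (f (c s)) (ν s)) t)
          (deriv (fun s => e' (f (c s))) t) +
        fderiv ℝ (gram g e') (e' (f (c t))) (chartDeriv e' (f (c t)) (ν t))
          (deriv (fun s => e' (f (c s))) t) (deriv (fun s => e' (f (c s))) t) / 2)) t :=
    ((hGx.clm_apply hx').clm_apply hx').prodMk (((hGx.clm_apply hv').clm_apply hx').add
      ((continuousAt_fderiv_bilin (hG.of_le (by norm_cast)) hx.continuousAt hv.continuousAt hx' hx').div_const 2))
  refine h1.congr ?_
  filter_upwards [hσ.continuous.continuousAt.eventually (e'.open_source.mem_nhds ht)] with s hs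
  exact (curvatureVector_eq hf hc h he' hs).symm

end Along

/-! ### Null curves through a singular point -/

section Calculus

variable {E : Type*} [NormedAddCommGroup E] [NormedSpace ℝ E]

theorem tendsto_inv_smul {y : ℝ → E} {W : E} {t : ℝ} (hy : HasDerivAt y W t) (h0 : y t = 0) :
    Tendsto (fun s => (s - t)⁻¹ • y s) (𝓝[≠] t) (𝓝 W) := by
  have := hasDerivAt_iff_tendsto_slope.1 hy
  refine this.congr fun s => ?_
  simp [slope, h0]

/-- The quotient by `s - t` replaces one factor `y` by `(s - t)⁻¹ • y`, which tends to `W`. Terms in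
which a second factor `y` remains tend to zero. -/
theorem tendsto_pairing_div {G : E → E →L[ℝ] E →L[ℝ] ℝ} {x v v' y : ℝ → E} {W : E} {t : ℝ}
    (hG : ContDiffAt ℝ 1 G (x t)) (hx : ContinuousAt x t) (hv : ContinuousAt v t)
    (hv' : ContinuousAt v' t) (hy : HasDerivAt y W t) (h0 : y t = 0) :
    Tendsto (fun s => (G (x s) (y s) (y s)) / (s - t)) (𝓝[≠] t) (𝓝 0) ∧
    Tendsto (fun s => (G (x s) (v' s) (y s) + fderiv ℝ G (x s) (v s) (y s) (y s) / 2) / (s - t))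
      (𝓝[≠] t) (𝓝 (G (x t) (v' t) W)) := by
  classical
  set q : ℝ → E := Function.update (fun s => (s - t)⁻¹ • y s) t W
  have hq : ContinuousAt q t := continuousAt_update_same.2 (tendsto_inv_smul hy h0)
  have hqt : q t = W := Function.update_self _ _ _
  have hqs : ∀ s, s ≠ t → q s = (s - t)⁻¹ • y s := fun s hs => Function.update_of_ne hs _ _
  have hGx : ContinuousAt (fun s => G (x s)) t := ContinuousAt.comp (f := x) hG.continuousAt hx
  have h1 : ContinuousAt (fun s => G (x s) (y s) (q s)) t :=
    (hGx.clm_apply hy.continuousAt).clm_apply hq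
  have h2 : ContinuousAt (fun s => G (x s) (v' s) (q s) +
      fderiv ℝ G (x s) (v s) (y s) (q s) / 2) t :=
    ((hGx.clm_apply hv').clm_apply hq).add
      ((continuousAt_fderiv_bilin hG hx hv hy.continuousAt hq).div_const 2)
  constructor
  · have h3 := h1.tendsto.mono_left (nhdsWithin_le_nhds (s := {t}ᶜ))
    simp only [h0, map_zero, _root_.zero_apply] at h3
    refine h3.congr' ?_
    filter_upwards [self_mem_nhdsWithin] with s hs
    rw [hqs s hs, map_smul, smul_eq_mul]; ring
  · have h3 := h2.tendsto.mono_left (nhdsWithin_le_nhds (s := {t}ᶜ))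
    simp only [h0, map_zero, _root_.zero_apply, zero_div, add_zero, hqt] at h3
    refine h3.congr' ?_
    filter_upwards [self_mem_nhdsWithin] with s hs
    rw [hqs s hs, map_smul, smul_eq_mul, map_smul, smul_eq_mul]; ring

theorem hess_one {n : ℕ} (X : Euc n) : hess 1 X = 6 * coord X 0 := by
  simp [hess]; norm_num

theorem hasDerivAt_coord {d : ℕ} {X : ℝ → Euc d} {X' : Euc d} {t : ℝ} (h : HasDerivAt X X' t)
    (j : ℕ) : HasDerivAt (fun s => coord (X s) j) (coord X' j) t := by
  have := (coordL d j).hasFDerivAt.comp_hasDerivAt t h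
  simpa only [coordL_apply, Function.comp_def] using this

/-- The image velocity `x'` satisfies `conormal x' = 0` and `conormal' x' = -6 τ τ'` with `τ = coord
X 0`. As `x'` and `τ` vanish at `t`, differentiating these identities gives the pairings with `W =
x''`. The velocity of `X` lies in the kernel, hence along the `0`-th coordinate, so `τ' ≠ 0`. -/
theorem null_curve_calculus {n : ℕ} (hn : 0 < n) {X : ℝ → Euc n} {t : ℝ} (hX : ContDiffAt ℝ 2 X t)
    (h0 : hess 1 (X t) = 0) (hreg : deriv X t ≠ 0)
    (hnull : germDeriv 1 (X t) (deriv X t) = 0) :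
    coord (deriv X t) 0 ≠ 0 ∧ deriv (fun s => frontGerm 1 (X s)) t = 0 ∧
    ∃ W, HasDerivAt (deriv fun s => frontGerm 1 (X s)) W t ∧
      conormal (n + 1) 1 (coord (X t) 0) W = 0 ∧
      conormal' (n + 1) 1 (coord (X t) 0) W = -(6 * coord (deriv X t) 0 ^ 2) := by
  have hd : ∀ᶠ s in 𝓝 t, HasDerivAt X (deriv X s) s := by
    filter_upwards [hX.eventually (by simp)] with s hs
    exact (hs.differentiableAt (by simp)).hasDerivAt
  have hx' : ∀ᶠ s in 𝓝 t, deriv (fun s => frontGerm 1 (X s)) s = germDeriv 1 (X s) (deriv X s) := by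
    filter_upwards [hd] with s hs
    exact HasDerivAt.deriv (HasFDerivAt.comp_hasDerivAt s (hasFDerivAt_frontGerm hn 1 (X s)) hs)
  have hx0 : deriv (fun s => frontGerm 1 (X s)) t = 0 := hx'.self_of_nhds.trans hnull
  have hx : ContDiffAt ℝ 2 (fun s => frontGerm 1 (X s)) t :=
    ContDiffAt.comp (f := X) (g := frontGerm 1) t (contDiff_frontGerm hn 1).contDiffAt hX
  have hW := hx.differentiableAt_deriv.hasDerivAt
  have hτ : HasDerivAt (fun s => coord (X s) 0) (coord (deriv X t) 0) t :=
    hasDerivAt_coord hd.self_of_nhds 0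
  have hτ0 : coord (X t) 0 = 0 := by rw [hess_one] at h0; linarith
  refine ⟨fun h => hreg ?_, hx0, _, hW, ?_, ?_⟩
  · have h1 := ((germDeriv_eq_zero_iff hn le_rfl hn _ _).1 hnull).1
    refine coord_ext fun j hj => ?_
    rcases Nat.eq_zero_or_pos j with rfl | hj'
    · rw [h, coord_zero]
    · rw [h1 j hj', coord_zero]
  · have h1 : HasDerivAt (fun s => conormal (n + 1) 1 (coord (X s) 0)) _ t :=
      HasDerivAt.scomp (h := fun s => coord (X s) 0) t (hasDerivAt_conormal (n + 1) 1 _) hτ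
    have h2 := h1.clm_apply hW
    have h3 : HasDerivAt (fun s => conormal (n + 1) 1 (coord (X s) 0)
        (deriv (fun s => frontGerm 1 (X s)) s)) 0 t := by
      refine (hasDerivAt_const t (0 : ℝ)).congr_of_eventuallyEq (hx'.mono fun s hs => ?_)
      beta_reduce
      rw [hs, conormal_germDeriv le_rfl hn]
    have h4 := h2.unique h3
    rw [hx0, map_zero, zero_add] at h4
    exact h4
  · have h1 : HasDerivAt (fun s => conormal' (n + 1) 1 (coord (X s) 0)) _ t :=
      HasDerivAt.scomp (h := fun s => coord (X s) 0) t
        (((contDiff_conormal' (n + 1) 1 (m := 1)).differentiable (by simp)) _).hasDerivAt hτ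
    have h2 := h1.clm_apply hW
    have hτ' : DifferentiableAt ℝ (fun s => coord (deriv X s) 0) t :=
      (hasDerivAt_coord hX.differentiableAt_deriv.hasDerivAt 0).differentiableAt
    have h3 : HasDerivAt (fun s => conormal' (n + 1) 1 (coord (X s) 0)
        (deriv (fun s => frontGerm 1 (X s)) s))
        (-(6 * coord (deriv X t) 0 ^ 2)) t := by
      have h5 := ((hτ.mul hτ'.hasDerivAt).const_mul 6).neg
      rw [hτ0, zero_mul, add_zero, ← sq] at h5
      refine h5.congr_of_eventuallyEq (hx'.mono fun s hs => ?_)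
      beta_reduce
      rw [hs, conormal'_germDeriv le_rfl hn, hess_one]
      simp only [Pi.neg_apply, Pi.mul_apply]
      ring
    have h4 := h2.unique h3
    rw [hx0, map_zero, zero_add] at h4
    exact h4

end Calculus

/-! ### The normal curvature near a singular parameter -/

section NullCurve

variable {n : ℕ}
  {M : Type*} [TopologicalSpace M] [ChartedSpace (Euc n) M] [IsManifold (𝓡 n) ∞ M]
  {N : Type*} [TopologicalSpace N] [ChartedSpace (Euc (n + 1)) N] [IsManifold (𝓡 (n + 1)) ∞ N]
  {g : RiemMetric (n + 1) N} {f : M → N}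

/-- Off the singular set both factors are nonzero, so the criterion for the root count applies. From
here on inwardness enters only through this sign. -/
theorem IsNormalFormOn.inwardSign_mul {k : ℕ} {e : OpenPartialHomeomorph M (Euc n)}
    {e' : OpenPartialHomeomorph N (Euc (n + 1))} (h : IsNormalFormOn f k e e')
    (hf : IsAFront g f) {q : M} (hq : q ∈ e.source) (hqS : q ∉ singularSet n f)
    {v : TangentSpace (𝓡 (n + 1)) (f q)} (hv : IsUnitNormalAt g f q v) :
    IsInward f k e e' q v ↔ hess k (e q) * conormalValue f k e e' q v < 0 := by
  unfold IsInward conormalValue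
  rw [h.eq_germ q hq]
  refine increasesRoots_iff h.pos h.one_le h.le _ _ (mul_ne_zero ?_ ?_)
  · exact fun h0 => hqS ((h.mem_singularSet_iff hf.contMDiff hq).2 h0)
  · exact h.conormalValue_ne_zero hf.contMDiff hq hv

/-- The behaviour of the normal curvature of a null curve near a singular point. -/
theorem exists_tendsto_curvature {c : ℝ → M} {ν : ∀ t, TangentSpace (𝓡 (n + 1)) (f (c t))}
    (hn : 0 < n) (hf : IsAFront g f)
    (hc : ContMDiff 𝓘(ℝ, ℝ) (𝓡 n) 1 c) (hν : IsUnitNormalAlong g f c univ ν) {t : ℝ}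
    (hS : c t ∈ singularSet n f)
    (hreg : velocity n c t ≠ 0)
    (hnull : mfderiv (𝓡 n) (𝓡 (n + 1)) f (c t) (velocity n c t) = 0)
    (hA : IsASingularity n f (c t) 1) (hc2 : ContMDiffAt 𝓘(ℝ, ℝ) (𝓡 n) 2 c t) :
    ∃ P : ℝ, P ≠ 0 ∧
      Tendsto (fun s => (curvatureVector g f c ν s).1 / (s - t)) (𝓝[≠] t) (𝓝 0) ∧
      Tendsto (fun s => (curvatureVector g f c ν s).2 / (s - t)) (𝓝[≠] t) (𝓝 P) ∧
      (∀ᶠ s in 𝓝[≠] t, c s ∉ singularSet n f) ∧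
      ∀ (k : ℕ) (e : OpenPartialHomeomorph M (Euc n)) (e' : OpenPartialHomeomorph N (Euc (n + 1))),
        IsNormalFormOn f k e e' → c t ∈ e.source → ∀ᶠ s in 𝓝[≠] t,
          hess k (e (c s)) * conormalValue f k e e' (c s) (ν s) * ((s - t) * P) < 0 := by
  obtain ⟨e, e', h, hte, he0⟩ := hA.exists_isNormalFormOn le_rfl hn
  have hte' := h.mapsTo hte
  have hces : ∀ᶠ s in 𝓝 t, c s ∈ e.source :=
    hc.continuous.continuousAt.eventually (e.open_source.mem_nhds hte)
  set X : ℝ → Euc n := fun s => e (c s) with hXdef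
  have hX : ContDiffAt ℝ 2 X t := contDiffAt_chart (by norm_cast) h.mem_atlas hte hc2
  have hX1 := hasDerivAt_chart h.mem_atlas hte (hc.mdifferentiable (by simp) t)
  have hx : (fun s => e' (f (c s))) =ᶠ[𝓝 t] fun s => frontGerm 1 (X s) :=
    hces.mono fun s hs => h.eq_germ _ hs
  have hhess : hess 1 (X t) = 0 := (h.mem_singularSet_iff hf.contMDiff hte).1 hS
  obtain ⟨hτ', hy0, W, hW, hW1, hW2⟩ := null_curve_calculus hn hX hhess
    (by rw [hX1.deriv]; exact fun h0 => hreg (chartDeriv_injective h.mem_atlas hte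
      (h0.trans (map_zero _).symm)))
    (by rw [hX1.deriv, ← h.chartDeriv_mfderiv hf.contMDiff hte, hnull, map_zero])
  rw [← hx.deriv_eq] at hy0
  have hW' : HasDerivAt (deriv fun s => e' (f (c s))) W t := hW.congr_of_eventuallyEq hx.deriv
  have hτ : HasDerivAt (fun s => coord (X s) 0) (coord (deriv X t) 0) t :=
    hasDerivAt_coord (hX.differentiableAt (by simp)).hasDerivAt 0
  set b := coord (deriv X t) 0 with hb
  have hv := hν.contDiffAt_chartDeriv (r := 1) (by norm_cast) hf hc.continuous hc.contMDiffAt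
    h.mem_atlas' hte'
  have hxc : ContinuousAt (fun s => e' (f (c s))) t :=
    ContinuousAt.comp (f := fun s => f (c s)) (e'.continuousAt hte')
      (hf.contMDiff.continuous.comp hc.continuous).continuousAt
  have hG := (contDiffOn_gram g h.mem_atlas').contDiffAt
    (e'.open_target.mem_nhds (e'.map_source hte'))
  set a := conormalValue f 1 e e' (c t) (ν t) with ha
  have ha0 : a ≠ 0 := h.conormalValue_ne_zero hf.contMDiff hte (hν.2 t (mem_univ t))
  -- the limit of the second component
  have hGv : gram g e' (e' (f (c t))) (deriv (fun s => chartDeriv e' (f (c s)) (ν s)) t) W =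
      a⁻¹ * (b * -(6 * b ^ 2)) := by
    have h1 : HasDerivAt (fun s => gram g e' (e' (f (c s)))) 0 t := by
      have h2 : HasDerivAt (fun s => e' (f (c s))) 0 t := by
        rw [← hy0]
        exact ((hX.differentiableAt (by simp)).hasDerivAt.differentiableAt |>
          fun hXd => DifferentiableAt.hasDerivAt (DifferentiableAt.congr_of_eventuallyEq
            ((hasFDerivAt_frontGerm hn 1 (X t)).differentiableAt.comp t hXd) hx))
      have h3 := HasFDerivAt.comp_hasDerivAt (f := fun s => e' (f (c s))) t
        (hG.differentiableAt (by simp)).hasFDerivAt h2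
      rw [map_zero] at h3
      exact h3
    have h2 := (h1.clm_apply (hv.differentiableAt (by simp)).hasDerivAt).clm_apply
      (hasDerivAt_const t W)
    simp only [map_zero, add_zero, _root_.zero_apply, zero_add] at h2
    have hl : DifferentiableAt ℝ (fun s => gram g e' (e' (f (c s)))
        (chartDeriv e' (f (c s)) (ν s)) (basisVec (n + 1) 0)) t :=
      ((h1.clm_apply (hv.differentiableAt (by simp)).hasDerivAt).clm_apply
        (hasDerivAt_const t (basisVec (n + 1) 0))).differentiableAt
    have h3 : HasDerivAt (fun s => conormal (n + 1) 1 (coord (X s) 0)) _ t :=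
      HasDerivAt.scomp (h := fun s => coord (X s) 0) t (hasDerivAt_conormal (n + 1) 1 _) hτ
    have h4 := hl.hasDerivAt.mul (h3.clm_apply (hasDerivAt_const t W))
    have h5 : (fun s => gram g e' (e' (f (c s))) (chartDeriv e' (f (c s)) (ν s)) W) =ᶠ[𝓝 t]
        fun s => gram g e' (e' (f (c s))) (chartDeriv e' (f (c s)) (ν s)) (basisVec (n + 1) 0) *
          conormal (n + 1) 1 (coord (X s) 0) W := by
      filter_upwards [hces] with s hs
      have := congrArg (fun L : Euc (n + 1) →L[ℝ] ℝ => L W)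
        (h.gram_unitNormal hf.contMDiff hs (hν.2 s (mem_univ s)))
      simpa using this
    rw [h2.unique (h4.congr_of_eventuallyEq h5)]
    have h6 := h.coeff_mul_conormalValue hf.contMDiff hte (hν.2 t (mem_univ t))
    rw [eq_inv_of_mul_eq_one_left h6, ← ha]
    simp only [_root_.smul_apply, smul_eq_mul, map_zero, add_zero, hW1, mul_zero,
      zero_add, hW2]
  obtain ⟨hT1, hT2⟩ := tendsto_pairing_div (hG.of_le (by norm_cast)) hxc hv.continuousAt
    hv.continuousAt_deriv hW' hy0
  have hcv : ∀ᶠ s in 𝓝[≠] t, f (c s) ∈ e'.source :=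
    ((hf.contMDiff.continuous.comp hc.continuous).continuousAt.eventually
      (e'.open_source.mem_nhds hte')).filter_mono nhdsWithin_le_nhds
  have hh : Tendsto (fun s => hess 1 (X s) / (s - t)) (𝓝[≠] t) (𝓝 (6 * b)) := by
    have h1 : HasDerivAt (fun s => hess 1 (X s)) (6 * b) t := by
      simp only [hess_one]
      exact hτ.const_mul 6
    refine (tendsto_inv_smul h1 hhess).congr fun s => ?_
    rw [smul_eq_mul]; ring
  set P := a⁻¹ * (b * -(6 * b ^ 2)) with hP
  have hP0 : P ≠ 0 := by
    rw [hP]; simp [ha0, hτ']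
  have hSev : ∀ᶠ s in 𝓝[≠] t, c s ∉ singularSet n f := by
    filter_upwards [hh.eventually_ne (mul_ne_zero (by norm_num : (6 : ℝ) ≠ 0) hτ'), hces.filter_mono nhdsWithin_le_nhds]
      with s hs hs' hsS
    rw [h.mem_singularSet_iff hf.contMDiff hs'] at hsS
    exact hs (by rw [hXdef]; simp [hsS])
  refine ⟨P, hP0, ?_, ?_, hSev, fun k₂ e₂ e₂' h₂ hte₂ => ?_⟩
  · refine hT1.congr' (hcv.mono fun s hs => ?_)
    beta_reduce
    rw [curvatureVector_eq hf hc hν h.mem_atlas' hs]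
  · rw [← hGv]
    refine hT2.congr' (hcv.mono fun s hs => ?_)
    beta_reduce
    rw [curvatureVector_eq hf hc hν h.mem_atlas' hs]
  · have hac : ContinuousAt (fun s => conormalValue f 1 e e' (c s) (ν s)) t := by
      refine ContinuousAt.clm_apply ?_ hv.continuousAt
      exact ContinuousAt.comp (f := fun s => coord (X s) 0)
        (contDiff_conormal (n + 1) 1 (m := 0)).continuous.continuousAt hτ.continuousAt
    -- In the `A₂` form the limit of `hess / (s - t) * conormalValue * P` is `6 b * a * P = -36 b^4
    -- < 0`. The sign carries over to an arbitrary normal form by `eventually_inward_sign`.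
    have h1 := ((hh.mul (hac.tendsto.mono_left nhdsWithin_le_nhds)).mul_const P).eventually_lt_const
      (u := 0) (by
        rw [hP, ← ha]
        have : 6 * b * a * (a⁻¹ * (b * -(6 * b ^ 2))) = -((6 * b ^ 2) ^ 2) := by
          field_simp
        rw [this, neg_lt_zero]
        have := hτ'
        positivity)
    have h2 := hc.continuous.continuousAt.eventually (eventually_inward_sign hf h h₂ hS hte hte₂)
    filter_upwards [h1, h2.filter_mono nhdsWithin_le_nhds, hSev, self_mem_nhdsWithin]
      with s hs1 hs2 hs3 hs4
    have hs5 := hs2 hs3 (ν s) (hν.2 s (mem_univ s))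
    have hs6 : 0 < (s - t) ^ 2 := by
      have : s - t ≠ 0 := sub_ne_zero.2 hs4
      positivity
    set A := hess 1 (e (c s)) * conormalValue f 1 e e' (c s) (ν s)
    set B := hess k₂ (e₂ (c s)) * conormalValue f k₂ e₂ e₂' (c s) (ν s)
    have hs7 : A * ((s - t) * P) < 0 := by
      have h8 : hess 1 (X s) / (s - t) * conormalValue f 1 e e' (c s) (ν s) * P * (s - t) ^ 2
          = A * ((s - t) * P) := by
        have : s - t ≠ 0 := sub_ne_zero.2 hs4
        simp only [A, hXdef]
        field_simp
      rw [← h8]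
      exact mul_neg_of_neg_of_pos hs1 hs6
    by_contra hcon
    push Not at hcon
    have := mul_nonneg hs5.le hcon
    have h9 : A * B * (B * ((s - t) * P)) = (A * ((s - t) * P)) * B ^ 2 := by ring
    rw [h9] at this
    have hB : 0 < B ^ 2 := by
      have : B ≠ 0 := by rintro h0; rw [h0] at hs5; simp at hs5
      positivity
    nlinarith

end NullCurve

/-! ### Orientations -/

section Determinant

theorem det_ne_zero_of_injective {d : ℕ} {L : Euc d →L[ℝ] Euc d} (h : Function.Injective L) :
    L.det ≠ 0 := by
  intro h0
  have := (LinearMap.bot_lt_ker_of_det_eq_zero (f := (L : Euc d →ₗ[ℝ] Euc d)) h0)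
  rw [LinearMap.ker_eq_bot.2 h] at this
  exact lt_irrefl _ this

/-- Splitting off the last coordinate. -/
noncomputable def splitLast (n : ℕ) : Euc (n + 1) →ₗ[ℝ] Euc n × ℝ :=
  LinearMap.prod (∑ i ∈ Finset.range n, (coordL (n + 1) i).smulRight (basisVec n i) :
    Euc (n + 1) →L[ℝ] Euc n) (coordL (n + 1) n : Euc (n + 1) →ₗ[ℝ] ℝ)

theorem splitLast_apply {n : ℕ} (x : Euc (n + 1)) :
    splitLast n x = (∑ i ∈ Finset.range n, coord x i • basisVec n i, coord x n) := by
  simp [splitLast, coordL_apply]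

theorem bijective_splitLast (n : ℕ) : Function.Bijective (splitLast n) := by
  have hi : Function.Injective (splitLast n) := by
    rw [injective_iff_map_eq_zero]
    intro x hx
    rw [splitLast_apply, Prod.mk_eq_zero] at hx
    refine coord_ext fun j hj => ?_
    rw [coord_zero]
    rcases Nat.lt_or_ge j n with h' | h'
    · rw [← coord_sum_basisVec (d := n) (fun i => coord x i) h', hx.1, coord_zero]
    · obtain rfl : j = n := by omega
      exact hx.2
  refine ⟨hi, (LinearMap.injective_iff_surjective_of_finrank_eq_finrank ?_).1 hi⟩
  simp

/-- After splitting off the last coordinate, precomposing `A` with `D` is precomposing the frame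
with the block map `D ⊕ id`. -/
theorem det_frameMap_comp_right {n : ℕ} (A : Euc n →L[ℝ] Euc (n + 1)) (D : Euc n →L[ℝ] Euc n)
    (v : Euc (n + 1)) : (frameMap (A.comp D) v).det = (frameMap A v).det * D.det := by
  set K := LinearEquiv.ofBijective (splitLast n) (bijective_splitLast n)
  have hK : ∀ x, K x = (∑ i ∈ Finset.range n, coord x i • basisVec n i, coord x n) :=
    splitLast_apply
  set Q : Euc n × ℝ →ₗ[ℝ] Euc n × ℝ := LinearMap.prodMap (D : Euc n →ₗ[ℝ] Euc n) LinearMap.id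
  have hQ : LinearMap.det Q = D.det := by
    rw [LinearMap.det_prodMap, LinearMap.det_id, mul_one]
  have h1 : (frameMap (A.comp D) v : Euc (n + 1) →ₗ[ℝ] Euc (n + 1)) =
      (frameMap A v : Euc (n + 1) →ₗ[ℝ] Euc (n + 1)) ∘ₗ
        (K.symm.toLinearMap ∘ₗ Q ∘ₗ K.symm.symm.toLinearMap) := by
    ext1 x
    have h2 := hK (K.symm (Q (K x)))
    rw [LinearEquiv.apply_symm_apply] at h2
    change frameMap (A.comp D) v x = frameMap A v (K.symm (Q (K x)))
    rw [frameMap_apply, frameMap_apply]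
    have h3 := congrArg Prod.fst h2
    have h4 := congrArg Prod.snd h2
    dsimp only at h3 h4
    rw [← h3, ← h4, hK]
    simp [Q]
  unfold ContinuousLinearMap.det
  rw [h1, LinearMap.det_comp, LinearMap.det_conj, hQ]

theorem det_frameMap_comp {n : ℕ} (A : Euc n →L[ℝ] Euc (n + 1)) (D : Euc n →L[ℝ] Euc n)
    (D' : Euc (n + 1) →L[ℝ] Euc (n + 1)) (v : Euc (n + 1)) :
    (frameMap (D'.comp (A.comp D)) (D' v)).det = D'.det * (frameMap A v).det * D.det := by
  have h1 : frameMap (D'.comp (A.comp D)) (D' v) = D'.comp (frameMap (A.comp D) v) := by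
    ext1 x
    simp [frameMap_apply]
  rw [h1, mul_assoc, ← det_frameMap_comp_right]
  unfold ContinuousLinearMap.det
  rw [ContinuousLinearMap.toLinearMap_comp, LinearMap.det_comp]

/-- Composition with `-id` on both sides leaves `A` unchanged and negates `v`; the determinants
contribute `(-1)^(n+1) (-1)^n`. -/
theorem det_frameMap_neg {n : ℕ} (A : Euc n →L[ℝ] Euc (n + 1)) (v : Euc (n + 1)) :
    (frameMap A (-v)).det = -(frameMap A v).det := by
  have h := det_frameMap_comp A (-ContinuousLinearMap.id ℝ _) (-ContinuousLinearMap.id ℝ _) v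
  have h1 : ∀ d : ℕ, (-ContinuousLinearMap.id ℝ (Euc d)).det = (-1) ^ d := by
    intro d
    have : ((-ContinuousLinearMap.id ℝ (Euc d) : Euc d →L[ℝ] Euc d) : Euc d →ₗ[ℝ] Euc d) =
      (-1 : ℝ) • LinearMap.id := by ext1; simp
    unfold ContinuousLinearMap.det
    rw [this, LinearMap.det_smul, LinearMap.det_id]
    simp
  rw [h1, h1] at h
  have h2 : (-ContinuousLinearMap.id ℝ (Euc (n + 1))).comp (A.comp (-ContinuousLinearMap.id ℝ (Euc n)))
      = A := by ext1; simp
  rw [h2] at h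
  have h3 : ((-1 : ℝ) ^ n) * (-1) ^ n = 1 := by rw [← mul_pow]; simp
  simp only [_root_.neg_apply, ContinuousLinearMap.id_apply] at h
  rw [h, pow_succ]
  linear_combination (-(frameMap A v).det) * h3

theorem continuous_frameMap {n : ℕ} : Continuous fun p : (Euc n →L[ℝ] Euc (n + 1)) × Euc (n + 1) =>
    frameMap p.1 p.2 := by
  unfold frameMap
  refine Continuous.add (by fun_prop) ?_
  exact (ContinuousLinearMap.smulRightL ℝ (Euc (n + 1)) (Euc (n + 1))
    (coordL (n + 1) n)).continuous.comp continuous_snd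

theorem continuousAt_det_frameMap {n : ℕ} {T : Type*} [TopologicalSpace T]
    {B : T → Euc n →L[ℝ] Euc (n + 1)} {w : T → Euc (n + 1)} {t : T} (hB : ContinuousAt B t)
    (hw : ContinuousAt w t) : ContinuousAt (fun s => (frameMap (B s) (w s)).det) t := by
  have h1 : Continuous fun p : (Euc n →L[ℝ] Euc (n + 1)) × Euc (n + 1) => (frameMap p.1 p.2).det :=
    ContinuousLinearMap.continuous_det.comp continuous_frameMap
  exact ContinuousAt.comp (f := fun s => (B s, w s)) h1.continuousAt (hB.prodMk hw)

/-- The derivative of the front germ, with the factor that vanishes on the singular set removed. -/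
noncomputable def germFrame {n : ℕ} (k : ℕ) (τ : ℝ) : Euc n →L[ℝ] Euc (n + 1) :=
  (coordL n 0).smulRight (nullImage n τ) + germRest n k τ

theorem continuous_germFrame {n : ℕ} (k : ℕ) : Continuous (germFrame (n := n) k) := by
  unfold germFrame germRest nullImage
  refine Continuous.add ?_ ?_
  · exact (ContinuousLinearMap.smulRightL ℝ (Euc n) (Euc (n + 1))
      (coordL n 0)).continuous.comp (by fun_prop)
  · have h : ∀ (c : ℝ → Euc n →L[ℝ] ℝ) (b : Euc (n + 1)), Continuous c →
        Continuous fun τ => (c τ).smulRight b := fun c b hc =>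
      ((ContinuousLinearMap.smulRightL ℝ (Euc n) (Euc (n + 1))).flip b).continuous.comp hc
    refine ((h _ _ ?_).sub (h _ _ ?_)).add continuous_const <;> fun_prop

/-- The differential is `germFrame` after scaling the `0`-th coordinate by `hess`. -/
theorem det_frameMap_germDeriv {n : ℕ} (hn : 0 < n) (k : ℕ) (X : Euc n) (v : Euc (n + 1)) :
    (frameMap (germDeriv k X) v).det = hess k X * (frameMap (germFrame k (coord X 0)) v).det := by
  set D : Euc n →L[ℝ] Euc n := ContinuousLinearMap.id ℝ _ +
    (coordL n 0).smulRight ((hess k X - 1) • basisVec n 0)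
  have h1 : germDeriv k X = (germFrame k (coord X 0)).comp D := by
    ext1 Y
    have h2 : germRest n k (coord X 0) (basisVec n 0) = 0 :=
      germRest_eq_zero k _ (fun j hj => by rw [coord_basisVec hn, if_neg (by omega)])
    simp [germDeriv_apply, germFrame, D, coordL_apply, h2, coord_basisVec hn]
    module
  have h2 : D.det = hess k X := by
    have : (D : Euc n →ₗ[ℝ] Euc n) =
        LinearMap.transvection (coordL n 0 : Euc n →ₗ[ℝ] ℝ) ((hess k X - 1) • basisVec n 0) := by
      ext1 Y
      simp [D, LinearMap.transvection.apply]
    unfold ContinuousLinearMap.det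
    rw [this, LinearMap.transvection.det]
    simp [coordL_apply, coord_basisVec hn]
  rw [h1, det_frameMap_comp_right, h2, mul_comm]

/-- In a vanishing combination, `conormal` isolates the coefficient of `v`, `conormal'` the `0`-th
coordinate of `Y`, and the higher coordinates of the image the rest. So the orientation of the true
frame changes exactly where `hess` changes sign. -/
theorem det_frameMap_germFrame_ne_zero {n k : ℕ} (h1 : 1 ≤ k) (hk : k ≤ n) (τ : ℝ)
    {v : Euc (n + 1)} (hv : conormal (n + 1) k τ v ≠ 0) : (frameMap (germFrame k τ) v).det ≠ 0 := by
  refine det_ne_zero_of_injective (injective_frameMap fun Y r h => ?_)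
  have hα : conormal (n + 1) k τ (germFrame k τ Y) = 0 := by
    simp [germFrame, conormal_nullImage h1 hk, conormal_germRest h1 hk]
  have hα' : conormal' (n + 1) k τ (germFrame k τ Y) = -coord Y 0 := by
    simp [germFrame, conormal'_nullImage h1 hk, conormal'_germRest h1 hk, coordL_apply]
  have hr : r = 0 := by
    have := congrArg (conormal (n + 1) k τ) h
    rw [map_add, hα, map_smul, map_zero, zero_add, smul_eq_mul] at this
    exact (mul_eq_zero.1 this).resolve_right hv
  refine ⟨?_, hr⟩
  rw [hr, zero_smul, add_zero] at h
  rw [h, map_zero] at hα'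
  have hY0 : coord Y 0 = 0 := by linarith
  have hrest : germRest n k τ Y = 0 := by
    have := h
    simpa [germFrame, coordL_apply, hY0] using this
  refine coord_ext fun j hj => ?_
  rcases Nat.eq_zero_or_pos j with rfl | hj'
  · rw [hY0, coord_zero]
  · have := congrArg (fun z => coord z (j + 1)) hrest
    simp only [coord_zero] at this
    rw [coord_germRest τ Y (by omega) (by omega)] at this
    rw [coord_zero]; simpa using this

end Determinant

/-! ### The orientation of the frame of `df` and a normal -/

section Orientation

variable {n : ℕ}
  {M : Type*} [TopologicalSpace M] [ChartedSpace (Euc n) M] [IsManifold (𝓡 n) ∞ M]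
  {N : Type*} [TopologicalSpace N] [ChartedSpace (Euc (n + 1)) N] [IsManifold (𝓡 (n + 1)) ∞ N]
  {g : RiemMetric (n + 1) N} {f : M → N}

/-- An oriented atlas. -/
structure IsOrientedAtlas (d : ℕ) {X : Type*} [TopologicalSpace X] [ChartedSpace (Euc d) X]
    (A : Set (OpenPartialHomeomorph X (Euc d))) : Prop where
  subset : A ⊆ IsManifold.maximalAtlas (𝓡 d) ∞ X
  cover : ∀ x : X, ∃ e ∈ A, x ∈ e.source
  pos : ∀ e ∈ A, ∀ e' ∈ A, ∀ x ∈ (e.symm.trans e').source,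
    0 < (fderiv ℝ (fun y => e' (e.symm y)) x).det

theorem IsOrientedAtlas.det_pos {d : ℕ} {X : Type*} [TopologicalSpace X] [ChartedSpace (Euc d) X]
    {A : Set (OpenPartialHomeomorph X (Euc d))} (h : IsOrientedAtlas d A)
    {e e₂ : OpenPartialHomeomorph X (Euc d)} (he : e ∈ A) (he₂ : e₂ ∈ A) {q : X}
    (hq : q ∈ e.source) (hq₂ : q ∈ e₂.source) : 0 < (fderiv ℝ (coordChange e e₂) (e q)).det := by
  refine h.pos e he e₂ he₂ (e q) ?_
  simp [hq, hq₂]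

theorem det_fderiv_coordChange_ne_zero {d : ℕ} {X : Type*} [TopologicalSpace X]
    [ChartedSpace (Euc d) X] [IsManifold (𝓡 d) ∞ X] {e e₂ : OpenPartialHomeomorph X (Euc d)}
    (he : e ∈ IsManifold.maximalAtlas (𝓡 d) ∞ X) (he₂ : e₂ ∈ IsManifold.maximalAtlas (𝓡 d) ∞ X)
    {q : X} (hq : q ∈ e.source) (hq₂ : q ∈ e₂.source) :
    (fderiv ℝ (coordChange e e₂) (e q)).det ≠ 0 := by
  refine det_ne_zero_of_injective fun a b hab => ?_
  obtain ⟨a, rfl⟩ := chartDeriv_surjective he hq a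
  obtain ⟨b, rfl⟩ := chartDeriv_surjective he hq b
  rw [← chartDeriv_coordChange he he₂ hq hq₂, ← chartDeriv_coordChange he he₂ hq hq₂] at hab
  rw [chartDeriv_injective he₂ hq₂ hab]

/-- The determinant of the frame formed by the differential of `f` and the vector `v`. -/
noncomputable def frameDet (f : M → N) (e : OpenPartialHomeomorph M (Euc n))
    (e' : OpenPartialHomeomorph N (Euc (n + 1))) (q : M) (v : TangentSpace (𝓡 (n + 1)) (f q)) : ℝ :=
  (frameMap (fderiv ℝ (chartRep f e e') (e q)) (chartDeriv e' (f q) v)).det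

theorem frameDet_change (hf : ContMDiff (𝓡 n) (𝓡 (n + 1)) ∞ f)
    {e e₂ : OpenPartialHomeomorph M (Euc n)} {e' e₂' : OpenPartialHomeomorph N (Euc (n + 1))}
    (he : e ∈ IsManifold.maximalAtlas (𝓡 n) ∞ M) (he₂ : e₂ ∈ IsManifold.maximalAtlas (𝓡 n) ∞ M)
    (he' : e' ∈ IsManifold.maximalAtlas (𝓡 (n + 1)) ∞ N)
    (he₂' : e₂' ∈ IsManifold.maximalAtlas (𝓡 (n + 1)) ∞ N) {q : M} (hq : q ∈ e.source)
    (hq₂ : q ∈ e₂.source) (hq' : f q ∈ e'.source) (hq₂' : f q ∈ e₂'.source)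
    (v : TangentSpace (𝓡 (n + 1)) (f q)) :
    frameDet f e e' q v = (fderiv ℝ (coordChange e₂' e') (e₂' (f q))).det *
      frameDet f e₂ e₂' q v * (fderiv ℝ (coordChange e e₂) (e q)).det := by
  unfold frameDet
  rw [← det_frameMap_comp, ← chartDeriv_coordChange he₂' he' hq₂' hq']
  congr 2
  ext1 a
  obtain ⟨a, rfl⟩ := chartDeriv_surjective he hq a
  simp only [ContinuousLinearMap.comp_apply]
  rw [← chartDeriv_mfderiv he he' hf hq hq', ← chartDeriv_coordChange he he₂ hq hq₂,
    ← chartDeriv_mfderiv he₂ he₂' hf hq₂ hq₂', ← chartDeriv_coordChange he₂' he' hq₂' hq']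

theorem frameDet_neg (e : OpenPartialHomeomorph M (Euc n))
    (e' : OpenPartialHomeomorph N (Euc (n + 1))) (q : M) (v : TangentSpace (𝓡 (n + 1)) (f q)) :
    frameDet f e e' q (-v) = -frameDet f e e' q v := by
  unfold frameDet
  rw [map_neg, det_frameMap_neg]

theorem frameDet_ne_zero (hf : ContMDiff (𝓡 n) (𝓡 (n + 1)) ∞ f)
    {e : OpenPartialHomeomorph M (Euc n)} {e' : OpenPartialHomeomorph N (Euc (n + 1))}
    (he : e ∈ IsManifold.maximalAtlas (𝓡 n) ∞ M)
    (he' : e' ∈ IsManifold.maximalAtlas (𝓡 (n + 1)) ∞ N) {q : M} (hq : q ∈ e.source)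
    (hq' : f q ∈ e'.source) (hqS : q ∉ singularSet n f) {v : TangentSpace (𝓡 (n + 1)) (f q)}
    (hv : IsUnitNormalAt g f q v) : frameDet f e e' q v ≠ 0 := by
  refine det_ne_zero_of_injective (bijective_frameMap (G := gram g e' (e' (f q)))
    ((notMem_singularSet_iff he he' hf hq hq').1 hqS) ?_ fun Y => ?_).1
  · rw [gram_chartDeriv g he' hq', hv.inner_self]
  · obtain ⟨Y, rfl⟩ := chartDeriv_surjective he hq Y
    rw [← chartDeriv_mfderiv he he' hf hq hq', gram_chartDeriv g he' hq', hv.inner_mfderiv]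

theorem continuousAt_frameDet (hf : ContMDiff (𝓡 n) (𝓡 (n + 1)) ∞ f)
    {e : OpenPartialHomeomorph M (Euc n)} {e' : OpenPartialHomeomorph N (Euc (n + 1))}
    (he : e ∈ IsManifold.maximalAtlas (𝓡 n) ∞ M)
    (he' : e' ∈ IsManifold.maximalAtlas (𝓡 (n + 1)) ∞ N) {q : M} (hq : q ∈ e.source)
    (hq' : f q ∈ e'.source) {U : Set M} {ν : ∀ x, TangentSpace (𝓡 (n + 1)) (f x)}
    (hν : IsUnitNormalField g f U ν) (hqU : q ∈ U) :
    ContinuousAt (fun x => frameDet f e e' x (ν x)) q := by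
  have h1 := continuousAt_fderiv_chartRep he he' hf hq hq'
  have h2 := (hν.contMDiffAt_chartDeriv hqU he' hq').continuousAt
  exact continuousAt_det_frameMap h1 h2

/-- The frame of the differential of `f` and the vector `v` is positively oriented. -/
def IsPosFrame (A : Set (OpenPartialHomeomorph M (Euc n)))
    (A' : Set (OpenPartialHomeomorph N (Euc (n + 1)))) (f : M → N) (q : M)
    (v : TangentSpace (𝓡 (n + 1)) (f q)) : Prop :=
  ∃ e ∈ A, ∃ e' ∈ A', q ∈ e.source ∧ f q ∈ e'.source ∧ 0 < frameDet f e e' q v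

variable {A : Set (OpenPartialHomeomorph M (Euc n))}
  {A' : Set (OpenPartialHomeomorph N (Euc (n + 1)))}

theorem isPosFrame_iff (hA : IsOrientedAtlas n A) (hA' : IsOrientedAtlas (n + 1) A')
    (hf : ContMDiff (𝓡 n) (𝓡 (n + 1)) ∞ f) {e : OpenPartialHomeomorph M (Euc n)}
    {e' : OpenPartialHomeomorph N (Euc (n + 1))} (he : e ∈ A) (he' : e' ∈ A') {q : M}
    (hq : q ∈ e.source) (hq' : f q ∈ e'.source) (v : TangentSpace (𝓡 (n + 1)) (f q)) :
    IsPosFrame A A' f q v ↔ 0 < frameDet f e e' q v := by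
  refine ⟨?_, fun h => ⟨e, he, e', he', hq, hq', h⟩⟩
  rintro ⟨e₂, he₂, e₂', he₂', hq₂, hq₂', h⟩
  rw [frameDet_change hf (hA.subset he) (hA.subset he₂) (hA'.subset he') (hA'.subset he₂') hq hq₂
    hq' hq₂']
  exact mul_pos (mul_pos (hA'.det_pos he₂' he' hq₂' hq') h) (hA.det_pos he he₂ hq hq₂)

theorem isPosFrame_neg (hA : IsOrientedAtlas n A) (hA' : IsOrientedAtlas (n + 1) A')
    (hf : ContMDiff (𝓡 n) (𝓡 (n + 1)) ∞ f) {q : M} (hqS : q ∉ singularSet n f)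
    {v : TangentSpace (𝓡 (n + 1)) (f q)} (hv : IsUnitNormalAt g f q v) :
    IsPosFrame A A' f q (-v) ↔ ¬ IsPosFrame A A' f q v := by
  obtain ⟨e, he, hq⟩ := hA.cover q
  obtain ⟨e', he', hq'⟩ := hA'.cover (f q)
  rw [isPosFrame_iff hA hA' hf he he' hq hq', isPosFrame_iff hA hA' hf he he' hq hq',
    frameDet_neg]
  have := frameDet_ne_zero hf (hA.subset he) (hA'.subset he') hq hq' hqS hv
  rw [not_lt, neg_pos]
  exact ⟨le_of_lt, fun h => lt_of_le_of_ne h this⟩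

theorem eventually_sign_eq {X : Type*} [TopologicalSpace X] {F : X → ℝ} {x : X}
    (h : ContinuousAt F x) (h0 : F x ≠ 0) : ∀ᶠ y in 𝓝 x, F y ≠ 0 ∧ (0 < F y ↔ 0 < F x) := by
  rcases lt_or_gt_of_ne h0 with h1 | h1
  · filter_upwards [h.eventually_lt_const h1] with y hy
    exact ⟨hy.ne, by constructor <;> intro <;> linarith⟩
  · filter_upwards [h.eventually_const_lt h1] with y hy
    exact ⟨hy.ne', by simp [hy, h1]⟩

theorem eventually_isPosFrame_iff (hA : IsOrientedAtlas n A) (hA' : IsOrientedAtlas (n + 1) A')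
    (hf : ContMDiff (𝓡 n) (𝓡 (n + 1)) ∞ f) {q : M} (hqS : q ∉ singularSet n f) {U : Set M}
    {ν : ∀ x, TangentSpace (𝓡 (n + 1)) (f x)} (hν : IsUnitNormalField g f U ν) (hqU : q ∈ U) :
    ∀ᶠ q' in 𝓝 q, IsPosFrame A A' f q' (ν q') ↔ IsPosFrame A A' f q (ν q) := by
  obtain ⟨e, he, hq⟩ := hA.cover q
  obtain ⟨e', he', hq'⟩ := hA'.cover (f q)
  filter_upwards [eventually_sign_eq (continuousAt_frameDet hf (hA.subset he) (hA'.subset he') hq hq'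
    hν hqU) (frameDet_ne_zero hf (hA.subset he) (hA'.subset he') hq hq' hqS
      (hν.isUnitNormalAt hqU)), e.open_source.mem_nhds hq,
    hf.continuous.continuousAt.eventually (e'.open_source.mem_nhds hq')] with q₂ h1 h2 h3
  rw [isPosFrame_iff hA hA' hf he he' hq hq', isPosFrame_iff hA hA' hf he he' h2 h3, h1.2]

theorem IsNormalFormOn.fderiv_chartRep {k : ℕ} {e : OpenPartialHomeomorph M (Euc n)}
    {e' : OpenPartialHomeomorph N (Euc (n + 1))} (h : IsNormalFormOn f k e e')
    (hf : ContMDiff (𝓡 n) (𝓡 (n + 1)) ∞ f) {q : M} (hq : q ∈ e.source) :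
    fderiv ℝ (chartRep f e e') (e q) = germDeriv k (e q) := by
  ext1 a
  obtain ⟨a, rfl⟩ := chartDeriv_surjective h.mem_atlas hq a
  rw [← FrontMaslov.chartDeriv_mfderiv h.mem_atlas h.mem_atlas' hf hq (h.mapsTo hq),
    h.chartDeriv_mfderiv hf hq]

theorem IsNormalFormOn.continuousAt_conormalValue {k : ℕ} {e : OpenPartialHomeomorph M (Euc n)}
    {e' : OpenPartialHomeomorph N (Euc (n + 1))} (h : IsNormalFormOn f k e e') {q : M}
    (hq : q ∈ e.source) {U : Set M} {ν : ∀ x, TangentSpace (𝓡 (n + 1)) (f x)}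
    (hν : IsUnitNormalField g f U ν) (hqU : q ∈ U) :
    ContinuousAt (fun x => conormalValue f k e e' x (ν x)) q := by
  refine ContinuousAt.clm_apply ?_
    (hν.contMDiffAt_chartDeriv hqU h.mem_atlas' (h.mapsTo hq)).continuousAt
  exact ((contDiff_conormal (n + 1) k (m := 0)).continuous.comp
    (contDiff_coord 0 (m := 0)).continuous).continuousAt.comp (e.continuousAt hq)

/-- Near a singular point, a unit normal field is positively oriented on one side of the singular
set and negatively oriented on the other side. -/
theorem IsNormalFormOn.eventually_isPosFrame_iff {k : ℕ} {e : OpenPartialHomeomorph M (Euc n)}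
    {e' : OpenPartialHomeomorph N (Euc (n + 1))} (h : IsNormalFormOn f k e e')
    (hA : IsOrientedAtlas n A) (hA' : IsOrientedAtlas (n + 1) A')
    (hf : ContMDiff (𝓡 n) (𝓡 (n + 1)) ∞ f) {r : M} (hr : r ∈ e.source) {U : Set M}
    {ν : ∀ x, TangentSpace (𝓡 (n + 1)) (f x)} (hν : IsUnitNormalField g f U ν) (hrU : r ∈ U) :
    ∃ s : Prop, ∀ᶠ q in 𝓝 r, q ∉ singularSet n f →
      ((IsPosFrame A A' f q (ν q) ↔ 0 < hess k (e q) * conormalValue f k e e' q (ν q)) ↔ s) := by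
  obtain ⟨e₁, he₁, hr₁⟩ := hA.cover r
  obtain ⟨e₁', he₁', hr₁'⟩ := hA'.cover (f r)
  have hr' := h.mapsTo hr
  -- This is the frame determinant in oriented charts, with the factor `hess` removed and
  -- `conormalValue` inserted. It does not vanish at `r`, so its sign is locally constant; it
  -- compares the orientation with the sign of `hess * conormalValue`.
  set F : M → ℝ := fun q => (fderiv ℝ (coordChange e' e₁') (e' (f q))).det *
    (frameMap (germFrame k (coord (e q) 0)) (chartDeriv e' (f q) (ν q))).det *
    (fderiv ℝ (coordChange e₁ e) (e₁ q)).det * conormalValue f k e e' q (ν q) with hF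
  have hFc : ContinuousAt F r := by
    have hd : ∀ (d : ℕ) (L : M → Euc d →L[ℝ] Euc d), ContinuousAt L r →
        ContinuousAt (fun q => (L q).det) r := fun d L hL =>
      ContinuousAt.comp (f := L) ContinuousLinearMap.continuous_det.continuousAt hL
    refine ((ContinuousAt.mul ?_ ?_).mul ?_).mul (h.continuousAt_conormalValue hr hν hrU)
    · have h1 : ContinuousAt (fun q => fderiv ℝ (coordChange e' e₁') (e' (f q))) r :=
        ContinuousAt.comp (f := fun q => e' (f q))
          (((contDiffAt_coordChange h.mem_atlas' (hA'.subset he₁') hr' hr₁').fderiv_right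
            (m := 0) (by simp)).continuousAt)
          (ContinuousAt.comp (e'.continuousAt hr') hf.continuous.continuousAt)
      exact hd _ _ h1
    · refine continuousAt_det_frameMap ?_
        (hν.contMDiffAt_chartDeriv hrU h.mem_atlas' hr').continuousAt
      exact ContinuousAt.comp (f := fun q => coord (e q) 0) (continuous_germFrame k).continuousAt
        ((contDiff_coord 0 (m := 0)).continuous.continuousAt.comp (e.continuousAt hr))
    · have h1 : ContinuousAt (fun q => fderiv ℝ (coordChange e₁ e) (e₁ q)) r :=
        ContinuousAt.comp (f := e₁)
          (((contDiffAt_coordChange (hA.subset he₁) h.mem_atlas hr₁ hr).fderiv_right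
            (m := 0) (by simp)).continuousAt) (e₁.continuousAt hr₁)
      exact hd _ _ h1
  have ha := h.conormalValue_ne_zero hf hr (hν.isUnitNormalAt hrU)
  have hF0 : F r ≠ 0 := mul_ne_zero (mul_ne_zero (mul_ne_zero
    (det_fderiv_coordChange_ne_zero h.mem_atlas' (hA'.subset he₁') hr' hr₁')
    (det_frameMap_germFrame_ne_zero h.one_le h.le _ ha))
    (det_fderiv_coordChange_ne_zero (hA.subset he₁) h.mem_atlas hr₁ hr)) ha
  refine ⟨0 < F r, ?_⟩
  filter_upwards [eventually_sign_eq hFc hF0, e.open_source.mem_nhds hr, e₁.open_source.mem_nhds hr₁,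
    hf.continuous.continuousAt.eventually (e₁'.open_source.mem_nhds hr₁'),
    hν.isOpen.mem_nhds hrU] with q hq1 hqe hqe₁ hqe₁' hqU hqS
  rw [← hq1.2, isPosFrame_iff hA hA' hf he₁ he₁' hqe₁ hqe₁',
    frameDet_change hf (hA.subset he₁) h.mem_atlas (hA'.subset he₁') h.mem_atlas' hqe₁ hqe hqe₁'
      (h.mapsTo hqe)]
  have hh : hess k (e q) ≠ 0 := fun h0 => hqS ((h.mem_singularSet_iff hf hqe).2 h0)
  have hF1 := hq1.1
  have h2 : frameDet f e e' q (ν q) = hess k (e q) *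
      (frameMap (germFrame k (coord (e q) 0)) (chartDeriv e' (f q) (ν q))).det := by
    unfold frameDet
    rw [h.fderiv_chartRep hf hqe, det_frameMap_germDeriv h.pos]
  rw [h2]
  set d1 := (fderiv ℝ (coordChange e' e₁') (e' (f q))).det
  set d2 := (frameMap (germFrame k (coord (e q) 0)) (chartDeriv e' (f q) (ν q))).det
  set d3 := (fderiv ℝ (coordChange e₁ e) (e₁ q)).det
  set a := conormalValue f k e e' q (ν q)
  set η := hess k (e q)
  have h3 : d1 * (η * d2) * d3 = η * (d1 * d2 * d3) := by ring
  have hFq : F q = d1 * d2 * d3 * a := rfl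
  rw [h3, hFq]
  rw [hFq] at hF1
  have hb : d1 * d2 * d3 ≠ 0 := left_ne_zero_of_mul hF1
  have haq : a ≠ 0 := right_ne_zero_of_mul hF1
  set b := d1 * d2 * d3
  rcases lt_or_gt_of_ne hh with h4 | h4 <;> rcases lt_or_gt_of_ne hb with h5 | h5 <;>
    rcases lt_or_gt_of_ne haq with h6 | h6 <;>
    simp [mul_pos_iff, h4, h5, h6, h4.le, h5.le, h6.le, not_lt.2 h4.le, not_lt.2 h5.le, not_lt.2 h6.le]

end Orientation

/-! ### The height covering -/

/-- The action of a change of height charts: `m ↦ m + (-1) ^ m j`. -/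
def twist (j m : ℤ) : ℤ := if Even m then m + j else m - j

/-- The parity of the value is that of `m + j`, so equal values force the same branch. -/
theorem twist_injective (j : ℤ) : Function.Injective (twist j) := by
  intro a b h
  unfold twist at h
  split_ifs at h with h1 h2 h2
  · linarith
  · exfalso; rw [Int.not_even_iff_odd] at h2
    obtain ⟨x, hx⟩ := h1; obtain ⟨y, hy⟩ := h2; omega
  · exfalso; rw [Int.not_even_iff_odd] at h1
    obtain ⟨x, hx⟩ := h1; obtain ⟨y, hy⟩ := h2; omega
  · linarith

theorem twist_add_even (j m : ℤ) {r : ℤ} (hr : Even r) : twist j (m + r) = twist j m + r := by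
  unfold twist
  have : Even (m + r) ↔ Even m := by simp [Int.even_add, hr]
  simp only [this]
  split_ifs <;> ring

theorem even_twist_iff (j m : ℤ) : Even (twist j m) ↔ (Even m ↔ Even j) := by
  unfold twist
  split_ifs with h
  · simp [Int.even_add, h]
  · simp [Int.even_sub, h]

/-- Change of height chart in the case of equal normal fields, where the height functions differ by
an even constant. -/
theorem twist_add_of_even {c : ℤ} (hc : Even c) (j m : ℤ) :
    twist (j + c) m = twist j (twist c m) := by
  have : Even (twist c m) ↔ Even m := by rw [even_twist_iff]; simp [hc]
  unfold twist at this ⊢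
  split_ifs at this ⊢ <;> first | ring1 | tauto

/-- Change of height chart in the case of opposite normal fields, where the height functions have an
odd constant sum. -/
theorem twist_sub_of_odd {c : ℤ} (hc : ¬ Even c) (j m : ℤ) :
    twist (c - j) m = twist j (twist c m) := by
  have : Even (twist c m) ↔ ¬ Even m := by rw [even_twist_iff]; simp [hc]
  unfold twist at this ⊢
  split_ifs at this ⊢ <;> first | ring1 | tauto

/-! ### Existence of height charts -/

section HeightCharts

variable {n : ℕ}
  {M : Type*} [TopologicalSpace M] [ChartedSpace (Euc n) M] [IsManifold (𝓡 n) ∞ M]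
  {N : Type*} [TopologicalSpace N] [ChartedSpace (Euc (n + 1)) N] [IsManifold (𝓡 (n + 1)) ∞ N]

/-- A smooth unit normal field `ν` on an open set with an integer valued function `j` off the
singular set that is even if the frame of `ν` is positively oriented, and that is larger by one on
the side of the singular set on which `ν` is inward. -/
structure HeightChart (g : RiemMetric (n + 1) N) (A : Set (OpenPartialHomeomorph M (Euc n)))
    (A' : Set (OpenPartialHomeomorph N (Euc (n + 1)))) (f : M → N) where
  dom : Set M
  ν : ∀ x, TangentSpace (𝓡 (n + 1)) (f x)
  j : M → ℤ
  field : IsUnitNormalField g f dom ν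
  parity : ∀ q ∈ dom, q ∉ singularSet n f → (Even (j q) ↔ IsPosFrame A A' f q (ν q))
  regular : ∀ q ∈ dom, q ∉ singularSet n f → ∀ᶠ q' in 𝓝 q, j q' = j q
  singular : ∀ q ∈ dom, q ∈ singularSet n f → ∀ (k : ℕ) (e : OpenPartialHomeomorph M (Euc n))
    (e' : OpenPartialHomeomorph N (Euc (n + 1))), IsNormalFormOn f k e e' → q ∈ e.source →
    ∃ b : ℤ, ∀ᶠ q' in 𝓝 q, q' ∉ singularSet n f →
      j q' = b + if hess k (e q') * conormalValue f k e e' q' (ν q') < 0 then 1 else 0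

variable {g : RiemMetric (n + 1) N} {f : M → N} {A : Set (OpenPartialHomeomorph M (Euc n))}
  {A' : Set (OpenPartialHomeomorph N (Euc (n + 1)))}

/-- On an open set of regular points no jumps are required; the orientation of the frame alone
serves as the integer `0` or `1`. -/
theorem exists_heightChart_of_notMem (hA : IsOrientedAtlas n A) (hA' : IsOrientedAtlas (n + 1) A')
    (hf : IsAFront g f) {p : M} (hp : p ∉ singularSet n f) :
    ∃ H : HeightChart g A A' f, p ∈ H.dom := by
  classical
  obtain ⟨U, ν, hpU, hν⟩ := hf.exists_unitNormalField p
  have hopen := (isClosed_singularSet hf.contMDiff).isOpen_compl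
  have hν' : IsUnitNormalField g f (U ∩ (singularSet n f)ᶜ) ν :=
    ⟨hν.isOpen.inter hopen, hν.smooth.mono inter_subset_left, fun x hx => hν.unit x hx.1,
      fun x hx => hν.normal x hx.1⟩
  refine ⟨⟨U ∩ (singularSet n f)ᶜ, ν, fun q => if IsPosFrame A A' f q (ν q) then 0 else 1, hν',
    fun q _ _ => ?_, fun q hq hqS => ?_, fun q hq hqS => absurd hqS hq.2⟩, hpU, hp⟩
  · split_ifs with h <;> simp [h]
  · filter_upwards [eventually_isPosFrame_iff hA hA' hf.contMDiff hqS hν hq.1] with q' hq'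
    simp only [hq']

/-- The integer is the indicator of the inward side, corrected by `0` or `1` to have the right
parity. The correction is constant off the singular set near every singular point of the domain,
since orientation and inward sign change together there. -/
theorem exists_heightChart_of_mem (hA : IsOrientedAtlas n A) (hA' : IsOrientedAtlas (n + 1) A')
    (hf : IsAFront g f) {p : M} (hp : p ∈ singularSet n f) :
    ∃ H : HeightChart g A A' f, p ∈ H.dom := by
  classical
  obtain ⟨U, ν, hpU, hν⟩ := hf.exists_unitNormalField p
  obtain ⟨k, e, e', h, hpe⟩ := hf.exists_normalForm hp
  have hν' : IsUnitNormalField g f (U ∩ e.source) ν :=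
    ⟨hν.isOpen.inter e.open_source, hν.smooth.mono inter_subset_left, fun x hx => hν.unit x hx.1,
      fun x hx => hν.normal x hx.1⟩
  set s : M → ℝ := fun q => hess k (e q) * conormalValue f k e e' q (ν q)
  have hs0 : ∀ q ∈ U ∩ e.source, q ∉ singularSet n f → s q ≠ 0 := fun q hq hqS =>
    mul_ne_zero (fun h0 => hqS ((h.mem_singularSet_iff hf.contMDiff hq.2).2 h0))
      (h.conormalValue_ne_zero hf.contMDiff hq.2 (hν.isUnitNormalAt hq.1))
  refine ⟨⟨U ∩ e.source, ν, fun q => (if (IsPosFrame A A' f q (ν q) ↔ 0 < s q) then 0 else 1) +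
    if s q < 0 then 1 else 0, hν', fun q hq hqS => ?_, fun q hq hqS => ?_,
    fun q hq hqS k₂ e₂ e₂' h₂ hq₂ => ?_⟩, hpU, hpe⟩
  · rcases lt_or_gt_of_ne (hs0 q hq hqS) with h1 | h1
    · by_cases h2 : IsPosFrame A A' f q (ν q) <;> simp [h1, h2, h1.not_gt]
    · by_cases h2 : IsPosFrame A A' f q (ν q) <;> simp [h1, h2, h1.not_gt]
  · have hc : ContinuousAt s q := by
      refine ContinuousAt.mul ?_ (h.continuousAt_conormalValue hq.2 hν hq.1)
      exact (contDiff_hess (m := 0)).continuous.continuousAt.comp (e.continuousAt hq.2)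
    filter_upwards [eventually_isPosFrame_iff hA hA' hf.contMDiff hqS hν hq.1,
      eventually_sign_eq hc (hs0 q hq hqS)] with q' h1 h2
    have h3 : s q' < 0 ↔ s q < 0 := by
      rw [← not_iff_not, not_lt, not_lt, le_iff_lt_or_eq, le_iff_lt_or_eq, h2.2]
      simp [h2.1.symm, (hs0 q hq hqS).symm]
    simp only [h1, h2.2, h3]
  · obtain ⟨σ, hσ⟩ := h.eventually_isPosFrame_iff hA hA' hf.contMDiff hq.2 hν hq.1
    refine ⟨if σ then 0 else 1, ?_⟩
    filter_upwards [hσ, eventually_inward_sign hf h h₂ hqS hq.2 hq₂, hν.isOpen.mem_nhds hq.1]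
      with q' h1 h2 hU hqS'
    have h3 := h2 hqS' (ν q') (hν.isUnitNormalAt hU)
    have h4 : s q' < 0 ↔ hess k₂ (e₂ q') * conormalValue f k₂ e₂ e₂' q' (ν q') < 0 :=
      neg_iff_neg_of_mul_pos h3
    simp only [h4, h1 hqS', s]

end HeightCharts

/-! ### Changes of height charts and the resulting bundle -/

section HeightCore

variable {n : ℕ}
  {M : Type*} [TopologicalSpace M] [ChartedSpace (Euc n) M] [IsManifold (𝓡 n) ∞ M]
  {N : Type*} [TopologicalSpace N] [ChartedSpace (Euc (n + 1)) N] [IsManifold (𝓡 (n + 1)) ∞ N]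
  {g : RiemMetric (n + 1) N} {f : M → N} {A : Set (OpenPartialHomeomorph M (Euc n))}
  {A' : Set (OpenPartialHomeomorph N (Euc (n + 1)))}

theorem IsUnitNormalField.eventually_eq (hf : IsAFront g f) {U V : Set M}
    {ν μ : ∀ x, TangentSpace (𝓡 (n + 1)) (f x)} (hν : IsUnitNormalField g f U ν)
    (hμ : IsUnitNormalField g f V μ) {q : M} (hqU : q ∈ U) (hqV : q ∈ V) (h : ν q = μ q) :
    ∀ᶠ q' in 𝓝 q, ν q' = μ q' := by
  have h1 : ∀ {W : Set M} {ξ : ∀ x, TangentSpace (𝓡 (n + 1)) (f x)}, IsUnitNormalField g f W ξ →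
      q ∈ W → ContinuousWithinAt (lift f ξ) univ q := fun hξ hq =>
    ((hξ.smooth _ hq).contMDiffAt (hξ.isOpen.mem_nhds hq)).continuousAt.continuousWithinAt
  have h2 : ContinuousWithinAt (fun q' => g.inner (f q') (ν q') (μ q')) univ q :=
    ContinuousWithinAt.inner_along (h1 hν hqU) (h1 hμ hqV)
  rw [continuousWithinAt_univ] at h2
  have h3 : ∀ᶠ q' in 𝓝 q, 0 < g.inner (f q') (ν q') (μ q') := by
    refine h2.eventually_const_lt (show (0 : ℝ) < _ from ?_)
    beta_reduce
    rw [h, hμ.unit _ hqV]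
    exact one_pos
  filter_upwards [h3, hν.isOpen.mem_nhds hqU, hμ.isOpen.mem_nhds hqV] with q' h3 hU hV
  rcases IsUnitNormalAt.eq_or_eq_neg hf (hμ.isUnitNormalAt hV) (hν.isUnitNormalAt hU) with h4 | h4
  · exact h4
  · rw [h4] at h3
    have := hμ.unit _ hV
    simp only [map_neg, _root_.neg_apply] at h3
    linarith

theorem IsAFront.exists_of_eventually (hf : IsAFront g f) {q : M} {P : M → Prop}
    (h : ∀ᶠ q' in 𝓝 q, P q') : ∃ q', q' ∉ singularSet n f ∧ P q' := by
  obtain ⟨q', h1, h2⟩ := hf.dense_compl_singularSet.inter_nhds_nonempty h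
  exact ⟨q', h1, h2⟩

theorem conormalValue_neg (k : ℕ) (e : OpenPartialHomeomorph M (Euc n))
    (e' : OpenPartialHomeomorph N (Euc (n + 1))) (q : M) (v : TangentSpace (𝓡 (n + 1)) (f q)) :
    conormalValue f k e e' q (-v) = -conormalValue f k e e' q v := by
  unfold conormalValue
  rw [map_neg, map_neg]

/-- Both integers jump by one to the same side, so the difference is locally constant off the
singular set. It is even because both parities record the orientation of the same frame. -/
theorem HeightChart.exists_sub_eq (hf : IsAFront g f)
    (H K : HeightChart g A A' f) {q : M} (hq : q ∈ H.dom) (hq' : q ∈ K.dom)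
    (h : ∀ᶠ q' in 𝓝 q, H.ν q' = K.ν q') :
    ∃ c, Even c ∧ ∀ᶠ q' in 𝓝 q, q' ∉ singularSet n f → H.j q' = K.j q' + c := by
  have h1 : ∃ c, ∀ᶠ q' in 𝓝 q, q' ∉ singularSet n f → H.j q' = K.j q' + c := by
    by_cases hS : q ∈ singularSet n f
    · obtain ⟨k, e, e', hN, hqe⟩ := hf.exists_normalForm hS
      obtain ⟨b, hb⟩ := H.singular q hq hS k e e' hN hqe
      obtain ⟨b', hb'⟩ := K.singular q hq' hS k e e' hN hqe
      refine ⟨b - b', ?_⟩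
      filter_upwards [hb, hb', h] with q' h1 h2 h3 h4
      rw [h1 h4, h2 h4, h3]; ring
    · refine ⟨H.j q - K.j q, ?_⟩
      filter_upwards [H.regular q hq hS, K.regular q hq' hS] with q' h1 h2 _
      rw [h1, h2]; ring
  obtain ⟨c, hc⟩ := h1
  refine ⟨c, ?_, hc⟩
  have hHK : ∀ᶠ q' in 𝓝 q, q' ∈ H.dom ∧ q' ∈ K.dom :=
    (H.field.isOpen.eventually_mem hq).and (K.field.isOpen.eventually_mem hq')
  obtain ⟨q', hS, h2, h3, h4, h5⟩ := hf.exists_of_eventually (hc.and (h.and hHK))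
  have h6 := H.parity q' h4 hS
  rw [h3, ← K.parity q' h5 hS, h2 hS, Int.even_add] at h6
  tauto

/-- Opposite normals are inward on opposite sides, so the jumps cancel in the sum. It is odd because
the two frames have opposite orientations. -/
theorem HeightChart.exists_add_eq (hA : IsOrientedAtlas n A) (hA' : IsOrientedAtlas (n + 1) A')
    (hf : IsAFront g f) (H K : HeightChart g A A' f) {q : M} (hq : q ∈ H.dom) (hq' : q ∈ K.dom)
    (h : ∀ᶠ q' in 𝓝 q, H.ν q' = -K.ν q') :
    ∃ c, ¬ Even c ∧ ∀ᶠ q' in 𝓝 q, q' ∉ singularSet n f → H.j q' = c - K.j q' := by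
  have h1 : ∃ c, ∀ᶠ q' in 𝓝 q, q' ∉ singularSet n f → H.j q' = c - K.j q' := by
    by_cases hS : q ∈ singularSet n f
    · obtain ⟨k, e, e', hN, hqe⟩ := hf.exists_normalForm hS
      obtain ⟨b, hb⟩ := H.singular q hq hS k e e' hN hqe
      obtain ⟨b', hb'⟩ := K.singular q hq' hS k e e' hN hqe
      refine ⟨b + b' + 1, ?_⟩
      filter_upwards [hb, hb', h, e.open_source.mem_nhds hqe, K.field.isOpen.mem_nhds hq']
        with q' h1 h2 h3 hqe' hK h4
      rw [h1 h4, h2 h4, h3, conormalValue_neg]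
      have h5 : hess k (e q') * conormalValue f k e e' q' (K.ν q') ≠ 0 :=
        mul_ne_zero (fun h0 => h4 ((hN.mem_singularSet_iff hf.contMDiff hqe').2 h0))
          (hN.conormalValue_ne_zero hf.contMDiff hqe' (K.field.isUnitNormalAt hK))
      simp only [mul_neg, neg_lt_zero]
      rcases lt_or_gt_of_ne h5 with h6 | h6
      · rw [if_neg h6.not_gt, if_pos h6]; ring
      · rw [if_pos h6, if_neg h6.not_gt]; ring
    · refine ⟨H.j q + K.j q, ?_⟩
      filter_upwards [H.regular q hq hS, K.regular q hq' hS] with q' h1 h2 _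
      rw [h1, h2]; ring
  obtain ⟨c, hc⟩ := h1
  refine ⟨c, ?_, hc⟩
  have hHK : ∀ᶠ q' in 𝓝 q, q' ∈ H.dom ∧ q' ∈ K.dom :=
    (H.field.isOpen.eventually_mem hq).and (K.field.isOpen.eventually_mem hq')
  obtain ⟨q', hS, h2, h3, h4, h5⟩ := hf.exists_of_eventually (hc.and (h.and hHK))
  have h6 := H.parity q' h4 hS
  rw [h3, isPosFrame_neg hA hA' hf.contMDiff hS (K.field.isUnitNormalAt h5), ← K.parity q' h5 hS,
    h2 hS, Int.even_sub] at h6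
  tauto

/-- The unit normal described by the integer `m` in a height chart. -/
noncomputable def HeightChart.normal (H : HeightChart g A A' f) (q : M) (m : ℤ) : TangentSpace (𝓡 (n + 1)) (f q) :=
  if Even m then H.ν q else -H.ν q

/-- The relation between the integers that describe the same local height function in two
height charts. -/
def HeightChart.Rel (H K : HeightChart g A A' f) (q : M) (m m' : ℤ) : Prop :=
  ∀ᶠ q' in 𝓝 q, q' ∉ singularSet n f → twist (H.j q') m = twist (K.j q') m'

theorem HeightChart.Rel.trans {H K L : HeightChart g A A' f} {q : M} {m m' m'' : ℤ}
    (h : H.Rel K q m m') (h' : K.Rel L q m' m'') : H.Rel L q m m'' := by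
  filter_upwards [h, h'] with q' h1 h2 hS
  rw [h1 hS, h2 hS]

/-- The relation is a condition on regular points near `q` only; these exist by density, and `twist`
is injective. -/
theorem HeightChart.Rel.unique (hf : IsAFront g f) {H K : HeightChart g A A' f} {q : M}
    {m m₁ m₂ : ℤ} (h₁ : H.Rel K q m m₁) (h₂ : H.Rel K q m m₂) : m₁ = m₂ := by
  obtain ⟨q', hS, h3, h4⟩ := hf.exists_of_eventually (h₁.and h₂)
  exact twist_injective _ ((h3 hS).symm.trans (h4 hS))

theorem HeightChart.Rel.add_even {H K : HeightChart g A A' f} {q : M} {m m' r : ℤ} (hr : Even r)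
    (h : H.Rel K q m m') : H.Rel K q (m + r) (m' + r) := by
  filter_upwards [h] with q' h1 hS
  rw [twist_add_even _ _ hr, twist_add_even _ _ hr, h1 hS]

/-- The same constant `c` works on a neighbourhood of `q`, so the transition map is locally constant
in `q`. The parity of `c` tells whether the normal fields agree or are opposite, so the normals
described match as well. -/
theorem HeightChart.exists_rel (hA : IsOrientedAtlas n A) (hA' : IsOrientedAtlas (n + 1) A')
    (hf : IsAFront g f) (H K : HeightChart g A A' f) {q : M} (hq : q ∈ H.dom) (hq' : q ∈ K.dom) :
    ∃ c, ∀ m, ∀ᶠ q' in 𝓝 q, H.Rel K q' m (twist c m) ∧ H.normal q' m = K.normal q' (twist c m) := by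
  rcases IsUnitNormalAt.eq_or_eq_neg hf (K.field.isUnitNormalAt hq') (H.field.isUnitNormalAt hq)
    with h | h
  · have h1 := H.field.eventually_eq hf K.field hq hq' h
    obtain ⟨c, hc, h2⟩ := H.exists_sub_eq hf K hq hq' h1
    refine ⟨c, fun m => ?_⟩
    filter_upwards [h2.eventually_nhds, h1] with q' h3 h4
    refine ⟨?_, ?_⟩
    · filter_upwards [h3] with q'' h5 hS
      rw [h5 hS, twist_add_of_even hc]
    · unfold HeightChart.normal
      have : Even (twist c m) ↔ Even m := by rw [even_twist_iff]; simp [hc]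
      simp only [this, h4]
  · have h1 := H.field.eventually_eq hf K.field.neg hq hq' h
    obtain ⟨c, hc, h2⟩ := H.exists_add_eq hA hA' hf K hq hq' h1
    refine ⟨c, fun m => ?_⟩
    filter_upwards [h2.eventually_nhds, h1] with q' h3 h4
    refine ⟨?_, ?_⟩
    · filter_upwards [h3] with q'' h5 hS
      rw [h5 hS, twist_sub_of_odd hc]
    · unfold HeightChart.normal
      have : Even (twist c m) ↔ ¬ Even m := by rw [even_twist_iff]; simp [hc]
      by_cases hm : Even m <;> simp [this, h4, hm]

theorem HeightChart.Rel.normal_eq (hA : IsOrientedAtlas n A) (hA' : IsOrientedAtlas (n + 1) A')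
    (hf : IsAFront g f) {H K : HeightChart g A A' f} {q : M} (hq : q ∈ H.dom) (hq' : q ∈ K.dom)
    {m m' : ℤ} (h : H.Rel K q m m') : H.normal q m = K.normal q m' := by
  obtain ⟨c, hc⟩ := H.exists_rel hA hA' hf K hq hq'
  rw [(hc m).self_of_nhds.2, (hc m).self_of_nhds.1.unique hf h]

theorem HeightChart.Rel.twist_eq {H K : HeightChart g A A' f} {q : M} (hS : q ∉ singularSet n f) {m m' : ℤ} (h : H.Rel K q m m') :
    twist (H.j q) m = twist (K.j q) m' := by
  exact h.self_of_nhds hS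

/-- The change of height charts. -/
noncomputable def HeightChart.change (H K : HeightChart g A A' f) (q : M) (m : ℤ) : ℤ :=
  Classical.epsilon (H.Rel K q m)

theorem HeightChart.rel_change (hA : IsOrientedAtlas n A) (hA' : IsOrientedAtlas (n + 1) A')
    (hf : IsAFront g f) (H K : HeightChart g A A' f) {q : M} (hq : q ∈ H.dom) (hq' : q ∈ K.dom)
    (m : ℤ) : H.Rel K q m (H.change K q m) := by
  obtain ⟨c, hc⟩ := H.exists_rel hA hA' hf K hq hq'
  exact Classical.epsilon_spec (p := H.Rel K q m) ⟨_, (hc m).self_of_nhds.1⟩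

/-- The bundle of local height functions. -/
noncomputable def heightCore (hA : IsOrientedAtlas n A) (hA' : IsOrientedAtlas (n + 1) A')
    (hf : IsAFront g f) : FiberBundleCore (HeightChart g A A' f) M ℤ where
  baseSet H := H.dom
  isOpen_baseSet H := H.field.isOpen
  indexAt p := Classical.choose (show ∃ H : HeightChart g A A' f, p ∈ H.dom by
    by_cases hp : p ∈ singularSet n f
    · exact exists_heightChart_of_mem hA hA' hf hp
    · exact exists_heightChart_of_notMem hA hA' hf hp)
  mem_baseSet_at p := Classical.choose_spec (show ∃ H : HeightChart g A A' f, p ∈ H.dom by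
    by_cases hp : p ∈ singularSet n f
    · exact exists_heightChart_of_mem hA hA' hf hp
    · exact exists_heightChart_of_notMem hA hA' hf hp)
  coordChange H K q m := H.change K q m
  coordChange_self H q hq m :=
    (H.rel_change hA hA' hf H hq hq m).unique hf (Eventually.of_forall fun _ _ => rfl)
  -- The fibre is discrete, so continuity amounts to local constancy in the base point.
  continuousOn_coordChange H K := by
    rintro ⟨q, m⟩ ⟨⟨hq, hq'⟩, -⟩
    obtain ⟨c, hc⟩ := H.exists_rel hA hA' hf K hq hq'
    refine ContinuousAt.continuousWithinAt ?_
    refine (continuousAt_const (y := twist c m)).congr ?_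
    have h1 : ∀ᶠ p : M × ℤ in 𝓝 (q, m), p.2 = m :=
      continuousAt_snd.eventually (IsOpen.eventually_mem (isOpen_discrete {m}) (mem_singleton m))
    have h2 : ∀ᶠ p : M × ℤ in 𝓝 (q, m), p.1 ∈ H.dom ∧ p.1 ∈ K.dom ∧ H.Rel K p.1 m (twist c m) :=
      continuousAt_fst.eventually ((H.field.isOpen.eventually_mem hq).and
        (((K.field.isOpen.eventually_mem hq')).and ((hc m).mono fun _ h => h.1)))
    filter_upwards [h1, h2] with p hp1 hp2
    rw [hp1]
    exact hp2.2.2.unique hf (H.rel_change hA hA' hf K hp2.1 hp2.2.1 m)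
  coordChange_comp H K L q hq m :=
    ((H.rel_change hA hA' hf K hq.1.1 hq.1.2 m).trans
      (K.rel_change hA hA' hf L hq.1.2 hq.2 _)).unique hf (H.rel_change hA hA' hf L hq.1.1 hq.2 m)

end HeightCore

/-! ### Lifts of maps to the height covering -/

section HeightLift

variable {n : ℕ}
  {M : Type*} [TopologicalSpace M] [ChartedSpace (Euc n) M] [IsManifold (𝓡 n) ∞ M]
  {N : Type*} [TopologicalSpace N] [ChartedSpace (Euc (n + 1)) N] [IsManifold (𝓡 (n + 1)) ∞ N]
  {g : RiemMetric (n + 1) N} {f : M → N} {A : Set (OpenPartialHomeomorph M (Euc n))}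
  {A' : Set (OpenPartialHomeomorph N (Euc (n + 1)))}

/-- The preferred height chart at a point. -/
noncomputable def heightChartAt (hA : IsOrientedAtlas n A) (hA' : IsOrientedAtlas (n + 1) A')
    (hf : IsAFront g f) (q : M) : HeightChart g A A' f := (heightCore hA hA' hf).indexAt q

variable (hA : IsOrientedAtlas n A) (hA' : IsOrientedAtlas (n + 1) A') (hf : IsAFront g f)

theorem mem_heightChartAt (q : M) : q ∈ (heightChartAt hA hA' hf q).dom :=
  (heightCore hA hA' hf).mem_baseSet_at q

/-- The unit normal that belongs to a point of the height covering. -/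
noncomputable def heightNormal (q : M) (m : ℤ) : TangentSpace (𝓡 (n + 1)) (f q) :=
  (heightChartAt hA hA' hf q).normal q m

/-- The height of a point of the height covering, over a regular point. -/
noncomputable def height (q : M) (m : ℤ) : ℤ := twist ((heightChartAt hA hA' hf q).j q) m

/-- A lift of a map to the height covering. -/
def IsHeightLift {T : Type*} [TopologicalSpace T] (γ : T → M) (ℓ : T → ℤ) : Prop :=
  Continuous fun t => (⟨γ t, ℓ t⟩ : (heightCore hA hA' hf).TotalSpace)

/-- In a local trivialization a continuous map to the discrete fibre is locally constant. The
integers `ℓ t'` themselves are given in preferred charts that vary with the point, so they need not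
be locally constant. -/
theorem isHeightLift_iff {T : Type*} [TopologicalSpace T] {γ : T → M} (hγ : Continuous γ)
    {ℓ : T → ℤ} : IsHeightLift hA hA' hf γ ℓ ↔ ∀ t (H : HeightChart g A A' f), γ t ∈ H.dom →
      ∃ m, ∀ᶠ t' in 𝓝 t, γ t' ∈ H.dom ∧
        (heightChartAt hA hA' hf (γ t')).Rel H (γ t') (ℓ t') m := by
  set Z := heightCore hA hA' hf
  have hiff : ∀ t (H : HeightChart g A A' f), γ t ∈ H.dom →
      (ContinuousAt (fun t => (⟨γ t, ℓ t⟩ : Z.TotalSpace)) t ↔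
        ContinuousAt (fun t' => (heightChartAt hA hA' hf (γ t')).change H (γ t') (ℓ t')) t) := by
    intro t H hH
    refine ((Z.localTriv H).tendsto_nhds_iff (f := fun t => (⟨γ t, ℓ t⟩ : Z.TotalSpace)) ?_).trans ?_
    · exact (Z.mem_localTriv_source H _).2 hH
    · exact and_iff_right hγ.continuousAt
  constructor
  · intro h t H hH
    have h1 := (hiff t H hH).1 h.continuousAt
    refine ⟨(heightChartAt hA hA' hf (γ t)).change H (γ t) (ℓ t), ?_⟩
    filter_upwards [hγ.continuousAt.eventually (H.field.isOpen.eventually_mem hH),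
      h1.eventually (IsOpen.eventually_mem (isOpen_discrete {_}) (mem_singleton _))] with t' h2 h3
    refine ⟨h2, ?_⟩
    rw [← mem_singleton_iff.1 h3]
    exact HeightChart.rel_change hA hA' hf _ H (mem_heightChartAt hA hA' hf _) h2 _
  · intro h
    rw [IsHeightLift, continuous_iff_continuousAt]
    intro t
    obtain ⟨m, hm⟩ := h t (heightChartAt hA hA' hf (γ t)) (mem_heightChartAt hA hA' hf (γ t))
    rw [hiff t _ (mem_heightChartAt hA hA' hf (γ t))]
    refine (continuousAt_const (y := m)).congr ?_
    filter_upwards [hm] with t' ht'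
    exact ht'.2.unique hf (HeightChart.rel_change hA hA' hf _ _ (mem_heightChartAt hA hA' hf _)
      ht'.1 _)

variable {hA hA' hf}

section Lift

variable {T : Type*} [TopologicalSpace T] {γ : T → M} {ℓ : T → ℤ}

theorem IsHeightLift.continuous (h : IsHeightLift hA hA' hf γ ℓ) : Continuous γ :=
  (heightCore hA hA' hf).continuous_proj.comp h

theorem IsHeightLift.exists_eventually (h : IsHeightLift hA hA' hf γ ℓ) (t : T)
    {H : HeightChart g A A' f} (hH : γ t ∈ H.dom) :
    ∃ m, ∀ᶠ t' in 𝓝 t, γ t' ∈ H.dom ∧ heightNormal hA hA' hf (γ t') (ℓ t') = H.normal (γ t') m ∧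
      (γ t' ∉ singularSet n f → height hA hA' hf (γ t') (ℓ t') = twist (H.j (γ t')) m) := by
  obtain ⟨m, hm⟩ := (isHeightLift_iff hA hA' hf h.continuous).1 h t H hH
  refine ⟨m, ?_⟩
  filter_upwards [hm] with t' ht'
  exact ⟨ht'.1, ht'.2.normal_eq hA hA' hf (mem_heightChartAt hA hA' hf _) ht'.1,
    fun hS => ht'.2.twist_eq hS⟩

/-- Adding an even integer commutes with all transition maps, so it is a deck transformation of the
covering. -/
theorem IsHeightLift.add_even (h : IsHeightLift hA hA' hf γ ℓ) {r : ℤ} (hr : Even r) :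
    IsHeightLift hA hA' hf γ fun t => ℓ t + r := by
  rw [isHeightLift_iff hA hA' hf h.continuous]
  intro t H hH
  obtain ⟨m, hm⟩ := (isHeightLift_iff hA hA' hf h.continuous).1 h t H hH
  exact ⟨m + r, hm.mono fun t' ht' => ⟨ht'.1, ht'.2.add_even hr⟩⟩

theorem height_add_even (q : M) (m : ℤ) {r : ℤ} (hr : Even r) :
    height hA hA' hf q (m + r) = height hA hA' hf q m + r := twist_add_even _ _ hr

theorem HeightChart.isUnitNormalField_normal (H : HeightChart g A A' f) (m : ℤ) :
    IsUnitNormalField g f H.dom fun q => H.normal q m := by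
  by_cases hm : Even m
  · simpa [HeightChart.normal, hm] using H.field
  · simpa [HeightChart.normal, hm] using H.field.neg

theorem isUnitNormalAt_heightNormal (q : M) (m : ℤ) :
    IsUnitNormalAt g f q (heightNormal hA hA' hf q m) :=
  ((heightChartAt hA hA' hf q).isUnitNormalField_normal m).isUnitNormalAt
    (mem_heightChartAt hA hA' hf q)

theorem heightNormal_eq_or (q : M) (m m' : ℤ) :
    (Even (m - m') ∧ heightNormal hA hA' hf q m = heightNormal hA hA' hf q m') ∨
    (¬ Even (m - m') ∧ heightNormal hA hA' hf q m = -heightNormal hA hA' hf q m') := by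
  unfold heightNormal HeightChart.normal
  by_cases h : Even m <;> by_cases h' : Even m' <;> simp [Int.even_sub, h, h']

theorem IsHeightLift.isUnitNormalAlong (h : IsHeightLift hA hA' hf γ ℓ) :
    IsUnitNormalAlong g f γ univ fun t => heightNormal hA hA' hf (γ t) (ℓ t) := by
  refine ⟨fun t _ => ?_, fun t _ => isUnitNormalAt_heightNormal _ _⟩
  set H := heightChartAt hA hA' hf (γ t)
  have hH : γ t ∈ H.dom := mem_heightChartAt hA hA' hf (γ t)
  obtain ⟨m, hm⟩ := h.exists_eventually t hH
  have h1 : ContinuousAt (lift f fun q => H.normal q m) (γ t) :=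
    (((H.isUnitNormalField_normal m).smooth _ hH).contMDiffAt
      (H.field.isOpen.mem_nhds hH)).continuousAt
  have h2 := (ContinuousAt.comp (f := γ) h1 h.continuous.continuousAt)
  refine (h2.congr ?_).continuousWithinAt
  filter_upwards [hm] with t' ht'
  simp only [Function.comp, lift]
  rw [ht'.2.1]

theorem IsHeightLift.eventually_height_eq (h : IsHeightLift hA hA' hf γ ℓ) {t : T}
    (ht : γ t ∉ singularSet n f) : ∀ᶠ t' in 𝓝 t,
      height hA hA' hf (γ t') (ℓ t') = height hA hA' hf (γ t) (ℓ t) := by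
  set H := heightChartAt hA hA' hf (γ t)
  have hH : γ t ∈ H.dom := mem_heightChartAt hA hA' hf (γ t)
  obtain ⟨m, hm⟩ := h.exists_eventually t hH
  filter_upwards [hm, h.continuous.continuousAt.eventually (H.regular _ hH ht),
    h.continuous.continuousAt.eventually
      ((isClosed_singularSet hf.contMDiff).isOpen_compl.eventually_mem ht)] with t' h1 h2 h3
  rw [h1.2.2 h3, h2, hm.self_of_nhds.2.2 ht]

theorem IsHeightLift.exists_eventually_height_eq (h : IsHeightLift hA hA' hf γ ℓ) {t : T}
    (ht : γ t ∈ singularSet n f) {k : ℕ} {e : OpenPartialHomeomorph M (Euc n)}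
    {e' : OpenPartialHomeomorph N (Euc (n + 1))} (hN : IsNormalFormOn f k e e')
    (hte : γ t ∈ e.source) :
    ∃ b : ℤ, ∀ᶠ t' in 𝓝 t, γ t' ∉ singularSet n f →
      height hA hA' hf (γ t') (ℓ t') = b + if hess k (e (γ t')) *
        conormalValue f k e e' (γ t') (heightNormal hA hA' hf (γ t') (ℓ t')) < 0 then 1 else 0 := by
  set H := heightChartAt hA hA' hf (γ t)
  have hH : γ t ∈ H.dom := mem_heightChartAt hA hA' hf (γ t)
  obtain ⟨m, hm⟩ := h.exists_eventually t hH
  obtain ⟨b, hb⟩ := H.singular _ hH ht k e e' hN hte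
  -- For odd `m` the height is `m - j` and the normal is `-H.ν`. Where `j = b + 1`, that normal is
  -- not inward; where `j = b`, it is, and `m - b = (m - b - 1) + 1`.
  refine ⟨if Even m then m + b else m - b - 1, ?_⟩
  filter_upwards [hm, h.continuous.continuousAt.eventually hb,
    h.continuous.continuousAt.eventually (e.open_source.eventually_mem hte)] with t' h1 h2 h3 hS
  rw [h1.2.2 hS, h1.2.1, h2 hS]
  unfold HeightChart.normal twist
  have h5 : hess k (e (γ t')) * conormalValue f k e e' (γ t') (H.ν (γ t')) ≠ 0 :=
    mul_ne_zero (fun h0 => hS ((hN.mem_singularSet_iff hf.contMDiff h3).2 h0))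
      (hN.conormalValue_ne_zero hf.contMDiff h3 (H.field.isUnitNormalAt h1.1))
  by_cases hm : Even m
  · simp only [hm, if_true]; ring
  · simp only [hm, if_false, conormalValue_neg, mul_neg, neg_lt_zero]
    rcases lt_or_gt_of_ne h5 with h6 | h6
    · rw [if_neg h6.not_gt, if_pos h6]; ring
    · rw [if_pos h6, if_neg h6.not_gt]; ring

end Lift

variable (hA hA' hf)

theorem isCoveringMap_heightCore : IsCoveringMap (heightCore hA hA' hf).proj :=
  FiberBundle.isCoveringMap

theorem exists_heightNormal_eq {q : M} {v : TangentSpace (𝓡 (n + 1)) (f q)}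
    (hv : IsUnitNormalAt g f q v) : ∃ m, heightNormal hA hA' hf q m = v := by
  rcases IsUnitNormalAt.eq_or_eq_neg hf (isUnitNormalAt_heightNormal (hA := hA) (hA' := hA')
    (hf := hf) q 0) hv with h | h
  · exact ⟨0, h.symm⟩
  · refine ⟨1, ?_⟩
    rw [h]
    rcases heightNormal_eq_or (hA := hA) (hA' := hA') (hf := hf) q 1 0 with h1 | h1
    · exact absurd h1.1 (by decide)
    · exact h1.2

theorem exists_isHeightLift {T : Type*} [TopologicalSpace T] [SimplyConnectedSpace T]
    [LocallyPathConnectedSpace T] {γ : T → M} (hγ : Continuous γ) (t : T) (m : ℤ) :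
    ∃ ℓ : T → ℤ, IsHeightLift hA hA' hf γ ℓ ∧ ℓ t = m := by
  obtain ⟨F, ⟨hF1, hF2⟩, -⟩ := (isCoveringMap_heightCore hA hA' hf).existsUnique_continuousMap_lifts
    ⟨γ, hγ⟩ t ⟨γ t, m⟩ rfl
  have hF3 : ∀ s, (F s).1 = γ s := fun s => congrFun hF2 s
  have hF4 : ∀ s, (⟨γ s, (F s).2⟩ : (heightCore hA hA' hf).TotalSpace) = F s := by
    intro s
    rw [← hF3 s]
  refine ⟨fun s => (F s).2, ?_, ?_⟩
  · exact F.continuous.congr fun s => (hF4 s).symm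
  · exact congrArg (fun p : (heightCore hA hA' hf).TotalSpace => (p.2 : ℤ)) hF1

theorem IsHeightLift.eq_of_eq {T : Type*} [TopologicalSpace T] [PreconnectedSpace T] {γ : T → M}
    {ℓ ℓ' : T → ℤ} (h : IsHeightLift hA hA' hf γ ℓ) (h' : IsHeightLift hA hA' hf γ ℓ') {t : T}
    (ht : ℓ t = ℓ' t) : ℓ = ℓ' := by
  have := (isCoveringMap_heightCore hA hA' hf).eq_of_comp_eq h h' (funext fun _ => rfl) t
    (by rw [ht])
  funext s
  have h1 := congrFun this s
  injection h1

end HeightLift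

/-! ### The holonomy of the height covering -/

section UnitNormalAlong

variable {n : ℕ}
  {M : Type*} [TopologicalSpace M] [ChartedSpace (Euc n) M] [IsManifold (𝓡 n) ∞ M]
  {N : Type*} [TopologicalSpace N] [ChartedSpace (Euc (n + 1)) N] [IsManifold (𝓡 (n + 1)) ∞ N]
  {g : RiemMetric (n + 1) N} {f : M → N}

theorem IsUnitNormalAlong.comp {T T' : Type*} [TopologicalSpace T] [TopologicalSpace T'] {γ : T → M}
    {s : Set T} {ν : ∀ t, TangentSpace (𝓡 (n + 1)) (f (γ t))} (h : IsUnitNormalAlong g f γ s ν)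
    {φ : T' → T} (hφ : Continuous φ) {s' : Set T'} (hs : MapsTo φ s' s) :
    IsUnitNormalAlong g f (fun t => γ (φ t)) s' fun t => ν (φ t) :=
  ⟨h.1.comp hφ.continuousOn hs, fun t ht => h.2 (φ t) (hs ht)⟩

theorem eq_neg_self_iff_eq_zero {d : ℕ} {v : Euc d} : v = -v ↔ v = 0 := by
  refine ⟨fun h => ?_, fun h => by simp [h]⟩
  have h1 : (2 : ℝ) • v = 0 := by
    rw [two_smul]
    nth_rewrite 2 [h]
    exact add_neg_cancel v
  exact (smul_eq_zero.1 h1).resolve_left two_ne_zero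

/-- Agreement is an open condition, as both fields are locally induced by smooth ones. Disagreement
means agreement with the negative, so it is open too. -/
theorem IsUnitNormalAlong.eq_of_eq {T : Type*} [TopologicalSpace T] [PreconnectedSpace T]
    {γ : T → M} (hf : IsAFront g f) (hγ : Continuous γ)
    {ν ν' : ∀ t, TangentSpace (𝓡 (n + 1)) (f (γ t))} (h : IsUnitNormalAlong g f γ univ ν)
    (h' : IsUnitNormalAlong g f γ univ ν') {t : T} (ht : ν t = ν' t) : ν = ν' := by
  have hopen : ∀ {ν ν' : ∀ t, TangentSpace (𝓡 (n + 1)) (f (γ t))}, IsUnitNormalAlong g f γ univ ν →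
      IsUnitNormalAlong g f γ univ ν' → IsOpen {t | ν t = ν' t} := by
    intro ν ν' h h'
    rw [isOpen_iff_mem_nhds]
    intro t ht
    obtain ⟨U, μ, hU, hμ, hev⟩ := h.exists_eventually_eq hf hγ (mem_univ t)
    obtain ⟨U', μ', hU', hμ', hev'⟩ := h'.exists_eventually_eq hf hγ (mem_univ t)
    rw [nhdsWithin_univ] at hev hev'
    have h1 : μ (γ t) = μ' (γ t) := by
      rw [← hev.self_of_nhds.2, ← hev'.self_of_nhds.2]; exact ht
    filter_upwards [hev, hev', hγ.continuousAt.eventually (hμ.eventually_eq hf hμ' hU hU' h1)]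
      with s h2 h3 h4
    rw [h2.2, h3.2, h4]
  have hclopen : IsClopen {t | ν t = ν' t} := by
    refine ⟨⟨?_⟩, hopen h h'⟩
    convert hopen h (h'.neg hf hγ) using 1
    ext s
    simp only [mem_compl_iff, mem_ofPred_eq]
    constructor
    · intro h1
      exact (IsUnitNormalAt.eq_or_eq_neg hf (h'.2 s (mem_univ s)) (h.2 s (mem_univ s))).resolve_left h1
    · intro h1 h2
      have h3 := (h'.2 s (mem_univ s)).ne_zero
      rw [h2] at h1
      exact h3 (eq_neg_self_iff_eq_zero.1 h1)
  have := hclopen.eq_univ ⟨t, ht⟩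
  funext s
  have hs : s ∈ {t | ν t = ν' t} := this ▸ mem_univ s
  exact hs

end UnitNormalAlong

/-! ### The action of loops on the fibre and co-orientability -/

section Holonomy

variable {n : ℕ}
  {M : Type*} [TopologicalSpace M] [ChartedSpace (Euc n) M] [IsManifold (𝓡 n) ∞ M]
  {N : Type*} [TopologicalSpace N] [ChartedSpace (Euc (n + 1)) N] [IsManifold (𝓡 (n + 1)) ∞ N]
  {g : RiemMetric (n + 1) N} {f : M → N} {A : Set (OpenPartialHomeomorph M (Euc n))}
  {A' : Set (OpenPartialHomeomorph N (Euc (n + 1)))}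
  (hA : IsOrientedAtlas n A) (hA' : IsOrientedAtlas (n + 1) A') (hf : IsAFront g f) {o : M}

theorem exists_loopClass_eq (x : FundamentalGroup M o) : ∃ γ : Path o o, loopClass γ = x := by
  obtain ⟨γ, hγ⟩ := Quotient.exists_rep (FundamentalGroup.toPath x)
  exact ⟨γ, hγ⟩

/-- The action of the fundamental group on the fibre of the height covering. -/
noncomputable def holonomy (x : FundamentalGroup M o) (m : ℤ) : ℤ :=
  ((isCoveringMap_heightCore hA hA' hf).monodromyPerm o x ⟨⟨o, m⟩, rfl⟩).1.2

theorem monodromyPerm_eq (x : FundamentalGroup M o) (m : ℤ) :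
    (isCoveringMap_heightCore hA hA' hf).monodromyPerm o x ⟨⟨o, m⟩, rfl⟩ =
      ⟨⟨o, holonomy hA hA' hf x m⟩, rfl⟩ := by
  unfold holonomy
  obtain ⟨⟨q, m'⟩, hq⟩ := (isCoveringMap_heightCore hA hA' hf).monodromyPerm o x ⟨⟨o, m⟩, rfl⟩
  have hq' : q = o := hq
  subst hq'
  rfl

theorem holonomy_mul (x y : FundamentalGroup M o) (m : ℤ) :
    holonomy hA hA' hf (x * y) m = holonomy hA hA' hf x (holonomy hA hA' hf y m) := by
  conv_lhs => unfold holonomy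
  rw [map_mul, Equiv.Perm.mul_apply, monodromyPerm_eq]
  rfl

theorem holonomy_one (m : ℤ) : holonomy hA hA' hf (1 : FundamentalGroup M o) m = m := by
  unfold holonomy
  rw [map_one]
  rfl

variable {hA hA' hf} in
theorem IsHeightLift.comp {T T' : Type*} [TopologicalSpace T] [TopologicalSpace T'] {γ : T → M}
    {ℓ : T → ℤ} (h : IsHeightLift hA hA' hf γ ℓ) {φ : T' → T} (hφ : Continuous φ) :
    IsHeightLift hA hA' hf (fun t => γ (φ t)) fun t => ℓ (φ t) :=
  Continuous.comp h hφ

theorem exists_isHeightLift_path {x y : M} (γ : Path x y) (m : ℤ) :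
    ∃ ℓ : unitInterval → ℤ, IsHeightLift hA hA' hf γ ℓ ∧ ℓ 0 = m := by
  obtain ⟨ℓ, hℓ, h0⟩ := exists_isHeightLift hA hA' hf γ.continuous_extend (0 : ℝ) m
  refine ⟨fun t => ℓ t, ?_, h0⟩
  have := hℓ.comp (φ := fun t : unitInterval => (t : ℝ)) continuous_subtype_val
  simpa using this

variable {hA hA' hf} in
theorem IsHeightLift.holonomy_eq {γ : Path o o} {ℓ : unitInterval → ℤ}
    (h : IsHeightLift hA hA' hf γ ℓ) : holonomy hA hA' hf (loopClass γ) (ℓ 0) = ℓ 1 := by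
  set cov := isCoveringMap_heightCore hA hA' hf
  have h0 : (⟨γ 0, ℓ 0⟩ : (heightCore hA hA' hf).TotalSpace) = ⟨o, ℓ 0⟩ := by rw [γ.source]
  have h1 : (⟨γ 1, ℓ 1⟩ : (heightCore hA hA' hf).TotalSpace) = ⟨o, ℓ 1⟩ := by rw [γ.target]
  have h2 := (cov.eq_liftPath_iff (γ := (γ : C(unitInterval, M)))
    (e := (⟨o, ℓ 0⟩ : (heightCore hA hA' hf).TotalSpace)) γ.source).2 ⟨h, funext fun _ => rfl, h0⟩
  have h3 := congrFun h2 1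
  have h4 : (cov.monodromyPerm o (loopClass γ) ⟨⟨o, ℓ 0⟩, rfl⟩).1 =
      (⟨o, ℓ 1⟩ : (heightCore hA hA' hf).TotalSpace) := h3.symm.trans h1
  exact congrArg (fun p : (heightCore hA hA' hf).TotalSpace => (p.2 : ℤ)) h4

/-- An evenly shifted lift is again a lift of the same loop. This turns composition of holonomies
into addition on the even shifts. -/
theorem holonomy_add_even (x : FundamentalGroup M o) (m : ℤ) {r : ℤ} (hr : Even r) :
    holonomy hA hA' hf x (m + r) = holonomy hA hA' hf x m + r := by
  obtain ⟨γ, rfl⟩ := exists_loopClass_eq x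
  obtain ⟨ℓ, hℓ, rfl⟩ := exists_isHeightLift_path hA hA' hf γ m
  rw [hℓ.holonomy_eq, (hℓ.add_even hr).holonomy_eq]

/-- The classes with holonomy of even height. -/
noncomputable def evenSubgroup (o : M) (m : ℤ) : Subgroup (FundamentalGroup M o) where
  carrier := {x | Even (holonomy hA hA' hf x m - m)}
  mul_mem' {x y} hx hy := by
    simp only [mem_ofPred_eq] at hx hy ⊢
    have h1 : holonomy hA hA' hf y m = m + (holonomy hA hA' hf y m - m) := by ring
    rw [holonomy_mul, h1, holonomy_add_even hA hA' hf x m hy, add_sub_right_comm]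
    exact hx.add hy
  one_mem' := by
    rw [mem_ofPred_eq, holonomy_one, sub_self]
    exact Even.zero
  inv_mem' {x} hx := by
    simp only [mem_ofPred_eq] at hx ⊢
    have h1 : holonomy hA hA' hf x m = m + (holonomy hA hA' hf x m - m) := by ring
    have h2 : holonomy hA hA' hf x⁻¹ (holonomy hA hA' hf x m) = m := by
      rw [← holonomy_mul, inv_mul_cancel, holonomy_one]
    rw [h1, holonomy_add_even hA hA' hf x⁻¹ m hx] at h2
    have h3 : holonomy hA hA' hf x⁻¹ m - m = -(holonomy hA hA' hf x m - m) := by linarith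
    rw [h3]
    exact hx.neg

theorem mem_evenSubgroup {m : ℤ} {x : FundamentalGroup M o} :
    x ∈ evenSubgroup hA hA' hf o m ↔ Even (holonomy hA hA' hf x m - m) := Iff.rfl

/-- The homomorphism given by half the change of height. -/
noncomputable def maslov (o : M) (m : ℤ) :
    evenSubgroup hA hA' hf o m →* Multiplicative ℤ :=
  -- The division is exact on the subgroup of even shifts. The minus sign is that of the height in
  -- the angle function of the normal curvature map.
  MonoidHom.mk' (fun x => Multiplicative.ofAdd (-((holonomy hA hA' hf x.1 m - m) / 2))) <| by
    rintro ⟨x, hx⟩ ⟨y, hy⟩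
    rw [mem_evenSubgroup] at hx hy
    have h1 : holonomy hA hA' hf y m = m + (holonomy hA hA' hf y m - m) := by ring
    rw [← ofAdd_add]
    congr 1
    dsimp only [Subgroup.coe_mul, MulMemClass.mk_mul_mk]
    rw [holonomy_mul, h1, holonomy_add_even hA hA' hf x m hy]
    obtain ⟨a, ha⟩ := hx
    obtain ⟨b, hb⟩ := hy
    omega

theorem maslov_apply {m : ℤ} (x : evenSubgroup hA hA' hf o m) :
    maslov hA hA' hf o m x = Multiplicative.ofAdd (-((holonomy hA hA' hf x.1 m - m) / 2)) := rfl

theorem heightNormal_congr {q q' : M} (h : q = q') (m : ℤ) :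
    (⟨f q, heightNormal hA hA' hf q m⟩ : TangentBundle (𝓡 (n + 1)) N) =
      ⟨f q', heightNormal hA hA' hf q' m⟩ := by
  subst h; rfl

variable {hA hA' hf} in
-- The lift carries a continuous normal field, which closes up exactly if the parity at both ends is
-- the same. Any other normal field along the loop agrees with it up to a global sign.
theorem IsHeightLift.isCoorientable_iff {γ : Path o o} {ℓ : unitInterval → ℤ}
    (h : IsHeightLift hA hA' hf γ ℓ) : IsCoorientable g f γ ↔ Even (ℓ 1 - ℓ 0) := by
  have hends : γ 0 = γ 1 := γ.source.trans γ.target.symm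
  constructor
  · rintro ⟨ν, hν, hν01⟩
    by_contra hodd
    have h1 := h.isUnitNormalAlong
    rcases heightNormal_eq_or (hA := hA) (hA' := hA') (hf := hf) (γ 1) (ℓ 1) (ℓ 0) with h2 | h2
    · exact hodd h2.1
    · -- a field agreeing with the lift up to a sign changes its sign
      have key : ∀ ν : ∀ t : unitInterval, TangentSpace (𝓡 (n + 1)) (f (γ t)),
          IsUnitNormalAlong g f γ univ ν → ν 0 = heightNormal hA hA' hf (γ 0) (ℓ 0) →
          (⟨f (γ 0), ν 0⟩ : TangentBundle (𝓡 (n + 1)) N) ≠ ⟨f (γ 1), ν 1⟩ := by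
        intro ν hν h0 h01
        have h3 := hν.eq_of_eq hf γ.continuous h1 h0
        rw [h3] at h01
        beta_reduce at h01
        rw [heightNormal_congr hA hA' hf hends, h2.2] at h01
        have h4 : (heightNormal hA hA' hf (γ 1) (ℓ 0) : Euc (n + 1)) =
          -(heightNormal hA hA' hf (γ 1) (ℓ 0) : Euc (n + 1)) := by
          injection h01
        exact (isUnitNormalAt_heightNormal (hA := hA) (hA' := hA') (hf := hf) (γ 1) (ℓ 0)).ne_zero
          (eq_neg_self_iff_eq_zero.1 h4)
      rcases IsUnitNormalAt.eq_or_eq_neg hf (h1.2 0 (mem_univ _)) (hν.2 0 (mem_univ _)) with h3 | h3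
      · exact key ν hν h3 hν01
      · refine key _ (hν.neg hf γ.continuous) ?_ ?_
        · rw [h3]; exact neg_neg (heightNormal hA hA' hf (γ 0) (ℓ 0) : Euc (n + 1))
        · have h4 : (ν 0 : Euc (n + 1)) = (ν 1 : Euc (n + 1)) := by injection hν01
          have h5 : f (γ 0) = f (γ 1) := by rw [hends]
          exact Bundle.TotalSpace.ext h5 (by
            refine heq_of_eq ?_
            exact congrArg (fun v : Euc (n + 1) => -v) h4)
  · intro heven
    refine ⟨_, h.isUnitNormalAlong, ?_⟩
    rw [heightNormal_congr hA hA' hf hends]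
    rcases heightNormal_eq_or (hA := hA) (hA' := hA') (hf := hf) (γ 1) (ℓ 1) (ℓ 0) with h2 | h2
    · rw [h2.2]
    · exact absurd heven h2.1

theorem loopClass_mem_evenSubgroup (γ : Path o o) (m : ℤ) :
    loopClass γ ∈ evenSubgroup hA hA' hf o m ↔ IsCoorientable g f γ := by
  obtain ⟨ℓ, hℓ, rfl⟩ := exists_isHeightLift_path hA hA' hf γ m
  rw [mem_evenSubgroup, hℓ.holonomy_eq, hℓ.isCoorientable_iff]

end Holonomy

/-! ### Null curves and the height -/

section NullHeight

variable {n : ℕ}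
  {M : Type*} [TopologicalSpace M] [ChartedSpace (Euc n) M] [IsManifold (𝓡 n) ∞ M]
  {N : Type*} [TopologicalSpace N] [ChartedSpace (Euc (n + 1)) N] [IsManifold (𝓡 (n + 1)) ∞ N]
  {g : RiemMetric (n + 1) N} {f : M → N} {A : Set (OpenPartialHomeomorph M (Euc n))}
  {A' : Set (OpenPartialHomeomorph N (Euc (n + 1)))}
  {hA : IsOrientedAtlas n A} {hA' : IsOrientedAtlas (n + 1) A'} {hf : IsAFront g f} {o : M}
  {c : ℝ → M} {ℓ : ℝ → ℤ}

theorem IsInwardNear.congr {v v' : ∀ t, TangentSpace (𝓡 (n + 1)) (f (c t))} {t : ℝ}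
    {l : Filter ℝ} (h : IsInwardNear f c v t l) (hv : ∀ᶠ s in l, v s = v' s) :
    IsInwardNear f c v' t l := by
  obtain ⟨k, e, e', h1, hk, hN, hev⟩ := h
  refine ⟨k, e, e', h1, hk, hN, ?_⟩
  filter_upwards [hev, hv] with s h1 h2
  rwa [← h2]

theorem conormalValue_smul (k : ℕ) (e : OpenPartialHomeomorph M (Euc n))
    (e' : OpenPartialHomeomorph N (Euc (n + 1))) (q : M) (a : ℝ)
    (v : TangentSpace (𝓡 (n + 1)) (f q)) :
    conormalValue f k e e' q (a • v) = a * conormalValue f k e e' q v := by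
  unfold conormalValue
  rw [map_smul, map_smul, smul_eq_mul]

theorem isUnitNormalAt_smul {q : M} {v : TangentSpace (𝓡 (n + 1)) (f q)}
    (hv : IsUnitNormalAt g f q v) (s : ℤˣ) : IsUnitNormalAt g f q (((s : ℤ) : ℝ) • v) := by
  rcases Int.units_eq_one_or s with rfl | rfl
  · simpa using hv
  · simpa using hv.neg

/-- Near a singular parameter of a null curve, the inward direction is determined by the limit of
the normal curvature. -/
theorem IsHeightLift.exists_crossing (hn : 0 < n) (hc : ContMDiff 𝓘(ℝ, ℝ) (𝓡 n) 1 c)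
    (hℓ : IsHeightLift hA hA' hf c ℓ) {t : ℝ} (hS : c t ∈ singularSet n f)
    (hreg : velocity n c t ≠ 0)
    (hnull : mfderiv (𝓡 n) (𝓡 (n + 1)) f (c t) (velocity n c t) = 0)
    (hA2 : IsASingularity n f (c t) 1) (hc2 : ContMDiffAt 𝓘(ℝ, ℝ) (𝓡 n) 2 c t) :
    ∃ (P : ℝ) (b : ℤ), P ≠ 0 ∧
      Tendsto (fun s => (curvatureVector g f c
        (fun t => heightNormal hA hA' hf (c t) (ℓ t)) s).1 / (s - t)) (𝓝[≠] t) (𝓝 0) ∧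
      Tendsto (fun s => (curvatureVector g f c
        (fun t => heightNormal hA hA' hf (c t) (ℓ t)) s).2 / (s - t)) (𝓝[≠] t) (𝓝 P) ∧
      (∀ᶠ s in 𝓝[≠] t, c s ∉ singularSet n f ∧
        height hA hA' hf (c s) (ℓ s) = b + if 0 < (s - t) * P then 1 else 0) ∧
      (∀ s : ℤˣ, IsInwardNear f c (fun t => ((s : ℤ) : ℝ) • heightNormal hA hA' hf (c t) (ℓ t)) t
        (𝓝[>] t) ↔ 0 < s * P) ∧
      (∀ s : ℤˣ, IsInwardNear f c (fun t => ((s : ℤ) : ℝ) • heightNormal hA hA' hf (c t) (ℓ t)) t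
        (𝓝[<] t) ↔ s * P < 0) := by
  obtain ⟨P, hP, hT1, hT2, hSev, hsign⟩ := exists_tendsto_curvature hn hf hc
    hℓ.isUnitNormalAlong hS hreg hnull hA2 hc2
  obtain ⟨k, h1, hk, e, e', hN⟩ := hf.2 _ hS
  have hN' := hN.isNormalFormOn h1 hk
  obtain ⟨b, hb⟩ := hℓ.exists_eventually_height_eq hS hN' hN.mem_source
  have hgt : 𝓝[>] t ≤ 𝓝[≠] t := nhdsWithin_mono t fun s hs => ne_of_gt hs
  have hlt : 𝓝[<] t ≤ 𝓝[≠] t := nhdsWithin_mono t fun s hs => ne_of_lt hs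
  -- `IsInwardNear` leaves the choice of the normal form open, so the equivalence is needed for all
  -- of them. The sign `s` factors out of `conormalValue`, and `hess * conormalValue` has the sign
  -- opposite to `(r - t) * P`.
  have key : ∀ (s : ℤˣ) (k : ℕ) (e : OpenPartialHomeomorph M (Euc n))
      (e' : OpenPartialHomeomorph N (Euc (n + 1))), IsNormalFormOn f k e e' → c t ∈ e.source →
      ∀ᶠ r in 𝓝[≠] t, (IsInward f k e e' (c r)
        (((s : ℤ) : ℝ) • heightNormal hA hA' hf (c r) (ℓ r)) ↔ 0 < s * ((r - t) * P)) := by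
    intro s k e e' hN hte
    filter_upwards [hsign k e e' hN hte, hSev, (hc.continuous.continuousAt.eventually
      (e.open_source.eventually_mem hte)).filter_mono nhdsWithin_le_nhds] with r h1 h2 h3
    rw [hN.inwardSign_mul hf h3 h2 (isUnitNormalAt_smul (isUnitNormalAt_heightNormal _ _) s),
      conormalValue_smul]
    set x := hess k (e (c r)) * conormalValue f k e e' (c r) (heightNormal hA hA' hf (c r) (ℓ r))
    have h4 : hess k (e (c r)) * (((s : ℤ) : ℝ) *
      conormalValue f k e e' (c r) (heightNormal hA hA' hf (c r) (ℓ r))) = s * x := by ring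
    rw [h4]
    rcases Int.units_eq_one_or s with rfl | rfl <;> rcases mul_neg_iff.1 h1 with ⟨h5, h6⟩ | ⟨h5, h6⟩
    · simp [h5.not_gt, h6.not_gt, h5, h6]
    · simp [h5, h6]
    · simp [h5, h6]
    · simp [h5.not_gt, h6.not_gt, h5, h6]
  refine ⟨P, b, hP, hT1, hT2, ?_, fun s => ⟨?_, ?_⟩, fun s => ⟨?_, ?_⟩⟩
  · filter_upwards [hb.filter_mono nhdsWithin_le_nhds, hSev, hsign k e e' hN' hN.mem_source]
      with s h1 h2 h3
    refine ⟨h2, ?_⟩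
    rw [h1 h2]
    congr 1
    have h4 : ∀ {x y : ℝ}, x * y < 0 → (x < 0 ↔ 0 < y) := by
      intro x y hxy
      rcases mul_neg_iff.1 hxy with ⟨h5, h6⟩ | ⟨h5, h6⟩
      · exact ⟨fun h => absurd h h5.not_gt, fun h => absurd h h6.not_gt⟩
      · exact ⟨fun _ => h6, fun _ => h5⟩
    simp only [h4 h3]
  · rintro ⟨k, e, e', h1, hk, hN, hev⟩
    obtain ⟨r, h2, h3, h4⟩ := (hev.and (((key s k e e' (hN.isNormalFormOn h1 hk)
      hN.mem_source).filter_mono hgt).and self_mem_nhdsWithin)).exists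
    have h5 := h3.1 h2
    have h6 : 0 < r - t := sub_pos.2 h4
    rw [show (((s : ℤ) : ℝ)) * ((r - t) * P) = (r - t) * (s * P) by ring] at h5
    exact pos_of_mul_pos_right h5 h6.le
  · intro hs
    refine ⟨k, e, e', h1, hk, hN, ?_⟩
    filter_upwards [(key s k e e' hN' hN.mem_source).filter_mono hgt, self_mem_nhdsWithin]
      with r h2 h3
    rw [h2, show (((s : ℤ) : ℝ)) * ((r - t) * P) = (r - t) * (s * P) by ring]
    exact mul_pos (sub_pos.2 h3) hs
  · rintro ⟨k, e, e', h1, hk, hN, hev⟩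
    obtain ⟨r, h2, h3, h4⟩ := (hev.and (((key s k e e' (hN.isNormalFormOn h1 hk)
      hN.mem_source).filter_mono hlt).and self_mem_nhdsWithin)).exists
    have h5 := h3.1 h2
    have h6 : r - t < 0 := sub_neg.2 h4
    rw [show (((s : ℤ) : ℝ)) * ((r - t) * P) = (r - t) * (s * P) by ring] at h5
    exact (neg_iff_neg_of_mul_pos h5).1 h6
  · intro hs
    refine ⟨k, e, e', h1, hk, hN, ?_⟩
    filter_upwards [(key s k e e' hN' hN.mem_source).filter_mono hlt, self_mem_nhdsWithin]
      with r h2 h3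
    rw [h2, show (((s : ℤ) : ℝ)) * ((r - t) * P) = (r - t) * (s * P) by ring]
    exact mul_pos_of_neg_of_neg (sub_neg.2 h3) hs

/-- The height is constant on intervals without singular parameters. -/
theorem IsHeightLift.height_eq_of_forall (hℓ : IsHeightLift hA hA' hf c ℓ) {s : Set ℝ}
    (hs : IsPreconnected s) (hreg : ∀ t ∈ s, c t ∉ singularSet n f) {t t' : ℝ} (ht : t ∈ s)
    (ht' : t' ∈ s) : height hA hA' hf (c t) (ℓ t) = height hA hA' hf (c t') (ℓ t') := by
  refine hs.constant (Y := ℤ) (f := fun t => height hA hA' hf (c t) (ℓ t)) ?_ ht ht'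
  intro r hr
  refine ContinuousAt.continuousWithinAt ?_
  exact (continuousAt_const (y := height hA hA' hf (c r) (ℓ r))).congr
    ((hℓ.eventually_height_eq (hreg r hr)).mono fun _ h => h.symm)

end NullHeight

/-! ### The real projective line -/

/-- The line through a nonzero vector, by its double angle. -/
noncomputable def doubleAngle (v : ℝ × ℝ) : ℝ × ℝ :=
  ((v.1 ^ 2 - v.2 ^ 2) / (v.1 ^ 2 + v.2 ^ 2), 2 * v.1 * v.2 / (v.1 ^ 2 + v.2 ^ 2))

theorem sq_add_sq_pos_of_ne_zero {v : ℝ × ℝ} (hv : v ≠ 0) : 0 < v.1 ^ 2 + v.2 ^ 2 := by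
  by_contra! h
  have h1 : v.1 = 0 := by nlinarith [sq_nonneg v.1, sq_nonneg v.2]
  have h2 : v.2 = 0 := by nlinarith [sq_nonneg v.1, sq_nonneg v.2]
  exact hv (Prod.ext h1 h2)

theorem doubleAngle_smul {a : ℝ} (ha : a ≠ 0) (v : ℝ × ℝ) :
    doubleAngle (a • v) = doubleAngle v := by
  unfold doubleAngle
  have h1 : (a • v).1 = a * v.1 := rfl
  have h2 : (a • v).2 = a * v.2 := rfl
  rw [h1, h2, show (a * v.1) ^ 2 - (a * v.2) ^ 2 = a ^ 2 * (v.1 ^ 2 - v.2 ^ 2) by ring,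
    show (a * v.1) ^ 2 + (a * v.2) ^ 2 = a ^ 2 * (v.1 ^ 2 + v.2 ^ 2) by ring,
    show 2 * (a * v.1) * (a * v.2) = a ^ 2 * (2 * v.1 * v.2) by ring,
    mul_div_mul_left _ _ (pow_ne_zero 2 ha), mul_div_mul_left _ _ (pow_ne_zero 2 ha)]

theorem projectivization_mk_eq_iff {v w : ℝ × ℝ} (hv : v ≠ 0) (hw : w ≠ 0) :
    Projectivization.mk ℝ v hv = Projectivization.mk ℝ w hw ↔ v.1 * w.2 = v.2 * w.1 := by
  rw [Projectivization.mk_eq_mk_iff']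
  constructor
  · rintro ⟨a, rfl⟩
    simp only [Prod.smul_fst, Prod.smul_snd, smul_eq_mul]; ring
  · intro h
    have hw' := sq_add_sq_pos_of_ne_zero hw
    refine ⟨(v.1 * w.1 + v.2 * w.2) / (w.1 ^ 2 + w.2 ^ 2), ?_⟩
    ext
    · simp only [Prod.smul_fst, smul_eq_mul]
      field_simp
      linear_combination (-w.2) * h
    · simp only [Prod.smul_snd, smul_eq_mul]
      field_simp
      linear_combination w.1 * h

/-- The double angle map on the projective line. -/
noncomputable def projDoubleAngle (x : ℙ ℝ (ℝ × ℝ)) : ℝ × ℝ :=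
  x.lift (fun v => doubleAngle v.1) (by
    rintro ⟨a, ha⟩ ⟨b, hb⟩ t h
    have h' : a = t • b := h
    subst h'
    refine doubleAngle_smul ?_ _
    rintro rfl
    simp at ha)

theorem continuous_projDoubleAngle : Continuous projDoubleAngle := by
  refine Continuous.quotient_lift (s := projectivizationSetoid ℝ (ℝ × ℝ))
    (f := fun v : {v : ℝ × ℝ // v ≠ 0} => doubleAngle v.1) ?_ _
  refine Continuous.prodMk ?_ ?_ <;> refine Continuous.div (by fun_prop) (by fun_prop) fun v => ?_
  · exact (sq_add_sq_pos_of_ne_zero v.2).ne'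
  · exact (sq_add_sq_pos_of_ne_zero v.2).ne'

/-- If the lines differ, equality of the double angles forces `v₁ w₁ - v₂ w₂ = 0` and `v₁ w₂ + v₂ w₁
= 0`, whose squares add up to `|v|² |w|²`. The map separates points, so the projective line is
Hausdorff and continuous extensions to it are unique. -/
theorem injective_projDoubleAngle : Function.Injective projDoubleAngle := by
  intro x y
  induction x using Projectivization.ind with | _ v hv
  induction y using Projectivization.ind with | _ w hw
  intro h
  have h' : doubleAngle v = doubleAngle w := h
  rw [projectivization_mk_eq_iff]
  have h1 : (v.1 ^ 2 - v.2 ^ 2) / (v.1 ^ 2 + v.2 ^ 2) = _ / _ := congrArg Prod.fst h'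
  have h2 : 2 * v.1 * v.2 / (v.1 ^ 2 + v.2 ^ 2) = _ / _ := congrArg Prod.snd h'
  have hv' := sq_add_sq_pos_of_ne_zero hv
  have hw' := sq_add_sq_pos_of_ne_zero hw
  rw [div_eq_div_iff hv'.ne' hw'.ne'] at h1 h2
  have e1 : v.1 ^ 2 * w.2 ^ 2 = v.2 ^ 2 * w.1 ^ 2 := by linear_combination h1 / 2
  have e3 : (v.1 * w.2 - v.2 * w.1) * (v.1 * w.1 - v.2 * w.2) = 0 := by linear_combination -h2 / 2
  have e2 : (v.1 * w.2 - v.2 * w.1) * (v.1 * w.2 + v.2 * w.1) = 0 := by linear_combination e1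
  by_contra hne
  have hne' : v.1 * w.2 - v.2 * w.1 ≠ 0 := sub_ne_zero.2 hne
  have e4 := (mul_eq_zero.1 e3).resolve_left hne'
  have e5 := (mul_eq_zero.1 e2).resolve_left hne'
  have e6 : (v.1 ^ 2 + v.2 ^ 2) * (w.1 ^ 2 + w.2 ^ 2) =
      (v.1 * w.1 - v.2 * w.2) ^ 2 + (v.1 * w.2 + v.2 * w.1) ^ 2 := by ring
  rw [e4, e5] at e6
  have := mul_pos hv' hw'
  rw [e6] at this
  norm_num at this

instance : T2Space (ℙ ℝ (ℝ × ℝ)) :=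
  T2Space.of_injective_continuous injective_projDoubleAngle continuous_projDoubleAngle

theorem cos_sin_ne_zero (θ : ℝ) : (Real.cos θ, Real.sin θ) ≠ (0 : ℝ × ℝ) := by
  intro h
  have h1 : Real.cos θ = 0 := congrArg Prod.fst h
  have h2 : Real.sin θ = 0 := congrArg Prod.snd h
  have := Real.cos_sq_add_sin_sq θ
  rw [h1, h2] at this
  norm_num at this

/-- The line at angle `θ`. -/
noncomputable def lineOfAngle (θ : ℝ) : ℙ ℝ (ℝ × ℝ) := Projectivization.mk ℝ _ (cos_sin_ne_zero θ)

theorem continuous_lineOfAngle : Continuous lineOfAngle := by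
  have h : Continuous fun θ : ℝ => (⟨_, cos_sin_ne_zero θ⟩ : {v : ℝ × ℝ // v ≠ 0}) := by
    fun_prop
  exact (continuous_quotient_mk' (s := projectivizationSetoid ℝ (ℝ × ℝ))).comp h

theorem lineOfAngle_eq_iff {θ φ : ℝ} : lineOfAngle θ = lineOfAngle φ ↔ ∃ k : ℤ, k * Real.pi = θ - φ := by
  rw [lineOfAngle, lineOfAngle, projectivization_mk_eq_iff, ← Real.sin_eq_zero_iff, Real.sin_sub,
    sub_eq_zero, eq_comm]

theorem lineOfAngle_arctan_sub {v : ℝ × ℝ} (hv : 0 < v.1) (h : ℤ) (hv0 : v ≠ 0) :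
    lineOfAngle (Real.arctan (v.2 / v.1) - Real.pi * h) = Projectivization.mk ℝ v hv0 := by
  have h1 : lineOfAngle (Real.arctan (v.2 / v.1) - Real.pi * h) =
      lineOfAngle (Real.arctan (v.2 / v.1)) :=
    lineOfAngle_eq_iff.2 ⟨-h, by push_cast; ring⟩
  rw [h1, lineOfAngle, projectivization_mk_eq_iff]
  have h2 := Real.tan_arctan (v.2 / v.1)
  rw [Real.tan_eq_sin_div_cos, div_eq_div_iff (Real.cos_arctan_pos _).ne' hv.ne'] at h2
  change Real.cos _ * v.2 = Real.sin _ * v.1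
  linear_combination -h2

/-- Two continuous angles of the same line differ by a continuous function with values in the
discrete set of multiples of `π`, hence by a constant. -/
theorem hasRotationIndex_unique {C : unitInterval → ℙ ℝ (ℝ × ℝ)} {μ μ' : ℤ}
    (h : HasRotationIndex C μ) (h' : HasRotationIndex C μ') : μ = μ' := by
  obtain ⟨θ, hθ, hC, hμ⟩ := h
  obtain ⟨θ', hθ', hC', hμ'⟩ := h'
  have key : ∀ t, ∃ k : ℤ, k * Real.pi = θ t - θ' t := fun t => by
    obtain ⟨_, h1⟩ := hC t
    obtain ⟨_, h2⟩ := hC' t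
    exact lineOfAngle_eq_iff.1 (h1.symm.trans h2)
  have hdisc : DiscreteTopology (range ((↑) : ℤ → ℝ)) :=
    Int.isClosedEmbedding_coe_real.isEmbedding.toHomeomorph.symm.isEmbedding.discreteTopology
  have hcont : ContinuousOn (fun t => (θ t - θ' t) / Real.pi) univ := by fun_prop
  have hconst := isPreconnected_univ.eqOn_const_of_mapsTo
    (T := range ((↑) : ℤ → ℝ)) ⟨hdisc⟩ hcont (fun t _ => ?_) ⟨0, 0, by simp⟩
  · obtain ⟨y, -, hy⟩ := hconst
    have h0 := hy (mem_univ (0 : unitInterval))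
    have h1 := hy (mem_univ (1 : unitInterval))
    have h2 : (θ 0 - θ' 0) / Real.pi = (θ 1 - θ' 1) / Real.pi := h0.trans h1.symm
    have h3 : θ 0 - θ' 0 = θ 1 - θ' 1 := by
      have := Real.pi_ne_zero
      field_simp at h2
      exact h2
    have h4 : 2 * Real.pi * (μ : ℝ) = 2 * Real.pi * μ' := by linarith
    exact_mod_cast mul_left_cancel₀ (mul_ne_zero two_ne_zero Real.pi_ne_zero) h4
  · obtain ⟨k, hk⟩ := key t
    refine ⟨k, ?_⟩
    rw [← hk]
    field_simp

/-! ### The angle of the normal curvature map -/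

/-- `arctan (y / x)` is `±π / 2 - arctan (x / y)`, and the indicator of `0 < y` removes the jump
between the two signs. The right-hand side has a limit as `x / y` tends to `0`. -/
theorem arctan_sub_eq {x y : ℝ} (hx : 0 < x) (hy : y ≠ 0) (b : ℤ) :
    Real.arctan (y / x) - Real.pi * ((b + if 0 < y then 1 else 0 : ℤ) : ℝ) =
      -(Real.pi / 2) - Real.pi * b - Real.arctan (x / y) := by
  rcases hy.lt_or_gt with h | h
  · have h1 := Real.arctan_inv_of_neg (div_neg_of_neg_of_pos h hx)
    rw [inv_div] at h1
    simp only [h.not_gt, if_false]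
    push_cast
    rw [h1]; ring
  · have h1 := Real.arctan_inv_of_pos (div_pos h hx)
    rw [inv_div] at h1
    simp only [h, if_true]
    push_cast
    rw [h1]; ring

section Angle

variable {n : ℕ}
  {M : Type*} [TopologicalSpace M] [ChartedSpace (Euc n) M] [IsManifold (𝓡 n) ∞ M]
  {N : Type*} [TopologicalSpace N] [ChartedSpace (Euc (n + 1)) N] [IsManifold (𝓡 (n + 1)) ∞ N]
  {g : RiemMetric (n + 1) N} {f : M → N} {A : Set (OpenPartialHomeomorph M (Euc n))}
  {A' : Set (OpenPartialHomeomorph N (Euc (n + 1)))}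
  {hA : IsOrientedAtlas n A} {hA' : IsOrientedAtlas (n + 1) A'} {hf : IsAFront g f} {o : M}
  {c : ℝ → M} {ℓ : ℝ → ℤ}

/-- The angle of the normal curvature map along a null loop. -/
theorem IsHeightLift.exists_angle (hn : 0 < n) (hc : IsNullLoop n f o c)
    (hℓ : IsHeightLift hA hA' hf c ℓ) :
    ∃ θ : ℝ → ℝ, Continuous θ ∧ ∀ t, c t ∉ singularSet n f →
      θ t = Real.arctan ((curvatureVector g f c
          (fun t => heightNormal hA hA' hf (c t) (ℓ t)) t).2 /
          (curvatureVector g f c (fun t => heightNormal hA hA' hf (c t) (ℓ t)) t).1) -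
        Real.pi * height hA hA' hf (c t) (ℓ t) := by
  set K := curvatureVector g f c (fun t => heightNormal hA hA' hf (c t) (ℓ t)) with hK
  have hpos : ∀ t, c t ∉ singularSet n f → 0 < (K t).1 := fun t ht =>
    curvatureVector_fst_pos hf.1.1 ((hc.contMDiff t).mdifferentiableAt one_ne_zero) (hc.regular t) ht
  have hlim : ∀ t, c t ∈ singularSet n f → ∃ L, Tendsto (fun s => Real.arctan ((K s).2 / (K s).1) -
      Real.pi * height hA hA' hf (c s) (ℓ s)) (𝓝[≠] t) (𝓝 L) ∧
      ∀ᶠ s in 𝓝[≠] t, c s ∉ singularSet n f := by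
    intro t ht
    obtain ⟨P, b, hP, hT1, hT2, hev, -, -⟩ := hℓ.exists_crossing hn hc.contMDiff ht (hc.regular t)
      (hc.null t ht) (hc.isA2 t ht) (hc.contMDiffAt t ht)
    refine ⟨-(Real.pi / 2) - Real.pi * b, ?_, hev.mono fun _ h => h.1⟩
    -- Both components are compared with `s - t`: the first quotient tends to `0`, the second to `P
    -- ≠ 0`.
    have h1 : Tendsto (fun s => (K s).1 / (K s).2) (𝓝[≠] t) (𝓝 0) := by
      have := hT1.div hT2 hP
      rw [zero_div] at this
      refine this.congr' ?_
      filter_upwards [self_mem_nhdsWithin] with s hs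
      exact div_div_div_cancel_right₀ (sub_ne_zero.2 hs) _ _
    have h2 := (Real.continuous_arctan.tendsto 0).comp h1
    rw [Real.arctan_zero] at h2
    have h3 : Tendsto (fun s => -(Real.pi / 2) - Real.pi * b - Real.arctan ((K s).1 / (K s).2))
      (𝓝[≠] t) (𝓝 (-(Real.pi / 2) - Real.pi * b)) := by
      simpa using (tendsto_const_nhds (x := -(Real.pi / 2) - Real.pi * (b : ℝ))).sub h2
    refine h3.congr' ?_
    -- Hence `(K s).2` has the sign of `(s - t) * P`, the quantity that governs the height. So the
    -- height is `b` plus the indicator of `0 < (K s).2`.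
    have hmul : Tendsto (fun s => (K s).2 / (s - t) * P) (𝓝[≠] t) (𝓝 (P * P)) :=
      hT2.mul tendsto_const_nhds
    filter_upwards [hev, hmul.eventually (lt_mem_nhds (mul_self_pos.2 hP)), self_mem_nhdsWithin]
      with s hs hs2 hs3
    have hst : s - t ≠ 0 := sub_ne_zero.2 hs3
    have e1 : (K s).2 * ((s - t) * P) = ((K s).2 / (s - t) * P) * (s - t) ^ 2 := by field_simp
    have e2 : 0 < (K s).2 * ((s - t) * P) := by
      rw [e1]; exact mul_pos hs2 (by positivity)
    have e3 : (0 < (s - t) * P ↔ 0 < (K s).2) := by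
      rcases mul_pos_iff.1 e2 with ⟨h5, h6⟩ | ⟨h5, h6⟩
      · exact ⟨fun _ => h5, fun _ => h6⟩
      · exact ⟨fun h => absurd h h6.not_gt, fun h => absurd h h5.not_gt⟩
    have e4 : (K s).2 ≠ 0 := by
      rintro h; rw [h, zero_mul] at e2; exact e2.false
    rw [hs.2]
    simp only [e3]
    exact (arctan_sub_eq (hpos s hs.1) e4 b).symm
  choose! L hL hev using hlim
  classical
  refine ⟨fun t => if c t ∈ singularSet n f then L t else Real.arctan ((K t).2 / (K t).1) -
      Real.pi * height hA hA' hf (c t) (ℓ t), continuous_iff_continuousAt.2 fun t => ?_, fun t ht => by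
        simp only [ht, if_false]⟩
  by_cases ht : c t ∈ singularSet n f
  · rw [continuousAt_iff_punctured_nhds]
    simp only [ht, if_true]
    refine (hL t ht).congr' ?_
    filter_upwards [hev t ht] with s hs
    simp only [hs, if_false]
  · have hKc : ContinuousAt K t := continuousAt_curvatureVector hf hc.contMDiff hℓ.isUnitNormalAlong t
    have h1 : ContinuousAt (fun s => Real.arctan ((K s).2 / (K s).1) -
        Real.pi * height hA hA' hf (c t) (ℓ t)) t :=
      (Real.continuous_arctan.continuousAt.comp (f := fun s => (K s).2 / (K s).1)
        (hKc.snd.div hKc.fst (hpos t ht).ne')).sub continuousAt_const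
    refine h1.congr ?_
    filter_upwards [hℓ.eventually_height_eq ht, hc.contMDiff.continuous.continuousAt.eventually
      ((isClosed_singularSet hf.1.1).isOpen_compl.eventually_mem ht)] with s hs hs2
    have hs3 : c s ∉ singularSet n f := hs2
    simp only [hs3, if_false, hs]

theorem curvatureVector_add (hf : ContMDiff (𝓡 n) (𝓡 (n + 1)) ∞ f)
    (hc : ContMDiff 𝓘(ℝ, ℝ) (𝓡 n) 1 c) (ν : ∀ t, TangentSpace (𝓡 (n + 1)) (f (c t))) (a t : ℝ) :
    curvatureVector g f (fun s => c (s + a)) (fun s => ν (s + a)) t =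
      curvatureVector g f c ν (t + a) := by
  have hσ : MDifferentiableAt 𝓘(ℝ, ℝ) (𝓡 (n + 1)) (fun s => f (c s)) (t + a) :=
    ((hf.of_le (by norm_cast)).comp hc (t + a)).mdifferentiableAt one_ne_zero
  have hv : velocity (n + 1) (fun s => f (c (s + a))) t =
      velocity (n + 1) (fun s => f (c s)) (t + a) := by
    have h1 : HasMFDerivAt 𝓘(ℝ, ℝ) 𝓘(ℝ, ℝ) (fun s : ℝ => s + a) t (ContinuousLinearMap.id ℝ ℝ) :=
      ((hasFDerivAt_id t).add_const a).hasMFDerivAt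
    have h2 := (HasMFDerivAt.comp t (g := fun s => f (c s)) (f := fun s : ℝ => s + a)
      hσ.hasMFDerivAt h1).mfderiv
    unfold velocity
    exact congrArg (fun L : ℝ →L[ℝ] Euc (n + 1) => L 1) h2
  unfold curvatureVector
  rw [Prod.mk.injEq]
  refine ⟨?_, ?_⟩
  · change g.inner (f (c (t + a))) _ _ = _
    rw [hv]
  · change covDerivPairing g (fun s => f (c (s + a))) (fun s => ν (s + a)) t _ = _
    rw [hv]
    unfold covDerivPairing
    dsimp only
    rw [deriv_comp_add_const (f := fun s => extChartAt (𝓡 (n + 1)) (f (c (t + a))) (f (c s))),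
      deriv_comp_add_const (f := fun s => mfderiv (𝓡 (n + 1)) 𝓘(ℝ, Euc (n + 1))
        (extChartAt (𝓡 (n + 1)) (f (c (t + a)))) (f (c s)) (ν s))]

theorem curvatureVector_congr {c' : ℝ → M} {ν : ∀ t, TangentSpace (𝓡 (n + 1)) (f (c t))}
    {ν' : ∀ t, TangentSpace (𝓡 (n + 1)) (f (c' t))} (h : c = c')
    (hν : ∀ t, (⟨f (c t), ν t⟩ : TangentBundle (𝓡 (n + 1)) N) = ⟨f (c' t), ν' t⟩) :
    curvatureVector g f c ν = curvatureVector g f c' ν' := by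
  subst h
  congr 1
  funext t
  exact eq_of_heq (Bundle.TotalSpace.mk.inj (hν t)).2

/-- Both sides are lifts of the same periodic curve, the right one by invariance under even shifts,
and they agree at `0`. -/
theorem IsHeightLift.add_one (hc : Function.Periodic c 1) (hℓ : IsHeightLift hA hA' hf c ℓ)
    (h : Even (ℓ 1 - ℓ 0)) (t : ℝ) : ℓ (t + 1) = ℓ t + (ℓ 1 - ℓ 0) := by
  have h1 : IsHeightLift hA hA' hf (fun t => c (t + 1)) fun t => ℓ (t + 1) :=
    hℓ.comp (continuous_id.add continuous_const)
  have h2 : (fun t => c (t + 1)) = c := funext hc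
  rw [h2] at h1
  have := IsHeightLift.eq_of_eq hA hA' hf h1 (hℓ.add_even h) (t := 0) (by simp)
  exact congrFun this t

/-- Translation by a period preserves the curve, and also its normal field, because an even shift
does not change the normal. -/
theorem IsHeightLift.curvatureVector_one (hc : IsNullLoop n f o c)
    (hℓ : IsHeightLift hA hA' hf c ℓ) (h : Even (ℓ 1 - ℓ 0)) :
    curvatureVector g f c (fun t => heightNormal hA hA' hf (c t) (ℓ t)) 1 =
      curvatureVector g f c (fun t => heightNormal hA hA' hf (c t) (ℓ t)) 0 := by
  have h1 := curvatureVector_add (g := g) hf.1.1 hc.contMDiff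
    (fun t => heightNormal hA hA' hf (c t) (ℓ t)) 1 0
  rw [zero_add] at h1
  rw [← h1]
  refine congrFun (curvatureVector_congr (funext hc.periodic) fun t => ?_) 0
  rw [hℓ.add_one hc.periodic h t, heightNormal_congr hA hA' hf (hc.periodic t)]
  rcases heightNormal_eq_or (hA := hA) (hA' := hA') (hf := hf) (c t) (ℓ t + (ℓ 1 - ℓ 0)) (ℓ t)
    with ⟨-, h2⟩ | ⟨h2, -⟩
  · rw [h2]
  · exact absurd (by simpa using h) h2

theorem dense_compl_singular (hc : IsNullLoop n f o c) :
    Dense {t : unitInterval | c t ∉ singularSet n f} := by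
  have h1 : {t : unitInterval | c t ∈ singularSet n f}.Finite := by
    refine Set.Finite.of_finite_image (f := Subtype.val) (hc.finite.subset ?_)
      Subtype.val_injective.injOn
    rintro _ ⟨t, ht, rfl⟩
    exact ⟨t.2, ht⟩
  have := (dense_univ (X := unitInterval)).sdiff_finite h1
  refine this.mono fun t ht => ht.2

/-- The normal curvature map of a co-orientable null loop and its rotation index. -/
theorem IsHeightLift.curvatureMap (hn : 0 < n) (ho : o ∉ singularSet n f)
    (hc : IsNullLoop n f o c) (hℓ : IsHeightLift hA hA' hf c ℓ)
    (h : Even (ℓ 1 - ℓ 0)) :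
    ∃ C : unitInterval → ℙ ℝ (ℝ × ℝ),
      (∀ C', IsNormalCurvatureMap g f (heightNormal hA hA' hf o (ℓ 0)) c C' ↔ C' = C) ∧
      ∀ μ', HasRotationIndex C μ' ↔ μ' = -((ℓ 1 - ℓ 0) / 2) := by
  obtain ⟨θ, hθ, hθr⟩ := hℓ.exists_angle hn hc
  have hpos : ∀ t, c t ∉ singularSet n f → 0 < (curvatureVector g f c
      (fun t => heightNormal hA hA' hf (c t) (ℓ t)) t).1 := fun t ht =>
    curvatureVector_fst_pos hf.1.1 ((hc.contMDiff t).mdifferentiableAt one_ne_zero) (hc.regular t) ht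
  have hC : ∀ t, c t ∉ singularSet n f → ∃ h : curvatureVector g f c
      (fun t => heightNormal hA hA' hf (c t) (ℓ t)) t ≠ 0,
      lineOfAngle (θ t) = Projectivization.mk ℝ _ h := by
    intro t ht
    have h0 : curvatureVector g f c (fun t => heightNormal hA hA' hf (c t) (ℓ t)) t ≠ 0 := by
      intro h0
      have := hpos t ht
      rw [h0] at this
      exact this.false
    exact ⟨h0, by rw [hθr t ht]; exact lineOfAngle_arctan_sub (hpos t ht) _ h0⟩
  have hν0 : (⟨f (c 0), heightNormal hA hA' hf (c 0) (ℓ 0)⟩ : TangentBundle (𝓡 (n + 1)) N) =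
      ⟨f o, heightNormal hA hA' hf o (ℓ 0)⟩ := heightNormal_congr hA hA' hf hc.base _
  refine ⟨fun t => lineOfAngle (θ t), fun C' => ⟨?_, ?_⟩, fun μ' => ⟨fun hμ' => ?_, ?_⟩⟩
  · rintro ⟨ν, hν, hν0', hcont, hC'⟩
    have hνeq : ν = fun t => heightNormal hA hA' hf (c t) (ℓ t) := by
      refine hν.eq_of_eq hf hc.contMDiff.continuous hℓ.isUnitNormalAlong (t := 0) ?_
      exact eq_of_heq (Bundle.TotalSpace.mk.inj (hν0'.trans hν0.symm)).2
    subst hνeq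
    -- The singular parameters are finite in number, so a continuous map into a Hausdorff space is
    -- determined by the others.
    refine Continuous.ext_on (dense_compl_singular hc) hcont
      (continuous_lineOfAngle.comp (hθ.comp continuous_subtype_val)) fun t ht => ?_
    obtain ⟨h1, h2⟩ := hC' t ht
    obtain ⟨h3, h4⟩ := hC t ht
    exact h2.trans h4.symm
  · rintro rfl
    exact ⟨_, hℓ.isUnitNormalAlong, hν0,
      continuous_lineOfAngle.comp (hθ.comp continuous_subtype_val), fun t ht => hC t ht⟩
  all_goals
    -- The base point is regular and the curvature vectors at both ends agree, so the `arctan` terms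
    -- cancel. What is left is `-π` times the increase of the height, an even number.
    have hidx : HasRotationIndex (fun t : unitInterval => lineOfAngle (θ t)) (-((ℓ 1 - ℓ 0) / 2)) := by
      refine ⟨fun t => θ t, hθ.comp continuous_subtype_val,
        fun t => ⟨cos_sin_ne_zero _, rfl⟩, ?_⟩
      have hc1 : c 1 = o := by simpa [hc.base] using hc.periodic 0
      have e1 : height hA hA' hf (c 1) (ℓ 1) = height hA hA' hf o (ℓ 0) + (ℓ 1 - ℓ 0) := by
        rw [hc1, ← height_add_even o (ℓ 0) h]; congr 1; ring
      have e0 : height hA hA' hf (c 0) (ℓ 0) = height hA hA' hf o (ℓ 0) := by rw [hc.base]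
      change θ 1 - θ 0 = _
      rw [hθr 1 (by rwa [hc1]), hθr 0 (by rwa [hc.base]), hℓ.curvatureVector_one hc h, e0, e1]
      obtain ⟨r, hr⟩ := h
      rw [hr, show (r + r) / 2 = r by omega]
      push_cast
      ring
  · exact hasRotationIndex_unique hμ' hidx
  · rintro rfl; exact hidx

end Angle

/-! ### Cancellation of signs -/

/-- The alternating sum of a sequence of signs. -/
def altSum : List ℤˣ → ℤ
  | [] => 0
  | a :: l => (a : ℤ) - altSum l

/-- A cancelled pair of equal neighbours contributes `a - a`, and its removal does not alter the
parity of later positions. -/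
theorem altSum_normalize (l : List ℤˣ) : altSum (normalize l) = altSum l := by
  induction l with
  | nil => rfl
  | cons a l ih =>
    rw [altSum, ← ih, normalize]
    cases h : normalize l with
    | nil => rfl
    | cons b l' =>
      by_cases hab : a = b
      · simp [hab, altSum]
      · simp [hab, altSum]

theorem isChain_normalize (l : List ℤˣ) : (normalize l).IsChain (· ≠ ·) := by
  induction l with
  | nil => exact List.isChain_nil
  | cons a l ih =>
    rw [normalize]
    cases h : normalize l with
    | nil => exact List.isChain_singleton a
    | cons b l' =>
      rw [h] at ih
      by_cases hab : a = b
      · simpa [hab] using ih.tail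
      · simpa [hab] using ih

/-- Such a sequence is `a, -a, a, …`, so every term contributes `a` to the alternating sum. The
minus signs are half of the terms, rounded down if `a = 1` and up if `a = -1`. -/
theorem altSum_cons_of_isChain (a : ℤˣ) (l : List ℤˣ) (h : (a :: l).IsChain (· ≠ ·)) :
    altSum (a :: l) = a * (l.length + 1) ∧
      2 * ((a :: l).count (-1) : ℤ) = (l.length + 1) - a * ((l.length + 1) % 2) := by
  induction l generalizing a with
  | nil => rcases Int.units_eq_one_or a with rfl | rfl <;> simp [altSum]
  | cons b l ih =>
    rw [List.isChain_cons_cons] at h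
    obtain ⟨h1, h2⟩ := ih b h.2
    have hb : b = -a := by
      rcases Int.units_eq_one_or a with rfl | rfl <;> rcases Int.units_eq_one_or b with rfl | rfl <;>
        simp_all
    subst hb
    rw [altSum, h1, List.count_cons]
    push_cast [List.length_cons] at h2 ⊢
    refine ⟨by ring, ?_⟩
    rw [mul_add, h2]
    rcases Int.units_eq_one_or a with rfl | rfl
    · have h0 : ((1 : ℤˣ) == -1) = false := by decide
      simp only [h0]
      push_cast
      simp
      omega
    · simp
      omega

/-- The normalized list alternates and has even length `2 |r|`, so exactly half of its terms are
minus signs. -/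
theorem count_normalize (l : List ℤˣ) {r : ℤ} (h : altSum l = 2 * r) :
    (normalize l).count (-1) = r.natAbs := by
  rw [← altSum_normalize] at h
  have hch := isChain_normalize l
  cases hl : normalize l with
  | nil => rw [hl] at h; simp [altSum] at h; simp [h]
  | cons a l' =>
    rw [hl] at h hch
    obtain ⟨h1, h2⟩ := altSum_cons_of_isChain a l' hch
    rw [h1] at h
    rcases Int.units_eq_one_or a with rfl | rfl
    · push_cast at h h2; omega
    · push_cast at h h2; omega

theorem altSum_append_singleton (l : List ℤˣ) (a : ℤˣ) :
    altSum (l ++ [a]) = altSum l + (-1) ^ l.length * a := by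
  induction l with
  | nil => simp [altSum]
  | cons b l ih =>
    rw [List.cons_append, altSum, ih, altSum, List.length_cons, pow_succ]; ring

theorem altSum_map_range (ε : ℕ → ℤˣ) (k : ℕ) :
    altSum ((List.range k).map ε) = ∑ j ∈ Finset.range k, (-1) ^ j * (ε j : ℤ) := by
  induction k with
  | zero => rfl
  | succ k ih =>
    rw [List.range_succ, List.map_append, List.map_singleton, altSum_append_singleton, ih,
      Finset.sum_range_succ]
    simp

/-! ### The zig-zag number of a null loop -/

theorem exists_units_mul_pos {P : ℝ} (hP : P ≠ 0) : ∃ s : ℤˣ, 0 < ((s : ℤ) : ℝ) * P := by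
  rcases hP.lt_or_gt with h | h
  · exact ⟨-1, by simpa using h⟩
  · exact ⟨1, by simpa using h⟩

theorem units_mul_neg_iff {P : ℝ} {s : ℤˣ} (hs : 0 < ((s : ℤ) : ℝ) * P) (s' : ℤˣ) :
    ((s' : ℤ) : ℝ) * P < 0 ↔ s' = -s := by
  rcases Int.units_eq_one_or s with rfl | rfl <;> rcases Int.units_eq_one_or s' with rfl | rfl <;>
    simp at hs ⊢ <;> first | exact hs | exact hs.le

section Zigzag

variable {n : ℕ}
  {M : Type*} [TopologicalSpace M] [ChartedSpace (Euc n) M] [IsManifold (𝓡 n) ∞ M]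
  {N : Type*} [TopologicalSpace N] [ChartedSpace (Euc (n + 1)) N] [IsManifold (𝓡 (n + 1)) ∞ N]
  {g : RiemMetric (n + 1) N} {f : M → N} {A : Set (OpenPartialHomeomorph M (Euc n))}
  {A' : Set (OpenPartialHomeomorph N (Euc (n + 1)))}
  {hA : IsOrientedAtlas n A} {hA' : IsOrientedAtlas (n + 1) A'} {hf : IsAFront g f} {o : M}
  {c : ℝ → M} {ℓ : ℝ → ℤ}

theorem IsUnitNormalAlong.exists_smul_eq {T : Type*} [TopologicalSpace T] {γ : T → M} {s : Set T}
    (hf : IsAFront g f) (hγ : Continuous γ) (hs : IsPreconnected s)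
    {ν ν' : ∀ t, TangentSpace (𝓡 (n + 1)) (f (γ t))} (h : IsUnitNormalAlong g f γ s ν)
    (h' : IsUnitNormalAlong g f γ s ν') :
    ∃ σ : ℤˣ, ∀ t ∈ s, ν t = ((σ : ℤ) : ℝ) • ν' t := by
  rcases s.eq_empty_or_nonempty with rfl | ⟨t₀, ht₀⟩
  · exact ⟨1, fun t ht => ht.elim⟩
  have : PreconnectedSpace s := isPreconnected_iff_preconnectedSpace.1 hs
  have hm : MapsTo (Subtype.val : s → T) univ s := fun t _ => t.2
  have h1 := h.comp continuous_subtype_val hm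
  have h2 := h'.comp continuous_subtype_val hm
  have hγ' : Continuous fun t : s => γ t := hγ.comp continuous_subtype_val
  rcases (h'.2 t₀ ht₀).eq_or_eq_neg hf (h.2 t₀ ht₀) with h3 | h3
  · refine ⟨1, fun t ht => ?_⟩
    have := congrFun (h1.eq_of_eq hf hγ' h2 (t := ⟨t₀, ht₀⟩) h3) ⟨t, ht⟩
    simpa using this
  · refine ⟨-1, fun t ht => ?_⟩
    have := congrFun (h1.eq_of_eq hf hγ' (h2.neg hf hγ') (t := ⟨t₀, ht₀⟩) h3) ⟨t, ht⟩
    simpa using this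

theorem IsUnitNormalAlong.smul {T : Type*} [TopologicalSpace T] {γ : T → M} {s : Set T}
    (hf : IsAFront g f) (hγ : Continuous γ) {ν : ∀ t, TangentSpace (𝓡 (n + 1)) (f (γ t))}
    (h : IsUnitNormalAlong g f γ s ν) (σ : ℤˣ) :
    IsUnitNormalAlong g f γ s fun t => ((σ : ℤ) : ℝ) • ν t := by
  rcases Int.units_eq_one_or σ with rfl | rfl
  · simpa using h
  · simpa using h.neg hf hγ

/-- A subdivision of `[0, 1]` at the singular parameters of a curve. -/
def IsSingularSubdivision (f : M → N) (c : ℝ → M) (m : ℕ) (τ : ℕ → ℝ) : Prop :=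
  (τ 0 = 0 ∧ τ (m + 1) = 1 ∧ ∀ j ≤ m, τ j < τ (j + 1)) ∧
    ∀ t ∈ Icc (0 : ℝ) 1, c t ∈ singularSet n f ↔ ∃ j, 1 ≤ j ∧ j ≤ m ∧ t = τ j

theorem IsNullLoop.exists_singularSubdivision (hc : IsNullLoop n f o c)
    (ho : o ∉ singularSet n f) : ∃ m τ, IsSingularSubdivision (n := n) f c m τ := by
  set S := hc.finite.toFinset with hS
  have hc1 : c 1 = o := by simpa [hc.base] using hc.periodic 0
  have hmem : ∀ t, t ∈ S ↔ t ∈ Icc (0 : ℝ) 1 ∧ c t ∈ singularSet n f := fun t => by simp [hS]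
  -- The base point is regular, so the ends of the interval are no singular parameters.
  have h01 : ∀ t ∈ S, 0 < t ∧ t < 1 := by
    intro t ht
    obtain ⟨⟨h0, h1⟩, h2⟩ := (hmem t).1 ht
    refine ⟨h0.lt_of_ne ?_, h1.lt_of_ne ?_⟩
    · rintro rfl; rw [hc.base] at h2; exact ho h2
    · rintro rfl; rw [hc1] at h2; exact ho h2
  let e := S.orderEmbOfFin rfl
  -- The increasing enumeration of the singular parameters, shifted by one to make room for `τ 0 =
  -- 0`, and with value `1` after the last of them.
  let τ : ℕ → ℝ := fun j => if j = 0 then 0 else if h : j - 1 < S.card then e ⟨j - 1, h⟩ else 1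
  have hτ : ∀ j (h : j < S.card), τ (j + 1) = e ⟨j, h⟩ := fun j h => by simp [τ, h]
  refine ⟨S.card, τ, ⟨by simp [τ], by simp [τ], fun j hj => ?_⟩, fun t ht => ⟨fun hts => ?_, ?_⟩⟩
  · rcases j with _ | j
    · by_cases h : 0 < S.card
      · rw [hτ 0 h]; simpa [τ] using (h01 _ (S.orderEmbOfFin_mem rfl ⟨0, h⟩)).1
      · simp [τ, h]
    · rw [hτ j hj]
      by_cases h : j + 1 < S.card
      · rw [hτ _ h]; exact e.strictMono (by simp)
      · have : τ (j + 1 + 1) = 1 := by simp [τ, h]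
        rw [this]; exact (h01 _ (S.orderEmbOfFin_mem rfl ⟨j, hj⟩)).2
  · have h1 : t ∈ (S : Set ℝ) := (hmem t).2 ⟨ht, hts⟩
    rw [← S.range_orderEmbOfFin rfl] at h1
    obtain ⟨i, rfl⟩ := h1
    exact ⟨i + 1, by omega, i.2, (hτ i i.2).symm⟩
  · rintro ⟨j, h1, h2, rfl⟩
    obtain ⟨j, rfl⟩ := Nat.exists_eq_add_of_le' h1
    rw [hτ j h2]
    exact ((hmem _).1 (S.orderEmbOfFin_mem rfl ⟨j, h2⟩)).2

theorem IsSingularSubdivision.lt {m : ℕ} {τ : ℕ → ℝ} (h : IsSingularSubdivision (n := n) f c m τ)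
    {i j : ℕ} (hij : i < j) (hj : j ≤ m + 1) : τ i < τ j := by
  induction j, hij using Nat.le_induction with
  | base => exact h.1.2.2 i (by omega)
  | succ j hij ih => exact (ih (by omega)).trans (h.1.2.2 j (by omega))

theorem IsSingularSubdivision.regular {m : ℕ} {τ : ℕ → ℝ}
    (h : IsSingularSubdivision (n := n) f c m τ) {j : ℕ} (hj : j ≤ m) {t : ℝ}
    (ht : t ∈ Ioo (τ j) (τ (j + 1))) : c t ∉ singularSet n f := by
  have h0 : 0 ≤ τ j := by
    rcases Nat.eq_zero_or_pos j with rfl | hj'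
    · exact h.1.1.ge
    · exact h.1.1 ▸ (h.lt hj' (by omega)).le
  have h1 : τ (j + 1) ≤ 1 := by
    rcases hj.eq_or_lt with rfl | hj'
    · exact h.1.2.1.le
    · exact h.1.2.1 ▸ (h.lt (i := j + 1) (j := m + 1) (by omega) le_rfl).le
  rw [h.2 t ⟨h0.trans ht.1.le, ht.2.le.trans h1⟩]
  rintro ⟨i, hi1, him, rfl⟩
  rcases lt_trichotomy i j with h2 | rfl | h2
  · exact (h.lt h2 (by omega)).not_gt ht.1
  · exact ht.1.false
  · rcases (Nat.succ_le_of_lt h2).eq_or_lt with h3 | h3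
    · rw [← h3] at ht; exact ht.2.false
    · exact (h.lt h3 (by omega)).not_gt ht.2

theorem IsSingularSubdivision.mem_singularSet {m : ℕ} {τ : ℕ → ℝ}
    (h : IsSingularSubdivision (n := n) f c m τ) {j : ℕ} (hj1 : 1 ≤ j) (hj : j ≤ m) :
    c (τ j) ∈ singularSet n f := by
  refine (h.2 _ ⟨?_, ?_⟩).2 ⟨j, hj1, hj, rfl⟩
  · exact h.1.1 ▸ (h.lt hj1 (by omega)).le
  · exact h.1.2.1 ▸ (h.lt (i := j) (j := m + 1) (by omega) le_rfl).le

/-- The heights between the singular parameters of a null loop and the signs of the crossings. -/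
theorem IsHeightLift.exists_signs (hn : 0 < n) (hc : IsNullLoop n f o c)
    (ho : o ∉ singularSet n f) (hℓ : IsHeightLift hA hA' hf c ℓ) (hr : Even (ℓ 1 - ℓ 0)) {m : ℕ}
    {τ : ℕ → ℝ} (h : IsSingularSubdivision (n := n) f c m τ) :
    ∃ s : ℕ → ℤˣ, s 0 = 1 ∧
      (∑ j ∈ Finset.range m, (s (j + 1) : ℤ) = ℓ 1 - ℓ 0) ∧
      ∀ j, 1 ≤ j → j ≤ m → (∀ σ : ℤˣ, IsInwardNear f c
          (fun t => ((σ : ℤ) : ℝ) • heightNormal hA hA' hf (c t) (ℓ t)) (τ j) (𝓝[>] (τ j)) ↔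
            σ = s j) ∧
        ∀ σ : ℤˣ, IsInwardNear f c
          (fun t => ((σ : ℤ) : ℝ) • heightNormal hA hA' hf (c t) (ℓ t)) (τ j) (𝓝[<] (τ j)) ↔
            σ = - s j := by
  set ht : ℝ → ℤ := fun t => height hA hA' hf (c t) (ℓ t) with hht
  -- The height on the open `j`-th interval, where it is constant; the midpoint is merely a sample.
  let K : ℕ → ℤ := fun j => ht ((τ j + τ (j + 1)) / 2)
  have hK : ∀ j ≤ m, ∀ t ∈ Ioo (τ j) (τ (j + 1)), ht t = K j := by
    intro j hj t ht'
    have := h.1.2.2 j hj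
    exact hℓ.height_eq_of_forall isPreconnected_Ioo (fun r hr => h.regular hj hr) ht'
      ⟨by linarith, by linarith⟩
  have hcross : ∀ j, j < m → ∃ s : ℤˣ, K (j + 1) = K j + s ∧
      (∀ σ : ℤˣ, IsInwardNear f c (fun t => ((σ : ℤ) : ℝ) • heightNormal hA hA' hf (c t) (ℓ t))
          (τ (j + 1)) (𝓝[>] (τ (j + 1))) ↔ σ = s) ∧
        ∀ σ : ℤˣ, IsInwardNear f c
          (fun t => ((σ : ℤ) : ℝ) • heightNormal hA hA' hf (c t) (ℓ t)) (τ (j + 1))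
            (𝓝[<] (τ (j + 1))) ↔ σ = - s := by
    intro j hj
    have hS := h.mem_singularSet (j := j + 1) (by omega) hj
    obtain ⟨P, b, hP, -, -, hev, hin, hin'⟩ := hℓ.exists_crossing hn hc.contMDiff hS
      (hc.regular _) (hc.null _ hS) (hc.isA2 _ hS) (hc.contMDiffAt _ hS)
    obtain ⟨s, hs⟩ := exists_units_mul_pos hP
    have hlt1 := h.1.2.2 j hj.le
    have hlt2 := h.1.2.2 (j + 1) hj
    have hgt : 𝓝[>] (τ (j + 1)) ≤ 𝓝[≠] (τ (j + 1)) := nhdsWithin_mono _ fun s hs => ne_of_gt hs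
    have hlt : 𝓝[<] (τ (j + 1)) ≤ 𝓝[≠] (τ (j + 1)) := nhdsWithin_mono _ fun s hs => ne_of_lt hs
    obtain ⟨r, hr1, hr2⟩ := ((hev.filter_mono hgt).and (Ioo_mem_nhdsGT hlt2)).exists
    obtain ⟨r', hr1', hr2'⟩ := ((hev.filter_mono hlt).and (Ioo_mem_nhdsLT hlt1)).exists
    have e1 := (hK (j + 1) hj r hr2).symm.trans hr1.2
    have e2 := (hK j hj.le r' hr2').symm.trans hr1'.2
    have e3 : 0 < r - τ (j + 1) := sub_pos.2 hr2.1
    have e4 : r' - τ (j + 1) < 0 := sub_neg.2 hr2'.2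
    refine ⟨s, ?_, fun σ => ?_, fun σ => ?_⟩
    · rw [e1, e2]
      rcases Int.units_eq_one_or s with rfl | rfl
      · have hP' : 0 < P := by simpa using hs
        simp [mul_pos e3 hP', (mul_neg_of_neg_of_pos e4 hP').not_gt]
      · have hP' : P < 0 := by simpa using hs
        simp [mul_pos_of_neg_of_neg e4 hP', (mul_neg_of_pos_of_neg e3 hP').not_gt]
    · rw [hin]
      have := units_mul_neg_iff hs (-σ)
      rw [neg_inj] at this
      rw [← this]
      push_cast
      rw [neg_mul, neg_lt_zero]
    · rw [hin', units_mul_neg_iff hs]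
  choose! s hs using hcross
  have hsum : ∀ k ≤ m, ∑ j ∈ Finset.range k, (s j : ℤ) = K k - K 0 := by
    intro k hk
    induction k with
    | zero => simp
    | succ k ih => rw [Finset.sum_range_succ, ih (by omega), (hs k hk).1]; ring
  have hc1 : c 1 = o := by simpa [hc.base] using hc.periodic 0
  have hreg0 : ∀ t ∈ Icc (τ 0) (τ (0 + 1)), t ≠ τ (0 + 1) → c t ∉ singularSet n f := by
    intro t ht1 ht2
    rcases ht1.1.eq_or_lt with h1 | h1
    · rw [← h1, h.1.1, hc.base]; exact ho
    · exact h.regular (Nat.zero_le m) ⟨h1, ht1.2.lt_of_ne ht2⟩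
  have hK0 : K 0 = ht 0 := by
    have h1 := h.1.2.2 0 (Nat.zero_le m)
    rw [← h.1.1]
    exact hℓ.height_eq_of_forall (s := Ico (τ 0) (τ (0 + 1))) isPreconnected_Ico
      (fun r hr => hreg0 r ⟨hr.1, hr.2.le⟩ hr.2.ne) ⟨by linarith, by linarith⟩ ⟨le_rfl, h1⟩
  have hKm : K m = ht 1 := by
    have h1 := h.1.2.2 m le_rfl
    rw [← h.1.2.1]
    refine hℓ.height_eq_of_forall (s := Ioc (τ m) (τ (m + 1))) isPreconnected_Ioc
      (fun r hr => ?_) ⟨by linarith, by linarith⟩ ⟨h1, le_rfl⟩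
    rcases hr.2.eq_or_lt with h2 | h2
    · rw [h2, h.1.2.1, hc1]; exact ho
    · exact h.regular le_rfl ⟨hr.1, h2⟩
  -- Index `0` stands for the initial normal, whose sign relative to the lift is `1`. The jumps
  -- telescope to the difference of the heights at the two ends; both lie over `o`, so that
  -- difference is `ℓ 1 - ℓ 0`.
  refine ⟨fun j => if j = 0 then 1 else s (j - 1), by simp, ?_, fun j hj1 hjm => ?_⟩
  · simp only [Nat.add_eq_zero_iff, one_ne_zero, and_false, if_false, Nat.add_sub_cancel]
    rw [hsum m le_rfl, hKm, hK0, hht]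
    beta_reduce
    rw [hc1, hc.base, show ℓ 1 = ℓ 0 + (ℓ 1 - ℓ 0) by ring, height_add_even _ _ hr]
    ring
  · obtain ⟨j, rfl⟩ := Nat.exists_eq_add_of_le' hj1
    simpa using (hs j hjm).2

theorem heightNormal_eq_of_even (hr : Even (ℓ 1 - ℓ 0)) :
    heightNormal hA hA' hf o (ℓ 1) = heightNormal hA hA' hf o (ℓ 0) := by
  rcases heightNormal_eq_or (hA := hA) (hA' := hA') (hf := hf) o (ℓ 1) (ℓ 0) with ⟨-, h⟩ | ⟨h, -⟩
  · exact h
  · exact absurd hr h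

theorem heightNormal_ne_neg (q : M) (m : ℤ) :
    heightNormal hA hA' hf q m ≠ -heightNormal hA hA' hf q m := by
  intro h
  have h1 := (isUnitNormalAt_heightNormal (hA := hA) (hA' := hA') (hf := hf) q m).inner_self
  have h2 : heightNormal hA hA' hf q m = 0 :=
    (eq_neg_self_iff_eq_zero (v := (heightNormal hA hA' hf q m : Euc (n + 1)))).1 h
  rw [h2] at h1
  simp at h1

theorem totalSpace_mk_heightNormal (hc : IsNullLoop n f o c) (hr : Even (ℓ 1 - ℓ 0)) (σ : ℤˣ) :
    (⟨f (c 1), ((σ : ℤ) : ℝ) • heightNormal hA hA' hf (c 1) (ℓ 1)⟩ : TangentBundle (𝓡 (n + 1)) N) =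
      ⟨f o, ((σ : ℤ) : ℝ) • heightNormal hA hA' hf o (ℓ 0)⟩ := by
  have hc1 : c 1 = o := by simpa [hc.base] using hc.periodic 0
  rw [hc1, heightNormal_eq_of_even hr]

theorem totalSpace_mk_heightNormal_zero (hc : IsNullLoop n f o c) (σ : ℤˣ) :
    (⟨f (c 0), ((σ : ℤ) : ℝ) • heightNormal hA hA' hf (c 0) (ℓ 0)⟩ : TangentBundle (𝓡 (n + 1)) N) =
      ⟨f o, ((σ : ℤ) : ℝ) • heightNormal hA hA' hf o (ℓ 0)⟩ := by
  rw [hc.base]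

theorem smul_heightNormal_inj {q : M} {m : ℤ} {σ σ' : ℤˣ}
    (h : ((σ : ℤ) : ℝ) • heightNormal hA hA' hf q m = ((σ' : ℤ) : ℝ) • heightNormal hA hA' hf q m) :
    σ = σ' := by
  have h1 := heightNormal_ne_neg (hA := hA) (hA' := hA') (hf := hf) q m
  rcases Int.units_eq_one_or σ with rfl | rfl <;> rcases Int.units_eq_one_or σ' with rfl | rfl
  · rfl
  · exact absurd (by simpa using h) h1
  · exact absurd (by simpa using h.symm) h1
  · rfl

/-- On the `j`-th interval the chosen field is `s j` times the normal of the lift, where `s j` is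
the jump of the height at its left end. The rules for the signs amount to `s j * ε j = (-1) ^ j`, so
the alternating sum of all signs is `1 + ∑ s (j + 1) - 1`, the increase of the height. -/
theorem IsHeightLift.count_signSequence (hn : 0 < n) (hc : IsNullLoop n f o c)
    (ho : o ∉ singularSet n f) (hℓ : IsHeightLift hA hA' hf c ℓ) (hr : Even (ℓ 1 - ℓ 0)) {m : ℕ}
    {ε : ℕ → ℤˣ} (h : IsSignSequence g f (heightNormal hA hA' hf o (ℓ 0)) c m ε) :
    (normalize ((List.range (m + 2)).map ε)).count (-1) = (-((ℓ 1 - ℓ 0) / 2)).natAbs := by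
  obtain ⟨τ, μ, hτ, hsing, hμ, hμ0, hin, hε0, hε, hend⟩ := h
  have hsub : IsSingularSubdivision (n := n) f c m τ := ⟨hτ, hsing⟩
  obtain ⟨s, hs0, hsum, hs⟩ := hℓ.exists_signs hn hc ho hr hsub
  have hσ : ∀ j ≤ m, ∃ σ : ℤˣ, ∀ t ∈ Icc (τ j) (τ (j + 1)),
      μ j t = ((σ : ℤ) : ℝ) • heightNormal hA hA' hf (c t) (ℓ t) := fun j hj =>
    (hμ j hj).exists_smul_eq hf hc.contMDiff.continuous isPreconnected_Icc
      ⟨hℓ.isUnitNormalAlong.1.mono (subset_univ _), fun t _ => hℓ.isUnitNormalAlong.2 t (mem_univ t)⟩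
  choose! σ hσ using hσ
  have hσs : ∀ j ≤ m, σ j = s j := by
    intro j hj
    rcases Nat.eq_zero_or_pos j with rfl | hj'
    · rw [hs0]
      have h1 := hσ 0 hj 0 ⟨hτ.1.le, by
        have h1 := hτ.2.2 0 hj
        rw [hτ.1] at h1
        exact h1.le⟩
      rw [h1, totalSpace_mk_heightNormal_zero hc] at hμ0
      have h2 := eq_of_heq (Bundle.TotalSpace.mk.inj hμ0).2
      exact smul_heightNormal_inj (hA := hA) (hA' := hA') (hf := hf) (σ' := 1) (by simpa using h2)
    · refine ((hs j hj' hj).1 (σ j)).1 ((hin j hj' hj).congr ?_)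
      filter_upwards [Ioo_mem_nhdsGT (hτ.2.2 j hj)] with t ht
      exact hσ j hj t (Ioo_subset_Icc_self ht)
  -- Just before `τ (j + 1)` the inward multiple of the normal is `-s (j + 1)`. So `ε` stays the
  -- same exactly if `s` changes.
  have hstep : ∀ j < m, s (j + 1) * ε (j + 1) = -(s j * ε j) := by
    intro j hj
    have hleft : ∀ᶠ t in 𝓝[<] (τ (j + 1)), μ j t =
        ((s j : ℤ) : ℝ) • heightNormal hA hA' hf (c t) (ℓ t) := by
      filter_upwards [Ioo_mem_nhdsLT (hτ.2.2 j hj.le)] with t ht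
      rw [← hσs j hj.le]
      exact hσ j hj.le t (Ioo_subset_Icc_self ht)
    rcases hε j hj with ⟨h1, h2⟩ | ⟨h1, h2⟩
    · have h3 := ((hs (j + 1) (by omega) hj).2 (s j)).1 (h1.congr hleft)
      rw [h2, h3]; simp
    · have h3 := ((hs (j + 1) (by omega) hj).2 (-s j)).1 (h1.congr (hleft.mono fun t ht => by
        rw [ht]; push_cast; rw [neg_smul]))
      rw [h2, neg_inj.1 h3]; simp
  have hprod : ∀ j ≤ m, s j * ε j = (-1) ^ j := by
    intro j hj
    induction j with
    | zero => simp [hs0, hε0]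
    | succ j ih => rw [hstep j hj, ih (by omega), pow_succ]; simp
  -- The last field ends with `s m` times the given normal, so the closing rule multiplies `ε m` by
  -- `s m`.
  have hlast : ε (m + 1) = (-1) ^ m := by
    rw [← hprod m le_rfl]
    have h1 := hσ m le_rfl 1 ⟨hτ.2.1 ▸ (hτ.2.2 m le_rfl).le, hτ.2.1.ge⟩
    rw [h1, totalSpace_mk_heightNormal hc hr, hσs m le_rfl] at hend
    rcases hend with ⟨h2, h3⟩ | ⟨h2, h3⟩
    · have h4 := eq_of_heq (Bundle.TotalSpace.mk.inj h2).2
      have h5 := smul_heightNormal_inj (hA := hA) (hA' := hA') (hf := hf) (σ := s m) (σ' := 1)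
        (by simpa using h4)
      rw [h3, h5, one_mul]
    · have h4 := eq_of_heq (Bundle.TotalSpace.mk.inj h2).2
      have h5 := smul_heightNormal_inj (hA := hA) (hA' := hA') (hf := hf) (σ := s m) (σ' := -1)
        (by simpa using h4)
      rw [h3, h5, neg_one_mul]
  have hεs : ∀ j ≤ m, (-1) ^ j * (ε j : ℤ) = s j := by
    intro j hj
    have h1 : (((s j * ε j : ℤˣ)) : ℤ) = (-1) ^ j := by rw [hprod j hj]; push_cast; rfl
    rw [← h1, Units.val_mul, mul_assoc, Int.units_coe_mul_self, mul_one]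
  obtain ⟨r, hr'⟩ := hr
  have hval : altSum ((List.range (m + 2)).map ε) = 2 * r := by
    rw [altSum_map_range, Finset.sum_range_succ, Finset.sum_range_succ', hlast,
      Finset.sum_congr rfl fun j hj => hεs (j + 1) (by simpa using hj), hsum, hε0, hr']
    have : ((-1 : ℤ)) ^ (m + 1) * (((-1) ^ m : ℤˣ) : ℤ) = -1 := by
      push_cast
      rw [← pow_add, show m + 1 + m = 2 * m + 1 by ring, pow_succ, pow_mul]; simp
    rw [this]; simp; ring
  rw [count_normalize _ hval, hr', show (r + r) / 2 = r by omega, Int.natAbs_neg]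

theorem IsHeightLift.exists_isSignSequence (hn : 0 < n) (hc : IsNullLoop n f o c)
    (ho : o ∉ singularSet n f) (hℓ : IsHeightLift hA hA' hf c ℓ) (hr : Even (ℓ 1 - ℓ 0)) :
    ∃ m ε, IsSignSequence g f (heightNormal hA hA' hf o (ℓ 0)) c m ε := by
  obtain ⟨m, τ, hsub⟩ := hc.exists_singularSubdivision ho
  obtain ⟨s, hs0, -, hs⟩ := hℓ.exists_signs hn hc ho hr hsub
  have hor : ∀ σ σ' : ℤˣ, σ = -σ' ∨ -σ = -σ' := by
    intro σ σ'
    rcases Int.units_eq_one_or σ with rfl | rfl <;> rcases Int.units_eq_one_or σ' with rfl | rfl <;>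
      simp
  -- These are the only signs compatible with the rules.
  refine ⟨m, fun j => if j = m + 1 then (-1) ^ m else (-1) ^ j * s j, τ,
    fun j t => ((s j : ℤ) : ℝ) • heightNormal hA hA' hf (c t) (ℓ t), hsub.1, hsub.2, fun j hj => ?_,
    ?_, fun j h1 h2 => ((hs j h1 h2).1 _).2 rfl, by simp [hs0], fun j hj => ?_, ?_⟩
  · exact IsUnitNormalAlong.smul hf hc.contMDiff.continuous
      ⟨hℓ.isUnitNormalAlong.1.mono (subset_univ _), fun t _ => hℓ.isUnitNormalAlong.2 t (mem_univ t)⟩ _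
  · rw [totalSpace_mk_heightNormal_zero hc, hs0]; simp
  · have e1 : j + 1 ≠ m + 1 := by omega
    have e2 : j ≠ m + 1 := by omega
    simp only [e1, e2, if_false]
    rcases hor (s j) (s (j + 1)) with h | h
    · refine Or.inl ⟨((hs (j + 1) (by omega) hj).2 _).2 h, ?_⟩
      rw [h, pow_succ]; simp
    · refine Or.inr ⟨?_, ?_⟩
      · have := ((hs (j + 1) (by omega) hj).2 _).2 h
        refine this.congr (Eventually.of_forall fun t => ?_)
        push_cast; rw [neg_smul]
      · rw [neg_inj.1 h, pow_succ]; simp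
  · rw [totalSpace_mk_heightNormal hc hr]
    have e2 : m ≠ m + 1 := by omega
    simp only [e2, if_false, if_true]
    rcases Int.units_eq_one_or (s m) with h | h
    · left; rw [h]; simp
    · right; rw [h]; simp

theorem IsHeightLift.hasZigzagNumber_iff (hn : 0 < n) (hc : IsNullLoop n f o c)
    (ho : o ∉ singularSet n f) (hℓ : IsHeightLift hA hA' hf c ℓ) (hr : Even (ℓ 1 - ℓ 0)) (z : ℕ) :
    HasZigzagNumber g f (heightNormal hA hA' hf o (ℓ 0)) c z ↔
      z = (-((ℓ 1 - ℓ 0) / 2)).natAbs := by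
  constructor
  · rintro ⟨m, ε, h, rfl⟩
    exact hℓ.count_signSequence hn hc ho hr h
  · rintro rfl
    obtain ⟨m, ε, h⟩ := hℓ.exists_isSignSequence hn hc ho hr
    exact ⟨m, ε, h, (hℓ.count_signSequence hn hc ho hr h).symm⟩

end Zigzag

/-! ### Homotopies of paths -/

section Homotopy

variable {X : Type*} [TopologicalSpace X]

open Path

/-- The image under `C` of the straight-line homotopy in `W`. It serves for charts with convex
target as well as for reparametrizations of a curve on an interval. -/
theorem homotopic_of_convex {E : Type*} [AddCommGroup E] [Module ℝ E] [TopologicalSpace E]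
    [ContinuousAdd E] [ContinuousSMul ℝ E] {W : Set E} (hW : Convex ℝ W) {C : E → X}
    (hC : ContinuousOn C W) {x y : X} {γ γ' : Path x y} {φ φ' : unitInterval → E}
    (hφ : Continuous φ) (hφ' : Continuous φ') (hφW : ∀ t, φ t ∈ W) (hφW' : ∀ t, φ' t ∈ W)
    (h0 : φ 0 = φ' 0) (h1 : φ 1 = φ' 1) (hγ : ∀ t, γ t = C (φ t)) (hγ' : ∀ t, γ' t = C (φ' t)) :
    γ.Homotopic γ' := by
  have hmem : ∀ p : unitInterval × unitInterval,
      (1 - (p.1 : ℝ)) • φ p.2 + (p.1 : ℝ) • φ' p.2 ∈ W := fun p =>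
    hW (hφW _) (hφW' _) (sub_nonneg.2 p.1.2.2) p.1.2.1 (by ring)
  refine ⟨{ toFun := fun p => C ((1 - (p.1 : ℝ)) • φ p.2 + (p.1 : ℝ) • φ' p.2)
            continuous_toFun := hC.comp_continuous (by fun_prop) hmem
            map_zero_left := fun t => by simp [hγ]
            map_one_left := fun t => by simp [hγ']
            prop' := ?_ }⟩
  rintro s t (rfl | rfl)
  · change C ((1 - (s : ℝ)) • φ 0 + (s : ℝ) • φ' 0) = γ 0
    rw [← h0, ← add_smul, sub_add_cancel, one_smul, hγ]
  · change C ((1 - (s : ℝ)) • φ 1 + (s : ℝ) • φ' 1) = γ 1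
    rw [← h1, ← add_smul, sub_add_cancel, one_smul, hγ]

/-- Paths in the source of a chart with convex target are determined up to homotopy by their
endpoints. -/
theorem homotopic_of_chart {E : Type*} [AddCommGroup E] [Module ℝ E] [TopologicalSpace E]
    [ContinuousAdd E] [ContinuousSMul ℝ E] {e : OpenPartialHomeomorph X E}
    (he : Convex ℝ e.target) {x y : X} {γ γ' : Path x y} (hγ : range γ ⊆ e.source)
    (hγ' : range γ' ⊆ e.source) : γ.Homotopic γ' := by
  have h1 : ∀ t, γ t ∈ e.source := fun t => hγ (mem_range_self t)
  have h2 : ∀ t, γ' t ∈ e.source := fun t => hγ' (mem_range_self t)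
  refine homotopic_of_convex he e.continuousOn_symm (φ := fun t => e (γ t))
    (φ' := fun t => e (γ' t)) (e.continuousOn.comp_continuous γ.continuous h1)
    (e.continuousOn.comp_continuous γ'.continuous h2) (fun t => e.map_source (h1 t))
    (fun t => e.map_source (h2 t)) (by simp) (by simp) (fun t => (e.left_inv (h1 t)).symm)
    fun t => (e.left_inv (h2 t)).symm

/-- The initial part of a path. -/
def initialPath {p q : X} (γ : Path p q) (s : unitInterval) : Path p (γ s) :=
  (γ.subpath 0 s).cast γ.source.symm rfl

theorem initialPath_of_eq_zero {p q : X} (γ : Path p q) {s : unitInterval} (hs : s = 0)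
    (x : unitInterval) : initialPath γ s x = p := by
  subst hs
  simp [initialPath]

theorem initialPath_of_eq_one {p q : X} (γ : Path p q) {s : unitInterval} (hs : s = 1)
    (x : unitInterval) : initialPath γ s x = γ x := by
  subst hs
  simp [initialPath]

theorem trans_trans_symm_trans {p q r r' s : X} (a : Homotopic.Quotient p q)
    (b : Homotopic.Quotient q r) (k : Homotopic.Quotient r r') (d : Homotopic.Quotient r s) :
    (a.trans (b.trans k)).trans (k.symm.trans d) = (a.trans b).trans d := by
  simp only [Homotopic.Quotient.trans_assoc]
  rw [← Homotopic.Quotient.trans_assoc k, Homotopic.Quotient.trans_symm,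
    Homotopic.Quotient.refl_trans]

theorem mk_initialPath_trans {p q : X} (γ : Path p q) (s s' : unitInterval) :
    (Homotopic.Quotient.mk (initialPath γ s)).trans (Homotopic.Quotient.mk (γ.subpath s s')) =
      Homotopic.Quotient.mk (initialPath γ s') :=
  Homotopic.Quotient.eq.2 ⟨(Path.Homotopy.subpathTransSubpath γ 0 s s').pathCast γ.source.symm rfl⟩

/-- A path with endpoints in a dense set `G` decomposes into paths with endpoints in `G`, each of
which runs in a member of a given open cover. -/
theorem path_induction [LocallyPathConnectedSpace X] {G : Set X} (hG : Dense G) {𝒰 : Set (Set X)}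
    (hopen : ∀ U ∈ 𝒰, IsOpen U) (hcov : ∀ x, ∃ U ∈ 𝒰, x ∈ U) {p : X} (hp : p ∈ G)
    (Q : ∀ {q : X}, Path.Homotopic.Quotient p q → Prop) (h0 : Q (Homotopic.Quotient.refl p))
    (hstep : ∀ {q r : X} (z : Path.Homotopic.Quotient p q) (σ : Path q r), q ∈ G → r ∈ G → Q z →
      (∃ U ∈ 𝒰, range σ ⊆ U) → Q (z.trans (Homotopic.Quotient.mk σ)))
    {q : X} (hq : q ∈ G) (γ : Path p q) : Q (Homotopic.Quotient.mk γ) := by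
  obtain ⟨t, ht0, htm, ⟨N, hN⟩, htU⟩ := exists_monotone_Icc_subset_open_cover_unitInterval
    (ι := 𝒰) (c := fun U => γ ⁻¹' U.1) (fun U => (hopen _ U.2).preimage γ.continuous)
    (fun s _ => by
      obtain ⟨U, hU, hs⟩ := hcov (γ s)
      exact mem_iUnion.2 ⟨⟨U, hU⟩, hs⟩)
  -- The subdivision points need not lie in `G`. So the induction runs over initial pieces of `γ`
  -- followed by any short path that ends in `G`.
  have key : ∀ k, ∀ r ∈ G, ∀ σ : Path (γ (t k)) r, (∃ U ∈ 𝒰, range σ ⊆ U) →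
      Q ((Homotopic.Quotient.mk (initialPath γ (t k))).trans (Homotopic.Quotient.mk σ)) := by
    intro k
    induction k with
    | zero =>
      intro r hr σ hσ
      have h1 : γ (t 0) = p := by rw [ht0, γ.source]
      have h2 : (Homotopic.Quotient.mk (initialPath γ (t 0))).trans (Homotopic.Quotient.mk σ) =
          (Homotopic.Quotient.refl p).trans (Homotopic.Quotient.mk (σ.cast h1.symm rfl)) := by
        rw [← Homotopic.Quotient.mk_refl, ← Homotopic.Quotient.mk_trans, ← Homotopic.Quotient.mk_trans]
        congr 1
        ext s
        simp only [Path.trans_apply, initialPath_of_eq_zero γ ht0, Path.cast_coe, Path.refl_apply]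
      rw [h2]
      exact hstep _ _ hp hr h0 hσ
    | succ k ih =>
      rintro r hr σ ⟨V, hV, hσV⟩
      obtain ⟨⟨U, hU⟩, hUk⟩ := htU k
      have hsub : range (γ.subpath (t k) (t (k + 1))) ⊆ U := by
        rw [Path.range_subpath_of_le _ _ _ (htm k.le_succ)]
        exact image_subset_iff.2 hUk
      have hmemU : γ (t (k + 1)) ∈ U := hUk ⟨htm k.le_succ, le_rfl⟩
      have hmemV : γ (t (k + 1)) ∈ V := hσV ⟨0, σ.source⟩
      -- A detour `κ` inside `U ∩ V` leads to a point of `G`: the part before it stays in `U`, the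
      -- part after it in `V`, and `κ` cancels against its inverse.
      obtain ⟨W, hW, hWUV⟩ := (pathConnected_subset_basis ((hopen U hU).inter (hopen V hV))
        ⟨hmemU, hmemV⟩).mem_iff.1 (((hopen U hU).inter (hopen V hV)).mem_nhds ⟨hmemU, hmemV⟩)
      obtain ⟨r', hr'W, hr'G⟩ := mem_closure_iff_nhds.1 (hG (γ (t (k + 1)))) W hW.1
      obtain ⟨κ, hκ⟩ := hW.2.1.joinedIn _ (mem_of_mem_nhds hW.1) _ hr'W
      have hκ' : ∀ s, κ s ∈ U ∩ V := fun s => hWUV (hκ s)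
      have h1 := ih r' hr'G ((γ.subpath (t k) (t (k + 1))).trans κ) ⟨U, hU, by
        rw [Path.trans_range]
        exact union_subset hsub (range_subset_iff.2 fun s => (hκ' s).1)⟩
      have h2 := hstep _ (κ.symm.trans σ) hr'G hr h1 ⟨V, hV, by
        rw [Path.trans_range, Path.symm_range]
        exact union_subset (range_subset_iff.2 fun s => (hκ' s).2) hσV⟩
      rw [Homotopic.Quotient.mk_trans, Homotopic.Quotient.mk_trans, Homotopic.Quotient.mk_symm,
        trans_trans_symm_trans, mk_initialPath_trans] at h2
      exact h2
  have hN1 : t N = 1 := hN N le_rfl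
  obtain ⟨U, hU, hqU⟩ := hcov q
  have h1 : q = γ (t N) := by rw [hN1, γ.target]
  have h2 := key N q hq ((Path.refl q).cast h1.symm rfl) ⟨U, hU, by
    rintro _ ⟨s, rfl⟩
    exact hqU⟩
  have h3 : (Homotopic.Quotient.mk (initialPath γ (t N))).trans
      (Homotopic.Quotient.mk ((Path.refl q).cast h1.symm rfl)) = Homotopic.Quotient.mk γ := by
    have h4 : (initialPath γ (t N)).trans ((Path.refl q).cast h1.symm rfl) =
        γ.trans (Path.refl q) := by
      ext s
      simp only [Path.trans_apply, initialPath_of_eq_one γ hN1, Path.cast_coe]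
    rw [← Homotopic.Quotient.mk_trans, h4, Homotopic.Quotient.mk_trans, Homotopic.Quotient.mk_refl, Homotopic.Quotient.trans_refl]
  rwa [h3] at h2

end Homotopy

/-! ### Concatenation of regular curves -/

section Glue

variable {E : Type*} [NormedAddCommGroup E] [NormedSpace ℝ E]

theorem hasDerivAt_ite_le {x y : ℝ → E} {x' : E} {t : ℝ} (hx : HasDerivAt x x' t)
    (hy : HasDerivAt y x' t) (h : x t = y t) :
    HasDerivAt (fun s => if s ≤ t then x s else y s) x' t := by
  have h1 : HasDerivWithinAt (fun s => if s ≤ t then x s else y s) x' (Iic t) t :=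
    hx.hasDerivWithinAt.congr (fun s hs => if_pos hs) (if_pos le_rfl)
  have h2 : HasDerivWithinAt (fun s => if s ≤ t then x s else y s) x' (Ici t) t := by
    refine hy.hasDerivWithinAt.congr (fun s hs => ?_) ?_
    · rcases (mem_Ici.1 hs).eq_or_lt with rfl | hlt
      · simp [h]
      · simp [hlt.not_ge]
    · simp [h]
  simpa using h1.union h2

theorem continuousAt_ite_le {x y : ℝ → E} {t : ℝ} (hx : ContinuousAt x t)
    (hy : ContinuousAt y t) (h : x t = y t) :
    ContinuousAt (fun s => if s ≤ t then x s else y s) t := by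
  rw [continuousAt_iff_continuous_left_right]
  refine ⟨hx.continuousWithinAt.congr (fun s hs => if_pos hs) (if_pos le_rfl),
    hy.continuousWithinAt.congr (fun s hs => ?_) (by simp [h])⟩
  rcases (mem_Ici.1 hs).eq_or_lt with rfl | hlt
  · simp [h]
  · simp [hlt.not_ge]

theorem eventually_ite_le_eq {β : Type*} {x y : ℝ → β} {t s : ℝ} (hs : s ≠ t) :
    (fun r => if r ≤ t then x r else y r) =ᶠ[𝓝 s] if s < t then x else y := by
  rcases hs.lt_or_gt with h | h
  · rw [if_pos h]
    filter_upwards [Iio_mem_nhds h] with r hr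
    exact if_pos (le_of_lt hr)
  · rw [if_neg h.not_gt]
    filter_upwards [Ioi_mem_nhds h] with r hr
    exact if_neg (not_le_of_gt hr)

theorem contDiffAt_ite_le {x y : ℝ → E} {t : ℝ} (hx : ContDiffAt ℝ 1 x t)
    (hy : ContDiffAt ℝ 1 y t) (h : x t = y t) (h' : deriv x t = deriv y t) :
    ContDiffAt ℝ 1 (fun s => if s ≤ t then x s else y s) t := by
  have hd : ∀ {x : ℝ → E}, ContDiffAt ℝ 1 x t → ∀ᶠ s in 𝓝 t, HasDerivAt x (deriv x s) s ∧
      ContinuousAt (deriv x) s := fun hx => by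
    filter_upwards [hx.eventually (by simp)] with s hs
    exact ⟨(hs.differentiableAt one_ne_zero).hasDerivAt, hs.continuousAt_deriv⟩
  have hev : ∀ᶠ s in 𝓝 t, HasDerivAt (fun s => if s ≤ t then x s else y s)
      (if s ≤ t then deriv x s else deriv y s) s ∧
      ContinuousAt (fun s => if s ≤ t then deriv x s else deriv y s) s := by
    filter_upwards [hd hx, hd hy] with s hxs hys
    rcases eq_or_ne s t with rfl | hs
    · rw [if_pos le_rfl]
      exact ⟨hasDerivAt_ite_le hxs.1 (h' ▸ hys.1) h, continuousAt_ite_le hxs.2 hys.2 h'⟩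
    · refine ⟨HasDerivAt.congr_of_eventuallyEq ?_ (eventually_ite_le_eq hs),
        ContinuousAt.congr_of_eventuallyEq ?_ (eventually_ite_le_eq hs)⟩
      · rcases hs.lt_or_gt with h1 | h1
        · simpa only [h1, h1.le, if_true] using hxs.1
        · simpa only [h1.not_gt, h1.not_ge, if_false] using hys.1
      · split_ifs
        exacts [hxs.2, hys.2]
  rw [contDiffAt_one_iff]
  refine ⟨fun s => ContinuousLinearMap.toSpanSingleton ℝ (if s ≤ t then deriv x s else deriv y s),
    _, hev, fun s hs => ?_, fun s hs => hs.1.hasFDerivAt⟩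
  exact ((ContinuousLinearMap.toSpanSingletonCLE (𝕜 := ℝ) (E := E)).continuous.continuousAt.comp
    (f := fun s => if s ≤ t then deriv x s else deriv y s) hs.2).continuousWithinAt

end Glue

/-! ### Null arcs, their concatenation, and closing them up to null loops -/

section NullArcs

variable {n : ℕ}
  {M : Type*} [TopologicalSpace M] [ChartedSpace (Euc n) M] [IsManifold (𝓡 n) ∞ M]
  {N : Type*} [TopologicalSpace N] [ChartedSpace (Euc (n + 1)) N] [IsManifold (𝓡 (n + 1)) ∞ N]
  {g : RiemMetric (n + 1) N} {f : M → N} {c c' c₁ c₂ : ℝ → M} {t : ℝ}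

theorem velocity_congr (h : c =ᶠ[𝓝 t] c') : (velocity n c t : Euc n) = velocity n c' t := by
  have := h.mfderiv_eq (I := 𝓘(ℝ, ℝ)) (I' := 𝓡 n)
  exact congrArg (fun L : ℝ →L[ℝ] Euc n => L 1) this

theorem velocity_comp_affine {a b : ℝ} (h : MDifferentiableAt 𝓘(ℝ, ℝ) (𝓡 n) c (a * t + b)) :
    (velocity n (fun s => c (a * s + b)) t : Euc n) = a • (velocity n c (a * t + b) : Euc n) := by
  have h0 : HasDerivAt (fun s : ℝ => a * s + b) a t := by
    simpa using ((hasDerivAt_id t).const_mul a).add_const b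
  have h1 : HasMFDerivAt 𝓘(ℝ, ℝ) 𝓘(ℝ, ℝ) (fun s : ℝ => a * s + b) t
    (ContinuousLinearMap.toSpanSingleton ℝ a) := h0.hasFDerivAt.hasMFDerivAt
  have h2 := (HasMFDerivAt.comp t (g := c) (f := fun s : ℝ => a * s + b) h.hasMFDerivAt h1).mfderiv
  have h3 := congrArg (fun L : ℝ →L[ℝ] Euc n => L 1) h2
  refine h3.trans ?_
  let L : ℝ →L[ℝ] Euc n := mfderiv 𝓘(ℝ, ℝ) (𝓡 n) c (a * t + b)
  have h4 : L ((1 : ℝ) • a) = a • L 1 := by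
    rw [smul_eq_mul, one_mul, ← map_smul, smul_eq_mul, mul_one]
  exact h4

theorem contMDiffAt_chart_symm {e : OpenPartialHomeomorph M (Euc n)} {r : ℕ∞ω} (hr : r ≤ ∞)
    (he : e ∈ IsManifold.maximalAtlas (𝓡 n) ∞ M) {X : ℝ → Euc n} (hX : ContDiffAt ℝ r X t)
    (ht : X t ∈ e.target) : ContMDiffAt 𝓘(ℝ, ℝ) (𝓡 n) r (fun s => e.symm (X s)) t := by
  have h1 := ((contMDiffOn_symm_of_mem_maximalAtlas he).contMDiffAt
    (e.open_target.mem_nhds ht)).of_le hr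
  exact ContMDiffAt.comp (g := e.symm) (f := X) t h1 hX.contMDiffAt

theorem chartDeriv_velocity_symm {e : OpenPartialHomeomorph M (Euc n)}
    (he : e ∈ IsManifold.maximalAtlas (𝓡 n) ∞ M) {X : ℝ → Euc n} (hX : ContDiffAt ℝ 1 X t)
    (ht : X t ∈ e.target) :
    chartDeriv e (e.symm (X t)) (velocity n (fun s => e.symm (X s)) t) = deriv X t := by
  have h1 := contMDiffAt_chart_symm (by norm_cast) he hX ht
  have h2 := hasDerivAt_chart he (c := fun s => e.symm (X s)) (e.map_target ht)
    (h1.mdifferentiableAt one_ne_zero)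
  have h3 : X =ᶠ[𝓝 t] fun s => e (e.symm (X s)) := by
    filter_upwards [hX.continuousAt.eventually (e.open_target.eventually_mem ht)] with s hs
    exact (e.right_inv hs).symm
  exact (h2.congr_of_eventuallyEq h3).deriv.symm

theorem contMDiffAt_ite_le (h₁ : ContMDiffAt 𝓘(ℝ, ℝ) (𝓡 n) 1 c₁ t)
    (h₂ : ContMDiffAt 𝓘(ℝ, ℝ) (𝓡 n) 1 c₂ t) (h : c₁ t = c₂ t)
    (hv : (velocity n c₁ t : Euc n) = velocity n c₂ t) :
    ContMDiffAt 𝓘(ℝ, ℝ) (𝓡 n) 1 (fun s => if s ≤ t then c₁ s else c₂ s) t ∧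
      (velocity n (fun s => if s ≤ t then c₁ s else c₂ s) t : Euc n) = velocity n c₁ t := by
  set e := chartAt (Euc n) (c₁ t)
  have he : e ∈ IsManifold.maximalAtlas (𝓡 n) ∞ M := IsManifold.chart_mem_maximalAtlas _
  have hm₁ : c₁ t ∈ e.source := mem_chart_source _ _
  have hm₂ : c₂ t ∈ e.source := h ▸ hm₁
  have hd₁ := hasDerivAt_chart he hm₁ (h₁.mdifferentiableAt one_ne_zero)
  have hd₂ := hasDerivAt_chart he hm₂ (h₂.mdifferentiableAt one_ne_zero)
  have haux : ∀ (q q' : M) (v v' : Euc n), q = q' → v = v' →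
      chartDeriv e q v = chartDeriv e q' v' := by
    rintro q _ v _ rfl rfl; rfl
  have hdd : chartDeriv e (c₁ t) (velocity n c₁ t) = chartDeriv e (c₂ t) (velocity n c₂ t) :=
    haux _ _ _ _ h hv
  set X : ℝ → Euc n := fun s => if s ≤ t then e (c₁ s) else e (c₂ s)
  have hX : ContDiffAt ℝ 1 X t := contDiffAt_ite_le (contDiffAt_chart (by norm_cast) he hm₁ h₁)
    (contDiffAt_chart (by norm_cast) he hm₂ h₂) (by rw [h]) (by rw [hd₁.deriv, hd₂.deriv, hdd])
  have hXd : HasDerivAt X (chartDeriv e (c₁ t) (velocity n c₁ t)) t :=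
    hasDerivAt_ite_le hd₁ (hdd ▸ hd₂) (by rw [h])
  have hXt : X t = e (c₁ t) := if_pos le_rfl
  have hXtt : X t ∈ e.target := hXt ▸ e.map_source hm₁
  have hev : (fun s => if s ≤ t then c₁ s else c₂ s) =ᶠ[𝓝 t] fun s => e.symm (X s) := by
    filter_upwards [h₁.continuousAt.eventually (e.open_source.eventually_mem hm₁),
      h₂.continuousAt.eventually (e.open_source.eventually_mem hm₂)] with s hs₁ hs₂
    by_cases hst : s ≤ t
    · simp [X, hst, e.left_inv hs₁]
    · simp [X, hst, e.left_inv hs₂]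
  refine ⟨(contMDiffAt_chart_symm (by norm_cast) he hX hXtt).congr_of_eventuallyEq hev, ?_⟩
  rw [velocity_congr hev]
  refine chartDeriv_injective he hm₁ ?_
  rw [← hXd.deriv, ← chartDeriv_velocity_symm he hX hXtt]
  exact haux _ _ _ _ (by rw [hXt, e.left_inv hm₁]) rfl

/-- A null curve near the parameter `t`. -/
structure NullAt (n : ℕ) {M : Type*} [TopologicalSpace M] [ChartedSpace (Euc n) M]
    {N : Type*} [TopologicalSpace N] [ChartedSpace (Euc (n + 1)) N] (f : M → N) (c : ℝ → M) (t : ℝ) :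
    Prop where
  contMDiffAt : ContMDiffAt 𝓘(ℝ, ℝ) (𝓡 n) 1 c t
  regular : velocity n c t ≠ 0
  null : c t ∈ singularSet n f →
    mfderiv (𝓡 n) (𝓡 (n + 1)) f (c t) (velocity n c t) = 0 ∧ IsASingularity n f (c t) 1 ∧
      ContMDiffAt 𝓘(ℝ, ℝ) (𝓡 n) 2 c t

theorem mfderiv_eq_zero_congr {q q' : M} {v v' : Euc n} {a : ℝ} (hq : q = q') (hv : v' = a • v)
    (h : (mfderiv (𝓡 n) (𝓡 (n + 1)) f q v : Euc (n + 1)) = 0) :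
    (mfderiv (𝓡 n) (𝓡 (n + 1)) f q' v' : Euc (n + 1)) = 0 := by
  subst hq hv
  have h1 : (mfderiv (𝓡 n) (𝓡 (n + 1)) f q : Euc n →L[ℝ] Euc (n + 1)) (a • v) =
    a • (mfderiv (𝓡 n) (𝓡 (n + 1)) f q : Euc n →L[ℝ] Euc (n + 1)) v := map_smul _ _ _
  refine h1.trans ?_
  have h2 : (mfderiv (𝓡 n) (𝓡 (n + 1)) f q : Euc n →L[ℝ] Euc (n + 1)) v = 0 := h
  rw [h2, smul_zero]

theorem NullAt.congr (h : NullAt n f c t) (hc : c =ᶠ[𝓝 t] c') : NullAt n f c' t := by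
  have hv := velocity_congr (n := n) hc
  have ht := hc.eq_of_nhds
  refine ⟨h.contMDiffAt.congr_of_eventuallyEq hc.symm, ?_, fun hS => ?_⟩
  · intro h0
    exact h.regular (hv.trans h0)
  · obtain ⟨h1, h2, h3⟩ := h.null (ht ▸ hS)
    exact ⟨mfderiv_eq_zero_congr (a := 1) ht (hv.symm.trans (one_smul ℝ _).symm) h1, ht ▸ h2,
      h3.congr_of_eventuallyEq hc.symm⟩

theorem NullAt.comp_affine {a b : ℝ} (ha : a ≠ 0) (h : NullAt n f c (a * t + b)) :
    NullAt n f (fun s => c (a * s + b)) t := by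
  have hv := velocity_comp_affine (h.contMDiffAt.mdifferentiableAt one_ne_zero)
  have hd : ∀ r : ℕ∞ω, ContMDiffAt 𝓘(ℝ, ℝ) 𝓘(ℝ, ℝ) r (fun s : ℝ => a * s + b) t := fun r =>
    (by fun_prop : ContDiffAt ℝ r (fun s : ℝ => a * s + b) t).contMDiffAt
  refine ⟨ContMDiffAt.comp (g := c) t h.contMDiffAt (hd 1), ?_, fun hS => ?_⟩
  · intro h0
    have h1 : a • (velocity n c (a * t + b) : Euc n) = 0 := hv.symm.trans h0
    exact h.regular ((smul_eq_zero.1 h1).resolve_left ha)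
  · obtain ⟨h1, h2, h3⟩ := h.null hS
    exact ⟨mfderiv_eq_zero_congr (a := a) rfl hv h1, h2, ContMDiffAt.comp (g := c) t h3 (hd 2)⟩

/-- A null arc in `U` from `p` to `q` with initial velocity `a` and terminal velocity `b`, of
homotopy class `z`. -/
def Reach (f : M → N) (U : Set M) {p q : M} (a b : Euc n) (z : Path.Homotopic.Quotient p q) :
    Prop :=
  ∃ (c : ℝ → M) (L : ℝ) (γ : Path p q), 0 < L ∧ (∀ t ∈ Icc 0 L, NullAt n f c t ∧ c t ∈ U) ∧
    (velocity n c 0 : Euc n) = a ∧ (velocity n c L : Euc n) = b ∧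
    (∀ t : unitInterval, γ t = c (L * t)) ∧ Path.Homotopic.Quotient.mk γ = z

theorem Reach.mono {U V : Set M} (hUV : U ⊆ V) {p q : M} {a b : Euc n}
    {z : Path.Homotopic.Quotient p q} (h : Reach f U a b z) : Reach f V a b z := by
  obtain ⟨c, L, γ, hL, hc, h⟩ := h
  exact ⟨c, L, γ, hL, fun t ht => ⟨(hc t ht).1, hUV (hc t ht).2⟩, h⟩

/-- Equal velocities make the concatenation `C^1` at the joint. As `q` is regular, neither class
`C^2` nor the kernel condition is required there. -/
theorem Reach.trans {U : Set M} {p q r : M} {a b d : Euc n}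
    {z : Path.Homotopic.Quotient p q} {w : Path.Homotopic.Quotient q r}
    (h₁ : Reach f U a b z) (h₂ : Reach f U b d w) (hq : q ∉ singularSet n f) :
    Reach f U a d (z.trans w) := by
  obtain ⟨c₁, L₁, γ₁, hL₁, hc₁, ha₁, hb₁, hγ₁, rfl⟩ := h₁
  obtain ⟨c₂, L₂, γ₂, hL₂, hc₂, ha₂, hb₂, hγ₂, rfl⟩ := h₂
  set c₃ : ℝ → M := fun s => c₂ (1 * s + -L₁) with hc₃
  have hnull₃ : ∀ t ∈ Icc L₁ (L₁ + L₂), NullAt n f c₃ t ∧ c₃ t ∈ U := by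
    intro t ht
    obtain ⟨h1, h2⟩ := hc₂ (1 * t + -L₁) ⟨by linarith [ht.1], by linarith [ht.2]⟩
    exact ⟨h1.comp_affine one_ne_zero, h2⟩
  have hvel₃ : ∀ t ∈ Icc L₁ (L₁ + L₂), (velocity n c₃ t : Euc n) = velocity n c₂ (1 * t + -L₁) := by
    intro t ht
    obtain ⟨h1, -⟩ := hc₂ (1 * t + -L₁) ⟨by linarith [ht.1], by linarith [ht.2]⟩
    have := velocity_comp_affine (h1.contMDiffAt.mdifferentiableAt one_ne_zero)
    rw [one_smul] at this
    exact this
  have e1 : c₁ L₁ = q := by simpa using (hγ₁ 1).symm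
  have e2 : c₂ 0 = q := by simpa using (hγ₂ 0).symm
  have e0 : c₁ 0 = p := by simpa using (hγ₁ 0).symm
  have e4 : c₂ L₂ = r := by simpa using (hγ₂ 1).symm
  have e3 : c₃ L₁ = q := by simp [hc₃, e2]
  set C : ℝ → M := fun s => if s ≤ L₁ then c₁ s else c₃ s with hC
  have hCL : C L₁ = q := by simp [hC, e1]
  have hglue := contMDiffAt_ite_le (hc₁ L₁ ⟨hL₁.le, le_rfl⟩).1.contMDiffAt
    (hnull₃ L₁ ⟨le_rfl, by linarith⟩).1.contMDiffAt (e1.trans e3.symm) (by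
      rw [hb₁, hvel₃ L₁ ⟨le_rfl, by linarith⟩]
      rw [show 1 * L₁ + -L₁ = 0 by ring]; exact ha₂.symm)
  have hlt : ∀ s, s < L₁ → C =ᶠ[𝓝 s] c₁ := fun s hs => by
    simpa only [hs, if_true] using eventually_ite_le_eq (x := c₁) (y := c₃) hs.ne
  have hgt : ∀ s, L₁ < s → C =ᶠ[𝓝 s] c₃ := fun s hs => by
    simpa only [hs.not_gt, if_false] using eventually_ite_le_eq (x := c₁) (y := c₃) hs.ne'
  have hCle : ∀ s, s ≤ L₁ → C s = c₁ s := fun s hs => if_pos hs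
  have hCge : ∀ s, L₁ ≤ s → C s = c₃ s := fun s hs => by
    rcases hs.eq_or_lt with rfl | h
    · rw [hCL, e3]
    · exact if_neg h.not_ge
  have hnull : ∀ t ∈ Icc 0 (L₁ + L₂), NullAt n f C t ∧ C t ∈ U := by
    intro t ht
    rcases lt_trichotomy t L₁ with h | rfl | h
    · obtain ⟨h1, h2⟩ := hc₁ t ⟨ht.1, h.le⟩
      exact ⟨h1.congr (hlt t h).symm, by rwa [hCle t h.le]⟩
    · obtain ⟨h1, h2⟩ := hc₁ t ⟨hL₁.le, le_rfl⟩
      refine ⟨⟨hglue.1, ?_, fun hS => absurd (hCL ▸ hS) hq⟩, by rwa [hCle t le_rfl]⟩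
      intro h0
      exact h1.regular (hglue.2.symm.trans h0)
    · obtain ⟨h1, h2⟩ := hnull₃ t ⟨h.le, ht.2⟩
      exact ⟨h1.congr (hgt t h).symm, by rwa [hCge t h.le]⟩
  have hL : 0 < L₁ + L₂ := add_pos hL₁ hL₂
  have hcont : ContinuousOn C (Icc 0 (L₁ + L₂)) := fun t ht =>
    (hnull t ht).1.contMDiffAt.continuousAt.continuousWithinAt
  have hmem : ∀ t : unitInterval, (L₁ + L₂) * (t : ℝ) ∈ Icc 0 (L₁ + L₂) := fun t =>
    ⟨mul_nonneg hL.le t.2.1, mul_le_of_le_one_right hL.le t.2.2⟩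
  let γ : Path p r :=
    { toFun := fun t => C ((L₁ + L₂) * t)
      continuous_toFun := hcont.comp_continuous (by fun_prop) hmem
      source' := by
        rw [Set.Icc.coe_zero, mul_zero, hCle 0 hL₁.le, e0]
      target' := by
        rw [Set.Icc.coe_one, mul_one, hCge _ (by linarith), ← e4, hc₃]
        simp }
  refine ⟨C, L₁ + L₂, γ, hL, hnull, ?_, ?_, fun t => rfl, ?_⟩
  · exact (velocity_congr (hlt 0 hL₁)).trans ha₁
  · refine (velocity_congr (hgt _ (by linarith))).trans ((hvel₃ _ ⟨by linarith, le_rfl⟩).trans ?_)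
    rw [show 1 * (L₁ + L₂) + -L₁ = L₂ by ring]; exact hb₂
  · rw [← Path.Homotopic.Quotient.mk_trans, Path.Homotopic.Quotient.eq]
    let φ₁ : Path (0 : ℝ) L₁ :=
      { toFun := fun t => L₁ * t, continuous_toFun := by fun_prop, source' := by simp
        target' := by simp }
    let φ₂ : Path L₁ (L₁ + L₂) :=
      { toFun := fun t => L₁ + L₂ * t, continuous_toFun := by fun_prop, source' := by simp
        target' := by simp }
    refine homotopic_of_convex (convex_Icc 0 (L₁ + L₂)) hcont (φ := fun t => (L₁ + L₂) * t)
      (φ' := φ₁.trans φ₂) (by fun_prop) (φ₁.trans φ₂).continuous hmem (fun t => ?_) (by simp) (by simp)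
      (fun t => rfl) fun t => ?_
    · rw [Path.trans_apply]
      split_ifs with h
      · change L₁ * (2 * (t : ℝ)) ∈ _
        have := t.2.1
        exact ⟨by positivity, by nlinarith⟩
      · change L₁ + L₂ * (2 * (t : ℝ) - 1) ∈ _
        have := t.2.2
        push Not at h
        exact ⟨by nlinarith, by nlinarith⟩
    · rw [Path.trans_apply, Path.trans_apply]
      split_ifs with h
      · change _ = C (L₁ * (2 * (t : ℝ)))
        rw [hCle _ (by nlinarith), hγ₁]
      · change _ = C (L₁ + L₂ * (2 * (t : ℝ) - 1))
        push Not at h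
        rw [hCge _ (by nlinarith), hγ₂, hc₃]
        simp only
        congr 1
        ring

theorem finite_of_eventually_notMem {s K : Set ℝ} (hK : IsCompact K) (hs : IsClosed s)
    (h : ∀ t ∈ K ∩ s, ∀ᶠ r in 𝓝[≠] t, r ∉ s) : (K ∩ s).Finite := by
  refine (hK.inter_right hs).finite ⟨discreteTopology_subtype_iff.2 fun t ht => ?_⟩
  rw [← disjoint_iff, disjoint_principal_right]
  filter_upwards [h t ht] with r hr hrs
  exact hr hrs.2

/-- A closed null arc gives a null loop. -/
theorem Reach.exists_isNullLoop {A : Set (OpenPartialHomeomorph M (Euc n))}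
    {A' : Set (OpenPartialHomeomorph N (Euc (n + 1)))} (hA : IsOrientedAtlas n A)
    (hA' : IsOrientedAtlas (n + 1) A') (hf : IsAFront g f) (hn : 0 < n) {o : M} {a : Euc n}
    {z : Path.Homotopic.Quotient o o} (h : Reach f univ a a z) (ho : o ∉ singularSet n f) :
    ∃ (c : ℝ → M) (hc : IsNullLoop n f o c), loopClass hc.path = FundamentalGroup.fromPath z := by
  obtain ⟨C, L, γ, hL, hnull, ha, hb, hγ, rfl⟩ := h
  have hC0 : C 0 = o := by simpa using (hγ 0).symm
  have hCL : C L = o := by simpa using (hγ 1).symm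
  set c : ℝ → M := fun t => C (L * Int.fract t) with hc
  have hper : Function.Periodic c 1 := fun t => by simp [hc]
  have hc0 : c 0 = o := by simp [hc, hC0]
  set c₀ : ℝ → M := fun s => C (L * s + 0) with hc₀
  set c₁ : ℝ → M := fun s => C (L * s + L) with hc₁
  have hn₀ : ∀ t ∈ Icc (0 : ℝ) 1, NullAt n f c₀ t := fun t ht =>
    NullAt.comp_affine hL.ne' (hnull _ ⟨by have := mul_nonneg hL.le ht.1; linarith,
      by have := mul_le_of_le_one_right hL.le ht.2; linarith⟩).1
  have hn₁ : NullAt n f c₁ 0 := NullAt.comp_affine hL.ne' (hnull _ ⟨by linarith, by linarith⟩).1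
  have hfract : ∀ t ∈ Ico (0 : ℝ) 1, c t = c₀ t := fun t ht => by
    simp only [hc, hc₀, Int.fract_eq_self.2 ht, add_zero]
  have hIoo : ∀ t ∈ Ioo (0 : ℝ) 1, NullAt n f c t := fun t ht => by
    refine (hn₀ t (Ioo_subset_Icc_self ht)).congr ?_
    filter_upwards [Ioo_mem_nhds ht.1 ht.2] with s hs
    exact (hfract s (Ioo_subset_Ico_self hs)).symm
  -- To the left of an integer the periodic curve is the end of the arc, to the right its beginning.
  -- Both have velocity `L • a` at the regular point `o`.
  have hzero : NullAt n f c 0 := by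
    have hv₁ : (velocity n c₁ 0 : Euc n) = L • a := by
      rw [hc₁, velocity_comp_affine ((hnull _ ⟨by linarith,
        by linarith⟩).1.contMDiffAt.mdifferentiableAt one_ne_zero), mul_zero, zero_add]
      exact congrArg _ hb
    have hv₀ : (velocity n c₀ 0 : Euc n) = L • a := by
      rw [hc₀, velocity_comp_affine ((hnull _ ⟨by linarith,
        by linarith⟩).1.contMDiffAt.mdifferentiableAt one_ne_zero), mul_zero, zero_add]
      exact congrArg _ ha
    have hglue := contMDiffAt_ite_le hn₁.contMDiffAt (hn₀ 0 ⟨le_rfl, zero_le_one⟩).contMDiffAt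
      (by simp [hc₁, hc₀, hC0, hCL]) (hv₁.trans hv₀.symm)
    have hgl : NullAt n f (fun s => if s ≤ 0 then c₁ s else c₀ s) 0 :=
      ⟨hglue.1, fun h0 => hn₁.regular (hglue.2.symm.trans h0), fun hS => by
        simp [hc₁, hCL] at hS
        exact absurd hS ho⟩
    refine hgl.congr ?_
    filter_upwards [Ioo_mem_nhds (show (-1 : ℝ) < 0 by norm_num) (show (0 : ℝ) < 1 by norm_num)]
      with s hs
    rcases lt_trichotomy s 0 with h | rfl | h
    · rw [if_pos h.le, ← hper s, hfract (s + 1) ⟨by linarith [hs.1], by linarith⟩]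
      simp only [hc₁, hc₀]
      congr 1
      ring
    · rw [hc0]; simp [hc₁, hCL]
    · rw [if_neg h.not_ge, hfract s ⟨h.le, hs.2⟩]
  have hall : ∀ t, NullAt n f c t := by
    intro t
    have h1 : NullAt n f c (Int.fract t) := by
      rcases (Int.fract_nonneg t).eq_or_lt with h | h
      · rw [← h]; exact hzero
      · exact hIoo _ ⟨h, Int.fract_lt_one t⟩
    have h2 : NullAt n f c (1 * t + -(⌊t⌋ : ℝ)) := by
      rwa [one_mul, ← sub_eq_add_neg]
    have h3 := h2.comp_affine one_ne_zero
    have h4 : (fun s => c (1 * s + -(⌊t⌋ : ℝ))) = c := by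
      funext s
      rw [one_mul, ← sub_eq_add_neg, ← hper.sub_zsmul_eq ⌊t⌋ (x := s)]
      simp
    rwa [h4] at h3
  have hcont : ContMDiff 𝓘(ℝ, ℝ) (𝓡 n) 1 c := fun t => (hall t).contMDiffAt
  have hfin : {t | t ∈ Icc (0 : ℝ) 1 ∧ c t ∈ singularSet n f}.Finite := by
    refine finite_of_eventually_notMem isCompact_Icc
      ((isClosed_singularSet hf.1.1).preimage hcont.continuous) fun t ht => ?_
    -- The lift merely supplies a normal field along the curve, as needed to conclude from
    -- `exists_tendsto_curvature` that the singular parameters are isolated.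
    obtain ⟨ℓ, hℓ, -⟩ := exists_isHeightLift hA hA' hf hcont.continuous 0 0
    obtain ⟨h1, h2, h3⟩ := (hall t).null ht.2
    obtain ⟨P, -, -, -, h4, -⟩ := exists_tendsto_curvature hn hf hcont hℓ.isUnitNormalAlong ht.2
      (hall t).regular h1 h2 h3
    exact h4
  refine ⟨c, ⟨hcont, hper, hc0, fun t => (hall t).regular, fun t ht => ((hall t).null ht).1, hfin,
    fun t ht => ((hall t).null ht).2.1, fun t ht => ((hall t).null ht).2.2⟩, ?_⟩
  unfold loopClass
  congr 2
  ext t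
  change c t = γ t
  rw [hγ]
  rcases t.2.2.eq_or_lt with h | h
  · rw [h, show c 1 = o by simpa [hc0] using hper 0, mul_one, hCL]
  · rw [hfract _ ⟨t.2.1, h⟩, hc₀]
    simp

end NullArcs

/-! ### Regular curves in convex sets -/

section Euclid

variable {E : Type*} [NormedAddCommGroup E] [NormedSpace ℝ E]

/-- A cubic curve with given endpoints and end velocities, all on the positive side of a linear
form. -/
theorem exists_regular_curve {W : Set E} (hW : IsOpen W) {x y a b : E}
    (hseg : segment ℝ x y ⊆ W) (l : E →L[ℝ] ℝ) (ha : 0 < l a) (hb : 0 < l b)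
    (hxy : 0 < l (y - x)) :
    ∃ (X : ℝ → E) (L : ℝ), 0 < L ∧ ContDiff ℝ ∞ X ∧ X 0 = x ∧ deriv X 0 = a ∧ X L = y ∧
      deriv X L = b ∧ ∀ t ∈ Icc 0 L, X t ∈ W ∧ 0 < l (deriv X t) := by
  have hcomp : IsCompact (segment ℝ x y) := by
    rw [segment_eq_image']
    exact isCompact_Icc.image (by fun_prop)
  obtain ⟨δ, hδ, hδW⟩ := hcomp.exists_thickening_subset_open hW hseg
  have hlim : ∀ B C : ℝ, 0 < C → ∀ᶠ L in 𝓝[>] (0 : ℝ), L * B < C := fun B C hC => by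
    have h1 : Tendsto (fun L : ℝ => L * B) (𝓝 0) (𝓝 0) := by
      simpa using (by fun_prop : Continuous fun L : ℝ => L * B).tendsto 0
    exact (h1.eventually (gt_mem_nhds hC)).filter_mono nhdsWithin_le_nhds
  obtain ⟨L, hL1, hL2, hL⟩ := ((hlim (l a + l b) (2 * l (y - x)) (by positivity)).and
    ((hlim (2 * (‖a‖ + ‖b‖)) δ hδ).and self_mem_nhdsWithin)).exists
  have hL0 : (0 : ℝ) < L := hL
  -- The velocity is to be `(1 - t/L) a + (t/L) b + t (L - t) K`. As `t (L - t)` has integral `L^3 /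
  -- 6`, this `K` makes the curve end at `y`. The first smallness condition on `L` gives `l K ≥ 0`,
  -- the second keeps the curve near the segment.
  set K : E := (6 / L ^ 3) • (y - x - (L / 2) • (a + b)) with hK
  have hlK : 0 ≤ l K := by
    rw [hK, map_smul, map_sub, map_smul, map_add, smul_eq_mul, smul_eq_mul]
    refine mul_nonneg (by positivity) (by linarith)
  set X : ℝ → E := fun t => x + (t - t ^ 2 / (2 * L)) • a + (t ^ 2 / (2 * L)) • b +
    (L * t ^ 2 / 2 - t ^ 3 / 3) • K with hX
  have hder : ∀ t, HasDerivAt X ((1 - t / L) • a + (t / L) • b + (t * (L - t)) • K) t := by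
    intro t
    have h2 : HasDerivAt (fun t : ℝ => t ^ 2) (2 * t) t := by simpa using hasDerivAt_pow 2 t
    have h3 : HasDerivAt (fun t : ℝ => t ^ 3) (3 * t ^ 2) t := by simpa using hasDerivAt_pow 3 t
    have e1 : HasDerivAt (fun t : ℝ => t - t ^ 2 / (2 * L)) (1 - t / L) t := by
      convert! (hasDerivAt_id t).sub (h2.div_const (2 * L)) using 1
      field_simp
    have e2 : HasDerivAt (fun t : ℝ => t ^ 2 / (2 * L)) (t / L) t := by
      convert! h2.div_const (2 * L) using 1
      field_simp
    have e3 : HasDerivAt (fun t : ℝ => L * t ^ 2 / 2 - t ^ 3 / 3) (t * (L - t)) t := by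
      convert! ((h2.const_mul L).div_const 2).sub (h3.div_const 3) using 1
      ring
    exact (((e1.smul_const a).const_add x).add (e2.smul_const b)).add (e3.smul_const K)
  refine ⟨X, L, hL0, by rw [hX]; fun_prop, by simp [hX], ?_, ?_, ?_, fun t ht => ⟨hδW ?_, ?_⟩⟩
  · rw [(hder 0).deriv]; simp
  · have e1 : L - L ^ 2 / (2 * L) = L / 2 := by field_simp; ring
    have e2 : L ^ 2 / (2 * L) = L / 2 := by field_simp
    have e3 : (L * L ^ 2 / 2 - L ^ 3 / 3) * (6 / L ^ 3) = 1 := by field_simp; ring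
    simp only [hX, hK]
    rw [e1, e2, smul_smul, e3]
    module
  · rw [(hder L).deriv]; simp [hL0.ne']
  -- The `K`-term moves the curve along the segment with parameter `u`; the deviation from it has
  -- norm at most `L (‖a‖ + ‖b‖)`.
  · set u := 3 * (t / L) ^ 2 - 2 * (t / L) ^ 3 with hu
    have hs0 : 0 ≤ t / L := div_nonneg ht.1 hL0.le
    have hs1 : t / L ≤ 1 := (div_le_one hL0).2 ht.2
    have hu0 : 0 ≤ u := by
      have : u = (t / L) ^ 2 * (3 - 2 * (t / L)) := by rw [hu]; ring
      rw [this]; exact mul_nonneg (sq_nonneg _) (by linarith)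
    have hu1 : u ≤ 1 := by
      have : 1 - u = (1 - t / L) ^ 2 * (1 + 2 * (t / L)) := by rw [hu]; ring
      have h2 : 0 ≤ (1 - t / L) ^ 2 * (1 + 2 * (t / L)) := mul_nonneg (sq_nonneg _) (by linarith)
      linarith
    rw [Metric.mem_thickening_iff]
    refine ⟨x + u • (y - x), ?_, ?_⟩
    · rw [segment_eq_image']
      exact ⟨u, ⟨hu0, hu1⟩, rfl⟩
    · have e3 : (L * t ^ 2 / 2 - t ^ 3 / 3) * (6 / L ^ 3) = u := by rw [hu]; field_simp; ring
      have e4 : X t - (x + u • (y - x)) =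
          (t - t ^ 2 / (2 * L) - L / 2 * u) • a + (t ^ 2 / (2 * L) - L / 2 * u) • b := by
        simp only [hX, hK]
        rw [smul_smul, e3]
        module
      have e5 : t ^ 2 / (2 * L) = L / 2 * (t / L) ^ 2 := by field_simp
      have e6 : t = L * (t / L) := by field_simp
      have hs2 : (t / L) ^ 2 ≤ 1 := pow_le_one₀ hs0 hs1
      have hs3 : 0 ≤ (t / L) ^ 2 := sq_nonneg _
      have h1 : |t ^ 2 / (2 * L) - L / 2 * u| ≤ L := by
        rw [e5, abs_le]; constructor <;> nlinarith
      have h2 : |t - t ^ 2 / (2 * L) - L / 2 * u| ≤ L := by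
        have h3 : |L * (t / L) - L / 2 * (t / L) ^ 2 - L / 2 * u| ≤ L := by
          rw [abs_le]; constructor <;> nlinarith
        rw [e5]
        rwa [← e6] at h3
      rw [dist_eq_norm, e4]
      refine (norm_add_le _ _).trans_lt ?_
      rw [norm_smul, norm_smul, Real.norm_eq_abs, Real.norm_eq_abs]
      have h4 := mul_le_mul_of_nonneg_right h2 (norm_nonneg a)
      have h5 := mul_le_mul_of_nonneg_right h1 (norm_nonneg b)
      have h6 := mul_nonneg hL0.le (norm_nonneg a)
      have h7 := mul_nonneg hL0.le (norm_nonneg b)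
      linarith
  · rw [(hder t).deriv, map_add, map_add, map_smul, map_smul, map_smul, smul_eq_mul, smul_eq_mul,
      smul_eq_mul]
    have hs0 : 0 ≤ t / L := div_nonneg ht.1 hL0.le
    have hs1 : t / L ≤ 1 := (div_le_one hL0).2 ht.2
    have h3 : 0 ≤ t * (L - t) * l K := mul_nonneg (mul_nonneg ht.1 (by linarith [ht.2])) hlK
    rcases hs0.eq_or_lt with h | h
    · rw [← h]; simp only [sub_zero, one_mul, zero_mul]; linarith
    · have := mul_pos h hb
      have := mul_nonneg (sub_nonneg.2 hs1) ha.le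
      linarith

/-- The inner product with the bisector `‖w‖ u + ‖u‖ w` works by the strict Cauchy–Schwarz
inequality, as `w` is not a negative multiple of `u`. -/
theorem exists_pos_pos {F : Type*} [NormedAddCommGroup F] [InnerProductSpace ℝ F] {u w : F}
    (hu : u ≠ 0) (hw : w ∉ Submodule.span ℝ {u}) : ∃ l : F →L[ℝ] ℝ, 0 < l u ∧ 0 < l w := by
  have hw0 : w ≠ 0 := by rintro rfl; exact hw (Submodule.zero_mem _)
  have hu' := norm_pos_iff.2 hu
  have hw' := norm_pos_iff.2 hw0
  have h1 : inner ℝ (-w) u < ‖-w‖ * ‖u‖ := by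
    rw [inner_lt_norm_mul_iff_real]
    intro h
    refine hw (Submodule.mem_span_singleton.2 ⟨-(‖w‖ / ‖u‖), ?_⟩)
    rw [norm_neg, smul_neg] at h
    rw [neg_smul, div_eq_inv_mul, ← smul_smul, ← h, smul_neg, smul_smul, inv_mul_cancel₀ hu'.ne',
      one_smul, neg_neg]
  rw [inner_neg_left, norm_neg] at h1
  refine ⟨innerSL ℝ (‖w‖ • u + ‖u‖ • w), ?_, ?_⟩
  · rw [innerSL_apply_apply, inner_add_left, real_inner_smul_left, real_inner_smul_left,
      real_inner_self_eq_norm_sq]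
    nlinarith
  · rw [innerSL_apply_apply, inner_add_left, real_inner_smul_left, real_inner_smul_left,
      real_inner_self_eq_norm_sq, real_inner_comm w u]
    nlinarith

/-- A real vector space is not a finite union of proper subspaces. This is where dimension at least
two enters the construction of null arcs. -/
theorem exists_notMem_spans {d : ℕ} (hd : 2 ≤ d) (u v w : Euc d) :
    ∃ x : Euc d, x ∉ Submodule.span ℝ {u} ∧ x ∉ Submodule.span ℝ {v} ∧
      x ∉ Submodule.span ℝ {w} := by
  have hne : ∀ u : Euc d, Submodule.span ℝ {u} ≠ ⊤ := fun u h => by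
    have h1 := finrank_span_le_card (R := ℝ) ({u} : Set (Euc d))
    rw [h, finrank_top, finrank_euclideanSpace_fin] at h1
    simp at h1
    omega
  by_contra! hcon
  have hcov : ⋃ i : Fin 3, ((Submodule.span ℝ {![u, v, w] i} : Submodule ℝ (Euc d)) : Set (Euc d)) =
      univ := by
    refine eq_univ_of_forall fun x => mem_iUnion.2 ?_
    by_cases h1 : x ∈ Submodule.span ℝ {u}
    · exact ⟨0, h1⟩
    by_cases h2 : x ∈ Submodule.span ℝ {v}
    · exact ⟨1, h2⟩
    · exact ⟨2, hcon x h1 h2⟩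
  obtain ⟨i, hi⟩ := Subspace.exists_eq_top_of_iUnion_eq_univ hcov
  exact hne _ hi

end Euclid

/-! ### Null arcs inside a chart -/

section ChartReach

variable {n : ℕ}
  {M : Type*} [TopologicalSpace M] [ChartedSpace (Euc n) M] [IsManifold (𝓡 n) ∞ M]
  {N : Type*} [TopologicalSpace N] [ChartedSpace (Euc (n + 1)) N] [IsManifold (𝓡 (n + 1)) ∞ N]
  {g : RiemMetric (n + 1) N} {f : M → N} {e : OpenPartialHomeomorph M (Euc n)} {U : Set M}

/-- In a chart with convex target there is only one homotopy class between two points, so the class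
of the arc constructed there is immaterial. -/
theorem Reach.of_chart {p q : M} {a b : Euc n} {z : Path.Homotopic.Quotient p q}
    (h : Reach f U a b z) (he : Convex ℝ e.target) (hU : U ⊆ e.source) (σ : Path p q)
    (hσ : range σ ⊆ e.source) : Reach f U a b (Path.Homotopic.Quotient.mk σ) := by
  obtain ⟨c, L, γ, hL, hc, ha, hb, hγ, -⟩ := h
  refine ⟨c, L, γ, hL, hc, ha, hb, hγ, Path.Homotopic.Quotient.eq.2 (homotopic_of_chart he ?_ hσ)⟩
  rintro _ ⟨t, rfl⟩
  rw [hγ]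
  exact hU (hc _ ⟨mul_nonneg hL.le t.2.1, mul_le_of_le_one_right hL.le t.2.2⟩).2

/-- A null arc given in a chart. -/
theorem exists_reach_of_curve (he : e ∈ IsManifold.maximalAtlas (𝓡 n) ∞ M) {X : ℝ → Euc n} {L : ℝ}
    (hL : 0 < L) (hX : ContDiff ℝ ∞ X)
    (hmem : ∀ t ∈ Icc 0 L, X t ∈ e.target ∧ deriv X t ≠ 0 ∧ e.symm (X t) ∈ U ∧
      (e.symm (X t) ∈ singularSet n f → IsASingularity n f (e.symm (X t)) 1 ∧
        ∀ v, chartDeriv e (e.symm (X t)) v = deriv X t →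
          mfderiv (𝓡 n) (𝓡 (n + 1)) f (e.symm (X t)) v = 0)) {p q : M} {a b : Euc n}
    (hp : p ∈ e.source) (hq : q ∈ e.source) (hXp : X 0 = e p) (hXq : X L = e q)
    (ha : deriv X 0 = chartDeriv e p a) (hb : deriv X L = chartDeriv e q b) :
    ∃ z : Path.Homotopic.Quotient p q, Reach f U a b z := by
  have hX1 : ∀ t, ContDiffAt ℝ 1 X t := fun t => hX.contDiffAt.of_le (by norm_cast)
  have hvel : ∀ t ∈ Icc 0 L, chartDeriv e (e.symm (X t)) (velocity n (fun s => e.symm (X s)) t) =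
      deriv X t := fun t ht => chartDeriv_velocity_symm he (hX1 t) (hmem t ht).1
  have hcont : ContinuousOn (fun t => e.symm (X t)) (Icc 0 L) :=
    e.continuousOn_symm.comp hX.continuous.continuousOn fun t ht => (hmem t ht).1
  have h0 : e.symm (X 0) = p := by rw [hXp, e.left_inv hp]
  have h1 : e.symm (X L) = q := by rw [hXq, e.left_inv hq]
  have haux : ∀ (q q' : M) (v v' : Euc n), q' ∈ e.source → q = q' →
      chartDeriv e q v = chartDeriv e q' v' → v = v' := by
    rintro q _ v v' hq rfl h
    exact chartDeriv_injective he hq h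
  let γ : Path p q :=
    { toFun := fun t => e.symm (X (L * t))
      continuous_toFun := hcont.comp_continuous (by fun_prop) fun t =>
        ⟨mul_nonneg hL.le t.2.1, mul_le_of_le_one_right hL.le t.2.2⟩
      source' := by simp [h0]
      target' := by simp [h1] }
  refine ⟨_, fun t => e.symm (X t), L, γ, hL, fun t ht => ⟨⟨?_, ?_, ?_⟩, (hmem t ht).2.2.1⟩, ?_, ?_,
    fun t => rfl, rfl⟩
  · exact contMDiffAt_chart_symm (by norm_cast) he (hX1 t) (hmem t ht).1
  · intro h2
    have h3 := hvel t ht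
    rw [h2, map_zero] at h3
    exact (hmem t ht).2.1 h3.symm
  · intro hS
    obtain ⟨h2, h3⟩ := (hmem t ht).2.2.2 hS
    exact ⟨h3 _ (hvel t ht), h2, contMDiffAt_chart_symm (by norm_cast) he
      (hX.contDiffAt.of_le (by norm_cast)) (hmem t ht).1⟩
  · exact haux _ _ _ _ hp h0 ((hvel 0 ⟨le_rfl, hL.le⟩).trans ha)
  · exact haux _ _ _ _ hq h1 ((hvel L ⟨hL.le, le_rfl⟩).trans hb)

theorem exists_reach_of_pos (he : e ∈ IsManifold.maximalAtlas (𝓡 n) ∞ M) {W : Set (Euc n)}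
    (hWo : IsOpen W) (hWc : Convex ℝ W) (hWe : W ⊆ e.target)
    (hWU : ∀ x ∈ W, e.symm x ∈ U ∧ e.symm x ∉ singularSet n f) {p q : M} (hp : p ∈ e.source)
    (hq : q ∈ e.source) (hpW : e p ∈ W) (hqW : e q ∈ W) {a b : Euc n} (l : Euc n →L[ℝ] ℝ)
    (ha : 0 < l (chartDeriv e p a)) (hb : 0 < l (chartDeriv e q b)) (hpq : 0 < l (e q - e p)) :
    ∃ z : Path.Homotopic.Quotient p q, Reach f U a b z := by
  obtain ⟨X, L, hL, hX, h0, h0', h1, h1', hm⟩ :=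
    exists_regular_curve hWo (hWc.segment_subset hpW hqW) l ha hb hpq
  refine exists_reach_of_curve he hL hX (fun t ht => ⟨hWe (hm t ht).1, fun h => ?_,
    (hWU _ (hm t ht).1).1, fun hS => absurd hS (hWU _ (hm t ht).1).2⟩) hp hq h0 h1 h0' h1'
  have := (hm t ht).2
  rw [h, map_zero] at this
  exact this.false

/-- In a convex set without singular points, of dimension at least `2`, all end velocities can be
realized. -/
theorem exists_reach_of_convex (hn : 2 ≤ n) (he : e ∈ IsManifold.maximalAtlas (𝓡 n) ∞ M)
    {W : Set (Euc n)} (hWo : IsOpen W) (hWc : Convex ℝ W) (hWe : W ⊆ e.target)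
    (hWU : ∀ x ∈ W, e.symm x ∈ U ∧ e.symm x ∉ singularSet n f) {p q : M} (hp : p ∈ e.source)
    (hq : q ∈ e.source) (hpW : e p ∈ W) (hqW : e q ∈ W) {a b : Euc n} (ha : a ≠ 0) (hb : b ≠ 0) :
    ∃ z : Path.Homotopic.Quotient p q, Reach f U a b z := by
  have hreg : ∀ r ∈ e.source, e r ∈ W → r ∉ singularSet n f := fun r hr hrW => by
    have := (hWU _ hrW).2
    rwa [e.left_inv hr] at this
  have hinj : ∀ (r : M) (v : Euc n), r ∈ e.source → v ≠ 0 → (chartDeriv e r v : Euc n) ≠ 0 := by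
    intro r v hr hv h
    exact hv (chartDeriv_injective he hr (h.trans (map_zero _).symm))
  have hlim : ∀ (x w : Euc n), x ∈ W → ∀ᶠ s in 𝓝[>] (0 : ℝ), x + s • w ∈ W := fun x w hx => by
    have h1 : Tendsto (fun s : ℝ => x + s • w) (𝓝 0) (𝓝 x) := by
      simpa using (by fun_prop : Continuous fun s : ℝ => x + s • w).tendsto 0
    exact (h1.eventually (hWo.eventually_mem hx)).filter_mono nhdsWithin_le_nhds
  -- Three arcs: the velocity is turned from `a` to an auxiliary direction `w` near `p`, kept equal
  -- to `w` at both ends of the way to a point near `q`, and turned to `b` there. On each arc a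
  -- linear form positive on both end velocities and on the displacement is available, because `w`
  -- avoids three lines.
  have main : ∀ {p q : M} {a b : Euc n}, p ∈ e.source → q ∈ e.source → e p ∈ W → e q ∈ W → a ≠ 0 →
      b ≠ 0 → e p ≠ e q → ∃ z : Path.Homotopic.Quotient p q, Reach f U a b z := by
    intro p q a b hp hq hpW hqW ha hb hpq
    obtain ⟨w, hwa, hwb, hwd⟩ := exists_notMem_spans hn (chartDeriv e p a) (chartDeriv e q b)
      (e q - e p)
    obtain ⟨s, hs1, hs2, hs⟩ := ((hlim (e p) w hpW).and ((hlim (e q) (-w) hqW).and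
      self_mem_nhdsWithin)).exists
    have hs0 : (0 : ℝ) < s := hs
    obtain ⟨p₁, hp₁, hpe⟩ : ∃ p₁ ∈ e.source, e p₁ = e p + s • w :=
      ⟨_, e.map_target (hWe hs1), e.right_inv (hWe hs1)⟩
    obtain ⟨q₁, hq₁, hqe⟩ : ∃ q₁ ∈ e.source, e q₁ = e q + s • -w :=
      ⟨_, e.map_target (hWe hs2), e.right_inv (hWe hs2)⟩
    have hpW₁ : e p₁ ∈ W := hpe ▸ hs1
    have hqW₁ : e q₁ ∈ W := hqe ▸ hs2
    obtain ⟨a₁, ha₁⟩ := chartDeriv_surjective he hp₁ w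
    obtain ⟨b₁, hb₁⟩ := chartDeriv_surjective he hq₁ w
    obtain ⟨l₁, hl₁, hl₁'⟩ := exists_pos_pos (hinj p a hp ha) hwa
    obtain ⟨l₃, hl₃, hl₃'⟩ := exists_pos_pos (hinj q b hq hb) hwb
    obtain ⟨l₂, hl₂, hl₂'⟩ : ∃ l : Euc n →L[ℝ] ℝ, 0 < l w ∧ 0 < l (e q - e p - (2 * s) • w) := by
      have hne : e q - e p - (2 * s) • w ≠ 0 := fun h => hwd (by
        rw [sub_eq_zero] at h
        refine Submodule.mem_span_singleton.2 ⟨(2 * s)⁻¹, ?_⟩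
        rw [h, smul_smul, inv_mul_cancel₀ (by positivity), one_smul])
      obtain ⟨l, h1, h2⟩ := exists_pos_pos hne (w := w) fun h => by
        obtain ⟨r, hr⟩ := Submodule.mem_span_singleton.1 h
        have h3 : (1 + r * (2 * s)) • w = r • (e q - e p) := by
          rw [add_smul, one_smul]
          nth_rewrite 1 [← hr]
          module
        by_cases h4 : 1 + r * (2 * s) = 0
        · rw [h4, zero_smul] at h3
          have h5 := (smul_eq_zero.1 h3.symm).resolve_right (sub_ne_zero.2 hpq.symm)
          rw [h5] at h4
          norm_num at h4
        · refine hwd (Submodule.mem_span_singleton.2 ⟨(1 + r * (2 * s))⁻¹ * r, ?_⟩)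
          rw [← smul_smul, ← h3, smul_smul, inv_mul_cancel₀ h4, one_smul]
      exact ⟨l, h2, h1⟩
    obtain ⟨z₁, hz₁⟩ := exists_reach_of_pos he hWo hWc hWe hWU hp hp₁ hpW hpW₁ l₁ hl₁
      (by rw [ha₁]; exact hl₁') (b := a₁) (by
        rw [hpe, add_sub_cancel_left, map_smul, smul_eq_mul]; exact mul_pos hs0 hl₁')
    obtain ⟨z₂, hz₂⟩ := exists_reach_of_pos he hWo hWc hWe hWU hp₁ hq₁ hpW₁ hqW₁ l₂
      (a := a₁) (b := b₁) (by rw [ha₁]; exact hl₂) (by rw [hb₁]; exact hl₂) (by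
        rw [hpe, hqe]
        convert! hl₂' using 2
        module)
    obtain ⟨z₃, hz₃⟩ := exists_reach_of_pos he hWo hWc hWe hWU hq₁ hq hqW₁ hqW l₃
      (a := b₁) (by rw [hb₁]; exact hl₃') hl₃ (by
        rw [hqe]
        have : e q - (e q + s • -w) = s • w := by module
        rw [this, map_smul, smul_eq_mul]; exact mul_pos hs0 hl₃')
    exact ⟨_, (hz₁.trans hz₂ (hreg _ hp₁ hpW₁)).trans hz₃ (hreg _ hq₁ hqW₁)⟩
  -- For coinciding ends the displacement is zero and no form is positive on it, so an intermediate
  -- point is inserted.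
  by_cases hpq : e p = e q
  · obtain ⟨s, hs1, hs⟩ := ((hlim (e p) (chartDeriv e p a) hpW).and self_mem_nhdsWithin).exists
    have hs0 : (0 : ℝ) < s := hs
    obtain ⟨p₁, hp₁, hpe⟩ : ∃ p₁ ∈ e.source, e p₁ = e p + s • chartDeriv e p a :=
      ⟨_, e.map_target (hWe hs1), e.right_inv (hWe hs1)⟩
    have hpW₁ : e p₁ ∈ W := hpe ▸ hs1
    have hne : e p ≠ e p₁ := by
      rw [hpe]
      intro h
      exact smul_ne_zero hs0.ne' (hinj p a hp ha) (left_eq_add.1 h)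
    obtain ⟨z₁, hz₁⟩ := main hp hp₁ hpW hpW₁ ha ha hne
    obtain ⟨z₂, hz₂⟩ := main hp₁ hq hpW₁ hqW ha hb (hpq ▸ hne.symm)
    exact ⟨_, hz₁.trans hz₂ (hreg _ hp₁ hpW₁)⟩
  · exact main hp hq hpW hqW ha hb hpq

end ChartReach

/-! ### Charts adapted to the singular set -/

section AdaptedCharts

variable {d : ℕ} {X : Type*} [TopologicalSpace X] [ChartedSpace (Euc d) X]
  [IsManifold (𝓡 d) ∞ X]

/-- A chart restricts to a chart with convex target in a given neighbourhood. -/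
theorem exists_convex_restr {e : OpenPartialHomeomorph X (Euc d)}
    (he : e ∈ IsManifold.maximalAtlas (𝓡 d) ∞ X) {p : X} (hp : p ∈ e.source) {V : Set X}
    (hV : V ∈ 𝓝 p) :
    ∃ e₁ ∈ IsManifold.maximalAtlas (𝓡 d) ∞ X, p ∈ e₁.source ∧ e₁.source ⊆ e.source ∩ V ∧
      Convex ℝ e₁.target ∧ (∀ q, e₁ q = e q) ∧ ∀ x, e₁.symm x = e.symm x := by
  have h1 : e.target ∩ e.symm ⁻¹' V ∈ 𝓝 (e p) :=
    inter_mem (e.open_target.mem_nhds (e.map_source hp))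
      ((e.continuousAt_symm (e.map_source hp)).preimage_mem_nhds (by rwa [e.left_inv hp]))
  obtain ⟨r, hr, hball⟩ := Metric.mem_nhds_iff.1 h1
  have hs : IsOpen (e.source ∩ e ⁻¹' Metric.ball (e p) r) :=
    e.continuousOn.isOpen_inter_preimage e.open_source Metric.isOpen_ball
  refine ⟨e.restr (e.source ∩ e ⁻¹' Metric.ball (e p) r), restr_mem_maximalAtlas _ he hs, ?_, ?_, ?_,
    fun q => rfl, fun x => rfl⟩
  · rw [e.restr_source, hs.interior_eq]
    exact ⟨hp, hp, Metric.mem_ball_self hr⟩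
  · rw [e.restr_source, hs.interior_eq]
    rintro q ⟨hq, -, hq2⟩
    refine ⟨hq, ?_⟩
    have := (hball hq2).2
    rwa [mem_preimage, e.left_inv hq] at this
  · have h2 : (e.restr (e.source ∩ e ⁻¹' Metric.ball (e p) r)).target = Metric.ball (e p) r := by
      rw [OpenPartialHomeomorph.restr_target, hs.interior_eq]
      ext x
      constructor
      · rintro ⟨hx, -, hx2⟩
        rwa [mem_preimage, e.right_inv hx] at hx2
      · intro hx
        have hxt := (hball hx).1
        refine ⟨hxt, e.map_target hxt, ?_⟩
        rwa [mem_preimage, e.right_inv hxt]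
    rw [h2]
    exact convex_ball _ _

theorem homeomorph_mem_contDiffGroupoid (Φ : Euc d ≃ₜ Euc d) (hΦ : ContDiff ℝ ∞ Φ)
    (hΦ' : ContDiff ℝ ∞ Φ.symm) :
    Φ.toOpenPartialHomeomorph ∈ contDiffGroupoid ∞ (𝓡 d) := by
  rw [contDiffGroupoid, mem_groupoid_of_pregroupoid]
  exact ⟨hΦ.contDiffOn, hΦ'.contDiffOn⟩

theorem transHomeomorph_mem_maximalAtlas {e : OpenPartialHomeomorph X (Euc d)}
    (he : e ∈ IsManifold.maximalAtlas (𝓡 d) ∞ X) (Φ : Euc d ≃ₜ Euc d) (hΦ : ContDiff ℝ ∞ Φ)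
    (hΦ' : ContDiff ℝ ∞ Φ.symm) :
    e.trans Φ.toOpenPartialHomeomorph ∈ IsManifold.maximalAtlas (𝓡 d) ∞ X := by
  have hG := homeomorph_mem_contDiffGroupoid Φ hΦ hΦ'
  rw [IsManifold.maximalAtlas, mem_maximalAtlas_iff] at he ⊢
  generalize contDiffGroupoid ∞ (𝓡 d) = G at *
  generalize Φ.toOpenPartialHomeomorph = φ at *
  intro e' he'
  obtain ⟨h1, h2⟩ := he e' he'
  rw [OpenPartialHomeomorph.trans_symm_eq_symm_trans_symm, OpenPartialHomeomorph.trans_assoc,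
    ← OpenPartialHomeomorph.trans_assoc e'.symm]
  exact ⟨G.trans (G.symm hG) h1, G.trans h2 hG⟩

end AdaptedCharts

/-- Global coordinates in which the function `hess` is linear. -/
theorem exists_homeomorph_hess {n k : ℕ} (h1 : 1 ≤ k) (hk : k ≤ n) :
    ∃ (Φ : Euc n ≃ₜ Euc n) (l : Euc n →L[ℝ] ℝ) (c : ℝ), ContDiff ℝ ∞ Φ ∧ ContDiff ℝ ∞ Φ.symm ∧
      0 < c ∧ ∀ X, hess k X = c * l (Φ X) := by
  obtain ⟨b, c, hc, hb⟩ := hess_add_smul h1 hk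
  have hb0 : b ≠ 0 := by
    rintro rfl
    have := hb 0 1
    simp at this
    exact hc.ne' this
  have hbb : inner ℝ b b ≠ (0 : ℝ) := inner_self_ne_zero.2 hb0
  set l : Euc n →L[ℝ] ℝ := (inner ℝ b b)⁻¹ • innerSL ℝ b with hl
  have hlb : l b = 1 := by
    rw [hl, _root_.smul_apply, innerSL_apply_apply, smul_eq_mul, inv_mul_cancel₀ hbb]
  -- `hess / c` and `l` both grow with slope `1` in the direction `b`, so `ψ` is invariant along
  -- `b`. Hence the shear `X + ψ X • b` is inverted by `-ψ`, and `l` of it is `hess / c`.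
  set ψ : Euc n → ℝ := fun X => hess k X / c - l X with hψ
  have hψs : ∀ (X : Euc n) (s : ℝ), ψ (X + s • b) = ψ X := fun X s => by
    simp only [hψ, hb, map_add, map_smul, hlb, smul_eq_mul]
    field_simp
    ring
  have hψc : ContDiff ℝ ∞ ψ := (contDiff_hess.div_const c).sub l.contDiff
  refine ⟨{ toFun := fun X => X + ψ X • b
            invFun := fun Y => Y + (-ψ Y) • b
            left_inv := fun X => by
              change X + ψ X • b + (-ψ (X + ψ X • b)) • b = X
              rw [hψs]; module
            right_inv := fun Y => by
              change Y + (-ψ Y) • b + (ψ (Y + (-ψ Y) • b)) • b = Y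
              rw [hψs]; module
            continuous_toFun := continuous_id.add (hψc.continuous.smul continuous_const)
            continuous_invFun := continuous_id.add (hψc.continuous.neg.smul continuous_const) },
    l, c, contDiff_id.add (hψc.smul contDiff_const), contDiff_id.add (hψc.neg.smul contDiff_const),
    hc, fun X => ?_⟩
  change _ = c * l (X + ψ X • b)
  rw [map_add, map_smul, hlb, hψ]
  simp only [smul_eq_mul, mul_one]
  field_simp
  ring

theorem hess_smul_basisVec {n k : ℕ} (hn : 0 < n) (t : ℝ) :
    hess k (t • basisVec n 0) = ((k : ℝ) + 2) * ((k : ℝ) + 1) * t ^ k := by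
  unfold hess
  rw [Finset.sum_eq_zero, add_zero, coord_smul, coord_basisVec hn, if_pos rfl, mul_one]
  intro j hj
  have h1 : j - 1 ≠ 0 := by have := (Finset.mem_Icc.1 hj).1; omega
  have h2 : coord (t • (basisVec n 0 : Euc n)) (j - 1) = 0 := by
    rw [coord_smul, coord_basisVec hn, if_neg h1, mul_zero]
  rw [h2, mul_zero]

/-- Near the origin there is a point at which the `0`-th coordinate line crosses the zero set of
`hess` transversally. -/
theorem exists_crossing_point {n k : ℕ} (h1 : 1 ≤ k) (hk : k ≤ n) {V : Set (Euc n)}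
    (hV : V ∈ 𝓝 (0 : Euc n)) :
    ∃ (Z : Euc n) (δ m : ℝ), 0 < δ ∧ m ≠ 0 ∧ hess k Z = 0 ∧
      HasDerivAt (fun s : ℝ => hess k (Z + s • basisVec n 0)) m 0 ∧
      ∀ s : ℝ, |s| ≤ δ → Z + s • basisVec n 0 ∈ V ∧
        (0 < s → 0 < hess k (Z + s • basisVec n 0)) ∧
        (s < 0 → hess k (Z + s • basisVec n 0) < 0) := by
  have hn : 0 < n := by omega
  obtain ⟨b, c, hc, hb⟩ := hess_add_smul h1 hk
  set C : ℝ := ((k : ℝ) + 2) * ((k : ℝ) + 1) with hC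
  have hC0 : 0 < C := by positivity
  -- The point `t • e_0` is moved along `b` into the zero set of `hess`. On the coordinate line
  -- through it `hess` is `C ((t + s)^k - t^k)`.
  let Z : ℝ → Euc n := fun t => t • basisVec n 0 + (-(C * t ^ k) / c) • b
  have hZ : ∀ t s, hess k (Z t + s • basisVec n 0) = C * ((t + s) ^ k - t ^ k) := by
    intro t s
    have : Z t + s • basisVec n 0 = (t + s) • basisVec n 0 + (-(C * t ^ k) / c) • b := by
      simp only [Z]; module
    rw [this, hb, hess_smul_basisVec hn]
    field_simp
    ring
  have hZ0 : Z 0 = 0 := by simp [Z, show k ≠ 0 by omega]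
  have hder : ∀ t, HasDerivAt (fun s : ℝ => hess k (Z t + s • basisVec n 0)) (C * (k * t ^ (k - 1))) 0 := by
    intro t
    simp only [hZ]
    have h2 : HasDerivAt (fun s : ℝ => (t + s) ^ k) (k * (t + 0) ^ (k - 1) * 1) 0 :=
      ((hasDerivAt_id (0 : ℝ)).const_add t).pow k
    simpa using (h2.sub_const (t ^ k)).const_mul C
  have hcont : Continuous fun q : ℝ × ℝ => Z q.1 + q.2 • basisVec n 0 := by
    simp only [Z]; fun_prop
  have hnhds : ∀ᶠ q : ℝ × ℝ in 𝓝 0, Z q.1 + q.2 • basisVec n 0 ∈ V :=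
    hcont.continuousAt.eventually (by simpa [hZ0] using hV)
  obtain ⟨r, hr, hball⟩ := Metric.eventually_nhds_iff.1 hnhds
  have hmem : ∀ t s : ℝ, |t| < r → |s| < r → Z t + s • basisVec n 0 ∈ V := fun t s ht hs =>
    hball (y := (t, s)) (by rw [dist_zero_right, Prod.norm_def, Real.norm_eq_abs, Real.norm_eq_abs]
                            exact max_lt ht hs)
  -- For `k = 1` the origin itself will do. For `k ≥ 2` the crossing there is not transversal, so a
  -- small `t > 0` is taken.
  rcases h1.eq_or_lt with rfl | h2
  · refine ⟨Z 0, r / 2, C * ((1 : ℕ) * 0 ^ (1 - 1)), by positivity, by simpa using hC0.ne', ?_, hder 0, fun s hs => ⟨hmem 0 s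
      (by simpa using hr) (by linarith), ?_, ?_⟩⟩
    · simpa using hZ 0 0
    · intro h; rw [hZ]; simpa using mul_pos hC0 h
    · intro h; rw [hZ]; simpa using mul_neg_of_pos_of_neg hC0 h
  · refine ⟨Z (r / 2), r / 4, C * (k * (r / 2) ^ (k - 1)), by positivity, by positivity, ?_, hder _,
      fun s hs => ⟨hmem _ s ?_ (by linarith), fun h => ?_, fun h => ?_⟩⟩
    · simpa using hZ (r / 2) 0
    · rw [abs_of_pos (by positivity)]; linarith
    · rw [hZ]
      exact mul_pos hC0 (sub_pos.2 (pow_lt_pow_left₀ (by linarith) (by positivity) (by omega)))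
    · rw [hZ]
      exact mul_neg_of_pos_of_neg hC0 (sub_neg.2 (pow_lt_pow_left₀ (by linarith)
        (by linarith [(abs_le.1 hs).1]) (by omega)))

/-! ### Null arcs that cross the singular set -/

section Crossing

variable {n : ℕ}
  {M : Type*} [TopologicalSpace M] [ChartedSpace (Euc n) M] [IsManifold (𝓡 n) ∞ M]
  {N : Type*} [TopologicalSpace N] [ChartedSpace (Euc (n + 1)) N] [IsManifold (𝓡 (n + 1)) ∞ N]
  {g : RiemMetric (n + 1) N} {f : M → N} {k : ℕ} {e : OpenPartialHomeomorph M (Euc n)}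
  {e' : OpenPartialHomeomorph N (Euc (n + 1))}

theorem IsNormalFormOn.mfderiv_eq_zero (h : IsNormalFormOn f k e e')
    (hf : ContMDiff (𝓡 n) (𝓡 (n + 1)) ∞ f) {q : M} (hq : q ∈ e.source) (h0 : hess k (e q) = 0)
    {v : TangentSpace (𝓡 n) q} (hv : chartDeriv e q v = basisVec n 0) :
    mfderiv (𝓡 n) (𝓡 (n + 1)) f q v = 0 := by
  refine chartDeriv_injective h.mem_atlas' (h.mapsTo hq) ?_
  rw [h.chartDeriv_mfderiv hf hq, hv, map_zero, germDeriv_eq_zero_iff h.pos h.one_le h.le, h0,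
    zero_mul]
  exact ⟨fun j hj => by rw [coord_basisVec h.pos, if_neg (by omega)], rfl⟩

/-- Where the kernel direction is transversal to the singular set, the singular point is of
type `A₂`. -/
theorem IsNormalFormOn.isASingularity_one (h : IsNormalFormOn f k e e') (hf : IsAFront g f) {q : M}
    (hq : q ∈ e.source) (h0 : hess k (e q) = 0) {m : ℝ} (hm : m ≠ 0)
    (hder : HasDerivAt (fun s : ℝ => hess k (e q + s • basisVec n 0)) m 0) :
    IsASingularity n f q 1 := by
  have hqS : q ∈ singularSet n f := (h.mem_singularSet_iff hf.1.1 hq).2 h0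
  obtain ⟨k₁, hk1, hkn, e₁, e₁', hN⟩ := hf.2 q hqS
  rcases hk1.eq_or_lt with rfl | hk2
  · exact ⟨e₁, e₁', hN⟩
  exfalso
  have h₁ := hN.isNormalFormOn hk1 hkn
  have hq₁ := hN.mem_source
  -- For a higher singularity this curve runs in the singular set with velocity in the kernel of
  -- `df`. In the chart `e` the kernel is spanned by `e_0`, so `hess` would have derivative zero
  -- along `e_0`, contrary to `m ≠ 0`.
  obtain ⟨r, hr0, hrd, hr⟩ := exists_null_curve hk2 hkn
  obtain ⟨v, hv⟩ := chartDeriv_surjective h₁.mem_atlas hq₁ (basisVec n 0)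
  have hv0 : mfderiv (𝓡 n) (𝓡 (n + 1)) f q v = 0 :=
    h₁.mfderiv_eq_zero hf.1.1 hq₁ (by rw [hN.center, ← hr0]; exact hr 0) hv
  set y : Euc n := chartDeriv e q v with hy
  have hgy : germDeriv k (e q) y = 0 := by
    rw [hy, ← h.chartDeriv_mfderiv hf.1.1 hq, hv0, map_zero]
  have hyc := ((germDeriv_eq_zero_iff h.pos h.one_le h.le _ _).1 hgy).1
  have hy1 : y = coord y 0 • basisVec n 0 := by
    refine coord_ext fun j hj => ?_
    rw [coord_smul, coord_basisVec h.pos]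
    split_ifs with hj0
    · rw [hj0, mul_one]
    · rw [hyc j (by omega), mul_zero]
  have hy0 : y ≠ 0 := by
    intro hy0
    have h2 : v = 0 := chartDeriv_injective h.mem_atlas hq (hy0.trans (map_zero _).symm)
    rw [h2, map_zero] at hv
    have h3 := congrArg (fun z => coord z 0) hv
    simp [coord_basisVec h.pos, coord_zero] at h3
  have hcc : HasFDerivAt (coordChange e₁ e) (fderiv ℝ (coordChange e₁ e) (r 0)) (r 0) := by
    rw [hr0, ← hN.center]
    exact ((contDiffAt_coordChange h₁.mem_atlas h.mem_atlas hq₁ hq).differentiableAt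
      (by simp)).hasFDerivAt
  have hY : HasDerivAt (fun t => coordChange e₁ e (r t)) y 0 := by
    have h2 := hcc.comp_hasDerivAt (0 : ℝ) hrd
    rw [hr0, ← hN.center, ← hv, ← chartDeriv_coordChange h₁.mem_atlas h.mem_atlas hq₁ hq] at h2
    exact h2
  have hY0 : coordChange e₁ e (r 0) = e q := by
    rw [hr0, ← hN.center, coordChange, e₁.left_inv hq₁]
  have hhess : DifferentiableAt ℝ (hess k : Euc n → ℝ) (e q) :=
    (contDiff_hess (m := 1)).differentiable one_ne_zero _
  have hd1 : HasDerivAt (fun t => hess k (coordChange e₁ e (r t))) (fderiv ℝ (hess k) (e q) y) 0 := by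
    have h2 := (hY0 ▸ hhess.hasFDerivAt : HasFDerivAt (hess k : Euc n → ℝ) (fderiv ℝ (hess k) (e q))
      (coordChange e₁ e (r 0)))
    have h3 := h2.comp_hasDerivAt (0 : ℝ) hY
    exact h3
  have hd2 : HasDerivAt (fun t => hess k (coordChange e₁ e (r t))) 0 0 := by
    refine (hasDerivAt_const (0 : ℝ) (0 : ℝ)).congr_of_eventuallyEq ?_
    have hc1 : ContinuousAt (fun t => e₁.symm (r t)) 0 := by
      refine ContinuousAt.comp (g := e₁.symm) (f := r) (e₁.continuousAt_symm ?_) hrd.continuousAt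
      rw [hr0, ← hN.center]; exact e₁.map_source hq₁
    have hq2 : e₁.symm (r 0) = q := by rw [hr0, ← hN.center, e₁.left_inv hq₁]
    filter_upwards [hc1.eventually (e.open_source.eventually_mem (by change e₁.symm (r 0) ∈ _; rw [hq2]; exact hq)),
      hrd.continuousAt.eventually (e₁.open_target.eventually_mem (by
        rw [hr0, ← hN.center]; exact e₁.map_source hq₁))] with t ht1 ht2
    refine (h.mem_singularSet_iff hf.1.1 ht1).1 ?_
    rw [h₁.mem_singularSet_iff hf.1.1 (e₁.map_target ht2), e₁.right_inv ht2]
    exact hr t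
  have hd3 : HasDerivAt (fun s : ℝ => hess k (e q + s • basisVec n 0))
      (fderiv ℝ (hess k) (e q) (basisVec n 0)) 0 := by
    have h2 : HasFDerivAt (hess k : Euc n → ℝ) (fderiv ℝ (hess k) (e q))
        (e q + (0 : ℝ) • basisVec n 0) := by
      rw [zero_smul, add_zero]; exact hhess.hasFDerivAt
    have h4 : HasDerivAt (fun s : ℝ => e q + s • basisVec n 0) (basisVec n 0) 0 := by
      simpa using ((hasDerivAt_id (0 : ℝ)).smul_const (basisVec n 0)).const_add (e q)
    have h3 := h2.comp_hasDerivAt (0 : ℝ) h4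
    exact h3
  have e1 := hd1.unique hd2
  have e2 := hd3.unique hder
  rw [hy1, map_smul, e2, smul_eq_mul] at e1
  rcases mul_eq_zero.1 e1 with h2 | h2
  · rw [h2, zero_smul] at hy1; exact hy0 hy1
  · exact hm h2

/-- Null arcs crossing the singular set in both directions. -/
theorem IsNormalFormOn.exists_reach_crossing (h : IsNormalFormOn f k e e') (hf : IsAFront g f)
    {U : Set M} (hUo : IsOpen U) (hUe : U ⊆ e.source) {p : M} (hp : p ∈ U) (hep : e p = 0) :
    ∃ (q r : M) (a b : Euc n), q ∈ U ∧ r ∈ U ∧ a ≠ 0 ∧ b ≠ 0 ∧ hess k (e q) < 0 ∧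
      0 < hess k (e r) ∧ (∃ z : Path.Homotopic.Quotient q r, Reach f U a b z) ∧
      ∃ z : Path.Homotopic.Quotient r q, Reach f U (-b) (-a) z := by
  have hV : e.target ∩ e.symm ⁻¹' U ∈ 𝓝 (0 : Euc n) := by
    rw [← hep]
    exact inter_mem (e.open_target.mem_nhds (e.map_source (hUe hp)))
      ((e.continuousAt_symm (e.map_source (hUe hp))).preimage_mem_nhds
        (by rw [e.left_inv (hUe hp)]; exact hUo.mem_nhds hp))
  obtain ⟨Z, δ, m, hδ, hm, hZ0, hZd, hZ⟩ := exists_crossing_point h.one_le h.le hV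
  have hbasis : basisVec n 0 ≠ 0 := by
    intro h0
    have h3 := congrArg (fun z => coord z 0) h0
    simp [coord_basisVec h.pos, coord_zero] at h3
  have hpt : ∀ s : ℝ, |s| ≤ δ → ∃ q ∈ U, e q = Z + s • basisVec n 0 ∧
      e.symm (Z + s • basisVec n 0) = q := fun s hs =>
    ⟨_, (hZ s hs).1.2, e.right_inv (hZ s hs).1.1, rfl⟩
  obtain ⟨q, hq, hqe, -⟩ := hpt (-δ) (by rw [abs_neg, abs_of_pos hδ])
  obtain ⟨r, hr, hre, -⟩ := hpt δ (by rw [abs_of_pos hδ])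
  obtain ⟨a, ha⟩ := chartDeriv_surjective h.mem_atlas (hUe hq) (basisVec n 0)
  obtain ⟨b, hb⟩ := chartDeriv_surjective h.mem_atlas (hUe hr) (basisVec n 0)
  have hne : ∀ (x : M) (v : Euc n), (chartDeriv e x v : Euc n) = basisVec n 0 → v ≠ 0 := by
    rintro x v hv rfl
    exact hbasis (hv.symm.trans (map_zero (chartDeriv e x)))
  -- The segment in the null direction is run through forwards or backwards. Its only singular point
  -- is `Z`, where the crossing is transversal, hence of type `A₂`.
  have harc : ∀ σ : ℝ, σ = 1 ∨ σ = -1 → ∀ (q r : M) (a b : Euc n), q ∈ U → r ∈ U →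
      e q = Z + (σ * -δ) • basisVec n 0 → e r = Z + (σ * δ) • basisVec n 0 →
      (chartDeriv e q a : Euc n) = σ • basisVec n 0 →
      (chartDeriv e r b : Euc n) = σ • basisVec n 0 →
      ∃ z : Path.Homotopic.Quotient q r, Reach f U a b z := by
    intro σ hσ q r a b hq hr hqe hre ha hb
    have hσ1 : |σ| = 1 := by rcases hσ with rfl | rfl <;> simp
    have hσ0 : σ ≠ 0 := by rintro rfl; simp at hσ1
    set X : ℝ → Euc n := fun t => Z + (σ * (t - δ)) • basisVec n 0 with hX
    have hXd : ∀ t, HasDerivAt X (σ • basisVec n 0) t := fun t => by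
      have h2 : HasDerivAt (fun t : ℝ => σ * (t - δ)) σ t := by
        simpa using ((hasDerivAt_id t).sub_const δ).const_mul σ
      exact (h2.smul_const (basisVec n 0)).const_add Z
    refine exists_reach_of_curve h.mem_atlas (X := X) (L := 2 * δ) (by positivity)
      (by rw [hX]; fun_prop) (fun t ht => ?_) (hUe hq) (hUe hr) (by rw [hqe, hX]; simp)
      (by rw [hre, hX]; simp only; congr 3; ring) (by rw [(hXd 0).deriv, ha])
      (by rw [(hXd _).deriv, hb])
    have hs : |σ * (t - δ)| ≤ δ := by
      rw [abs_mul, hσ1, one_mul, abs_le]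
      exact ⟨by linarith [ht.1], by linarith [ht.2]⟩
    obtain ⟨⟨hm1, hm2⟩, hm3, hm4⟩ := hZ _ hs
    refine ⟨hm1, by rw [(hXd t).deriv]; exact smul_ne_zero hσ0 hbasis, hm2, fun hS => ?_⟩
    have hh0 : hess k (X t) = 0 := by
      rw [h.mem_singularSet_iff hf.1.1 (e.map_target hm1), e.right_inv hm1] at hS
      exact hS
    have hst : σ * (t - δ) = 0 := by
      rcases lt_trichotomy (σ * (t - δ)) 0 with h2 | h2 | h2
      · exact absurd hh0 (hm4 h2).ne
      · exact h2
      · exact absurd hh0 (hm3 h2).ne'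
    have hXZ : X t = Z := by simp [hX, hst]
    refine ⟨h.isASingularity_one hf (e.map_target hm1) (by rwa [e.right_inv hm1]) hm ?_,
      fun v hv => ?_⟩
    · rw [e.right_inv hm1, hst, zero_smul, add_zero]; exact hZd
    · rw [(hXd t).deriv] at hv
      have h5 : chartDeriv e (e.symm (X t)) (σ • v) = basisVec n 0 := by
        rw [map_smul, hv, smul_smul]
        rcases hσ with rfl | rfl <;> simp
      have h6 := h.mfderiv_eq_zero hf.1.1 (e.map_target hm1) (by rwa [e.right_inv hm1]) h5
      rw [map_smul] at h6
      exact (smul_eq_zero.1 h6).resolve_left hσ0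
  refine ⟨q, r, a, b, hq, hr, hne q a ha, hne r b hb, ?_, ?_, ?_, ?_⟩
  · rw [hqe]; exact (hZ _ (by rw [abs_neg, abs_of_pos hδ])).2.2 (by linarith)
  · rw [hre]; exact (hZ _ (by rw [abs_of_pos hδ])).2.1 hδ
  · exact harc 1 (Or.inl rfl) q r a b hq hr (by rw [hqe, one_mul]) (by rw [hre, one_mul])
      (by rw [ha, one_smul]) (by rw [hb, one_smul])
  · refine harc (-1) (Or.inr rfl) r q (-b) (-a) hr hq (by rw [hre]; congr 2; ring)
      (by rw [hqe]; congr 2; ring) ?_ ?_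
    · have h2 : chartDeriv e r (-b) = -chartDeriv e r b := map_neg _ _
      rw [neg_one_smul, ← hb]; exact h2
    · have h2 : chartDeriv e q (-a) = -chartDeriv e q a := map_neg _ _
      rw [neg_one_smul, ← ha]; exact h2

end Crossing

/-! ### Loops of manifolds of dimension at least two -/

section HighDimension

variable {n : ℕ}
  {M : Type*} [TopologicalSpace M] [ChartedSpace (Euc n) M] [IsManifold (𝓡 n) ∞ M]
  {N : Type*} [TopologicalSpace N] [ChartedSpace (Euc (n + 1)) N] [IsManifold (𝓡 (n + 1)) ∞ N]
  {g : RiemMetric (n + 1) N} {f : M → N}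

/-- Around a singular point of the front there are coordinates in which the singular set is a
hyperplane. -/
theorem IsNormalFormOn.exists_chart_linear {k : ℕ} {e : OpenPartialHomeomorph M (Euc n)}
    {e' : OpenPartialHomeomorph N (Euc (n + 1))} (h : IsNormalFormOn f k e e') {p : M}
    (hp : p ∈ e.source) :
    ∃ D ∈ IsManifold.maximalAtlas (𝓡 n) ∞ M, p ∈ D.source ∧ D.source ⊆ e.source ∧
      Convex ℝ D.target ∧ ∃ (l : Euc n →L[ℝ] ℝ) (c : ℝ), 0 < c ∧
        ∀ q, hess k (e q) = c * l (D q) := by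
  obtain ⟨Φ, l, c, hΦ, hΦ', hc, hl⟩ := exists_homeomorph_hess h.one_le h.le
  obtain ⟨D, hD, hpD, hDs, hconv, hDe, -⟩ := exists_convex_restr
    (transHomeomorph_mem_maximalAtlas h.mem_atlas Φ hΦ hΦ') (p := p) (by simpa using hp) univ_mem
  refine ⟨D, hD, hpD, fun q hq => by simpa using (hDs hq).1, hconv, l, c, hc, fun q => ?_⟩
  rw [hDe, hl]
  rfl

/-- The manifold is covered by charts in which null arcs with arbitrary end velocities exist. -/
theorem IsAFront.exists_chart_reach (hf : IsAFront g f) (hn : 2 ≤ n) (p : M) :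
    ∃ D ∈ IsManifold.maximalAtlas (𝓡 n) ∞ M, p ∈ D.source ∧ Convex ℝ D.target ∧
      ∀ q ∈ D.source, ∀ r ∈ D.source, q ∉ singularSet n f → r ∉ singularSet n f →
        ∀ a b : Euc n, a ≠ 0 → b ≠ 0 →
          ∃ z : Path.Homotopic.Quotient q r, Reach f D.source a b z := by
  by_cases hp : p ∈ singularSet n f
  · obtain ⟨k, hk1, hkn, hsing⟩ := hf.2 p hp
    obtain ⟨e, e', h, hpe, hep⟩ := hsing.exists_isNormalFormOn hk1 hkn
    obtain ⟨D, hD, hpD, hDe, hconv, l, c, hc, hl⟩ := h.exists_chart_linear hpe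
    refine ⟨D, hD, hpD, hconv, ?_⟩
    -- The sign of `σ` selects a side of the hyperplane; its intersection with the convex target is
    -- convex and free of singular points.
    have same : ∀ σ : ℝ, ∀ q ∈ D.source, ∀ r ∈ D.source, 0 < σ * l (D q) → 0 < σ * l (D r) →
        ∀ a b : Euc n, a ≠ 0 → b ≠ 0 →
          ∃ z : Path.Homotopic.Quotient q r, Reach f D.source a b z := by
      intro σ q hq r hr hlq hlr a b ha hb
      refine exists_reach_of_convex hn hD (W := D.target ∩ {x | 0 < σ * l x}) ?_ ?_ inter_subset_left
        (fun x hx => ⟨D.map_target hx.1, fun hS => ?_⟩) hq hr ⟨D.map_source hq, hlq⟩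
        ⟨D.map_source hr, hlr⟩ ha hb
      · exact D.open_target.inter (isOpen_lt continuous_const (by fun_prop))
      · refine hconv.inter ?_
        have := convex_halfSpace_gt (𝕜 := ℝ) (f := fun x => (σ • l) x)
          ⟨fun x y => map_add _ x y, fun t x => map_smul _ t x⟩ 0
        simpa using this
      · have h1 := (h.mem_singularSet_iff hf.1.1 (hDe (D.map_target hx.1))).1 hS
        rw [hl, D.right_inv hx.1] at h1
        have h2 : 0 < σ * l x := hx.2
        rcases mul_eq_zero.1 h1 with h3 | h3
        · exact hc.ne' h3
        · rw [h3, mul_zero] at h2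
          exact h2.false
    have hne : ∀ q ∈ D.source, q ∉ singularSet n f → l (D q) ≠ 0 := fun q hq hS h0 => hS
      ((h.mem_singularSet_iff hf.1.1 (hDe hq)).2 (by rw [hl, h0, mul_zero]))
    obtain ⟨q', r', a', b', hq', hr', ha', hb', hlq', hlr', ⟨z₁, hz₁⟩, z₂, hz₂⟩ :=
      h.exists_reach_crossing hf D.open_source hDe hpD hep
    have hsq' : q' ∉ singularSet n f := fun hS =>
      hlq'.ne ((h.mem_singularSet_iff hf.1.1 (hDe hq')).1 hS)
    have hsr' : r' ∉ singularSet n f := fun hS =>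
      hlr'.ne' ((h.mem_singularSet_iff hf.1.1 (hDe hr')).1 hS)
    rw [hl] at hlq' hlr'
    have hlq'' : l (D q') < 0 := by
      by_contra h0
      exact absurd hlq' (not_lt.2 (mul_nonneg hc.le (not_lt.1 h0)))
    have hlr'' : 0 < l (D r') := (mul_pos_iff_of_pos_left hc).1 hlr'
    intro q hq r hr hqS hrS a b ha hb
    rcases lt_or_gt_of_ne (hne q hq hqS) with h1 | h1 <;>
      rcases lt_or_gt_of_ne (hne r hr hrS) with h2 | h2
    · exact same (-1) q hq r hr (by linarith) (by linarith) a b ha hb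
    · obtain ⟨w₁, hw₁⟩ := same (-1) q hq q' hq' (by linarith) (by linarith) a a' ha ha'
      obtain ⟨w₂, hw₂⟩ := same 1 r' hr' r hr (by linarith) (by linarith) b' b hb' hb
      exact ⟨_, (hw₁.trans hz₁ hsq').trans hw₂ hsr'⟩
    · obtain ⟨w₁, hw₁⟩ := same 1 q hq r' hr' (by linarith) (by linarith) a (-b') ha
        (neg_ne_zero.2 hb')
      obtain ⟨w₂, hw₂⟩ := same (-1) q' hq' r hr (by linarith) (by linarith) (-a') b
        (neg_ne_zero.2 ha') hb
      exact ⟨_, (hw₁.trans hz₂ hsr').trans hw₂ hsq'⟩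
    · exact same 1 q hq r hr (by linarith) (by linarith) a b ha hb
  · obtain ⟨D, hD, hpD, hDs, hconv, -, -⟩ := exists_convex_restr
      (IsManifold.chart_mem_maximalAtlas (I := 𝓡 n) (n := ∞) p) (mem_chart_source _ p)
      ((isClosed_singularSet hf.1.1).isOpen_compl.mem_nhds hp)
    refine ⟨D, hD, hpD, hconv, fun q hq r hr _ _ a b ha hb => ?_⟩
    exact exists_reach_of_convex hn hD D.open_target hconv Subset.rfl
      (fun x hx => ⟨D.map_target hx, (hDs (D.map_target hx)).2⟩) hq hr (D.map_source hq)
      (D.map_source hr) ha hb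

/-- Every loop is homotopic to a null loop, in dimension at least two. -/
theorem exists_isNullLoop_of_two_le {A : Set (OpenPartialHomeomorph M (Euc n))}
    {A' : Set (OpenPartialHomeomorph N (Euc (n + 1)))} (hA : IsOrientedAtlas n A)
    (hA' : IsOrientedAtlas (n + 1) A') (hf : IsAFront g f) (hn : 2 ≤ n) {o : M}
    (ho : o ∉ singularSet n f) (γ : Path o o) :
    ∃ (c : ℝ → M) (hc : IsNullLoop n f o c), loopClass hc.path = loopClass γ := by
  have : LocallyPathConnectedSpace M := ChartedSpace.locallyPathConnectedSpace (Euc n) M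
  have : Nonempty (Fin n) := ⟨⟨0, by omega⟩⟩
  obtain ⟨a, ha⟩ := exists_ne (0 : Euc n)
  -- The induction is over the assertion that the class contains a null arc with initial velocity
  -- `a` and any prescribed nonzero terminal velocity. The next arc can then always be attached with
  -- matching velocity.
  have key := path_induction (X := M) (p := o) hf.dense_compl_singularSet
    (𝒰 := {U | ∃ D ∈ IsManifold.maximalAtlas (𝓡 n) ∞ M, U = D.source ∧ Convex ℝ D.target ∧
      ∀ q ∈ D.source, ∀ r ∈ D.source, q ∉ singularSet n f → r ∉ singularSet n f →
        ∀ a b : Euc n, a ≠ 0 → b ≠ 0 →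
          ∃ z : Path.Homotopic.Quotient q r, Reach f D.source a b z}) ?_ ?_ ho
    (fun {q} z => ∀ b : Euc n, b ≠ 0 → Reach f univ a b z) ?_ ?_ ho γ a ha
  · exact Reach.exists_isNullLoop hA hA' hf (by omega) key ho
  · rintro _ ⟨D, -, rfl, -⟩
    exact D.open_source
  · intro p
    obtain ⟨D, hD, hpD, h⟩ := hf.exists_chart_reach hn p
    exact ⟨_, ⟨D, hD, rfl, h⟩, hpD⟩
  · intro b hb
    obtain ⟨D, hD, hpD, hconv, h⟩ := hf.exists_chart_reach hn o
    obtain ⟨z, hz⟩ := h o hpD o hpD ho ho a b ha hb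
    have h1 := hz.of_chart hconv Subset.rfl (Path.refl o) (by
      rintro _ ⟨t, rfl⟩
      exact hpD)
    exact h1.mono (subset_univ _)
  · rintro q r z σ hq hr hz ⟨_, ⟨D, hD, rfl, hconv, h⟩, hσ⟩ b hb
    obtain ⟨w, hw⟩ := h q (hσ σ.source_mem_range) r (hσ σ.target_mem_range) hq hr a b ha hb
    exact (hz a ha).trans ((hw.of_chart hconv Subset.rfl σ hσ).mono (subset_univ _)) hq

end HighDimension

/-! ### Integral curves and homotopy classes of paths -/

section IntegralCurves

variable {d : ℕ} {X : Type*} [TopologicalSpace X] [ChartedSpace (Euc d) X]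
  [IsManifold (𝓡 d) ∞ X] {v : ∀ x : X, TangentSpace (𝓡 d) x} {c c' : ℝ → X} {t : ℝ}

theorem contDiffAt_of_eventually_hasDerivAt {E : Type*} [NormedAddCommGroup E] [NormedSpace ℝ E]
    {y Y : ℝ → E} {r : ℕ} (h : ∀ᶠ s in 𝓝 t, HasDerivAt y (Y s) s) (hY : ContDiffAt ℝ r Y t) :
    ContDiffAt ℝ (r + 1) y t := by
  refine contDiffAt_succ_iff_hasFDerivAt.2
    ⟨fun s => ContinuousLinearMap.toSpanSingleton ℝ (Y s), ⟨_, h, fun s hs => hs.hasFDerivAt⟩, ?_⟩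
  exact (ContinuousLinearMap.toSpanSingletonCLE (𝕜 := ℝ) (E := E)).contDiff.contDiffAt.comp t hY

theorem velocity_eq_of_isMIntegralCurveAt (hc : IsMIntegralCurveAt c v t) :
    velocity d c t = v (c t) := by
  rw [velocity, hc.hasMFDerivAt.mfderiv]
  exact one_smul ℝ (v (c t))

/-- Integral curves in charts. -/
theorem contDiffAt_chart_of_isMIntegralCurveAt
    (hv : ContMDiff (𝓡 d) (𝓡 d).tangent ∞ fun x => (⟨x, v x⟩ : TangentBundle (𝓡 d) X))
    (hc : IsMIntegralCurveAt c v t) {e : OpenPartialHomeomorph X (Euc d)}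
    (he : e ∈ IsManifold.maximalAtlas (𝓡 d) ∞ X) (ht : c t ∈ e.source) :
    ContDiffAt ℝ 2 (fun s => e (c s)) t ∧ HasDerivAt (fun s => e (c s)) (chartDeriv e (c t) (v (c t))) t := by
  have hev : ∀ᶠ s in 𝓝 t, c s ∈ e.source :=
    hc.continuousAt.eventually (e.open_source.eventually_mem ht)
  have hder : ∀ᶠ s in 𝓝 t, HasDerivAt (fun s => e (c s)) (chartDeriv e (c s) (v (c s))) s := by
    filter_upwards [hev, eventually_eventually_nhds.2 hc] with s hs hcs
    have h1 := hasDerivAt_chart he hs (IsMIntegralCurveAt.hasMFDerivAt hcs).mdifferentiableAt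
    rwa [velocity_eq_of_isMIntegralCurveAt hcs] at h1
  set V : Euc d → Euc d := fun z => chartDeriv e (e.symm z) (v (e.symm z)) with hV
  have hVc : ContDiffAt ℝ ∞ V (e (c t)) := by
    rw [← contMDiffAt_iff_contDiffAt]
    have hes : ContMDiffAt (𝓡 d) (𝓡 d) ∞ e.symm (e (c t)) :=
      contMDiffAt_symm_of_mem_maximalAtlas he (e.map_source ht)
    exact contMDiffAt_chartDeriv (F := e.symm) (ν := fun z => v (e.symm z)) (r := ∞) (by norm_cast)
      he (by rwa [e.left_inv ht]) (hv.contMDiffAt.comp _ hes)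
  have hcont : ∀ᶠ s in 𝓝 t, ContinuousAt (fun s => e (c s)) s :=
    hder.mono fun s hs => hs.continuousAt
  have hY : (fun s => chartDeriv e (c s) (v (c s))) =ᶠ[𝓝 t] fun s => V (e (c s)) := by
    filter_upwards [hev] with s hs
    rw [hV]
    have haux : ∀ q q' : X, q = q' →
        (chartDeriv e q (v q) : Euc d) = chartDeriv e q' (v q') := by
      rintro q _ rfl; rfl
    exact haux _ _ (e.left_inv hs).symm
  have h0 : ContDiffAt ℝ 0 (fun s => e (c s)) t :=
    contDiffAt_zero.2 ⟨_, hcont, fun s hs => ContinuousAt.continuousWithinAt hs⟩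
  -- Bootstrapping in the equation `y' = V y`: each degree of smoothness of `y` gives the next one.
  have h1 : ContDiffAt ℝ (0 + 1) (fun s => e (c s)) t :=
    contDiffAt_of_eventually_hasDerivAt (r := 0) hder
      ((ContDiffAt.comp (g := V) t (hVc.of_le (by simp)) h0).congr_of_eventuallyEq hY)
  have h2 : ContDiffAt ℝ (1 + 1) (fun s => e (c s)) t :=
    contDiffAt_of_eventually_hasDerivAt (r := 1) hder
      ((ContDiffAt.comp (g := V) t (hVc.of_le (show (1 : ℕ∞ω) ≤ ∞ by norm_cast))
        (by simpa using h1)).congr_of_eventuallyEq hY)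
  exact ⟨by simpa [one_add_one_eq_two] using h2, hder.self_of_nhds⟩

theorem contMDiffAt_of_isMIntegralCurveAt
    (hv : ContMDiff (𝓡 d) (𝓡 d).tangent ∞ fun x => (⟨x, v x⟩ : TangentBundle (𝓡 d) X))
    (hc : IsMIntegralCurveAt c v t) : ContMDiffAt 𝓘(ℝ, ℝ) (𝓡 d) 2 c t := by
  have he := IsManifold.chart_mem_maximalAtlas (I := 𝓡 d) (n := ∞) (c t)
  have ht := mem_chart_source (Euc d) (c t)
  generalize chartAt (Euc d) (c t) = e at he ht
  have h1 := (contDiffAt_chart_of_isMIntegralCurveAt hv hc he ht).1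
  refine (contMDiffAt_chart_symm (by norm_cast) he h1 (e.map_source ht)).congr_of_eventuallyEq ?_
  filter_upwards [hc.continuousAt.eventually (e.open_source.eventually_mem ht)] with s hs
  exact (e.left_inv hs).symm

/-- The homotopy class `z` contains an arc of an integral curve of `v`, run through forwards or
backwards. -/
def FlowsTo (v : ∀ x : X, TangentSpace (𝓡 d) x) {p q : X} (z : Path.Homotopic.Quotient p q) :
    Prop :=
  ∃ (a b T : ℝ) (c : ℝ → X) (γ : Path p q), IsMIntegralCurveOn c v (Ioo a b) ∧ 0 ∈ Ioo a b ∧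
    T ∈ Ioo a b ∧ (∀ t : unitInterval, γ t = c (T * t)) ∧ Path.Homotopic.Quotient.mk γ = z

/-- After a time shift the second integral curve agrees with the first at `T`, so by uniqueness the
two form one integral curve on the union of the intervals. The concatenated path may run back and
forth on it, but is homotopic to the direct run, the interval being convex. -/
theorem FlowsTo.trans [T2Space X]
    (hv : ContMDiff (𝓡 d) (𝓡 d).tangent ∞ fun x => (⟨x, v x⟩ : TangentBundle (𝓡 d) X))
    {p q r : X} {z : Path.Homotopic.Quotient p q} (h : FlowsTo v z) {a' b' s s' : ℝ}
    (hc' : IsMIntegralCurveOn c' v (Ioo a' b')) (hs : s ∈ Ioo a' b') (hs' : s' ∈ Ioo a' b')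
    (σ : Path q r) (hσ : ∀ t : unitInterval, σ t = c' (s + (s' - s) * t)) :
    FlowsTo v (z.trans (Path.Homotopic.Quotient.mk σ)) := by
  obtain ⟨a, b, T, c, γ, hc, h0, hT, hγ, rfl⟩ := h
  have hv1 := hv.of_le (show (1 : ℕ∞ω) ≤ ∞ by norm_cast)
  set c₂ : ℝ → X := c' ∘ (· + (s - T)) with hc₂
  have hc₂i : IsMIntegralCurveOn c₂ v (Ioo (a' - (s - T)) (b' - (s - T))) := by
    refine (hc'.comp_add (s - T)).mono fun t ht => ?_
    exact ⟨by linarith [ht.1], by linarith [ht.2]⟩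
  have hT2 : T ∈ Ioo a b ∩ Ioo (a' - (s - T)) (b' - (s - T)) :=
    ⟨hT, by linarith [hs.1], by linarith [hs.2]⟩
  have hTc : c T = c₂ T := by
    have h1 : γ 1 = c (T * 1) := by simpa using hγ 1
    have h2 : σ 0 = c' (s + (s' - s) * 0) := by simpa using hσ 0
    rw [γ.target, mul_one] at h1
    rw [σ.source, mul_zero, add_zero] at h2
    rw [← h1, hc₂, Function.comp, add_sub_cancel, ← h2]
  have hunion : Ioo a b ∪ Ioo (a' - (s - T)) (b' - (s - T)) =
      Ioo (min a (a' - (s - T))) (max b (b' - (s - T))) :=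
    Ioo_union_Ioo' (hT2.2.1.trans hT2.1.2) (hT2.1.1.trans hT2.2.2)
  classical
  set c₃ : ℝ → X := piecewise (Ioo a b) c c₂ with hc₃
  have hc₃i : IsMIntegralCurveOn c₃ v (Ioo (min a (a' - (s - T))) (max b (b' - (s - T)))) := by
    rw [← hunion]
    exact isMIntegralCurveOn_piecewise hv1 hc hc₂i hT2 hTc
  have heq₁ : EqOn c₃ c (Ioo a b) := piecewise_eqOn _ _ _
  have heq₂ : EqOn c₃ c₂ (Ioo (a' - (s - T)) (b' - (s - T))) :=
    eqOn_piecewise_of_isMIntegralCurveOn_Ioo hv1 hc hc₂i hT2 hTc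
  set T' : ℝ := T + (s' - s) with hT'
  have hT'm : T' ∈ Ioo (a' - (s - T)) (b' - (s - T)) :=
    ⟨by rw [hT']; linarith [hs'.1], by rw [hT']; linarith [hs'.2]⟩
  have hm : ∀ {x y u w : ℝ} (t : unitInterval), u ∈ Ioo x y → w ∈ Ioo x y →
      u + (w - u) * t ∈ Ioo x y := by
    intro x y u w t hu hw
    have := (convex_Ioo x y) hu hw (sub_nonneg.2 t.2.2) t.2.1 (by ring)
    simpa only [smul_eq_mul, show (1 - (t : ℝ)) * u + t * w = u + (w - u) * t by ring] using this
  let P₁ : Path (0 : ℝ) T := ⟨⟨fun t => T * t, by fun_prop⟩, by simp, by simp⟩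
  let P₂ : Path T T' := ⟨⟨fun t => T + (T' - T) * t, by fun_prop⟩, by simp, by simp⟩
  have hP₁ : ∀ t, P₁ t ∈ Ioo a b := fun t => by
    have := hm t h0 hT
    rwa [zero_add, sub_zero] at this
  have hP₂ : ∀ t, P₂ t ∈ Ioo (a' - (s - T)) (b' - (s - T)) := fun t => hm t hT2.2 hT'm
  have hγ₃ : ∀ t, γ t = c₃ (P₁ t) := fun t => (hγ t).trans (heq₁ (hP₁ t)).symm
  have hσ₃ : ∀ t, σ t = c₃ (P₂ t) := fun t => by
    rw [heq₂ (hP₂ t), hσ]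
    change c' _ = c' (T + (T' - T) * t + (s - T))
    congr 1
    rw [hT']; ring
  have h0' : (0 : ℝ) ∈ Ioo (min a (a' - (s - T))) (max b (b' - (s - T))) :=
    hunion ▸ Or.inl h0
  have hT'' : T' ∈ Ioo (min a (a' - (s - T))) (max b (b' - (s - T))) :=
    hunion ▸ Or.inr hT'm
  have hP : ∀ t : unitInterval, T' * t ∈ Ioo (min a (a' - (s - T))) (max b (b' - (s - T))) :=
    fun t => by
      have := hm t h0' hT''
      rwa [zero_add, sub_zero] at this
  let Γ : Path p r := ⟨⟨fun t => c₃ (T' * t), hc₃i.continuousOn.comp_continuous (by fun_prop) hP⟩,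
    by
      have h1 := hγ₃ 0
      simp only [P₁.source, γ.source] at h1
      simpa using h1.symm, by
      have h1 := hσ₃ 1
      simp only [P₂.target, σ.target] at h1
      simpa using h1.symm⟩
  refine ⟨_, _, T', c₃, Γ, hc₃i, h0', hT'', fun t => rfl, ?_⟩
  rw [← Path.Homotopic.Quotient.mk_trans, Path.Homotopic.Quotient.eq]
  refine homotopic_of_convex (convex_Ioo _ _) hc₃i.continuousOn (φ := fun t => T' * t)
    (φ' := P₁.trans P₂) (by fun_prop) (P₁.trans P₂).continuous hP (fun t => ?_) (by simp) (by simp)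
    (fun t => rfl) fun t => ?_
  · rw [Path.trans_apply, ← hunion]
    split_ifs
    · exact Or.inl (hP₁ _)
    · exact Or.inr (hP₂ _)
  · rw [Path.trans_apply, Path.trans_apply]
    split_ifs
    · exact hγ₃ _
    · exact hσ₃ _

end IntegralCurves

/-! ### Loops of one-dimensional manifolds -/

section OneDimensional

theorem coord_eq_zero_of_le {d : ℕ} (x : Euc d) {j : ℕ} (hj : d ≤ j) : coord x j = 0 := by
  unfold coord
  rw [dif_neg (by omega)]

theorem eq_coord_smul_basisVec (x : Euc 1) : x = coord x 0 • basisVec 1 0 := by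
  refine coord_ext fun j hj => ?_
  obtain rfl : j = 0 := by omega
  rw [coord_smul, coord_basisVec one_pos, if_pos rfl, mul_one]

theorem det_eq_coord (L : Euc 1 →L[ℝ] Euc 1) : L.det = coord (L (basisVec 1 0)) 0 := by
  have h1 : L = coord (L (basisVec 1 0)) 0 • ContinuousLinearMap.id ℝ (Euc 1) := by
    ext1 x
    rw [_root_.smul_apply, ContinuousLinearMap.id_apply]
    conv_lhs => rw [eq_coord_smul_basisVec x, map_smul, eq_coord_smul_basisVec (L (basisVec 1 0)),
      smul_comm, ← eq_coord_smul_basisVec x]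
  conv_lhs => rw [h1]
  rw [ContinuousLinearMap.det, ContinuousLinearMap.toLinearMap_smul, LinearMap.det_smul]
  simp

variable {M : Type*} [TopologicalSpace M] [ChartedSpace (Euc 1) M] [IsManifold (𝓡 1) ∞ M]

/-- An oriented `1`-manifold has a nowhere vanishing vector field. -/
theorem IsOrientedAtlas.exists_vectorField [T2Space M] [SecondCountableTopology M]
    {A : Set (OpenPartialHomeomorph M (Euc 1))} (hA : IsOrientedAtlas 1 A) :
    ∃ v : ∀ x : M, TangentSpace (𝓡 1) x,
      ContMDiff (𝓡 1) (𝓡 1).tangent ∞ (fun x => (⟨x, v x⟩ : TangentBundle (𝓡 1) M)) ∧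
        ∀ x, (v x : Euc 1) ≠ 0 := by
  have : LocallyCompactSpace M := ChartedSpace.locallyCompactSpace (Euc 1) M
  -- The vectors that are positive in all oriented charts form a convex set and have local smooth
  -- sections. A partition of unity then gives a global section, which cannot vanish.
  set P : ∀ x : M, Set (TangentSpace (𝓡 1) x) := fun x =>
    {w | ∀ e ∈ A, x ∈ e.source → 0 < coord (chartDeriv e x w) 0} with hP
  have hconv : ∀ x, Convex ℝ (P x) := by
    intro x w hw w' hw' a b ha hb hab e he hx
    rw [map_add, map_smul, map_smul, coord_add, coord_smul, coord_smul]
    have h1 := hw e he hx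
    have h2 := hw' e he hx
    rcases ha.eq_or_lt with rfl | ha
    · rw [zero_add] at hab
      rw [hab]; simpa using h2
    · have := mul_pos ha h1
      have := mul_nonneg hb h2.le
      linarith
  have hloc : ∀ x₀ : M, ∃ U ∈ 𝓝 x₀, ∃ s : ∀ x : M, TangentSpace (𝓡 1) x,
      ContMDiffOn (𝓡 1) (𝓡 1).tangent ∞ (fun x => (⟨x, s x⟩ : TangentBundle (𝓡 1) M)) U ∧
        ∀ y ∈ U, s y ∈ P y := by
    intro x₀
    obtain ⟨e, he, hx₀⟩ := hA.cover x₀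
    have hem := hA.subset he
    have hsymm : ∀ x ∈ e.source, ∀ w : Euc 1,
        (⟨e.symm (e x), chartDerivSymm e (e x) w⟩ : TangentBundle (𝓡 1) M) =
          ⟨x, (chartDerivSymm e (e x) w : Euc 1)⟩ := by
      intro x hx w
      have haux : ∀ (q q' : M) (u : Euc 1), q = q' →
          (⟨q, u⟩ : TangentBundle (𝓡 1) M) = ⟨q', u⟩ := by
        rintro q _ u rfl; rfl
      exact haux _ _ _ (e.left_inv hx)
    refine ⟨e.source, e.open_source.mem_nhds hx₀, fun x => (chartDerivSymm e (e x) (basisVec 1 0) : Euc 1),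
      ?_, fun x hx e' he' hx' => ?_⟩
    · exact ((contMDiffOn_chartDerivSymm hem (basisVec 1 0)).comp
        (contMDiffOn_of_mem_maximalAtlas hem) fun x hx => e.map_source hx).congr
        fun x hx => (hsymm x hx _).symm
    · obtain ⟨u, hu⟩ := chartDeriv_surjective hem hx (basisVec 1 0)
      have h1 : (chartDerivSymm e (e x) (basisVec 1 0) : Euc 1) = u := by
        rw [← hu]; exact chartDerivSymm_chartDeriv hem hx u
      have h2 : (0 : ℝ) < coord (chartDeriv e' x u) 0 := by
        rw [chartDeriv_coordChange hem (hA.subset he') hx hx', hu, ← det_eq_coord]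
        exact hA.det_pos he he' hx hx'
      have h3 : (chartDeriv e' x : Euc 1 →L[ℝ] Euc 1) (chartDerivSymm e (e x) (basisVec 1 0) : Euc 1) =
        chartDeriv e' x u := congrArg (chartDeriv e' x : Euc 1 →L[ℝ] Euc 1) h1
      exact h2.trans_eq (congrArg (fun z => coord z 0) h3.symm)
  obtain ⟨s, hs⟩ := exists_contMDiffSection_forall_mem_convex_of_local (n := (⊤ : ℕ∞)) (𝓡 1)
    (F_fiber := Euc 1) (TangentSpace (𝓡 1) : M → Type _) P hconv hloc
  refine ⟨s, s.contMDiff, fun x h0 => ?_⟩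
  obtain ⟨e, he, hx⟩ := hA.cover x
  have h1 := hs x e he hx
  have h2 : (chartDeriv e x (s x) : Euc 1) = 0 :=
    (congrArg (chartDeriv e x : Euc 1 →L[ℝ] Euc 1) h0).trans (map_zero (chartDeriv e x))
  rw [h2, coord_zero] at h1
  exact h1.false

variable {v : ∀ x : M, TangentSpace (𝓡 1) x}

/-- The integral curves of a nowhere vanishing vector field on a `1`-manifold are local
parametrizations. -/
theorem exists_integralCurve_chart
    (hv : ContMDiff (𝓡 1) (𝓡 1).tangent ∞ fun x => (⟨x, v x⟩ : TangentBundle (𝓡 1) M))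
    (hv0 : ∀ x, (v x : Euc 1) ≠ 0) (p : M) :
    ∃ D ∈ IsManifold.maximalAtlas (𝓡 1) ∞ M, Convex ℝ D.target ∧
      ∃ (U : Set M) (c : ℝ → M) (a b : ℝ), IsOpen U ∧ p ∈ U ∧ U ⊆ D.source ∧
        IsMIntegralCurveOn c v (Ioo a b) ∧ (∀ t ∈ Ioo a b, c t ∈ D.source) ∧
          U ⊆ c '' Ioo a b := by
  obtain ⟨D, hD, hpD, -, hconv, -, -⟩ := exists_convex_restr
    (IsManifold.chart_mem_maximalAtlas (I := 𝓡 1) (n := ∞) p) (mem_chart_source _ p) univ_mem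
  obtain ⟨c, hc0, hc⟩ := exists_isMIntegralCurveAt_of_contMDiffAt_boundaryless (t₀ := 0)
    (hv.contMDiffAt (x := p) |>.of_le (show (1 : ℕ∞ω) ≤ ∞ by norm_cast))
  have hcD : c 0 ∈ D.source := by rwa [hc0]
  have hev : ∀ᶠ t in 𝓝 (0 : ℝ), c t ∈ D.source ∧ IsMIntegralCurveAt c v t :=
    (hc.continuousAt.eventually (D.open_source.eventually_mem hcD)).and
      (eventually_eventually_nhds.2 hc)
  obtain ⟨δ, hδ, hball⟩ := Metric.eventually_nhds_iff.1 hev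
  have hmem : ∀ t ∈ Ioo (-δ) δ, c t ∈ D.source ∧ IsMIntegralCurveAt c v t := fun t ht =>
    hball (by rw [dist_zero_right, Real.norm_eq_abs]; exact abs_lt.2 ht)
  obtain ⟨h1, h2⟩ := contDiffAt_chart_of_isMIntegralCurveAt hv hc hD hcD
  -- A nonzero velocity spans the one-dimensional target, so the strict derivative is onto and the
  -- curve covers a neighbourhood of `p`.
  have h3 : HasStrictFDerivAt (fun s => D (c s))
      (ContinuousLinearMap.toSpanSingleton ℝ (chartDeriv D (c 0) (v (c 0)))) 0 :=
    h1.hasStrictFDerivAt' h2.hasFDerivAt (by norm_num)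
  have hne : coord (chartDeriv D (c 0) (v (c 0))) 0 ≠ 0 := by
    intro h0
    have h4 : chartDeriv D (c 0) (v (c 0)) = 0 :=
      (eq_coord_smul_basisVec _).trans (by rw [h0, zero_smul])
    exact hv0 (c 0) (chartDeriv_injective hD hcD (h4.trans (map_zero _).symm))
  have hsurj : (ContinuousLinearMap.toSpanSingleton ℝ (chartDeriv D (c 0) (v (c 0)))).range = ⊤ := by
    refine LinearMap.range_eq_top.2 fun y =>
      ⟨coord y 0 / coord (chartDeriv D (c 0) (v (c 0))) 0, ?_⟩
    refine coord_ext fun j hj => ?_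
    obtain rfl : j = 0 := by omega
    change coord ((coord y 0 / coord (chartDeriv D (c 0) (v (c 0))) 0) •
      (chartDeriv D (c 0) (v (c 0)) : Euc 1)) 0 = coord y 0
    rw [coord_smul, div_mul_cancel₀ _ hne]
  have hnhds : (fun s => D (c s)) '' Ioo (-δ) δ ∈ 𝓝 (D (c 0)) := by
    rw [← h3.map_nhds_eq_of_surj hsurj]
    exact image_mem_map (Ioo_mem_nhds (by linarith) hδ)
  refine ⟨D, hD, hconv, interior (c '' Ioo (-δ) δ), c, -δ, δ, isOpen_interior, ?_, ?_,
    IsMIntegralCurveAt.isMIntegralCurveOn fun t ht => (hmem t ht).2, fun t ht => (hmem t ht).1,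
    interior_subset⟩
  · rw [mem_interior_iff_mem_nhds]
    rw [hc0] at hnhds
    filter_upwards [(D.continuousAt hpD).preimage_mem_nhds hnhds, D.open_source.mem_nhds hpD]
      with q hq hqD
    obtain ⟨t, ht, htq⟩ := hq
    exact ⟨t, ht, D.injOn (hmem t ht).1 hqD htq⟩
  · intro q hq
    obtain ⟨t, ht, rfl⟩ := interior_subset hq
    exact (hmem t ht).1

/-- In a `1`-manifold every path is homotopic to an arc of an integral curve. -/
theorem flowsTo_mk [T2Space M]
    (hv : ContMDiff (𝓡 1) (𝓡 1).tangent ∞ fun x => (⟨x, v x⟩ : TangentBundle (𝓡 1) M))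
    (hv0 : ∀ x, (v x : Euc 1) ≠ 0) {p q : M} (γ : Path p q) :
    FlowsTo v (Path.Homotopic.Quotient.mk γ) := by
  have : LocallyPathConnectedSpace M := ChartedSpace.locallyPathConnectedSpace (Euc 1) M
  refine path_induction (X := M) (p := p) (G := univ) dense_univ
    (𝒰 := {U | ∃ D ∈ IsManifold.maximalAtlas (𝓡 1) ∞ M, Convex ℝ D.target ∧
      ∃ (c : ℝ → M) (a b : ℝ), IsOpen U ∧ U ⊆ D.source ∧
        IsMIntegralCurveOn c v (Ioo a b) ∧ (∀ t ∈ Ioo a b, c t ∈ D.source) ∧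
          U ⊆ c '' Ioo a b}) ?_ ?_ (mem_univ p) (fun {q} z => FlowsTo v z) ?_ ?_ (mem_univ q) γ
  · rintro U ⟨D, -, -, c, a, b, hU, -⟩
    exact hU
  · intro x
    obtain ⟨D, hD, hconv, U, c, a, b, hU, hxU, h⟩ := exists_integralCurve_chart hv hv0 x
    exact ⟨U, ⟨D, hD, hconv, c, a, b, hU, h⟩, hxU⟩
  · obtain ⟨c, hc0, hc⟩ := exists_isMIntegralCurveAt_of_contMDiffAt_boundaryless (t₀ := 0)
      (hv.contMDiffAt (x := p) |>.of_le (show (1 : ℕ∞ω) ≤ ∞ by norm_cast))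
    obtain ⟨ε, hε, hcε⟩ := isMIntegralCurveAt_iff'.1 hc
    rw [Real.ball_eq_Ioo] at hcε
    exact ⟨_, _, 0, c, Path.refl p, hcε, by simpa using hε, by simpa using hε,
      fun t => by simp [hc0], rfl⟩
  · rintro q r z σ - - hz ⟨U, ⟨D, hD, hconv, c, a, b, hU, hUD, hc, hcD, hUc⟩, hσ⟩
    obtain ⟨s, hs, hsq⟩ := hUc (hσ σ.source_mem_range)
    obtain ⟨s', hs', hsr⟩ := hUc (hσ σ.target_mem_range)
    have hm : ∀ t : unitInterval, s + (s' - s) * t ∈ Ioo a b := fun t => by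
      have := (convex_Ioo a b) hs hs' (sub_nonneg.2 t.2.2) t.2.1 (by ring)
      simpa only [smul_eq_mul, show (1 - (t : ℝ)) * s + t * s' = s + (s' - s) * t by ring]
        using this
    let τ : Path q r := ⟨⟨fun t => c (s + (s' - s) * t),
      hc.continuousOn.comp_continuous (by fun_prop) hm⟩, by simpa using hsq, by simpa using hsr⟩
    -- Inside a chart with convex target, the given path may be replaced by the arc of the integral
    -- curve between its ends.
    have h1 : Path.Homotopic.Quotient.mk σ = Path.Homotopic.Quotient.mk τ :=
      Path.Homotopic.Quotient.eq.2 (homotopic_of_chart hconv (hσ.trans hUD) (by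
        rintro _ ⟨t, rfl⟩
        exact hcD _ (hm t)))
    rw [h1]
    exact hz.trans hv hc hs hs' τ fun t => rfl

variable {N : Type*} [TopologicalSpace N] [ChartedSpace (Euc (1 + 1)) N] [IsManifold (𝓡 (1 + 1)) ∞ N]
  {g : RiemMetric (1 + 1) N} {f : M → N}

/-- In dimension one every singular point is of type `A₂`, and there `df` vanishes altogether. So
the null condition holds for every regular curve of class `C^2`. -/
theorem IsAFront.nullAt_of_isMIntegralCurveAt (hf : IsAFront g f)
    (hv : ContMDiff (𝓡 1) (𝓡 1).tangent ∞ fun x => (⟨x, v x⟩ : TangentBundle (𝓡 1) M))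
    (hv0 : ∀ x, (v x : Euc 1) ≠ 0) {c : ℝ → M} {t : ℝ} (hc : IsMIntegralCurveAt c v t) :
    NullAt 1 f c t := by
  have h2 := contMDiffAt_of_isMIntegralCurveAt hv hc
  refine ⟨h2.of_le (by norm_num), fun h0 => hv0 (c t)
    ((velocity_eq_of_isMIntegralCurveAt hc).symm.trans h0), fun hS => ?_⟩
  obtain ⟨k, hk1, hkn, hsing⟩ := hf.2 _ hS
  obtain rfl : k = 1 := by omega
  refine ⟨?_, hsing, h2⟩
  obtain ⟨e, e', h, hte, -⟩ := hsing.exists_isNormalFormOn le_rfl le_rfl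
  have h0 := (h.mem_singularSet_iff hf.1.1 hte).1 hS
  refine chartDeriv_injective h.mem_atlas' (h.mapsTo hte) ?_
  rw [h.chartDeriv_mfderiv hf.1.1 hte, map_zero, germDeriv_eq_zero_iff h.pos h.one_le h.le, h0,
    zero_mul]
  exact ⟨fun j hj => coord_eq_zero_of_le _ hj, rfl⟩

/-- Every loop of a `1`-manifold is trivial or homotopic to a null loop or the inverse of one. -/
theorem exists_isNullLoop_of_one [T2Space M] [SecondCountableTopology M]
    {A : Set (OpenPartialHomeomorph M (Euc 1))}
    {A' : Set (OpenPartialHomeomorph N (Euc (1 + 1)))} (hA : IsOrientedAtlas 1 A)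
    (hA' : IsOrientedAtlas (1 + 1) A') (hf : IsAFront g f) {o : M}
    (ho : o ∉ singularSet 1 f) (γ : Path o o) :
    loopClass γ = 1 ∨ ∃ (c : ℝ → M) (hc : IsNullLoop 1 f o c),
      loopClass hc.path = loopClass γ ∨ loopClass hc.path = (loopClass γ)⁻¹ := by
  obtain ⟨v, hv, hv0⟩ := hA.exists_vectorField
  obtain ⟨a, b, T, c, γ', hc, h0, hT, hγ', hγ⟩ := flowsTo_mk hv hv0 γ
  have hcls : loopClass γ = FundamentalGroup.fromPath (Path.Homotopic.Quotient.mk γ') := by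
    rw [loopClass, hγ]
  have hat := (isMIntegralCurveOn_iff_isMIntegralCurveAt isOpen_Ioo).1 hc
  have hc0 : c 0 = o := by simpa using (hγ' 0).symm
  have hcT : c T = o := by simpa using (hγ' 1).symm
  have hvel : ∀ s ∈ Ioo a b, c s = o → (velocity 1 c s : Euc 1) = v o := by
    rintro s hs rfl
    exact velocity_eq_of_isMIntegralCurveAt (hat s hs)
  -- The sign of the time `T` decides whether the loop runs along the vector field or against it. In
  -- the latter case its reverse is the null loop.
  rcases lt_trichotomy T 0 with hneg | rfl | hpos
  · right
    have hreach : Reach f univ (v o) (v o) (Path.Homotopic.Quotient.mk γ'.symm) := by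
      have hmem : ∀ t ∈ Icc 0 (-T), 1 * t + T ∈ Ioo a b := fun t ht =>
        ⟨by linarith [ht.1, hT.1], by linarith [ht.2, h0.2]⟩
      have hvel' : ∀ t ∈ Icc 0 (-T), c (1 * t + T) = o →
          (velocity 1 (fun s => c (1 * s + T)) t : Euc 1) = v o := by
        intro t ht hto
        have h1 := velocity_comp_affine (a := 1) (b := T)
          (hat _ (hmem t ht)).hasMFDerivAt.mdifferentiableAt
        rw [one_smul] at h1
        exact h1.trans (hvel _ (hmem t ht) hto)
      refine ⟨fun s => c (1 * s + T), -T, γ'.symm, by linarith, fun t ht => ⟨?_, mem_univ _⟩,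
        hvel' 0 ⟨le_rfl, by linarith⟩ (by simpa using hcT),
        hvel' (-T) ⟨by linarith, le_rfl⟩ (by simpa using hc0), fun t => ?_, rfl⟩
      · exact (hf.nullAt_of_isMIntegralCurveAt hv hv0 (hat _ (hmem t ht))).comp_affine one_ne_zero
      · change γ' (unitInterval.symm t) = _
        rw [hγ', unitInterval.coe_symm_eq]
        congr 1; ring
    obtain ⟨C, hC, h1⟩ := hreach.exists_isNullLoop hA hA' hf one_pos ho
    exact ⟨C, hC, Or.inr (by rw [h1, hcls]; rfl)⟩
  · left
    have h1 : γ' = Path.refl o := by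
      ext t
      simp [hγ', hc0]
    rw [hcls, h1]; rfl
  · right
    have hmem : ∀ t ∈ Icc 0 T, t ∈ Ioo a b := fun t ht =>
      ⟨by linarith [ht.1, h0.1], by linarith [ht.2, hT.2]⟩
    have hreach : Reach f univ (v o) (v o) (Path.Homotopic.Quotient.mk γ') :=
      ⟨c, T, γ', hpos, fun t ht =>
        ⟨hf.nullAt_of_isMIntegralCurveAt hv hv0 (hat t (hmem t ht)), mem_univ _⟩,
        hvel 0 h0 hc0, hvel T hT hcT, hγ', rfl⟩
    obtain ⟨C, hC, h1⟩ := hreach.exists_isNullLoop hA hA' hf one_pos ho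
    exact ⟨C, hC, Or.inl (by rw [h1, hcls])⟩

end OneDimensional

/-- Every loop is trivial or homotopic to a null loop or the inverse of one. -/
theorem exists_isNullLoop {n : ℕ} (hn : 0 < n)
    {M : Type*} [TopologicalSpace M] [T2Space M] [SecondCountableTopology M]
    [ChartedSpace (Euc n) M] [IsManifold (𝓡 n) ∞ M]
    {N : Type*} [TopologicalSpace N] [ChartedSpace (Euc (n + 1)) N] [IsManifold (𝓡 (n + 1)) ∞ N]
    {g : RiemMetric (n + 1) N} {f : M → N} {A : Set (OpenPartialHomeomorph M (Euc n))}
    {A' : Set (OpenPartialHomeomorph N (Euc (n + 1)))} (hA : IsOrientedAtlas n A)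
    (hA' : IsOrientedAtlas (n + 1) A') (hf : IsAFront g f) {o : M}
    (ho : o ∉ singularSet n f) (γ : Path o o) :
    loopClass γ = 1 ∨ ∃ (c : ℝ → M) (hc : IsNullLoop n f o c),
      loopClass hc.path = loopClass γ ∨ loopClass hc.path = (loopClass γ)⁻¹ := by
  rcases (show 1 ≤ n from hn).eq_or_lt with rfl | h2
  · exact exists_isNullLoop_of_one hA hA' hf ho γ
  · obtain ⟨c, hc, h⟩ := exists_isNullLoop_of_two_le hA hA' hf h2 ho γ
    exact Or.inr ⟨c, hc, Or.inl h⟩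

end FrontMaslov

theorem mainTheorem10 {n : ℕ} (hn : 0 < n)
    {M : Type*} [TopologicalSpace M] [T2Space M] [SecondCountableTopology M]
    [ChartedSpace (Euc n) M] [IsManifold (𝓡 n) ∞ M]
    {N : Type*} [TopologicalSpace N] [T2Space N] [SecondCountableTopology N]
    [ChartedSpace (Euc (n + 1)) N] [IsManifold (𝓡 (n + 1)) ∞ N]
    (hM : IsOrientable n M) (hN : IsOrientable (n + 1) N)
    (g : RiemMetric (n + 1) N) (f : M → N) (hf : IsAFront g f)
    (o : M) (ho : o ∉ singularSet n f)
    (ν₀ : TangentSpace (𝓡 (n + 1)) (f o)) (hν₀ : IsUnitNormalAt g f o ν₀) :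
    (∀ (c : ℝ → M) (hc : IsNullLoop n f o c), IsCoorientable g f hc.path →
      ∃ (C : unitInterval → ℙ ℝ (ℝ × ℝ)) (μ : ℤ),
        (∀ C', IsNormalCurvatureMap g f ν₀ c C' ↔ C' = C) ∧
        (∀ μ', HasRotationIndex C μ' ↔ μ' = μ) ∧
        ∀ z, HasZigzagNumber g f ν₀ c z ↔ z = μ.natAbs) ∧
    ∃ H : Subgroup (FundamentalGroup M o),
      (∀ γ : Path o o, loopClass γ ∈ H ↔ IsCoorientable g f γ) ∧
      ∃! ρ : H →* Multiplicative ℤ,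
        ∀ (c : ℝ → M) (hc : IsNullLoop n f o c) (hH : loopClass hc.path ∈ H)
          (C : unitInterval → ℙ ℝ (ℝ × ℝ)) (μ : ℤ),
          IsNormalCurvatureMap g f ν₀ c C → HasRotationIndex C μ →
            ρ ⟨loopClass hc.path, hH⟩ = Multiplicative.ofAdd μ := by
  obtain ⟨A, hA1, hA2, hA3⟩ := hM
  obtain ⟨A', hA1', hA2', hA3'⟩ := hN
  have hA : IsOrientedAtlas n A := ⟨hA1, hA2, hA3⟩
  have hA' : IsOrientedAtlas (n + 1) A' := ⟨hA1', hA2', hA3'⟩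
  -- The given normal is encoded by a point `m` of the fibre over `o`; all lifts start there.
  obtain ⟨m, rfl⟩ := exists_heightNormal_eq (hA := hA) (hA' := hA') (hf := hf) hν₀
  have hlift : ∀ (c : ℝ → M) (hc : IsNullLoop n f o c), ∃ ℓ : ℝ → ℤ, IsHeightLift hA hA' hf c ℓ ∧
      ℓ 0 = m ∧ (IsCoorientable g f hc.path ↔ Even (ℓ 1 - ℓ 0)) ∧
      holonomy hA hA' hf (loopClass hc.path) m = ℓ 1 := by
    intro c hc
    obtain ⟨ℓ, hℓ, h0⟩ := exists_isHeightLift hA hA' hf hc.contMDiff.continuous (0 : ℝ) m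
    have h1 : IsHeightLift hA hA' hf hc.path fun t => ℓ t :=
      hℓ.comp (φ := fun t : unitInterval => (t : ℝ)) continuous_subtype_val
    have h2 := h1.isCoorientable_iff
    have h3 := h1.holonomy_eq
    simp only [Icc.coe_zero, Icc.coe_one] at h2 h3
    exact ⟨ℓ, hℓ, h0, h2, h0 ▸ h3⟩
  refine ⟨fun c hc hco => ?_, evenSubgroup hA hA' hf o m,
    fun γ => loopClass_mem_evenSubgroup hA hA' hf γ m, maslov hA hA' hf o m, ?_, ?_⟩
  · obtain ⟨ℓ, hℓ, h0, hiff, -⟩ := hlift c hc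
    have heven := hiff.1 hco
    obtain ⟨C, hC, hμ⟩ := hℓ.curvatureMap hn ho hc heven
    have hz := hℓ.hasZigzagNumber_iff hn hc ho heven
    rw [h0] at hC hμ hz
    exact ⟨C, -((ℓ 1 - m) / 2), hC, hμ, hz⟩
  · intro c hc hH C μ hC hμ
    obtain ⟨ℓ, hℓ, h0, hiff, hhol⟩ := hlift c hc
    obtain ⟨C₀, hC₀, hμ₀⟩ := hℓ.curvatureMap hn ho hc
      (hiff.1 ((loopClass_mem_evenSubgroup hA hA' hf _ m).1 hH))
    rw [h0] at hC₀ hμ₀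
    obtain rfl := (hC₀ C).1 hC
    rw [maslov_apply, (hμ₀ μ).1 hμ, hhol]
  · intro ρ hρ
    have hnull : ∀ (c : ℝ → M) (hc : IsNullLoop n f o c)
        (hH : loopClass hc.path ∈ evenSubgroup hA hA' hf o m),
        ρ ⟨_, hH⟩ = maslov hA hA' hf o m ⟨_, hH⟩ := by
      intro c hc hH
      obtain ⟨ℓ, hℓ, h0, hiff, hhol⟩ := hlift c hc
      obtain ⟨C, hC, hμ⟩ := hℓ.curvatureMap hn ho hc
        (hiff.1 ((loopClass_mem_evenSubgroup hA hA' hf _ m).1 hH))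
      rw [h0] at hC hμ
      rw [hρ c hc hH C _ ((hC C).2 rfl) ((hμ _).2 rfl), maslov_apply, hhol]
    -- Both homomorphisms are known on null loops. Every class in the subgroup is trivial, that of a
    -- null loop, or the inverse of one, and the null loop then lies in the subgroup too.
    refine MonoidHom.ext fun ⟨x, hx⟩ => ?_
    obtain ⟨γ, rfl⟩ := exists_loopClass_eq x
    rcases exists_isNullLoop hn hA hA' hf ho γ with h1 | ⟨c, hc, h1 | h1⟩
    · have h2 : (⟨loopClass γ, hx⟩ : evenSubgroup hA hA' hf o m) = 1 := Subtype.ext h1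
      rw [h2, map_one, map_one]
    · have h2 : (⟨loopClass γ, hx⟩ : evenSubgroup hA hA' hf o m) =
          ⟨loopClass hc.path, h1 ▸ hx⟩ := Subtype.ext h1.symm
      rw [h2]
      exact hnull c hc _
    · have h2 : (⟨loopClass γ, hx⟩ : evenSubgroup hA hA' hf o m) =
          ⟨loopClass hc.path, h1 ▸ inv_mem hx⟩⁻¹ :=
        Subtype.ext ((inv_inv _).symm.trans (congrArg Inv.inv h1.symm))
      rw [h2, map_inv, map_inv, hnull c hc]
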